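/- Let $3\le p\le 5$ and let $u:\mathbb R^3\times\mathbb R\to\mathbb R$ be a finite-energy solution of $\partial_t^2u-\Delta u=-|u|^{p-1}u$ on $\mathbb R^3\times\mathbb R$. That is, $(u,u_t)\in C(\mathbb R;\dot H^1\times L^2(\mathbb R^3))$, $u\in L^{\frac{2p}{p-3}}_tL^{2p}_x(I\times\mathbb R^3)$ for every bounded interval $I$ (with $\frac{2p}{p-3}=\infty$ if $p=3$), the equation holds in the sense of distributions, and the energy $$\int_{\mathbb R^3}\Big(\tfrac12|\nabla u|^2+\tfrac12|u_t|^2+\tfrac1{p+1}|u|^{p+1}\Big)dx$$ is finite at time $0$. Here $\dot H^1(\mathbb R^3)$ is the space of functions in $L^6(\mathbb R^3)$ whose weak gradient is in $L^2$. Write $\mathbf L_\pm u=\nabla u\cdot\frac{x}{|x|}+\frac{u}{|x|}\pm u_t$, let $\slashed\nabla u=\nabla u-\big(\nabla u\cdot\frac{x}{|x|}\big)\frac{x}{|x|}$ be the angular gradient, and define the inward energy $E_-$ and the outward energy $E_+$ by $$E_\mp(t)=\int_{\mathbb R^3}\Big(\tfrac14|\mathbf L_\pm u(x,t)|^2+\tfrac14|\slashed\nabla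 u(x,t)|^2+\tfrac1{2(p+1)}|u(x,t)|^{p+1}\Big)dx .$$ For $\Omega\subset\mathbb R^3\times\mathbb R$ let $$\mathcal M(\Omega)=\iint_\Omega\Big(\tfrac{p-1}{2(p+1)}\tfrac{|u|^{p+1}}{|x|}+\tfrac12\tfrac{|\slashed\nabla u|^2}{|x|}\Big)dx\,dt .$$ Then: 1. $E_-(t)$ and $E_+(t)$ are finite for every $t\in\mathbb R$; $E_-$ is nonincreasing and $E_+$ is nondecreasing in $t$. 2. $\lim_{t\to+\infty}E_-(t)=0$ and $\lim_{t\to-\infty}E_+(t)=0$. 3. There is exactly one finite nonnegative Borel measure $\mu$ on $\mathbb R$ without atoms such that, for all $t_1\le t_2$, $$\pi\,\mu([t_1,t_2])=\lim_{r\to0^+}\int_{t_1}^{t_2}\!\int_{|x|=r}\Big(\tfrac14|\mathbf L_+u|^2-\tfrac14|\slashed\nabla u|^2-\tfrac1{2(p+1)}|u|^{p+1}\Big)d\sigma_r(x)\,dt ,$$ where the surface integrals converge absolutely for almost every small $r>0$ and the limit is an essential limit (taken over $r$ outside a null set that may depend on $t_1,t_2$). With this measure, for every $t_0\in\mathbb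 R$, $$E_-(t_0)=\pi\,\mu([t_0,\infty))+\mathcal M(\mathbb R^3\times[t_0,\infty)).$$ -/

import Mathlib

open MeasureTheory Set Filter Topology
open scoped ENNReal ContDiff

noncomputable section

namespace WaveEnergy

/-- Three-dimensional Euclidean space. -/
abbrev E3 : Type := EuclideanSpace ℝ (Fin 3)

/-- `g` is the weak (distributional) gradient of `f` on `ℝ³`. -/
def HasWeakGradient (f : E3 → ℝ) (g : E3 → E3) : Prop :=
  ∀ φ : E3 → ℝ, ContDiff ℝ ∞ φ → HasCompactSupport φ → ∀ e : E3,
    ∫ x, f x * fderiv ℝ φ x e = -∫ x, inner ℝ (g x) e * φ x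

/-- `f` belongs to the homogeneous Sobolev space `Ḣ¹(ℝ³)` and has gradient `g`. In dimension three
`Ḣ¹` is the space of `L⁶` functions whose weak gradient is square integrable. -/
structure IsHomogeneousH1 (f : E3 → ℝ) (g : E3 → E3) : Prop where
  memLp : MemLp f 6 volume
  memLp_grad : MemLp g 2 volume
  weakGradient : HasWeakGradient f g

/-- `u` is a (global in time) solution of `∂ₜ²u - Δu = -|u|^(p-1) u` on `ℝ³ × ℝ` in the energy
space, with gradient `Du` and time derivative `ut`:
`(u, ut) ∈ C(ℝ; Ḣ¹ × L²)`, `u ∈ L^(2p/(p-3)) L^(2p)` on every bounded time interval, and the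
equation holds in the sense of distributions. The first argument of `u`, `Du`, `ut` is the time.
For `p = 3` the time exponent `2p/(p-3)` is `∞`. -/
structure IsSolution (p : ℝ) (u : ℝ → E3 → ℝ) (Du : ℝ → E3 → E3) (ut : ℝ → E3 → ℝ) : Prop where
  aestronglyMeasurable : AEStronglyMeasurable (fun z : ℝ × E3 => u z.1 z.2) volume
  aestronglyMeasurable_grad : AEStronglyMeasurable (fun z : ℝ × E3 => Du z.1 z.2) volume
  aestronglyMeasurable_time : AEStronglyMeasurable (fun z : ℝ × E3 => ut z.1 z.2) volume
  homogeneousH1 : ∀ t, IsHomogeneousH1 (u t) (Du t)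
  memLp_time : ∀ t, MemLp (ut t) 2 volume
  continuous_grad : ∀ t, Tendsto (fun s => eLpNorm (Du s - Du t) 2 volume) (𝓝 t) (𝓝 0)
  continuous_time : ∀ t, Tendsto (fun s => eLpNorm (ut s - ut t) 2 volume) (𝓝 t) (𝓝 0)
  strichartz : ∀ a b : ℝ,
    eLpNorm (fun t => eLpNorm (u t) (ENNReal.ofReal (2 * p)) volume)
      (ENNReal.ofReal (2 * p) / ENNReal.ofReal (p - 3)) (volume.restrict (Icc a b)) < ⊤
  time_derivative : ∀ φ : ℝ × E3 → ℝ, ContDiff ℝ ∞ φ → HasCompactSupport φ →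
    ∫ z : ℝ × E3, u z.1 z.2 * fderiv ℝ φ z (1, 0) = -∫ z : ℝ × E3, ut z.1 z.2 * φ z
  equation : ∀ φ : ℝ × E3 → ℝ, ContDiff ℝ ∞ φ → HasCompactSupport φ →
    ∫ z : ℝ × E3, (-(ut z.1 z.2 * fderiv ℝ φ z (1, 0)) + fderiv ℝ φ z (0, Du z.1 z.2)
      + |u z.1 z.2| ^ (p - 1) * u z.1 z.2 * φ z) = 0

/-- The energy of a state with position `f`, gradient `g` and velocity `h`. -/
def energy (p : ℝ) (f : E3 → ℝ) (g : E3 → E3) (h : E3 → ℝ) : ℝ≥0∞ :=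
  ∫⁻ x, ENNReal.ofReal (‖g x‖ ^ 2 / 2 + (h x) ^ 2 / 2 + |f x| ^ (p + 1) / (p + 1))

/-- The radial unit vector `x / |x|`. -/
def radial (x : E3) : E3 := ‖x‖⁻¹ • x

/-- The angular gradient at `x`: the component of the gradient `g` tangent to the sphere centred at
the origin through `x`. -/
def angular (g x : E3) : E3 := g - inner ℝ g (radial x) • radial x

/-- `L₊u = ∇u · x/|x| + u/|x| + uₜ` at the point `x`, from the values `a = u`, `g = ∇u`, `b = uₜ`
at this point. -/
def LPlus (a : ℝ) (g : E3) (b : ℝ) (x : E3) : ℝ := inner ℝ g (radial x) + a / ‖x‖ + b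

/-- `L₋u = ∇u · x/|x| + u/|x| - uₜ` at the point `x`. -/
def LMinus (a : ℝ) (g : E3) (b : ℝ) (x : E3) : ℝ := inner ℝ g (radial x) + a / ‖x‖ - b

/-- The inward energy `E₋(t)`. -/
def inwardEnergy (p : ℝ) (u : ℝ → E3 → ℝ) (Du : ℝ → E3 → E3) (ut : ℝ → E3 → ℝ) (t : ℝ) : ℝ≥0∞ :=
  ∫⁻ x, ENNReal.ofReal ((LPlus (u t x) (Du t x) (ut t x) x) ^ 2 / 4
    + ‖angular (Du t x) x‖ ^ 2 / 4 + |u t x| ^ (p + 1) / (2 * (p + 1)))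

/-- The outward energy `E₊(t)`. -/
def outwardEnergy (p : ℝ) (u : ℝ → E3 → ℝ) (Du : ℝ → E3 → E3) (ut : ℝ → E3 → ℝ) (t : ℝ) : ℝ≥0∞ :=
  ∫⁻ x, ENNReal.ofReal ((LMinus (u t x) (Du t x) (ut t x) x) ^ 2 / 4
    + ‖angular (Du t x) x‖ ^ 2 / 4 + |u t x| ^ (p + 1) / (2 * (p + 1)))

/-- The Morawetz integral `M(Ω)` over a space-time region (time is the first coordinate). -/
def morawetz (p : ℝ) (u : ℝ → E3 → ℝ) (Du : ℝ → E3 → E3) (Ω : Set (ℝ × E3)) : ℝ≥0∞ :=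
  ∫⁻ z in Ω, ENNReal.ofReal ((p - 1) / (2 * (p + 1)) * (|u z.1 z.2| ^ (p + 1) / ‖z.2‖)
    + 1 / 2 * (‖angular (Du z.1 z.2) z.2‖ ^ 2 / ‖z.2‖))

/-- The density of the flux of inward energy through a cylinder `|x| = const`, oriented inward:
`|L₊u|²/4 - |∇̸u|²/4 - |u|^(p+1) / (2(p+1))`. -/
def cylinderFluxDensity (p : ℝ) (u : ℝ → E3 → ℝ) (Du : ℝ → E3 → E3) (ut : ℝ → E3 → ℝ)
    (t : ℝ) (x : E3) : ℝ :=
  (LPlus (u t x) (Du t x) (ut t x) x) ^ 2 / 4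
    - ‖angular (Du t x) x‖ ^ 2 / 4 - |u t x| ^ (p + 1) / (2 * (p + 1))

/-- The surface measure of `[t₁, t₂] × S²`, where `S²` is the unit sphere of `ℝ³`. -/
def cylinderMeasure (t₁ t₂ : ℝ) : Measure (ℝ × Metric.sphere (0 : E3) 1) :=
  (volume.restrict (Icc t₁ t₂)).prod (volume : Measure E3).toSphere

/-- The surface integral of the inward energy flux over the cylinder
`{(x, t) : |x| = r, t₁ ≤ t ≤ t₂}`; the surface element is `r² dσ(ω) dt` at `x = r ω`. -/
def cylinderFlux (p : ℝ) (u : ℝ → E3 → ℝ) (Du : ℝ → E3 → E3) (ut : ℝ → E3 → ℝ)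
    (t₁ t₂ r : ℝ) : ℝ :=
  ∫ q, r ^ 2 * cylinderFluxDensity p u Du ut q.1 (r • (q.2 : E3)) ∂(cylinderMeasure t₁ t₂)

/-- Statements "for almost every sufficiently small `r > 0`"; limits along this filter are essential
limits as `r → 0⁺`. -/
def essNhdsZero : Filter ℝ := 𝓝[>] (0 : ℝ) ⊓ ae (volume : Measure ℝ)

/-- `μ` is the measure on the time axis appearing in the energy flux formula of `u`: a finite
measure without atoms such that `π μ([t₁, t₂])` is the limit, as `r → 0⁺`, of the inward energy flux
through the cylinder `{|x| = r, t₁ ≤ t ≤ t₂}`. The derivatives of `u` are only square integrable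
functions, so that surface integrals make sense for almost every `r`. -/
structure IsOriginFluxMeasure (p : ℝ) (u : ℝ → E3 → ℝ) (Du : ℝ → E3 → E3) (ut : ℝ → E3 → ℝ)
    (μ : Measure ℝ) : Prop where
  finite : IsFiniteMeasure μ
  noAtoms : ∀ t, μ {t} = 0
  integrable : ∀ t₁ t₂ : ℝ, t₁ ≤ t₂ → ∀ᶠ r in essNhdsZero,
    Integrable (fun q : ℝ × Metric.sphere (0 : E3) 1 =>
      r ^ 2 * cylinderFluxDensity p u Du ut q.1 (r • (q.2 : E3))) (cylinderMeasure t₁ t₂)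
  flux : ∀ t₁ t₂ : ℝ, t₁ ≤ t₂ →
    Tendsto (cylinderFlux p u Du ut t₁ t₂) essNhdsZero (𝓝 (Real.pi * (μ (Icc t₁ t₂)).toReal))

end WaveEnergy

end

open scoped Convolution

noncomputable section
namespace WaveEnergy

/-! ### Dominated convergence with a converging sequence of bounds -/

/-! Writing `v = |x| u`, one has `L₊u = (∂_r + ∂_t) v / |x|`. Away from the origin the inward energy
density `e` therefore obeys a local balance law: it is transported by a flux whose component towards
the origin is `f = fluxDensity`, and it is damped by exactly the Morawetz density `m`. Against a
radial weight `α(t, r)` this reads d/dt ∫ α e = ∫ (α_t e - α_r f - α m), and the theorem follows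
from suitable choices of `α`.

Justification. The solution is mollified in space. For the mollified solution the identity is
pointwise algebra (`divergence_algebra`, `densityDeriv_eq`) followed by integration with weights
that vanish near the origin and at infinity (`IsSolution.mollified_identity`). Removing the
mollification gives `IsSolution.weighted_identity`. The Strichartz norm serves only this step: for
`p ≤ 5` it places the nonlinearity in `L¹_loc(ℝ; L²)`, so the commutator of mollification and
nonlinearity disappears in the limit. Energy weights give the energy bound. Together with Hardy's
inequality it provides the majorant `totalDensity`, which admits all weights vanishing linearly at
the origin (`IsSolution.radial_identity`).

Monotonicity. With `α` an approximation `r² / (r² + ε²)` of `1`, the derivative `α_r` concentrates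
at the origin, and its contribution of the wrong sign is absorbed by half-strength Morawetz terms.
As `ε → 0` this gives `M ≤ E₋(t₁) - E₋(t₂)` (`IsSolution.morawetz_estimate`).

Decay. For `α = c(t + r)` one has `α_t = α_r`, and `e - f = |∇̸u|²/2 + |u|^(p+1)/(p+1) ≤ r m` since
`p ≥ 3`. Up to the regularization at the origin the rate is at most `(r c' - c) m`, which is
nonpositive for `t ≥ 0` if `s c'(s) ≤ c(s)`. For `c(s) = s / √(s² + N²)` the weighted inward energy
at time `0` is small when `N` is large, while at late times it is at least nearly all of `E₋`. Hence
`E₋ → 0`.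

The measure. Taking for `α` a primitive of a test function of `r` identifies the flux through `|x| =
r`, for almost every `r`, with the energy balance outside that cylinder. As `r → 0` it tends to
`E₋(t₁) - E₋(t₂) - M`, the increment of `-E₋ - ∫ M`. That function is bounded, nondecreasing by the
Morawetz estimate, and continuous: `E₋ - E₊` is the integral of `u_t (∂_r u + u/|x|)`, which is
continuous in time, and the opposite monotonicities of `E₋` and `E₊` force both to be continuous.
Its Stieltjes measure, divided by `π`, is `μ`. Letting `t₂ → ∞` and using `E₋ → 0` gives the final
formula. All statements on `E₊` are those on `E₋` for the time-reversed solution. -/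

theorem tendsto_integral_of_tendsto_bound {α : Type*} [MeasurableSpace α] {μ : Measure α}
    {f : ℕ → α → ℝ} {g : α → ℝ} {h : ℕ → α → ℝ} {k : α → ℝ}
    (hf : ∀ n, AEStronglyMeasurable (f n) μ) (hh : ∀ n, Integrable (h n) μ)
    (hk : Integrable k μ) (hfh : ∀ n, ∀ᵐ x ∂μ, |f n x| ≤ h n x)
    (hfg : ∀ᵐ x ∂μ, Tendsto (fun n => f n x) atTop (𝓝 (g x)))
    (hhk : ∀ᵐ x ∂μ, Tendsto (fun n => h n x) atTop (𝓝 (k x)))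
    (hint : Tendsto (fun n => ∫ x, h n x ∂μ) atTop (𝓝 (∫ x, k x ∂μ))) :
    Tendsto (fun n => ∫ x, f n x ∂μ) atTop (𝓝 (∫ x, g x ∂μ)) := by
  have hh0 : ∀ᵐ x ∂μ, ∀ n, |f n x| ≤ h n x := ae_all_iff.2 hfh
  have hgk : ∀ᵐ x ∂μ, |g x| ≤ k x := by
    filter_upwards [hh0, hfg, hhk] with x h0 h1 h2
    exact le_of_tendsto_of_tendsto' h1.abs h2 h0
  have hfi : ∀ n, Integrable (f n) μ := fun n => (hh n).mono' (hf n) (hfh n)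
  -- Only `(k - h n)⁺` has a fixed majorant, namely `k`, so its integral tends to `0`. Convergence
  -- of `∫ h n` transfers this to `(h n - k)⁺`.
  have hneg : Tendsto (fun n => ∫ x, max (k x - h n x) 0 ∂μ) atTop (𝓝 (∫ _, (0 : ℝ) ∂μ)) := by
    refine tendsto_integral_of_dominated_convergence k
      (fun n => (hk.aestronglyMeasurable.sub (hh n).aestronglyMeasurable).sup
        aestronglyMeasurable_const) hk (fun n => ?_) ?_
    · filter_upwards [hh0, hgk] with x h0 h1
      have := (abs_nonneg _).trans (h0 n)
      have := (abs_nonneg _).trans h1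
      rw [Real.norm_of_nonneg (le_max_right _ _)]
      exact max_le (by linarith) this
    · filter_upwards [hhk] with x hx
      simpa using (hx.const_sub (k x)).max (tendsto_const_nhds (x := (0 : ℝ)))
  have hpos : Tendsto (fun n => ∫ x, max (h n x - k x) 0 ∂μ) atTop (𝓝 0) := by
    have : ∀ n, ∫ x, max (h n x - k x) 0 ∂μ
        = ((∫ x, h n x ∂μ) - ∫ x, k x ∂μ) + ∫ x, max (k x - h n x) 0 ∂μ := by
      intro n
      have hi : Integrable (fun x => max (k x - h n x) 0) μ := (hk.sub (hh n)).pos_part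
      have hs : Integrable (fun x => h n x - k x) μ := (hh n).sub hk
      rw [← integral_sub (hh n) hk, ← integral_add hs hi]
      refine integral_congr_ae (.of_forall fun x => ?_)
      show max (h n x - k x) 0 = (h n x - k x) + max (k x - h n x) 0
      rcases le_total (h n x) (k x) with hx | hx
      · rw [max_eq_right (by linarith), max_eq_left (by linarith)]; ring
      · rw [max_eq_left (by linarith), max_eq_right (by linarith)]; ring
    simp_rw [this]
    simpa using (hint.sub_const (∫ x, k x ∂μ)).add hneg
  -- Clamped to `[-k, k]`, the functions fall under ordinary dominated convergence. The clamping
  -- error is at most `(h n - k)⁺` because `|f n| ≤ h n`.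
  have hclamp : Tendsto (fun n => ∫ x, max (min (f n x) (k x)) (-k x) ∂μ) atTop
      (𝓝 (∫ x, g x ∂μ)) := by
    refine tendsto_integral_of_dominated_convergence k
      (fun n => ((hf n).inf hk.aestronglyMeasurable).sup hk.aestronglyMeasurable.neg) hk
      (fun n => ?_) ?_
    · filter_upwards [hgk] with x h1
      have := (abs_nonneg _).trans h1
      rw [Real.norm_eq_abs, abs_le]
      exact ⟨le_max_right _ _, max_le (min_le_right _ _) (by linarith)⟩
    · filter_upwards [hfg, hgk] with x hx h1
      have h2 := (hx.min (tendsto_const_nhds (x := k x))).max (tendsto_const_nhds (x := -k x))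
      rwa [min_eq_left (le_of_abs_le h1), max_eq_left (neg_le_of_abs_le h1)] at h2
  refine tendsto_of_tendsto_of_dist hclamp ?_
  refine squeeze_zero (fun _ => dist_nonneg) (fun n => ?_) hpos
  have hci : Integrable (fun x => max (min (f n x) (k x)) (-k x)) μ :=
    ((hfi n).inf hk).sup hk.neg
  rw [dist_eq_norm, ← integral_sub hci (hfi n)]
  refine (norm_integral_le_integral_norm _).trans ?_
  refine integral_mono_ae (hci.sub (hfi n)).norm ((hh n).sub hk).pos_part ?_
  filter_upwards [hh0, hgk] with x h0 h1
  have h2 := abs_le.1 (h0 n)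
  have h3 := (abs_nonneg _).trans h1
  show |max (min (f n x) (k x)) (-k x) - f n x| ≤ max (h n x - k x) 0
  rcases le_total (f n x) (k x) with hx | hx
  · rw [min_eq_left hx]
    rcases le_total (f n x) (-k x) with hy | hy
    · rw [max_eq_right hy, abs_of_nonneg (by linarith)]
      exact le_max_of_le_left (by linarith)
    · rw [max_eq_left hy, sub_self, abs_zero]; exact le_max_right _ _
  · rw [min_eq_right hx, max_eq_left (by linarith), abs_of_nonpos (by linarith)]
    exact le_max_of_le_left (by linarith)

/-! ### Mollification -/

/-- A sequence of bump functions with supports shrinking to the origin. -/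
def bump (n : ℕ) : ContDiffBump (0 : E3) where
  rIn := 1 / (2 * (n + 1))
  rOut := 1 / (n + 1)
  rIn_pos := by positivity
  rIn_lt_rOut := by
    apply one_div_lt_one_div_of_lt <;> nlinarith [(Nat.cast_nonneg n : (0 : ℝ) ≤ n)]

/-- The standard mollifying kernels. -/
def rho (n : ℕ) : E3 → ℝ := (bump n).normed volume

/-- Mollification of a function on `ℝ³`. -/
def mollify {F : Type*} [NormedAddCommGroup F] [NormedSpace ℝ F] (n : ℕ) (g : E3 → F) (x : E3) :
    F := ∫ y, rho n (x - y) • g y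

theorem rho_nonneg (n : ℕ) (x : E3) : 0 ≤ rho n x := (bump n).nonneg_normed x

theorem rho_contDiff (n : ℕ) : ContDiff ℝ ∞ (rho n) := (bump n).contDiff_normed

theorem rho_continuous (n : ℕ) : Continuous (rho n) := (rho_contDiff n).continuous

theorem rho_hasCompactSupport (n : ℕ) : HasCompactSupport (rho n) :=
  (bump n).hasCompactSupport_normed

theorem rho_integrable (n : ℕ) : Integrable (rho n) :=
  (rho_continuous n).integrable_of_hasCompactSupport (rho_hasCompactSupport n)

theorem rho_integral (n : ℕ) : ∫ x, rho n x = 1 := (bump n).integral_normed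

theorem bump_rOut_tendsto : Tendsto (fun n => (bump n).rOut) atTop (𝓝 0) :=
  tendsto_one_div_add_atTop_nhds_zero_nat

theorem hasCompactSupport_comp_sub {F : Type*} [NormedAddCommGroup F] {k : E3 → F} (hk : HasCompactSupport k) (x : E3) :
    HasCompactSupport fun y => k (x - y) :=
  hk.comp_homeomorph (Homeomorph.subLeft x)

variable {F : Type*} [NormedAddCommGroup F] [NormedSpace ℝ F]

theorem mollify_eq_convolution (n : ℕ) (g : E3 → F) :
    mollify n g = (rho n ⋆[ContinuousLinearMap.lsmul ℝ ℝ, volume] g) := by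
  ext x
  rw [convolution_eq_swap]; rfl

theorem integrable_kernel_smul {k : E3 → ℝ} (hk : Continuous k) (hc : HasCompactSupport k)
    {g : E3 → F} (hg : LocallyIntegrable g) (x : E3) : Integrable fun y => k (x - y) • g y :=
  hg.integrable_smul_left_of_hasCompactSupport (hk.comp (continuous_const.sub continuous_id))
    (hasCompactSupport_comp_sub hc x)

theorem mollify_contDiff (n : ℕ) {g : E3 → F} (hg : LocallyIntegrable g) :
    ContDiff ℝ ∞ (mollify n g) := by
  rw [mollify_eq_convolution]
  exact (rho_hasCompactSupport n).contDiff_convolution_left _ (rho_contDiff n) hg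

theorem hasFDerivAt_kernel_convolution {k : E3 → ℝ} (hk : ContDiff ℝ 1 k)
    (hc : HasCompactSupport k) {g : E3 → ℝ} (hg : LocallyIntegrable g) (x e : E3) :
    HasLineDerivAt ℝ (fun x => ∫ y, k (x - y) * g y) (∫ y, fderiv ℝ k (x - y) e * g y) x e := by
  have h := hc.hasFDerivAt_convolution_left (ContinuousLinearMap.lsmul ℝ ℝ) hk hg x
  have h2 := h.hasLineDerivAt e
  have e1 : (k ⋆[ContinuousLinearMap.lsmul ℝ ℝ, volume] g) = fun x => ∫ y, k (x - y) * g y := by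
    ext x; rw [convolution_eq_swap]; rfl
  rw [e1] at h2
  suffices ∫ y, fderiv ℝ k (x - y) e * g y = ((fderiv ℝ k ⋆[ContinuousLinearMap.precompL E3
      (ContinuousLinearMap.lsmul ℝ ℝ), volume] g) x) e by rwa [this]
  rw [convolution_eq_swap]
  have hi : Integrable fun y => (ContinuousLinearMap.precompL E3
      (ContinuousLinearMap.lsmul ℝ ℝ (E := ℝ)) (fderiv ℝ k (x - y))) (g y) := by
    have := (hc.fderiv ℝ).convolutionExists_left
      (ContinuousLinearMap.precompL E3 (ContinuousLinearMap.lsmul ℝ ℝ (E := ℝ)))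
      (hk.continuous_fderiv one_ne_zero) hg x
    exact this.integrable_swap
  rw [ContinuousLinearMap.integral_apply hi]
  rfl

theorem mollify_lineDeriv (n : ℕ) {g : E3 → ℝ} (hg : LocallyIntegrable g) (x e : E3) :
    fderiv ℝ (mollify n g) x e = ∫ y, fderiv ℝ (rho n) (x - y) e * g y := by
  have h1 := ((mollify_contDiff n hg).differentiable (by simp) x).hasFDerivAt.hasLineDerivAt e
  have h2 := hasFDerivAt_kernel_convolution ((rho_contDiff n).of_le (by simp))
    (rho_hasCompactSupport n) hg x e
  exact h1.unique h2

theorem fderiv_comp_sub_left {k : E3 → ℝ} (hk : Differentiable ℝ k) (x y e : E3) :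
    fderiv ℝ (fun y => k (x - y)) y e = -fderiv ℝ k (x - y) e := by
  have := (hk (x - y)).hasFDerivAt.comp y ((hasFDerivAt_id y).const_sub x)
  erw [this.fderiv]; simp

/-- The reflected kernel `y ↦ rho n (x - y)` is an admissible test function, and the sign produced
by the reflection cancels the sign in the definition of the weak gradient. -/
theorem mollify_fderiv_of_weakGradient (n : ℕ) {f : E3 → ℝ} {g : E3 → E3}
    (hf : LocallyIntegrable f) (hg : LocallyIntegrable g) (hfg : HasWeakGradient f g) (x e : E3) :
    fderiv ℝ (mollify n f) x e = inner ℝ (mollify n g x) e := by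
  rw [mollify_lineDeriv n hf]
  have h := hfg (fun y => rho n (x - y))
    ((rho_contDiff n).comp (contDiff_const.sub contDiff_id))
    (hasCompactSupport_comp_sub (rho_hasCompactSupport n) x) e
  simp_rw [fderiv_comp_sub_left ((rho_contDiff n).differentiable (by simp)) x _ e, mul_neg,
    integral_neg, neg_inj] at h
  rw [mollify, real_inner_comm, ← integral_inner (integrable_kernel_smul (rho_continuous n) (rho_hasCompactSupport n) hg x)]
  simp_rw [real_inner_smul_right, mul_comm (fderiv ℝ (rho n) _ e)]
  rw [h]
  refine integral_congr_ae (.of_forall fun y => ?_)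
  simp only [real_inner_comm, mul_comm]

/-- Lebesgue differentiation. It requires the outer radius of `bump n` to be at most a fixed
multiple of the inner one; here the ratio is exactly `2`. -/
theorem mollify_tendsto_ae {g : E3 → F} [CompleteSpace F] (hg : LocallyIntegrable g) :
    ∀ᵐ x, Tendsto (fun n => mollify n g x) atTop (𝓝 (g x)) := by
  have := ContDiffBump.ae_convolution_tendsto_right_of_locallyIntegrable (μ := volume) (φ := bump)
    (l := atTop) (K := 2) bump_rOut_tendsto (.of_forall fun n => ?_) hg
  · simpa only [mollify_eq_convolution, rho] using this
  · show 1 / ((n : ℝ) + 1) ≤ 2 * (1 / (2 * (n + 1)))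
    apply le_of_eq; field_simp

theorem mollify_integrable (n : ℕ) {h : E3 → ℝ} (hh : Integrable h) : Integrable (mollify n h) := by
  rw [mollify_eq_convolution]
  exact (rho_integrable n).integrable_convolution _ hh

theorem mollify_integral (n : ℕ) {h : E3 → ℝ} (hh : Integrable h) :
    ∫ x, mollify n h x = ∫ x, h x := by
  rw [mollify_eq_convolution, integral_convolution _ (rho_integrable n) hh, rho_integral]
  simp

theorem mollify_nonneg (n : ℕ) {h : E3 → ℝ} (hh : ∀ x, 0 ≤ h x) (x : E3) : 0 ≤ mollify n h x :=
  integral_nonneg fun y => mul_nonneg (rho_nonneg n _) (hh y)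

/-- Jensen's inequality for mollification. -/
theorem norm_mollify_rpow_le (n : ℕ) {g : E3 → F} {q : ℝ} (hq : 1 ≤ q)
    (hg : LocallyIntegrable g) (hgq : LocallyIntegrable fun x => ‖g x‖ ^ q) (x : E3) :
    ‖mollify n g x‖ ^ q ≤ mollify n (fun x => ‖g x‖ ^ q) x := by
  -- The kernel centred at `x` is the density of a probability measure `ν`, and the claim is
  -- Jensen's inequality for `s ↦ s ^ q` under `ν`.
  set w : E3 → NNReal := fun y => ⟨rho n (x - y), rho_nonneg n _⟩
  have hwc : Continuous w := ((rho_continuous n).comp (continuous_const.sub continuous_id)).subtype_mk _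
  set ν : Measure E3 := volume.withDensity fun y => (w y : ℝ≥0∞)
  have key : ∀ φ : E3 → ℝ, ∫ y, φ y ∂ν = mollify n φ x := fun φ =>
    integral_withDensity_eq_integral_smul hwc.measurable φ
  have keyi : ∀ φ : E3 → ℝ, LocallyIntegrable φ → Integrable φ ν := fun φ hφ =>
    (integrable_withDensity_iff_integrable_smul hwc.measurable).2
      (integrable_kernel_smul (rho_continuous n) (rho_hasCompactSupport n) hφ x)
  have : IsProbabilityMeasure ν := by
    refine ⟨?_⟩
    rw [withDensity_apply _ MeasurableSet.univ, setLIntegral_univ]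
    have h1 : ∀ y, (w y : ℝ≥0∞) = ENNReal.ofReal (rho n (x - y)) := fun y => by
      rw [ENNReal.ofReal, Real.toNNReal_of_nonneg (rho_nonneg n _)]; rfl
    simp_rw [h1]
    rw [← ofReal_integral_eq_lintegral_ofReal ((rho_integrable n).comp_sub_left x)
      (.of_forall fun y => rho_nonneg n _), integral_sub_left_eq_self, rho_integral]
    simp
  have hjen := (convexOn_rpow hq).map_integral_le (μ := ν) (f := fun y => ‖g y‖)
    (Real.continuous_rpow_const (by linarith)).continuousOn isClosed_Ici
    (.of_forall fun y => norm_nonneg _) (keyi _ (fun x => (hg x).norm)) (keyi _ hgq)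
  rw [key] at hjen
  refine le_trans (Real.rpow_le_rpow (norm_nonneg _) ?_ (by linarith)) (hjen.trans_eq (key _))
  refine (norm_integral_le_integral_norm _).trans_eq (integral_congr_ae (.of_forall fun y => ?_))
  simp [norm_smul, abs_of_nonneg (rho_nonneg n _)]

theorem norm_mollify_sq_le (n : ℕ) {g : E3 → F}
    (hg : LocallyIntegrable g) (hgq : LocallyIntegrable fun x => ‖g x‖ ^ 2) (x : E3) :
    ‖mollify n g x‖ ^ 2 ≤ mollify n (fun x => ‖g x‖ ^ 2) x := by
  have := norm_mollify_rpow_le n (q := 2) (by norm_num) hg (by simpa using hgq) x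
  simpa using this

end WaveEnergy
end

/-! ### Sobolev and Hardy inequalities on the homogeneous Sobolev space -/

noncomputable section
namespace WaveEnergy

/-- Jensen's inequality pointwise, then preservation of the integral of `‖g‖ ^ q` under
mollification. -/
theorem eLpNorm_mollify_le {F : Type*} [NormedAddCommGroup F] [NormedSpace ℝ F] (n : ℕ)
    {g : E3 → F} {q : ℝ} (hq : 1 ≤ q) (hg : MemLp g (ENNReal.ofReal q)) :
    eLpNorm (mollify n g) (ENNReal.ofReal q) volume ≤ eLpNorm g (ENNReal.ofReal q) volume := by
  have hq0 : 0 < q := by linarith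
  have h0 : ENNReal.ofReal q ≠ 0 := by simpa using hq0
  have hT : (ENNReal.ofReal q).toReal = q := ENNReal.toReal_ofReal hq0.le
  have hl : LocallyIntegrable g := hg.locallyIntegrable (by simpa using hq)
  have hi : Integrable fun x => ‖g x‖ ^ q := by
    have := hg.integrable_norm_rpow h0 ENNReal.ofReal_ne_top
    rwa [hT] at this
  have key : ∀ k : E3 → F, (∫⁻ x, ‖k x‖ₑ ^ q) = ∫⁻ x, ENNReal.ofReal (‖k x‖ ^ q) := fun k => by
    refine lintegral_congr fun x => ?_
    rw [← ofReal_norm, ENNReal.ofReal_rpow_of_nonneg (norm_nonneg _) hq0.le]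
  rw [eLpNorm_eq_lintegral_rpow_enorm_toReal h0 ENNReal.ofReal_ne_top,
    eLpNorm_eq_lintegral_rpow_enorm_toReal h0 ENNReal.ofReal_ne_top, hT, key, key]
  refine ENNReal.rpow_le_rpow ?_ (by positivity)
  calc ∫⁻ x, ENNReal.ofReal (‖mollify n g x‖ ^ q)
      ≤ ∫⁻ x, ENNReal.ofReal (mollify n (fun x => ‖g x‖ ^ q) x) := by
        refine lintegral_mono fun x => ENNReal.ofReal_le_ofReal ?_
        exact norm_mollify_rpow_le n hq hl hi.locallyIntegrable x
    _ = ENNReal.ofReal (∫ x, ‖g x‖ ^ q) := by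
        rw [← ofReal_integral_eq_lintegral_ofReal (mollify_integrable n hi)
          (.of_forall fun x => mollify_nonneg n (fun y => by positivity) x), mollify_integral n hi]
    _ = _ := ofReal_integral_eq_lintegral_ofReal hi (.of_forall fun x => by positivity)

theorem IsHomogeneousH1.locallyIntegrable {f : E3 → ℝ} {g : E3 → E3} (h : IsHomogeneousH1 f g) :
    LocallyIntegrable f := h.memLp.locallyIntegrable (by norm_num)

theorem IsHomogeneousH1.locallyIntegrable_grad {f : E3 → ℝ} {g : E3 → E3}
    (h : IsHomogeneousH1 f g) : LocallyIntegrable g := h.memLp_grad.locallyIntegrable (by norm_num)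

/-- Smooth cutoffs, equal to one on the ball of radius `n + 1`. -/
def cutoff (n : ℕ) (x : E3) : ℝ :=
  (⟨1, 2, one_pos, one_lt_two⟩ : ContDiffBump (0 : E3)) (((n : ℝ) + 1)⁻¹ • x)

theorem cutoff_contDiff (n : ℕ) : ContDiff ℝ ∞ (cutoff n) :=
  (ContDiffBump.contDiff _).comp (contDiff_const_smul _)

theorem cutoff_nonneg (n : ℕ) (x : E3) : 0 ≤ cutoff n x := ContDiffBump.nonneg _

theorem cutoff_le_one (n : ℕ) (x : E3) : cutoff n x ≤ 1 := ContDiffBump.le_one _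

theorem norm_inv_smul_nat (n : ℕ) (x : E3) : ‖((n : ℝ) + 1)⁻¹ • x‖ = ‖x‖ / (n + 1) := by
  rw [norm_smul, norm_inv, Real.norm_of_nonneg (by positivity)]; ring

theorem cutoff_eq_one {n : ℕ} {x : E3} (hx : ‖x‖ ≤ n + 1) : cutoff n x = 1 := by
  refine ContDiffBump.one_of_mem_closedBall _ ?_
  rw [mem_closedBall_zero_iff, norm_inv_smul_nat, div_le_iff₀ (by positivity)]
  simpa using hx

theorem cutoff_eq_zero {n : ℕ} {x : E3} (hx : 2 * ((n : ℝ) + 1) ≤ ‖x‖) : cutoff n x = 0 := by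
  refine ContDiffBump.zero_of_le_dist _ ?_
  rw [dist_zero_right, norm_inv_smul_nat, le_div_iff₀ (by positivity)]
  simpa using hx

theorem cutoff_hasCompactSupport (n : ℕ) : HasCompactSupport (cutoff n) := by
  refine HasCompactSupport.intro (isCompact_closedBall (0 : E3) (2 * ((n : ℝ) + 1))) fun x hx => ?_
  rw [mem_closedBall_zero_iff, not_le] at hx
  exact cutoff_eq_zero hx.le

theorem cutoff_tendsto (x : E3) : Tendsto (fun n => cutoff n x) atTop (𝓝 1) := by
  refine tendsto_const_nhds.congr' ?_
  filter_upwards [eventually_ge_atTop ⌈‖x‖⌉₊] with n hn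
  have h1 : ‖x‖ ≤ n := (Nat.le_ceil _).trans (by exact_mod_cast hn)
  exact (cutoff_eq_one (by linarith)).symm

/-- Scaling: differentiating one fixed bump at `x / (n + 1)` produces the factor `1 / (n + 1)`. -/
theorem exists_fderiv_cutoff_le :
    ∃ M : ℝ, 0 ≤ M ∧ ∀ (n : ℕ) (x : E3), ‖fderiv ℝ (cutoff n) x‖ ≤ M / (n + 1) := by
  set b : ContDiffBump (0 : E3) := ⟨1, 2, one_pos, one_lt_two⟩
  obtain ⟨M, hM⟩ := (b.hasCompactSupport.fderiv ℝ).exists_bound_of_continuous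
    ((b.contDiff (n := 1)).continuous_fderiv one_ne_zero)
  refine ⟨M, (norm_nonneg _).trans (hM 0), fun n x => ?_⟩
  have h1 : HasFDerivAt (cutoff n)
      ((fderiv ℝ b (((n : ℝ) + 1)⁻¹ • x)).comp (((n : ℝ) + 1)⁻¹ • ContinuousLinearMap.id ℝ E3)) x :=
    ((b.contDiff (n := 1)).differentiable one_ne_zero _).hasFDerivAt.comp x
      (((n : ℝ) + 1)⁻¹ • ContinuousLinearMap.id ℝ E3).hasFDerivAt
  rw [h1.fderiv, ContinuousLinearMap.comp_smul, norm_smul, ContinuousLinearMap.comp_id, norm_inv,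
    Real.norm_of_nonneg (by positivity), div_eq_inv_mul]
  gcongr
  exact hM _

theorem fderiv_cutoff_eq_zero {n : ℕ} {x : E3} (hx : ‖x‖ < n + 1 ∨ 2 * ((n : ℝ) + 1) < ‖x‖) :
    fderiv ℝ (cutoff n) x = 0 := by
  rcases hx with hx | hx
  · have : cutoff n =ᶠ[𝓝 x] fun _ => 1 := by
      filter_upwards [(continuous_norm.isOpen_preimage _ isOpen_Iio).mem_nhds hx] with y hy
      exact cutoff_eq_one (le_of_lt hy)
    rw [this.fderiv_eq]; simp
  · have : cutoff n =ᶠ[𝓝 x] fun _ => 0 := by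
      filter_upwards [(continuous_norm.isOpen_preimage _ isOpen_Ioi).mem_nhds hx] with y hy
      exact cutoff_eq_zero (le_of_lt hy)
    rw [this.fderiv_eq]; simp

/-- Approximate `f` in `L⁶` by a compactly supported function. Far out the approximant vanishes, so
the tail of `f` is part of the approximation error. -/
theorem tendsto_eLpNorm_tail {f : E3 → ℝ} (hf : MemLp f 6) :
    Tendsto (fun n : ℕ => eLpNorm ({x : E3 | (n : ℝ) + 1 ≤ ‖x‖}.indicator f) 6 volume) atTop (𝓝 0) := by
  rw [ENNReal.tendsto_nhds_zero]
  intro ε hε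
  obtain ⟨k, hk, hk2, -⟩ := hf.exists_hasCompactSupport_eLpNorm_sub_le (by norm_num) hε.ne'
  obtain ⟨R, hR⟩ := hk.isCompact.isBounded.subset_closedBall 0
  filter_upwards [eventually_ge_atTop ⌈R⌉₊] with n hn
  refine le_trans (eLpNorm_mono fun x => ?_) hk2
  by_cases hx : (n : ℝ) + 1 ≤ ‖x‖
  · have : k x = 0 := by
      by_contra h
      have := hR (subset_tsupport _ h)
      rw [mem_closedBall_zero_iff] at this
      have h1 : R ≤ n := (Nat.le_ceil _).trans (by exact_mod_cast hn)
      linarith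
    rw [indicator_of_mem (by exact hx)]; simp [this]
  · rw [indicator_of_notMem (by exact hx)]; simp

/-- Hölder with exponents `6` and `3`: the `L³` norm of the gradient of the cutoff is bounded by
scale invariance, and that gradient lives where `‖x‖ ≥ n + 1`, a region in which the `L⁶` norm of
`f` tends to `0`. This is what allows cutoffs although `f` need not lie in `L²`. -/
theorem tendsto_eLpNorm_mul_fderiv_cutoff {f : E3 → ℝ} (hf : MemLp f 6) :
    Tendsto (fun n : ℕ => eLpNorm (fun x => f x • fderiv ℝ (cutoff n) x) 2 volume) atTop (𝓝 0) := by
  obtain ⟨M, hM0, hM⟩ := exists_fderiv_cutoff_le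
  -- The gradient is at most `M / (n + 1)` on a ball of radius `2 (n + 1)`; the cube root of the
  -- volume contributes a factor `n + 1`, which cancels.
  set B : ℝ≥0∞ := ENNReal.ofReal M * (volume (Metric.closedBall (0 : E3) 2)) ^ (1 / (3:ℝ))
  have hB : B ≠ ⊤ := by
    refine ENNReal.mul_ne_top ENNReal.ofReal_ne_top
      (ENNReal.rpow_ne_top_of_nonneg (by norm_num) measure_closedBall_lt_top.ne)
  have h3 : ∀ n : ℕ, eLpNorm (fderiv ℝ (cutoff n)) 3 volume ≤ B := by
    intro n
    have hn : (0 : ℝ) < n + 1 := by positivity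
    set S := Metric.closedBall (0 : E3) (((n : ℝ) + 1) * 2)
    calc eLpNorm (fderiv ℝ (cutoff n)) 3 volume
        ≤ eLpNorm (S.indicator fun _ => M / ((n : ℝ) + 1)) 3 volume := by
          refine eLpNorm_mono fun x => ?_
          by_cases hx : x ∈ S
          · rw [indicator_of_mem hx, Real.norm_of_nonneg (by positivity)]; exact hM n x
          · rw [fderiv_cutoff_eq_zero (Or.inr ?_)]; · simp
            rw [mem_closedBall_zero_iff, not_le] at hx; linarith
      _ = ENNReal.ofReal (M / ((n : ℝ) + 1)) * volume S ^ (1 / (3 : ℝ)) := by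
          rw [eLpNorm_indicator_const Metric.isClosed_closedBall.measurableSet (by norm_num)
            (by norm_num), ← ofReal_norm, Real.norm_of_nonneg (by positivity)]
          simp only [ENNReal.toReal_ofNat]; rfl
      _ = B := by
          rw [Measure.addHaar_closedBall_mul volume (0 : E3) hn.le (by norm_num),
            ENNReal.mul_rpow_of_nonneg _ _ (by norm_num),
            ENNReal.ofReal_rpow_of_nonneg (by positivity) (by norm_num), ← mul_assoc,
            ← ENNReal.ofReal_mul (by positivity)]
          simp only [finrank_euclideanSpace, Fintype.card_fin, B]
          rw [← Real.rpow_natCast_mul hn.le]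
          congr 2
          norm_num
          field_simp
  have htail := tendsto_eLpNorm_tail hf
  have : Tendsto (fun n : ℕ =>
      eLpNorm ({x : E3 | (n : ℝ) + 1 ≤ ‖x‖}.indicator f) 6 volume * B) atTop (𝓝 0) := by
    simpa using ENNReal.Tendsto.mul_const htail (Or.inr hB)
  refine tendsto_of_tendsto_of_tendsto_of_le_of_le tendsto_const_nhds this (fun _ => zero_le)
    fun n => ?_
  have hm : MeasurableSet {x : E3 | (n : ℝ) + 1 ≤ ‖x‖} := measurableSet_le (by fun_prop) (by fun_prop)
  have e1 : (fun x => f x • fderiv ℝ (cutoff n) x)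
      = ({x : E3 | (n : ℝ) + 1 ≤ ‖x‖}.indicator f) • fderiv ℝ (cutoff n) := by
    ext1 x
    by_cases hx : (n : ℝ) + 1 ≤ ‖x‖
    · simp only [Pi.smul_apply']; rw [indicator_of_mem (by exact hx)]
    · simp only [Pi.smul_apply']
      rw [fderiv_cutoff_eq_zero (Or.inl (not_le.1 hx)), smul_zero, smul_zero]
  have : ENNReal.HolderTriple 6 3 2 := ⟨by
    rw [← ENNReal.toReal_eq_toReal_iff' (by simp) (by simp), ENNReal.toReal_add (by simp) (by simp)]
    norm_num [ENNReal.toReal_inv]⟩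
  rw [e1]
  refine (eLpNorm_smul_le_mul_eLpNorm (p := 6) (q := 3) (r := 2)
    (((cutoff_contDiff n).continuous_fderiv (by simp)).aestronglyMeasurable)
    (hf.aestronglyMeasurable.indicator hm)).trans ?_
  gcongr
  exact h3 n

theorem eLpNorm_fderiv_mollify_le (n : ℕ) {f : E3 → ℝ} {g : E3 → E3} (h : IsHomogeneousH1 f g) :
    eLpNorm (fderiv ℝ (mollify n f)) 2 volume ≤ eLpNorm g 2 volume := by
  refine le_trans (eLpNorm_mono fun x => ?_) (by
    simpa using eLpNorm_mollify_le n (q := 2) (by norm_num) (g := g) (by simpa using h.memLp_grad))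
  refine ContinuousLinearMap.opNorm_le_bound _ (norm_nonneg _) fun e => ?_
  rw [mollify_fderiv_of_weakGradient n h.locallyIntegrable h.locallyIntegrable_grad h.weakGradient]
  exact norm_inner_le_norm _ _

theorem liminf_add_tendsto_zero_le {a : ℝ≥0∞} {b : ℕ → ℝ≥0∞} (C : ℝ≥0∞) (hC : C ≠ ⊤)
    (hb : Tendsto b atTop (𝓝 0)) : liminf (fun n => C * (a + b n)) atTop ≤ C * a := by
  have : Tendsto (fun n => C * (a + b n)) atTop (𝓝 (C * (a + 0))) :=
    ENNReal.Tendsto.const_mul (tendsto_const_nhds.add hb) (Or.inr hC)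
  rw [this.liminf_eq, add_zero]

/-- Weighted inequalities for test functions extend to the homogeneous Sobolev space. -/
theorem IsHomogeneousH1.weighted_le {w : E3 → ℝ} (hw : Measurable w) {q C : ℝ≥0∞} (hC : C ≠ ⊤)
    (hwC : ∀ φ : E3 → ℝ, ContDiff ℝ ∞ φ → HasCompactSupport φ →
      eLpNorm (fun x => w x * φ x) q volume ≤ C * eLpNorm (fderiv ℝ φ) 2 volume)
    {f : E3 → ℝ} {g : E3 → E3} (h : IsHomogeneousH1 f g) :
    eLpNorm (fun x => w x * f x) q volume ≤ C * eLpNorm g 2 volume := by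
  have step : ∀ n, eLpNorm (fun x => w x * mollify n f x) q volume ≤ C * eLpNorm g 2 volume := by
    intro n
    have hs := mollify_contDiff n h.locallyIntegrable
    have h6 : MemLp (mollify n f) 6 := by
      refine ⟨hs.continuous.aestronglyMeasurable, lt_of_le_of_lt ?_ h.memLp.2⟩
      simpa using eLpNorm_mollify_le n (q := 6) (by norm_num) (g := f) (by simpa using h.memLp)
    -- The cutoff of the mollified function is an admissible test function. The product rule costs
    -- only the term with the gradient of the cutoff, which disappears as `m → ∞`.
    have hb : ∀ m, eLpNorm (fun x => w x * (cutoff m x * mollify n f x)) q volume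
        ≤ C * (eLpNorm g 2 volume
          + eLpNorm (fun x => mollify n f x • fderiv ℝ (cutoff m) x) 2 volume) := by
      intro m
      refine (hwC _ ((cutoff_contDiff m).mul hs)
        ((cutoff_hasCompactSupport m).mul_right)).trans ?_
      gcongr
      have e1 : fderiv ℝ (fun x => cutoff m x * mollify n f x)
          = (fun x => cutoff m x • fderiv ℝ (mollify n f) x)
            + fun x => mollify n f x • fderiv ℝ (cutoff m) x := by
        ext1 x
        exact fderiv_fun_mul ((cutoff_contDiff m).differentiable (by simp) x)
          (hs.differentiable (by simp) x)
      rw [e1]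
      have c1 := (cutoff_contDiff m).continuous
      have c2 := (cutoff_contDiff m).continuous_fderiv (by simp)
      have c3 := hs.continuous
      have c4 := hs.continuous_fderiv (by simp)
      refine (eLpNorm_add_le (c1.smul c4).aestronglyMeasurable
        (c3.smul c2).aestronglyMeasurable (by norm_num)).trans ?_
      refine add_le_add ?_ le_rfl
      refine le_trans (eLpNorm_mono fun x => ?_) (eLpNorm_fderiv_mollify_le n h)
      show ‖cutoff m x • fderiv ℝ (mollify n f) x‖ ≤ _
      rw [norm_smul, Real.norm_of_nonneg (cutoff_nonneg m x)]
      exact mul_le_of_le_one_left (norm_nonneg _) (cutoff_le_one m x)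
    refine le_trans (Lp.eLpNorm_lim_le_liminf_eLpNorm
      (f := fun m x => w x * (cutoff m x * mollify n f x)) (fun m => ?_) _ ?_) ?_
    · exact (hw.mul ((cutoff_contDiff m).continuous.mul hs.continuous).measurable).aestronglyMeasurable
    · refine .of_forall fun x => ?_
      simpa using ((cutoff_tendsto x).mul_const (mollify n f x)).const_mul (w x)
    · exact (liminf_le_liminf (.of_forall hb)).trans
        (liminf_add_tendsto_zero_le C hC (tendsto_eLpNorm_mul_fderiv_cutoff h6))
  -- Fatou once more, now to remove the mollification; the constant survives because mollifying does
  -- not increase the `L²` norm of the gradient.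
  refine le_trans (Lp.eLpNorm_lim_le_liminf_eLpNorm
    (f := fun n x => w x * mollify n f x) (fun n => ?_) _ ?_) ?_
  · exact (hw.mul (mollify_contDiff n h.locallyIntegrable).continuous.measurable).aestronglyMeasurable
  · filter_upwards [mollify_tendsto_ae h.locallyIntegrable] with x hx using hx.const_mul _
  · exact (liminf_le_liminf (.of_forall step)).trans (by simp)

/-- The Sobolev inequality on `Ḣ¹(ℝ³)`. -/
theorem exists_sobolev : ∃ C : ℝ≥0∞, C ≠ ⊤ ∧ ∀ (f : E3 → ℝ) (g : E3 → E3), IsHomogeneousH1 f g →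
    eLpNorm f 6 volume ≤ C * eLpNorm g 2 volume := by
  refine ⟨eLpNormLESNormFDerivOfEqInnerConst (volume : Measure E3) 2, ENNReal.coe_ne_top,
    fun f g h => ?_⟩
  have := IsHomogeneousH1.weighted_le (w := fun _ => 1) measurable_const (q := 6)
    (C := eLpNormLESNormFDerivOfEqInnerConst (volume : Measure E3) 2) ENNReal.coe_ne_top ?_ h
  · simpa using this
  · intro φ hφ hc
    have := eLpNorm_le_eLpNorm_fderiv_of_eq_inner (volume : Measure E3) (u := φ) (hφ.of_le (by simp)) hc
      (p := 2) (p' := 6) (by norm_num) (by simp) (by simp; norm_num)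
    simpa using this

theorem hasLineDerivAt_coord (i j : Fin 3) (x : E3) :
    HasLineDerivAt ℝ (fun x : E3 => x i) (if i = j then 1 else 0) x
      (EuclideanSpace.single j (1 : ℝ)) := by
  have h := (EuclideanSpace.proj i : E3 →L[ℝ] ℝ).hasFDerivAt (x := x)
    |>.hasLineDerivAt (EuclideanSpace.single j (1 : ℝ))
  simpa [Pi.single_apply] using! h

theorem hasLineDerivAt_norm_sq (j : Fin 3) (x : E3) :
    HasLineDerivAt ℝ (fun x : E3 => ‖x‖ ^ 2) (2 * x j) x (EuclideanSpace.single j (1 : ℝ)) := by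
  have h := (hasStrictFDerivAt_norm_sq x).hasFDerivAt.hasLineDerivAt
    (EuclideanSpace.single j (1 : ℝ))
  simpa [EuclideanSpace.inner_single_right] using! h

/-- Integrate by parts against the field `x / (|x|² + δ)`, whose divergence `3 / (|x|² + δ) - 2|x|²
/ (|x|² + δ)²` is at least `1 / (|x|² + δ)`. The cross term is absorbed by Young's inequality, and
`δ` removes the singularity at the origin. -/
theorem hardy_regularized {φ : E3 → ℝ} (hφ : ContDiff ℝ ∞ φ) (hc : HasCompactSupport φ)
    {δ : ℝ} (hδ : 0 < δ) :
    ∫ x, φ x ^ 2 / (‖x‖ ^ 2 + δ) ≤ 4 * ∫ x, ‖fderiv ℝ φ x‖ ^ 2 := by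
  have hpos : ∀ x : E3, 0 < ‖x‖ ^ 2 + δ := fun x => by positivity
  have cφ := hφ.continuous
  have cD := hφ.continuous_fderiv (by simp)
  have cinv : Continuous fun x : E3 => (‖x‖ ^ 2 + δ)⁻¹ :=
    Continuous.inv₀ (by fun_prop) fun x => (hpos x).ne'
  have ci : ∀ i : Fin 3, Continuous fun x : E3 => x i := fun i => by fun_prop
  set e : Fin 3 → E3 := fun i => EuclideanSpace.single i (1 : ℝ)
  have hz : ∀ x, x ∉ tsupport φ → φ x = 0 ∧ fderiv ℝ φ x = 0 := fun x hx =>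
    ⟨image_eq_zero_of_notMem_tsupport hx,
      image_eq_zero_of_notMem_tsupport fun h => hx (tsupport_fderiv_subset ℝ h)⟩
  have hint : ∀ k : E3 → ℝ, Continuous k → (∀ x, φ x = 0 → fderiv ℝ φ x = 0 → k x = 0) →
      Integrable k := fun k hk h0 =>
    hk.integrable_of_hasCompactSupport (HasCompactSupport.intro hc fun x hx =>
      h0 x (hz x hx).1 (hz x hx).2)
  have ibp : ∀ i : Fin 3, ∫ x, φ x ^ 2 * ((‖x‖ ^ 2 + δ)⁻¹ - 2 * x i ^ 2 * ((‖x‖ ^ 2 + δ)⁻¹) ^ 2)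
      = -∫ x, 2 * φ x * fderiv ℝ φ x (e i) * (x i * (‖x‖ ^ 2 + δ)⁻¹) := by
    intro i
    refine integral_bilinear_hasLineDerivAt_right_eq_neg_left_of_integrable
      (B := ContinuousLinearMap.mul ℝ ℝ) (v := e i) (f := fun x => φ x ^ 2)
      (g := fun x => x i * (‖x‖ ^ 2 + δ)⁻¹) ?_ ?_ ?_ ?_ ?_
    · refine hint _ ?_ fun x h1 h2 => by simp [h1]
      exact ((continuous_const.mul cφ).mul (cD.clm_apply continuous_const)).mul ((ci i).mul cinv)
    · refine hint _ ?_ fun x h1 h2 => by simp [h1]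
      exact (cφ.pow 2).mul (cinv.sub ((continuous_const.mul ((ci i).pow 2)).mul (cinv.pow 2)))
    · refine hint _ ?_ fun x h1 h2 => by simp [h1]
      exact (cφ.pow 2).mul ((ci i).mul cinv)
    · intro x _
      have h := (hφ.differentiable (by simp) x).hasFDerivAt.hasLineDerivAt (e i)
      have h2 := HasDerivAt.pow h 2
      simpa [HasLineDerivAt] using! h2
    · intro x _
      have h1 := hasLineDerivAt_coord i i x
      have h2 := HasDerivAt.inv (HasDerivAt.add_const δ (hasLineDerivAt_norm_sq i x))
        (by simpa using (hpos x).ne')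
      have h3 := HasDerivAt.mul h1 h2
      refine HasDerivAt.congr_deriv h3 ?_
      simp; field_simp; ring
  have hsum : ∫ x, φ x ^ 2 * (3 * (‖x‖ ^ 2 + δ)⁻¹ - 2 * ‖x‖ ^ 2 * ((‖x‖ ^ 2 + δ)⁻¹) ^ 2)
      = -∫ x, 2 * φ x * fderiv ℝ φ x x * (‖x‖ ^ 2 + δ)⁻¹ := by
    have e1 : ∀ x : E3, φ x ^ 2 * (3 * (‖x‖ ^ 2 + δ)⁻¹ - 2 * ‖x‖ ^ 2 * ((‖x‖ ^ 2 + δ)⁻¹) ^ 2)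
        = ∑ i : Fin 3, φ x ^ 2 * ((‖x‖ ^ 2 + δ)⁻¹ - 2 * x i ^ 2 * ((‖x‖ ^ 2 + δ)⁻¹) ^ 2) := by
      intro x
      rw [EuclideanSpace.real_norm_sq_eq x]
      simp only [Fin.sum_univ_three]; ring
    have e2 : ∀ x : E3, 2 * φ x * fderiv ℝ φ x x * (‖x‖ ^ 2 + δ)⁻¹
        = ∑ i : Fin 3, 2 * φ x * fderiv ℝ φ x (e i) * (x i * (‖x‖ ^ 2 + δ)⁻¹) := by
      intro x
      have : x = ∑ i, x i • e i := by
        ext j; fin_cases j <;> simp [e, Fin.sum_univ_three]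
      have h : fderiv ℝ φ x x = ∑ i, x i * fderiv ℝ φ x (e i) := by
        conv_lhs => rw [this]
        simp only [map_sum, map_smul, smul_eq_mul]
        rw [← this]
      rw [h, Finset.mul_sum, Finset.sum_mul]
      exact Finset.sum_congr rfl fun i _ => by ring
    simp_rw [e1, e2]
    rw [integral_finsetSum, integral_finsetSum, ← Finset.sum_neg_distrib]
    · exact Finset.sum_congr rfl fun i _ => ibp i
    · intro i _
      refine hint _ ?_ fun x h1 h2 => by simp [h1]
      exact ((continuous_const.mul cφ).mul (cD.clm_apply continuous_const)).mul ((ci i).mul cinv)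
    · intro i _
      refine hint _ ?_ fun x h1 h2 => by simp [h1]
      exact (cφ.pow 2).mul (cinv.sub ((continuous_const.mul ((ci i).pow 2)).mul (cinv.pow 2)))
  have i1 : Integrable fun x => φ x ^ 2 / (‖x‖ ^ 2 + δ) := by
    refine hint _ ?_ fun x h1 h2 => by simp [h1]
    exact (cφ.pow 2).mul cinv
  have i2 : Integrable fun x => ‖fderiv ℝ φ x‖ ^ 2 :=
    hint _ (cD.norm.pow 2) fun x h1 h2 => by simp [h2]
  have i3 : Integrable fun x => φ x ^ 2 * (3 * (‖x‖ ^ 2 + δ)⁻¹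
      - 2 * ‖x‖ ^ 2 * ((‖x‖ ^ 2 + δ)⁻¹) ^ 2) := by
    refine hint _ ?_ fun x h1 h2 => by simp [h1]
    have : Continuous fun x : E3 => ‖x‖ := continuous_norm
    fun_prop
  have i4 : Integrable fun x => -(2 * φ x * fderiv ℝ φ x x * (‖x‖ ^ 2 + δ)⁻¹) := by
    refine hint _ ?_ fun x h1 h2 => by simp [h1]
    exact (((continuous_const.mul cφ).mul (cD.clm_apply continuous_id)).mul cinv).neg
  have h1 : ∫ x, φ x ^ 2 / (‖x‖ ^ 2 + δ)
      ≤ ∫ x, φ x ^ 2 * (3 * (‖x‖ ^ 2 + δ)⁻¹ - 2 * ‖x‖ ^ 2 * ((‖x‖ ^ 2 + δ)⁻¹) ^ 2) := by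
    refine integral_mono i1 i3 fun x => ?_
    have h : ‖x‖ ^ 2 * (‖x‖ ^ 2 + δ)⁻¹ ≤ 1 := by
      rw [← div_eq_mul_inv, div_le_one (hpos x)]; linarith
    have h' : 0 ≤ (‖x‖ ^ 2 + δ)⁻¹ := (inv_pos.2 (hpos x)).le
    show φ x ^ 2 / (‖x‖ ^ 2 + δ) ≤ _
    rw [div_eq_mul_inv]
    refine mul_le_mul_of_nonneg_left ?_ (sq_nonneg _)
    nlinarith
  -- Young's inequality with weights `1/2` and `2`: half of the left-hand side is absorbed, which
  -- yields the constant `4`.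
  have h2 : -∫ x, 2 * φ x * fderiv ℝ φ x x * (‖x‖ ^ 2 + δ)⁻¹
      ≤ ∫ x, (φ x ^ 2 / (‖x‖ ^ 2 + δ) / 2 + 2 * ‖fderiv ℝ φ x‖ ^ 2) := by
    rw [← integral_neg]
    refine integral_mono i4 ((i1.div_const 2).add (i2.const_mul 2)) fun x => ?_
    have h := (abs_le.1 ((fderiv ℝ φ x).le_opNorm x)).1
    show -(2 * φ x * fderiv ℝ φ x x * (‖x‖ ^ 2 + δ)⁻¹)
      ≤ φ x ^ 2 / (‖x‖ ^ 2 + δ) / 2 + 2 * ‖fderiv ℝ φ x‖ ^ 2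
    have hsq : (fderiv ℝ φ x x) ^ 2 ≤ ‖fderiv ℝ φ x‖ ^ 2 * (‖x‖ ^ 2 + δ) := by
      have := sq_le_sq' h (le_of_abs_le ((fderiv ℝ φ x).le_opNorm x))
      nlinarith [sq_nonneg (‖fderiv ℝ φ x‖)]
    rw [← sub_nonneg]
    have : φ x ^ 2 / (‖x‖ ^ 2 + δ) / 2 + 2 * ‖fderiv ℝ φ x‖ ^ 2
        - -(2 * φ x * fderiv ℝ φ x x * (‖x‖ ^ 2 + δ)⁻¹)
        = (φ x ^ 2 / 2 + 2 * (‖fderiv ℝ φ x‖ ^ 2 * (‖x‖ ^ 2 + δ))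
          + 2 * φ x * fderiv ℝ φ x x) / (‖x‖ ^ 2 + δ) := by
      have := (hpos x).ne'
      field_simp
      ring
    rw [this]
    refine div_nonneg ?_ (hpos x).le
    nlinarith [sq_nonneg (φ x + 2 * fderiv ℝ φ x x)]
  rw [integral_add (i1.div_const 2) (i2.const_mul 2), integral_div, integral_const_mul] at h2
  linarith

theorem eLpNorm_two_sq {F : Type*} [NormedAddCommGroup F] (f : E3 → F) :
    eLpNorm f 2 volume ^ 2 = ∫⁻ x, ENNReal.ofReal (‖f x‖ ^ 2) := by
  rw [eLpNorm_eq_lintegral_rpow_enorm_toReal (by norm_num) (by norm_num)]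
  simp only [ENNReal.toReal_ofNat, one_div]
  rw [← ENNReal.rpow_natCast, ← ENNReal.rpow_mul]
  norm_num

/-- Hardy's inequality on `Ḣ¹(ℝ³)`. -/
theorem IsHomogeneousH1.hardy {f : E3 → ℝ} {g : E3 → E3} (h : IsHomogeneousH1 f g) :
    eLpNorm (fun x => ‖x‖⁻¹ * f x) 2 volume ≤ 2 * eLpNorm g 2 volume := by
  refine IsHomogeneousH1.weighted_le (by fun_prop) (by norm_num) (fun φ hφ hc => ?_) h
  rw [← ENNReal.pow_le_pow_left_iff two_ne_zero, mul_pow, eLpNorm_two_sq, eLpNorm_two_sq]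
  -- The regularization is removed by Fatou along `δ = 1 / (n + 1)`; the origin, where the limit
  -- fails, is a null set.
  have hlim : ∀ x : E3, x ≠ 0 → Tendsto (fun n : ℕ => φ x ^ 2 / (‖x‖ ^ 2 + 1 / ((n : ℝ) + 1))) atTop
      (𝓝 (‖‖x‖⁻¹ * φ x‖ ^ 2)) := by
    intro x hx
    have : ‖‖x‖⁻¹ * φ x‖ ^ 2 = φ x ^ 2 / (‖x‖ ^ 2 + 0) := by
      rw [Real.norm_eq_abs, sq_abs, add_zero]; field_simp
    rw [this]
    refine Tendsto.div tendsto_const_nhds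
      (tendsto_const_nhds.add tendsto_one_div_add_atTop_nhds_zero_nat) ?_
    simpa using hx
  have cD := hφ.continuous_fderiv (by simp)
  have i1 : Integrable fun x => ‖fderiv ℝ φ x‖ ^ 2 :=
    Continuous.integrable_of_hasCompactSupport (by fun_prop)
      (HasCompactSupport.intro (hc.fderiv ℝ) fun x hx => by
        rw [image_eq_zero_of_notMem_tsupport hx]; simp)
  calc ∫⁻ x, ENNReal.ofReal (‖‖x‖⁻¹ * φ x‖ ^ 2)
      = ∫⁻ x, liminf (fun n : ℕ =>
          ENNReal.ofReal (φ x ^ 2 / (‖x‖ ^ 2 + 1 / ((n : ℝ) + 1)))) atTop := by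
        refine lintegral_congr_ae ?_
        filter_upwards [compl_mem_ae_iff.2 (measure_singleton (0 : E3))] with x hx
        exact ((ENNReal.continuous_ofReal.tendsto _).comp (hlim x hx)).liminf_eq.symm
    _ ≤ liminf (fun n : ℕ => ∫⁻ x, ENNReal.ofReal (φ x ^ 2 / (‖x‖ ^ 2 + 1 / ((n : ℝ) + 1)))) atTop :=
        lintegral_liminf_le fun n => by have := hφ.continuous; fun_prop
    _ ≤ liminf (fun n : ℕ => 2 ^ 2 * ∫⁻ x, ENNReal.ofReal (‖fderiv ℝ φ x‖ ^ 2)) atTop := by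
        refine liminf_le_liminf (.of_forall fun n => ?_)
        have hδ : (0 : ℝ) < 1 / ((n : ℝ) + 1) := by positivity
        show ∫⁻ x, ENNReal.ofReal (φ x ^ 2 / (‖x‖ ^ 2 + 1 / ((n : ℝ) + 1))) ≤ _
        rw [← ofReal_integral_eq_lintegral_ofReal, ← ofReal_integral_eq_lintegral_ofReal,
          show (2 : ℝ≥0∞) ^ 2 = ENNReal.ofReal 4 by norm_num, ← ENNReal.ofReal_mul (by norm_num)]
        · exact ENNReal.ofReal_le_ofReal (hardy_regularized hφ hc hδ)
        · exact i1
        · exact .of_forall fun x => by positivity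
        · refine Continuous.integrable_of_hasCompactSupport ?_
            (HasCompactSupport.intro hc fun x hx => ?_)
          · exact (hφ.continuous.pow 2).div (by fun_prop) fun x => by positivity
          · simp [image_eq_zero_of_notMem_tsupport hx]
        · exact .of_forall fun x => by positivity
    _ = _ := by simp

end WaveEnergy
end

noncomputable section
namespace WaveEnergy

/-! ### Weak derivatives on the line -/

theorem LocallyIntegrable.intervalIntegrable' {g : ℝ → ℝ} (hg : LocallyIntegrable g) (a b : ℝ) :
    IntervalIntegrable g volume a b :=
  (hg.integrableOn_isCompact isCompact_uIcc).intervalIntegrable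

theorem continuous_primitive_of_locallyIntegrable {g : ℝ → ℝ} (hg : LocallyIntegrable g) (a : ℝ) :
    Continuous fun t => ∫ s in a..t, g s :=
  intervalIntegral.continuous_primitive (fun a b => LocallyIntegrable.intervalIntegrable' hg a b) a

/-- The primitive is only absolutely continuous, so the product rule holds almost everywhere. The
fundamental theorem for absolutely continuous functions is applied on an interval containing the
support of `ψ`, where the boundary terms vanish. -/
theorem integral_deriv_mul_primitive {g : ℝ → ℝ} (hg : LocallyIntegrable g) {ψ : ℝ → ℝ}
    (hψ : ContDiff ℝ ∞ ψ) (hc : HasCompactSupport ψ) :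
    ∫ t, deriv ψ t * (∫ s in (0 : ℝ)..t, g s) = -∫ t, ψ t * g t := by
  set P : ℝ → ℝ := fun t => ∫ s in (0 : ℝ)..t, g s
  have hP : Continuous P := continuous_primitive_of_locallyIntegrable hg 0
  obtain ⟨R, hR⟩ := hc.isCompact.isBounded.subset_ball (0 : ℝ)
  have hz : ∀ t, t ∉ Ioo (-R) R → t ∉ tsupport ψ := fun t ht h => ht (by
    have := hR h
    rwa [Real.ball_eq_Ioo, zero_sub, zero_add] at this)
  have hz1 : ∀ t, t ∉ Ioo (-R) R → ψ t = 0 := fun t ht => image_eq_zero_of_notMem_tsupport (hz t ht)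
  have hz2 : ∀ t, t ∉ Ioo (-R) R → deriv ψ t = 0 := fun t ht =>
    image_eq_zero_of_notMem_tsupport fun h => hz t ht (tsupport_deriv_subset h)
  rcases le_or_gt R 0 with hR0 | hR0
  · have h1 : ∀ t, ψ t = 0 := fun t => hz1 t (by simp; intro h; linarith)
    have h2 : ∀ t, deriv ψ t = 0 := fun t => hz2 t (by simp; intro h; linarith)
    simp [h1, h2]
  have hac : AbsolutelyContinuousOnInterval (fun t => ψ t * P t) (-R) R := by
    refine AbsolutelyContinuousOnInterval.mul
      (hψ.of_le (by simp)).contDiffOn.absolutelyContinuousOnInterval ?_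
    exact (LocallyIntegrable.intervalIntegrable' hg _ _).absolutelyContinuousOnInterval_intervalIntegral
      (by rw [uIcc_of_le (by linarith)]; constructor <;> linarith)
  have hd := hac.integral_deriv_eq_sub
  simp only [hz1 R (by simp), hz1 (-R) (by simp), zero_mul, sub_zero] at hd
  have hae : ∀ᵐ t : ℝ, deriv (fun t => ψ t * P t) t = deriv ψ t * P t + ψ t * g t := by
    filter_upwards [LocallyIntegrable.ae_hasDerivAt_integral hg] with t ht
    exact (((hψ.differentiable (by simp)) t).hasDerivAt.mul (ht 0)).deriv
  rw [intervalIntegral.integral_congr_ae (hae.mono fun t ht _ => ht),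
    intervalIntegral.integral_eq_integral_of_support_subset, integral_add] at hd
  · linarith
  · refine Continuous.integrable_of_hasCompactSupport
      ((hψ.continuous_deriv (by simp)).mul hP) ?_
    exact (hc.deriv).mul_right
  · exact hg.integrable_smul_left_of_hasCompactSupport hψ.continuous hc
  · intro t ht
    by_contra h
    have h' : t ∉ Ioo (-R) R := fun h2 => h (Ioo_subset_Ioc_self h2)
    exact ht (by simp [hz1 t h', hz2 t h'])

/-- Du Bois-Reymond: the hypothesis, tested with translated kernels, says that the smooth
mollifications of `w` have zero derivative. They are constant, and converge to `w` at every point by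
continuity. -/
theorem const_of_integral_deriv_mul_eq_zero {w : ℝ → ℝ} (hw : Continuous w)
    (H : ∀ ψ : ℝ → ℝ, ContDiff ℝ ∞ ψ → HasCompactSupport ψ → ∫ t, deriv ψ t * w t = 0) (a b : ℝ) :
    w a = w b := by
  let φ : ℕ → ContDiffBump (0 : ℝ) := fun n =>
    ⟨1 / (2 * (n + 1)), 1 / (n + 1), by positivity, by
      apply one_div_lt_one_div_of_lt <;> nlinarith [(Nat.cast_nonneg n : (0 : ℝ) ≤ n)]⟩
  have hφ : Tendsto (fun n => (φ n).rOut) atTop (𝓝 0) := tendsto_one_div_add_atTop_nhds_zero_nat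
  have hlim := ContDiffBump.convolution_tendsto_right_of_continuous (μ := volume) hφ hw
  have hconst : ∀ n, ((φ n).normed volume ⋆[ContinuousLinearMap.lsmul ℝ ℝ, volume] w) a
      = ((φ n).normed volume ⋆[ContinuousLinearMap.lsmul ℝ ℝ, volume] w) b := by
    intro n
    have hd := fun x => (φ n).hasCompactSupport_normed (μ := volume)
      |>.hasDerivAt_convolution_left (ContinuousLinearMap.lsmul ℝ ℝ) (μ := volume)
        (φ n).contDiff_normed hw.locallyIntegrable x
    refine is_const_of_deriv_eq_zero (𝕜 := ℝ) (fun x => (hd x).differentiableAt) (fun x => ?_) a b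
    rw [(hd x).deriv, convolution_eq_swap]
    have hs : ContDiff ℝ ∞ fun y => (φ n).normed volume (x - y) :=
      (φ n).contDiff_normed.comp (contDiff_const.sub contDiff_id)
    have h := H _ hs (((φ n).hasCompactSupport_normed).comp_homeomorph (Homeomorph.subLeft x))
    have e : ∀ y, deriv (fun y => (φ n).normed volume (x - y)) y
        = -deriv ((φ n).normed volume) (x - y) := fun y => deriv_comp_const_sub _ _ _
    simp_rw [e, neg_mul, integral_neg, neg_eq_zero] at h
    exact h
  exact tendsto_nhds_unique (hlim a) ((hlim b).congr fun n => (hconst n).symm)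

/-- Subtracting a primitive of `g` from `h` leaves a continuous function with vanishing weak
derivative. This turns distributional identities in time into integrated ones valid at every time,
not just almost every time. -/
theorem sub_eq_integral_of_weak_deriv {h g : ℝ → ℝ} (hh : Continuous h) (hg : LocallyIntegrable g)
    (H : ∀ ψ : ℝ → ℝ, ContDiff ℝ ∞ ψ → HasCompactSupport ψ →
      ∫ t, deriv ψ t * h t = -∫ t, ψ t * g t) (a b : ℝ) : h b - h a = ∫ t in a..b, g t := by
  have hP := continuous_primitive_of_locallyIntegrable hg 0
  have hc := const_of_integral_deriv_mul_eq_zero (hh.sub hP) (fun ψ hψ hc => by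
    have i1 : ∀ k : ℝ → ℝ, Continuous k → Integrable fun t => deriv ψ t * k t := fun k hk =>
      ((hψ.continuous_deriv (by simp)).mul hk).integrable_of_hasCompactSupport hc.deriv.mul_right
    simp_rw [Pi.sub_apply, mul_sub]
    rw [integral_sub (i1 _ hh) (i1 _ hP), H ψ hψ hc, integral_deriv_mul_primitive hg hψ hc, sub_self])
    a b
  have i2 := fun a b => LocallyIntegrable.intervalIntegrable' hg a b
  rw [← intervalIntegral.integral_interval_sub_left (i2 0 b) (i2 0 a)]
  simp only [Pi.sub_apply] at hc
  linarith

/-! ### Pairing space-time functions with kernels -/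

section Pairing

/-- Space-time functions in `L¹_loc(ℝ; L^q(ℝ³))`. -/
structure LocLp {F : Type*} [NormedAddCommGroup F] (q : ℝ≥0∞) (g : ℝ → E3 → F) : Prop where
  meas : AEStronglyMeasurable (fun z : ℝ × E3 => g z.1 z.2) volume
  lint : ∀ a b : ℝ, ∫⁻ t in Icc a b, eLpNorm (g t) q volume < ⊤

variable {F : Type*} [NormedAddCommGroup F] [NormedSpace ℝ F]

/-- Hölder on the compact support of `k`. The constant depends on `k` and `q` but not on `f`, so
bounds on `eLpNorm (f t) q` pass to pairings with `k` as functions of `t`. -/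
theorem exists_lintegral_smul_le {k : E3 → ℝ} (hk : Continuous k) (hc : HasCompactSupport k)
    {q : ℝ≥0∞} (hq : 1 ≤ q) : ∃ C : ℝ≥0∞, C ≠ ⊤ ∧ ∀ f : E3 → F, AEStronglyMeasurable f volume →
      ∫⁻ y, ‖k y • f y‖ₑ ≤ C * eLpNorm f q volume := by
  obtain ⟨M, hM⟩ := hc.exists_bound_of_continuous hk
  set K := tsupport k
  have hK : volume K ≠ ⊤ := hc.isCompact.measure_lt_top.ne
  -- For `q = ⊤` the conventions `⊤.toReal = 0` and `1 / 0 = 0` give `r = 1`, the correct exponent.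
  set r : ℝ := 1 / (1 : ℝ≥0∞).toReal - 1 / q.toReal
  have hr : 0 ≤ r := by
    simp only [ENNReal.toReal_one, div_one, r, sub_nonneg]
    rcases eq_or_ne q ⊤ with rfl | hqt
    · simp
    · have : 1 ≤ q.toReal := by simpa using ENNReal.toReal_mono hqt hq
      rw [div_le_one (by linarith)]; exact this
  refine ⟨ENNReal.ofReal M * volume K ^ r, ENNReal.mul_ne_top ENNReal.ofReal_ne_top
    (ENNReal.rpow_ne_top_of_nonneg hr hK), fun f hf => ?_⟩
  calc ∫⁻ y, ‖k y • f y‖ₑ = ∫⁻ y in K, ‖k y • f y‖ₑ := by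
        rw [setLIntegral_eq_of_support_subset]
        intro y hy
        refine subset_tsupport _ fun h => hy ?_
        simp [h]
    _ ≤ ∫⁻ y in K, ENNReal.ofReal M * ‖f y‖ₑ := by
        refine lintegral_mono fun y => ?_
        rw [enorm_smul]
        gcongr
        rw [← ofReal_norm]
        exact ENNReal.ofReal_le_ofReal (hM y)
    _ = ENNReal.ofReal M * eLpNorm f 1 (volume.restrict K) := by
        rw [lintegral_const_mul'' _ hf.enorm.restrict, eLpNorm_one_eq_lintegral_enorm]
    _ ≤ ENNReal.ofReal M * (eLpNorm f q (volume.restrict K)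
          * (volume.restrict K) univ ^ r) := by
        gcongr
        exact eLpNorm_le_eLpNorm_mul_rpow_measure_univ hq hf.restrict
    _ ≤ ENNReal.ofReal M * (eLpNorm f q volume * volume K ^ r) := by
        rw [Measure.restrict_apply_univ]
        gcongr
        exact Measure.restrict_le_self
    _ = _ := by ring

theorem exists_enorm_integral_smul_le {k : E3 → ℝ} (hk : Continuous k) (hc : HasCompactSupport k)
    {q : ℝ≥0∞} (hq : 1 ≤ q) : ∃ C : ℝ≥0∞, C ≠ ⊤ ∧ ∀ f : E3 → F, AEStronglyMeasurable f volume →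
      ‖∫ y, k y • f y‖ₑ ≤ C * eLpNorm f q volume := by
  obtain ⟨C, hC, h⟩ := exists_lintegral_smul_le (F := F) hk hc hq
  exact ⟨C, hC, fun f hf => (enorm_integral_le_lintegral_enorm _).trans (h f hf)⟩

theorem continuous_integral_smul {k : E3 → ℝ} (hk : Continuous k) (hc : HasCompactSupport k)
    {q : ℝ≥0∞} (hq : 1 ≤ q) {f : ℝ → E3 → F} (hf : ∀ t, MemLp (f t) q)
    (hcont : ∀ t, Tendsto (fun s => eLpNorm (f s - f t) q volume) (𝓝 t) (𝓝 0)) :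
    Continuous fun t => ∫ y, k y • f t y := by
  obtain ⟨C, hC, h⟩ := exists_enorm_integral_smul_le (F := F) hk hc hq
  rw [continuous_iff_continuousAt]
  intro t
  rw [ContinuousAt, tendsto_iff_edist_tendsto_0]
  have h0 : Tendsto (fun s => C * eLpNorm (f s - f t) q volume) (𝓝 t) (𝓝 0) := by
    simpa using ENNReal.Tendsto.const_mul (hcont t) (Or.inr hC)
  refine tendsto_of_tendsto_of_tendsto_of_le_of_le tendsto_const_nhds h0 (fun _ => zero_le)
    fun s => ?_
  have i : ∀ t, Integrable fun y => k y • f t y := fun t =>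
    ((hf t).locallyIntegrable hq).integrable_smul_left_of_hasCompactSupport hk hc
  simp only
  rw [edist_eq_enorm_sub, ← integral_sub (i s) (i t)]
  simp_rw [← smul_sub]
  exact h _ ((hf s).sub (hf t)).aestronglyMeasurable

theorem aemeasurable_eLpNorm {F : Type*} [NormedAddCommGroup F] {q : ℝ} (hq : 0 < q) {g : ℝ → E3 → F}
    (hg : AEStronglyMeasurable (fun z : ℝ × E3 => g z.1 z.2) volume) :
    AEMeasurable (fun t => eLpNorm (g t) (ENNReal.ofReal q) volume) := by
  simp_rw [eLpNorm_eq_lintegral_rpow_enorm_toReal (p := ENNReal.ofReal q) (by simpa using hq)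
    ENNReal.ofReal_ne_top, ENNReal.toReal_ofReal hq.le]
  refine AEMeasurable.pow_const ?_ _
  exact AEMeasurable.lintegral_prod_right' (f := fun z : ℝ × E3 => ‖g z.1 z.2‖ₑ ^ q)
    (hg.enorm.pow_const q)

theorem ae_lt_top_of_lintegral_Icc {f : ℝ → ℝ≥0∞} (hf : AEMeasurable f)
    (h : ∀ a b : ℝ, ∫⁻ t in Icc a b, f t < ⊤) : ∀ᵐ t, f t < ⊤ := by
  have : ∀ n : ℕ, ∀ᵐ t, t ∈ Icc (-(n : ℝ)) n → f t < ⊤ := fun n =>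
    (ae_restrict_iff' measurableSet_Icc).1 (ae_lt_top' hf.restrict (h _ _).ne)
  filter_upwards [ae_all_iff.2 this] with t ht
  exact ht ⌈|t|⌉₊ (abs_le.1 (Nat.le_ceil _))

theorem LocLp.ae_memLp {F : Type*} [NormedAddCommGroup F] {q : ℝ} (hq : 0 < q) {g : ℝ → E3 → F} (hg : LocLp (ENNReal.ofReal q) g) :
    ∀ᵐ t, MemLp (g t) (ENNReal.ofReal q) := by
  filter_upwards [hg.meas.prodMk_left, ae_lt_top_of_lintegral_Icc (aemeasurable_eLpNorm hq hg.meas)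
    hg.lint] with t h1 h2 using ⟨h1, h2⟩

theorem LocLp.integrable_prod {q : ℝ≥0∞} (hq : 1 ≤ q) {g : ℝ → E3 → F} (hg : LocLp q g)
    {ψ : ℝ → ℝ} (hψ : Continuous ψ) (hψc : HasCompactSupport ψ) {k : E3 → ℝ} (hk : Continuous k)
    (hkc : HasCompactSupport k) :
    Integrable fun z : ℝ × E3 => (ψ z.1 * k z.2) • g z.1 z.2 := by
  have hm : AEStronglyMeasurable (fun z : ℝ × E3 => (ψ z.1 * k z.2) • g z.1 z.2) volume :=
    (((hψ.comp continuous_fst).mul (hk.comp continuous_snd)).aestronglyMeasurable).smul hg.meas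
  refine ⟨hm, ?_⟩
  obtain ⟨C, hC, h⟩ := exists_lintegral_smul_le (F := F) hk hkc hq
  obtain ⟨M, hM⟩ := hψc.exists_bound_of_continuous hψ
  obtain ⟨R, hR⟩ := hψc.isCompact.isBounded.subset_closedBall (0 : ℝ)
  rw [Real.closedBall_eq_Icc, zero_sub, zero_add] at hR
  rw [hasFiniteIntegral_iff_enorm, Measure.volume_eq_prod, lintegral_prod _ hm.enorm]
  calc ∫⁻ t, ∫⁻ y, ‖(ψ t * k y) • g t y‖ₑ
      ≤ ∫⁻ t, (Icc (-R) R).indicator (fun t => ENNReal.ofReal M * (C * eLpNorm (g t) q volume)) t := by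
        refine lintegral_mono_ae ?_
        filter_upwards [hg.meas.prodMk_left] with t ht
        by_cases h1 : t ∈ Icc (-R) R
        · rw [indicator_of_mem h1]
          simp_rw [mul_smul, enorm_smul (ψ t)]
          rw [lintegral_const_mul' _ _ (by simp)]
          gcongr
          · rw [← ofReal_norm]; exact ENNReal.ofReal_le_ofReal (hM t)
          · exact h _ ht
        · have : ψ t = 0 := image_eq_zero_of_notMem_tsupport fun h => h1 (hR h)
          simp [this]
    _ < ⊤ := by
        rw [lintegral_indicator measurableSet_Icc, lintegral_const_mul' _ _ (by simp),
          lintegral_const_mul' _ _ hC]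
        exact ENNReal.mul_lt_top (by simp) (ENNReal.mul_lt_top hC.lt_top (hg.lint _ _))

theorem LocLp.integral_prod {q : ℝ≥0∞} (hq : 1 ≤ q) {g : ℝ → E3 → F} (hg : LocLp q g)
    {ψ : ℝ → ℝ} (hψ : Continuous ψ) (hψc : HasCompactSupport ψ) {k : E3 → ℝ} (hk : Continuous k)
    (hkc : HasCompactSupport k) :
    ∫ z : ℝ × E3, (ψ z.1 * k z.2) • g z.1 z.2 = ∫ t, ψ t • ∫ y, k y • g t y := by
  rw [Measure.volume_eq_prod, MeasureTheory.integral_prod _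
    (by simpa [Measure.volume_eq_prod] using hg.integrable_prod hq hψ hψc hk hkc)]
  refine integral_congr_ae (.of_forall fun t => ?_)
  simp only [mul_smul]
  rw [integral_smul]

theorem LocLp.locallyIntegrable {q : ℝ≥0∞} (hq : 1 ≤ q) {g : ℝ → E3 → F} (hg : LocLp q g)
    {k : E3 → ℝ} (hk : Continuous k) (hkc : HasCompactSupport k) :
    LocallyIntegrable fun t => ∫ y, k y • g t y := by
  obtain ⟨C, hC, h⟩ := exists_enorm_integral_smul_le (F := F) hk hkc hq
  have hm : AEStronglyMeasurable (fun t => ∫ y, k y • g t y) volume :=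
    AEStronglyMeasurable.integral_prod_right' (f := fun z : ℝ × E3 => k z.2 • g z.1 z.2)
      ((hk.comp continuous_snd).aestronglyMeasurable.smul hg.meas)
  rw [locallyIntegrable_iff]
  intro K hK
  obtain ⟨R, hR⟩ := hK.isBounded.subset_closedBall (0 : ℝ)
  rw [Real.closedBall_eq_Icc, zero_sub, zero_add] at hR
  refine ⟨hm.restrict, ?_⟩
  rw [hasFiniteIntegral_iff_enorm]
  calc ∫⁻ t in K, ‖∫ y, k y • g t y‖ₑ ≤ ∫⁻ t in Icc (-R) R, ‖∫ y, k y • g t y‖ₑ :=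
        lintegral_mono_set hR
    _ ≤ ∫⁻ t in Icc (-R) R, C * eLpNorm (g t) q volume := by
        refine lintegral_mono_ae (ae_restrict_of_ae ?_)
        filter_upwards [hg.meas.prodMk_left] with t ht using h _ ht
    _ < ⊤ := by
        rw [lintegral_const_mul' _ _ hC]
        exact ENNReal.mul_lt_top hC.lt_top (hg.lint _ _)

theorem continuous_eLpNorm {F : Type*} [NormedAddCommGroup F] {q : ℝ≥0∞} (hq : 1 ≤ q) {f : ℝ → E3 → F} (hf : ∀ t, MemLp (f t) q)
    (hcont : ∀ t, Tendsto (fun s => eLpNorm (f s - f t) q volume) (𝓝 t) (𝓝 0)) :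
    Continuous fun t => eLpNorm (f t) q volume := by
  rw [continuous_iff_continuousAt]
  intro t
  have hu : Tendsto (fun s => eLpNorm (f t) q volume + eLpNorm (f s - f t) q volume) (𝓝 t)
      (𝓝 (eLpNorm (f t) q volume)) := by simpa using (hcont t).const_add (eLpNorm (f t) q volume)
  have hl : Tendsto (fun s => eLpNorm (f t) q volume - eLpNorm (f s - f t) q volume) (𝓝 t)
      (𝓝 (eLpNorm (f t) q volume)) := by
    simpa using ENNReal.Tendsto.sub tendsto_const_nhds (hcont t) (Or.inl (hf t).2.ne)
  refine tendsto_of_tendsto_of_tendsto_of_le_of_le hl hu (fun s => ?_) fun s => ?_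
  · rw [tsub_le_iff_right]
    have := eLpNorm_sub_le (hf s).1 ((hf s).sub (hf t)).1 hq
    rwa [sub_sub_cancel] at this
  · have := eLpNorm_add_le (hf t).1 ((hf s).sub (hf t)).1 hq
    rwa [add_sub_cancel] at this

theorem LocLp.of_continuous {F : Type*} [NormedAddCommGroup F] {q : ℝ≥0∞} (hq : 1 ≤ q) {f : ℝ → E3 → F}
    (hm : AEStronglyMeasurable (fun z : ℝ × E3 => f z.1 z.2) volume) (hf : ∀ t, MemLp (f t) q)
    (hcont : ∀ t, Tendsto (fun s => eLpNorm (f s - f t) q volume) (𝓝 t) (𝓝 0)) : LocLp q f := by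
  refine ⟨hm, fun a b => ?_⟩
  obtain ⟨B, hB⟩ := isCompact_Icc.exists_bound_of_continuousOn (s := Icc a b)
    (f := fun t => (eLpNorm (f t) q volume).toReal)
    (continuous_iff_continuousAt.2 fun t => (ENNReal.tendsto_toReal (hf t).2.ne).comp
      ((continuous_eLpNorm hq hf hcont).tendsto t)).continuousOn
  refine lt_of_le_of_lt (setLIntegral_mono' measurableSet_Icc
    (g := fun _ => ENNReal.ofReal B) fun t ht => ?_) ?_
  · rw [← ENNReal.ofReal_toReal (hf t).2.ne]
    exact ENNReal.ofReal_le_ofReal (le_of_abs_le (hB t ht))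
  · rw [setLIntegral_const]
    exact ENNReal.mul_lt_top (by simp) measure_Icc_lt_top

end Pairing

end WaveEnergy
end

/-! ### The solution paired with test functions of the space variable -/

noncomputable section
namespace WaveEnergy

/-- The nonlinearity `|s|^(p-1) s`. -/
def nonlin (p s : ℝ) : ℝ := |s| ^ (p - 1) * s

/-- The standard basis vectors of `ℝ³`. -/
def basisVec (i : Fin 3) : E3 := EuclideanSpace.single i (1 : ℝ)

theorem inner_basisVec (x : E3) (i : Fin 3) : inner ℝ x (basisVec i) = x i := by
  simp [basisVec, EuclideanSpace.inner_single_right]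

theorem sum_basisVec (x : E3) : ∑ i, x i • basisVec i = x := by
  ext j; fin_cases j <;> simp [basisVec, Fin.sum_univ_three]

theorem clm_apply_eq_sum (L : E3 →L[ℝ] ℝ) (x : E3) : L x = ∑ i, L (basisVec i) * x i := by
  conv_lhs => rw [← sum_basisVec x]
  simp [mul_comm]

theorem abs_nonlin {p : ℝ} (hp : 0 < p) (s : ℝ) : |nonlin p s| = |s| ^ p := by
  rw [nonlin, abs_mul, abs_of_nonneg (Real.rpow_nonneg (abs_nonneg s) _)]
  rcases eq_or_ne s 0 with rfl | hs
  · simp [Real.zero_rpow hp.ne']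
  · have := Real.rpow_add_one (abs_ne_zero.2 hs) (p - 1)
    rw [sub_add_cancel] at this
    exact this.symm

theorem continuous_nonlin {p : ℝ} (hp : 1 < p) : Continuous (nonlin p) :=
  (continuous_abs.rpow_const fun _ => Or.inr (by linarith)).mul continuous_id

theorem memLp_coord {g : E3 → E3} {q : ℝ≥0∞} (hg : MemLp g q) (i : Fin 3) :
    MemLp (fun x => g x i) q :=
  hg.of_le ((by fun_prop : Continuous fun x : E3 => x i).comp_aestronglyMeasurable hg.1)
    (.of_forall fun x => by simpa using PiLp.norm_apply_le (g x) i)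

section Solution

variable {p : ℝ} {u : ℝ → E3 → ℝ} {Du : ℝ → E3 → E3} {ut : ℝ → E3 → ℝ}

/-- Needed so that the Sobolev and Hardy inequalities apply to time increments of the solution. -/
theorem IsHomogeneousH1.sub {f f' : E3 → ℝ} {g g' : E3 → E3} (h : IsHomogeneousH1 f g)
    (h' : IsHomogeneousH1 f' g') : IsHomogeneousH1 (f - f') (g - g') := by
  refine ⟨h.memLp.sub h'.memLp, h.memLp_grad.sub h'.memLp_grad, fun φ hφ hc e => ?_⟩
  have cD : Continuous fun x => fderiv ℝ φ x e := (hφ.continuous_fderiv (by simp)).clm_apply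
    continuous_const
  have i1 : ∀ {k : E3 → ℝ}, LocallyIntegrable k → Integrable fun x => k x * fderiv ℝ φ x e :=
    fun {k} hk => LocallyIntegrable.integrable_smul_right_of_hasCompactSupport
      (f := k) hk cD (hc.fderiv_apply ℝ e)
  have i2 : ∀ {k : E3 → E3}, LocallyIntegrable k → Integrable fun x => inner ℝ (k x) e * φ x := by
    intro k hk
    refine LocallyIntegrable.integrable_smul_right_of_hasCompactSupport
      (f := fun x => inner ℝ (k x) e) ?_ hφ.continuous hc
    intro x
    obtain ⟨s, hs, hi⟩ := hk x
    exact ⟨s, hs, hi.inner_const e⟩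
  simp_rw [Pi.sub_apply, inner_sub_left, sub_mul]
  rw [integral_sub (i1 h.locallyIntegrable) (i1 h'.locallyIntegrable),
    integral_sub (i2 h.locallyIntegrable_grad) (i2 h'.locallyIntegrable_grad),
    h.weakGradient φ hφ hc e, h'.weakGradient φ hφ hc e]
  ring

/-- Only the gradient is assumed continuous in time; continuity of `u` itself in `L⁶` is Sobolev
applied to increments. -/
theorem IsSolution.tendsto_position (hu : IsSolution p u Du ut) (t : ℝ) :
    Tendsto (fun s => eLpNorm (u s - u t) 6 volume) (𝓝 t) (𝓝 0) := by
  obtain ⟨C, hC, h⟩ := exists_sobolev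
  have h0 : Tendsto (fun s => C * eLpNorm (Du s - Du t) 2 volume) (𝓝 t) (𝓝 0) := by
    simpa using ENNReal.Tendsto.const_mul (hu.continuous_grad t) (Or.inr hC)
  exact tendsto_of_tendsto_of_tendsto_of_le_of_le tendsto_const_nhds h0 (fun _ => zero_le)
    fun s => h _ _ ((hu.homogeneousH1 s).sub (hu.homogeneousH1 t))

theorem IsSolution.tendsto_hardy (hu : IsSolution p u Du ut) (t : ℝ) :
    Tendsto (fun s => eLpNorm (fun x => ‖x‖⁻¹ * (u s x - u t x)) 2 volume) (𝓝 t) (𝓝 0) := by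
  have h0 : Tendsto (fun s => 2 * eLpNorm (Du s - Du t) 2 volume) (𝓝 t) (𝓝 0) := by
    simpa using ENNReal.Tendsto.const_mul (hu.continuous_grad t) (Or.inr (by norm_num))
  exact tendsto_of_tendsto_of_tendsto_of_le_of_le tendsto_const_nhds h0 (fun _ => zero_le)
    fun s => ((hu.homogeneousH1 s).sub (hu.homogeneousH1 t)).hardy

theorem IsSolution.locLp_position (hu : IsSolution p u Du ut) : LocLp 6 u :=
  .of_continuous (by norm_num) hu.aestronglyMeasurable (fun t => (hu.homogeneousH1 t).memLp)
    hu.tendsto_position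

theorem IsSolution.locLp_velocity (hu : IsSolution p u Du ut) : LocLp 2 ut :=
  .of_continuous (by norm_num) hu.aestronglyMeasurable_time hu.memLp_time hu.continuous_time

theorem IsSolution.tendsto_coord (hu : IsSolution p u Du ut) (i : Fin 3) (t : ℝ) :
    Tendsto (fun s => eLpNorm ((fun x => Du s x i) - fun x => Du t x i) 2 volume) (𝓝 t) (𝓝 0) :=
  tendsto_of_tendsto_of_tendsto_of_le_of_le tendsto_const_nhds (hu.continuous_grad t)
    (fun _ => zero_le) fun s => eLpNorm_mono fun x => by
      simpa using PiLp.norm_apply_le ((Du s - Du t) x) i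

theorem IsSolution.locLp_coord (hu : IsSolution p u Du ut) (i : Fin 3) :
    LocLp 2 fun t x => Du t x i :=
  .of_continuous (by norm_num) ((by fun_prop : Continuous fun x : E3 => x i).comp_aestronglyMeasurable
    hu.aestronglyMeasurable_grad) (fun t => memLp_coord (hu.homogeneousH1 t).memLp_grad i)
    (hu.tendsto_coord i)

theorem eLpNorm_nonlin (hp : 1 ≤ p) (f : E3 → ℝ) :
    eLpNorm (fun x => nonlin p (f x)) 2 volume
      = eLpNorm f (ENNReal.ofReal (2 * p)) volume ^ p := by
  have h1 : eLpNorm (fun x => nonlin p (f x)) 2 volume = eLpNorm (fun x => ‖f x‖ ^ p) 2 volume := by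
    refine eLpNorm_congr_norm_ae (.of_forall fun x => ?_)
    rw [Real.norm_eq_abs, Real.norm_eq_abs, abs_nonlin (by linarith),
      abs_of_nonneg (Real.rpow_nonneg (norm_nonneg _) _), Real.norm_eq_abs]
  rw [h1, eLpNorm_norm_rpow _ (by linarith), ENNReal.ofReal_mul (by norm_num)]
  norm_num

/-- The time exponent satisfies `2p / (p - 3) ≥ p` exactly when `p ≤ 5`, so on a bounded interval
Hölder lowers it to `p`. For `p = 3` the exponent is `⊤` and the comparison still makes sense in
`ℝ≥0∞`. -/
theorem IsSolution.lintegral_strichartz (hp₃ : 3 ≤ p) (hp₅ : p ≤ 5) (hu : IsSolution p u Du ut)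
    (a b : ℝ) :
    ∫⁻ t in Icc a b, eLpNorm (u t) (ENNReal.ofReal (2 * p)) volume ^ p < ⊤ := by
  set G : ℝ → ℝ≥0∞ := fun t => eLpNorm (u t) (ENNReal.ofReal (2 * p)) volume
  have hG : AEStronglyMeasurable G (volume.restrict (Icc a b)) :=
    (aemeasurable_eLpNorm (by linarith) hu.aestronglyMeasurable).restrict.aestronglyMeasurable
  have hle : ENNReal.ofReal p ≤ ENNReal.ofReal (2 * p) / ENNReal.ofReal (p - 3) := by
    rw [ENNReal.le_div_iff_mul_le (Or.inr (by simp; linarith)) (Or.inl (by simp)),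
      ← ENNReal.ofReal_mul (by linarith)]
    exact ENNReal.ofReal_le_ofReal (by nlinarith)
  have h := eLpNorm_le_eLpNorm_mul_rpow_measure_univ hle hG
  have hr : 0 ≤ 1 / (ENNReal.ofReal p).toReal
      - 1 / (ENNReal.ofReal (2 * p) / ENNReal.ofReal (p - 3)).toReal := by
    rw [sub_nonneg]
    rcases eq_or_ne (ENNReal.ofReal (2 * p) / ENNReal.ofReal (p - 3)) ⊤ with ht | ht
    · rw [ht]; simp
    · refine one_div_le_one_div_of_le ?_ (ENNReal.toReal_mono ht hle)
      rw [ENNReal.toReal_ofReal] <;> linarith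
  have hfin : eLpNorm G (ENNReal.ofReal p) (volume.restrict (Icc a b)) < ⊤ := by
    refine h.trans_lt (ENNReal.mul_lt_top (hu.strichartz a b) ?_)
    rw [Measure.restrict_apply_univ]
    exact (ENNReal.rpow_ne_top_of_nonneg hr measure_Icc_lt_top.ne).lt_top
  have := lintegral_rpow_enorm_lt_top_of_eLpNorm_lt_top (p := ENNReal.ofReal p)
    (by simp; linarith) ENNReal.ofReal_ne_top hfin
  rw [ENNReal.toReal_ofReal (by linarith)] at this
  simpa only [enorm_eq_self] using this

/-- Since the `L²` norm of the nonlinearity is the `p`-th power of the `L^(2p)` norm of `u`, the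
nonlinearity is a source in `L¹_loc(ℝ; L²)`. The Strichartz hypothesis is used only in this form. -/
theorem IsSolution.locLp_nonlin (hp₃ : 3 ≤ p) (hp₅ : p ≤ 5) (hu : IsSolution p u Du ut) :
    LocLp 2 fun t x => nonlin p (u t x) := by
  refine ⟨(continuous_nonlin (by linarith)).comp_aestronglyMeasurable hu.aestronglyMeasurable,
    fun a b => ?_⟩
  simp_rw [eLpNorm_nonlin (by linarith : 1 ≤ p)]
  exact hu.lintegral_strichartz hp₃ hp₅ a b

theorem contDiff_prod_kernel {ψ : ℝ → ℝ} (hψ : ContDiff ℝ ∞ ψ) {k : E3 → ℝ} (hk : ContDiff ℝ ∞ k) :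
    ContDiff ℝ ∞ fun z : ℝ × E3 => ψ z.1 * k z.2 :=
  (hψ.comp contDiff_fst).mul (hk.comp contDiff_snd)

theorem hasCompactSupport_prod_kernel {ψ : ℝ → ℝ} (hψ : HasCompactSupport ψ) {k : E3 → ℝ}
    (hk : HasCompactSupport k) : HasCompactSupport fun z : ℝ × E3 => ψ z.1 * k z.2 := by
  refine HasCompactSupport.intro (hψ.isCompact.prod hk.isCompact) fun z hz => ?_
  rw [mem_prod, not_and_or] at hz
  rcases hz with h | h
  · simp [image_eq_zero_of_notMem_tsupport h]
  · simp [image_eq_zero_of_notMem_tsupport h]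

theorem fderiv_prod_kernel {ψ : ℝ → ℝ} (hψ : ContDiff ℝ ∞ ψ) {k : E3 → ℝ} (hk : ContDiff ℝ ∞ k)
    (z : ℝ × E3) (s : ℝ) (e : E3) :
    fderiv ℝ (fun z : ℝ × E3 => ψ z.1 * k z.2) z (s, e)
      = s * deriv ψ z.1 * k z.2 + ψ z.1 * fderiv ℝ k z.2 e := by
  have h1 : HasFDerivAt (fun z : ℝ × E3 => ψ z.1) _ z :=
    ((hψ.differentiable (by simp) z.1).hasFDerivAt).comp z hasFDerivAt_fst
  have h2 : HasFDerivAt (fun z : ℝ × E3 => k z.2) _ z :=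
    ((hk.differentiable (by simp) z.2).hasFDerivAt).comp z hasFDerivAt_snd
  erw [(h1.mul h2).fderiv]
  simp; ring

/-- The pairing of the solution with a test function is continuously differentiable in time. -/
theorem IsSolution.integral_position (hu : IsSolution p u Du ut) {k : E3 → ℝ}
    (hk : ContDiff ℝ ∞ k) (hc : HasCompactSupport k) (a b : ℝ) :
    (∫ y, k y • u b y) - ∫ y, k y • u a y = ∫ t in a..b, ∫ y, k y • ut t y := by
  refine sub_eq_integral_of_weak_deriv
    (continuous_integral_smul hk.continuous hc (by norm_num)
      (fun t => (hu.homogeneousH1 t).memLp) hu.tendsto_position)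
    (hu.locLp_velocity.locallyIntegrable (by norm_num) hk.continuous hc) (fun ψ hψ hψc => ?_) a b
  have h := hu.time_derivative _ (contDiff_prod_kernel hψ hk) (hasCompactSupport_prod_kernel hψc hc)
  simp_rw [fderiv_prod_kernel hψ hk, map_zero, mul_zero, add_zero, one_mul] at h
  have e1 := hu.locLp_position.integral_prod (by norm_num) (hψ.continuous_deriv (by simp)) hψc.deriv
    hk.continuous hc
  have e2 := hu.locLp_velocity.integral_prod (by norm_num) hψ.continuous hψc hk.continuous hc
  simp only [smul_eq_mul] at e1 e2 ⊢
  rw [← e1, ← e2]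
  simp_rw [mul_comm (_ * _) (u _ _), mul_comm (_ * _) (ut _ _)]
  exact h

/-- The weak form of the equation, tested with a function of the space variable. -/
theorem IsSolution.integral_velocity (hp₃ : 3 ≤ p) (hp₅ : p ≤ 5) (hu : IsSolution p u Du ut)
    {k : E3 → ℝ} (hk : ContDiff ℝ ∞ k) (hc : HasCompactSupport k) (a b : ℝ) :
    (∫ y, k y • ut b y) - ∫ y, k y • ut a y
      = ∫ t in a..b, (-(∑ i, ∫ y, fderiv ℝ k y (basisVec i) • Du t y i)
        - ∫ y, k y • nonlin p (u t y)) := by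
  have hN := hu.locLp_nonlin hp₃ hp₅
  have cD : ∀ i, Continuous fun y => fderiv ℝ k y (basisVec i) := fun i =>
    (hk.continuous_fderiv (by simp)).clm_apply continuous_const
  have cS : ∀ i, HasCompactSupport fun y => fderiv ℝ k y (basisVec i) := fun i =>
    hc.fderiv_apply ℝ (basisVec i)
  have l1 := fun i => (hu.locLp_coord i).locallyIntegrable (by norm_num) (cD i) (cS i)
  have l2 := hN.locallyIntegrable (by norm_num) hk.continuous hc
  have l3 : LocallyIntegrable fun t => ∑ i, ∫ y, fderiv ℝ k y (basisVec i) • Du t y i := by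
    simp only [Fin.sum_univ_three]
    exact ((l1 0).add (l1 1)).add (l1 2)
  refine sub_eq_integral_of_weak_deriv
    (continuous_integral_smul hk.continuous hc (by norm_num) hu.memLp_time hu.continuous_time)
    (l3.neg.sub l2) (fun ψ hψ hψc => ?_) a b
  -- Tensor products `ψ(t) k(x)` suffice as test functions: by Fubini the equation becomes a
  -- statement on the weak time derivative of the pairing with `k`.
  have h := hu.equation _ (contDiff_prod_kernel hψ hk) (hasCompactSupport_prod_kernel hψc hc)
  have i1 := hu.locLp_velocity.integrable_prod (by norm_num) (hψ.continuous_deriv (by simp))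
    hψc.deriv hk.continuous hc
  have i2 := fun i => (hu.locLp_coord i).integrable_prod (by norm_num) hψ.continuous hψc (cD i) (cS i)
  have i3 := hN.integrable_prod (by norm_num) hψ.continuous hψc hk.continuous hc
  have e0 : ∀ z : ℝ × E3, (-(ut z.1 z.2 * fderiv ℝ (fun z : ℝ × E3 => ψ z.1 * k z.2) z (1, 0))
      + fderiv ℝ (fun z : ℝ × E3 => ψ z.1 * k z.2) z (0, Du z.1 z.2)
      + |u z.1 z.2| ^ (p - 1) * u z.1 z.2 * (ψ z.1 * k z.2))
      = -((deriv ψ z.1 * k z.2) • ut z.1 z.2)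
        + (∑ i, (ψ z.1 * fderiv ℝ k z.2 (basisVec i)) • Du z.1 z.2 i)
        + (ψ z.1 * k z.2) • nonlin p (u z.1 z.2) := by
    intro z
    rw [fderiv_prod_kernel hψ hk, fderiv_prod_kernel hψ hk, clm_apply_eq_sum _ (Du z.1 z.2)]
    simp only [Fin.sum_univ_three, smul_eq_mul, map_zero, nonlin]
    ring
  simp_rw [e0] at h
  have i2s : Integrable fun z : ℝ × E3 =>
      ∑ i, (ψ z.1 * fderiv ℝ k z.2 (basisVec i)) • Du z.1 z.2 i :=
    integrable_finsetSum _ fun i _ => i2 i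
  have i1n : Integrable fun z : ℝ × E3 => -((deriv ψ z.1 * k z.2) • ut z.1 z.2) := i1.neg
  have i12 : Integrable fun z : ℝ × E3 => -((deriv ψ z.1 * k z.2) • ut z.1 z.2)
      + ∑ i, (ψ z.1 * fderiv ℝ k z.2 (basisVec i)) • Du z.1 z.2 i := i1n.add i2s
  rw [integral_add i12 i3, integral_add i1n i2s, integral_neg,
    integral_finsetSum _ fun i _ => i2 i,
    hu.locLp_velocity.integral_prod (by norm_num) (hψ.continuous_deriv (by simp)) hψc.deriv
      hk.continuous hc, hN.integral_prod (by norm_num) hψ.continuous hψc hk.continuous hc] at h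
  simp_rw [fun i => (hu.locLp_coord i).integral_prod (by norm_num) hψ.continuous hψc (cD i) (cS i)]
    at h
  have j1 : ∀ i, Integrable fun t => ψ t • ∫ y, fderiv ℝ k y (basisVec i) • Du t y i := fun i =>
    (l1 i).integrable_smul_left_of_hasCompactSupport hψ.continuous hψc
  have j2 : Integrable fun t => ψ t • ∫ y, k y • nonlin p (u t y) :=
    l2.integrable_smul_left_of_hasCompactSupport hψ.continuous hψc
  have e3 : ∫ t, ψ t * (-(∑ i, ∫ y, fderiv ℝ k y (basisVec i) • Du t y i)
        - ∫ y, k y • nonlin p (u t y))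
      = -(∑ i, ∫ t, ψ t • ∫ y, fderiv ℝ k y (basisVec i) • Du t y i)
        - ∫ t, ψ t • ∫ y, k y • nonlin p (u t y) := by
    have j1s : Integrable fun t => -∑ i, ψ t • ∫ y, fderiv ℝ k y (basisVec i) • Du t y i :=
      (integrable_finsetSum _ fun i _ => j1 i).neg
    rw [← integral_finsetSum _ fun i _ => j1 i, ← integral_neg, ← integral_sub j1s j2]
    refine integral_congr_ae (.of_forall fun t => ?_)
    simp only [Fin.sum_univ_three, smul_eq_mul]
    ring
  simp only [Pi.sub_apply, Pi.neg_apply]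
  rw [e3]
  simp only [smul_eq_mul] at h ⊢
  linarith

end Solution

end WaveEnergy
end

noncomputable section
namespace WaveEnergy

/-! ### Energy densities as functions of the values of the solution -/

/-- The potential energy density `|s|^(p+1) / (p+1)`. -/
def potential (p s : ℝ) : ℝ := |s| ^ (p + 1) / (p + 1)

/-- The density of the inward energy. -/
def inwardDensity (p a : ℝ) (g : E3) (b : ℝ) (x : E3) : ℝ :=
  LPlus a g b x ^ 2 / 4 + ‖angular g x‖ ^ 2 / 4 + potential p a / 2

/-- The density of the flux of inward energy. -/
def fluxDensity (p a : ℝ) (g : E3) (b : ℝ) (x : E3) : ℝ :=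
  LPlus a g b x ^ 2 / 4 - ‖angular g x‖ ^ 2 / 4 - potential p a / 2

/-- The Morawetz density. -/
def morawetzDensity (p a : ℝ) (g : E3) (x : E3) : ℝ :=
  ((p - 1) / 2 * potential p a + ‖angular g x‖ ^ 2 / 2) * ‖x‖⁻¹

/-- The energy density. -/
def energyDensity (p a : ℝ) (g : E3) (b : ℝ) : ℝ := ‖g‖ ^ 2 / 2 + b ^ 2 / 2 + potential p a

theorem hasDerivAt_potential {p : ℝ} (hp : 1 ≤ p) (s : ℝ) :
    HasDerivAt (potential p) (nonlin p s) s := by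
  have h := (hasDerivAt_abs_rpow s (p := p + 1) (by linarith)).div_const (p + 1)
  refine h.congr_deriv ?_
  rw [nonlin, show p + 1 - 2 = p - 1 by ring]
  field_simp

/-- Source of the Morawetz coefficient: the multiplier contains `u / (2|x|)`, which paired with the
nonlinearity gives `(p + 1)/2` potentials; the divergence takes away one, leaving `(p - 1)/2`. -/
theorem mul_nonlin {p : ℝ} (hp : 1 ≤ p) (s : ℝ) : nonlin p s * s = (p + 1) * potential p s := by
  rw [nonlin, potential, mul_assoc, ← sq, ← sq_abs]
  rcases eq_or_ne s 0 with rfl | hs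
  · simp [Real.zero_rpow (by linarith : p + 1 ≠ 0)]
  · have := Real.rpow_add (abs_pos.2 hs) (p - 1) 2
    rw [show p - 1 + 2 = p + 1 by ring, Real.rpow_two] at this
    rw [← this]
    field_simp

theorem radial_apply (x : E3) (i : Fin 3) : radial x i = ‖x‖⁻¹ * x i := rfl

theorem inner_eq_sum (g h : E3) : inner ℝ g h = ∑ i, g i * h i := by
  simp [PiLp.inner_apply, mul_comm]

theorem norm_radial {x : E3} (hx : x ≠ 0) : ‖radial x‖ = 1 := by
  rw [radial, norm_smul, norm_inv, norm_norm, inv_mul_cancel₀ (norm_ne_zero_iff.2 hx)]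

theorem sum_radial_sq {x : E3} (hx : x ≠ 0) :
    radial x 0 ^ 2 + radial x 1 ^ 2 + radial x 2 ^ 2 = 1 := by
  have := EuclideanSpace.real_norm_sq_eq (radial x)
  rw [norm_radial hx, Fin.sum_univ_three] at this
  linarith

theorem norm_angular_sq (g x : E3) :
    ‖angular g x‖ ^ 2 = ‖g‖ ^ 2 - (inner ℝ g (radial x)) ^ 2 := by
  rw [angular, norm_sub_sq_real, norm_smul, mul_pow, real_inner_smul_right, Real.norm_eq_abs, sq_abs]
  rcases eq_or_ne x 0 with rfl | hx
  · simp [radial]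
  · rw [norm_radial hx]; ring

theorem angular_apply (g x : E3) (i : Fin 3) :
    angular g x i = g i - inner ℝ g (radial x) * radial x i := rfl

theorem norm_sq_eq_sum (g : E3) : ‖g‖ ^ 2 = g 0 ^ 2 + g 1 ^ 2 + g 2 ^ 2 := by
  rw [EuclideanSpace.real_norm_sq_eq, Fin.sum_univ_three]

theorem hasLineDerivAt_norm {x : E3} (hx : x ≠ 0) (i : Fin 3) :
    HasLineDerivAt ℝ (fun x : E3 => ‖x‖) (radial x i) x (basisVec i) := by
  have h := HasDerivAt.sqrt (hasLineDerivAt_norm_sq i x) (by simpa using hx)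
  have e : (fun t : ℝ => √((fun x : E3 => ‖x‖ ^ 2) (x + t • EuclideanSpace.single i (1 : ℝ))))
      = fun t => ‖x + t • basisVec i‖ := by
    ext t; simp [Real.sqrt_sq (norm_nonneg _), basisVec]
  rw [e] at h
  refine HasDerivAt.congr_deriv h ?_
  simp [Real.sqrt_sq (norm_nonneg _), radial_apply]
  field_simp

theorem hasLineDerivAt_norm_inv {x : E3} (hx : x ≠ 0) (i : Fin 3) :
    HasLineDerivAt ℝ (fun x : E3 => ‖x‖⁻¹) (-‖x‖⁻¹ ^ 2 * radial x i) x (basisVec i) := by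
  have h := HasDerivAt.inv (hasLineDerivAt_norm hx i) (by simpa using hx)
  refine HasDerivAt.congr_deriv h ?_
  simp; field_simp

theorem hasLineDerivAt_radial {x : E3} (hx : x ≠ 0) (i j : Fin 3) :
    HasLineDerivAt ℝ (fun x : E3 => radial x j)
      (‖x‖⁻¹ * ((if j = i then 1 else 0) - radial x j * radial x i)) x (basisVec i) := by
  have h := HasDerivAt.mul (hasLineDerivAt_norm_inv hx i) (hasLineDerivAt_coord j i x)
  refine HasDerivAt.congr_deriv h ?_
  simp [radial_apply]; split_ifs <;> ring

section Curves

variable {a s U V b Ψ : ℝ → ℝ} {w G : Fin 3 → ℝ → ℝ} {a' s' U' V' b' Ψ' : ℝ} {w' G' : Fin 3 → ℝ}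
  {t : ℝ}

/-- Derivative of `∇u · w` along a curve. -/
theorem hasDerivAt_radial_component (hG : ∀ j, HasDerivAt (G j) (G' j) t)
    (hw : ∀ j, HasDerivAt (w j) (w' j) t) :
    HasDerivAt (fun h => ∑ j, G j h * w j h) (∑ j, (G' j * w j t + G j t * w' j)) t :=
  HasDerivAt.fun_sum fun j _ => (hG j).mul (hw j)

theorem hasDerivAt_angular_sq (hG : ∀ j, HasDerivAt (G j) (G' j) t) {γ : ℝ → ℝ} {γ' : ℝ}
    (hγ : HasDerivAt γ γ' t) :
    HasDerivAt (fun h => G 0 h ^ 2 + G 1 h ^ 2 + G 2 h ^ 2 - γ h ^ 2)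
      (2 * (G 0 t * G' 0 + G 1 t * G' 1 + G 2 t * G' 2) - 2 * γ t * γ') t := by
  have h := ((((hG 0).pow 2).add ((hG 1).pow 2)).add ((hG 2).pow 2)).sub (hγ.pow 2)
  refine HasDerivAt.congr_deriv h ?_
  simp; ring

theorem hasDerivAt_field (i : Fin 3) {L Q γ : ℝ → ℝ} {L' Q' γ' : ℝ} (ha : HasDerivAt a a' t)
    (hL : HasDerivAt L L' t) (hQ : HasDerivAt Q Q' t) (hγ : HasDerivAt γ γ' t)
    (hw : ∀ j, HasDerivAt (w j) (w' j) t) (hG : ∀ j, HasDerivAt (G j) (G' j) t)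
    (hV : HasDerivAt V V' t) (hb : HasDerivAt b b' t) (hΨ : HasDerivAt Ψ Ψ' t) :
    HasDerivAt (fun h => 1 / 4 * a h * (L h ^ 2 - Q h) * w i h
        + 1 / 2 * a h * L h * (G i h - γ h * w i h) - 1 / 2 * a h * Ψ h * w i h
        + b h * V h * G i h)
      (1 / 4 * (a' * (L t ^ 2 - Q t) + a t * (2 * L t * L' - Q')) * w i t
        + 1 / 4 * a t * (L t ^ 2 - Q t) * w' i
        + 1 / 2 * (a' * L t + a t * L') * (G i t - γ t * w i t)
        + 1 / 2 * a t * L t * (G' i - γ' * w i t - γ t * w' i)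
        - 1 / 2 * (a' * Ψ t + a t * Ψ') * w i t - 1 / 2 * a t * Ψ t * w' i
        + b' * V t * G i t + b t * V' * G i t + b t * V t * G' i) t := by
  have h1 := ((ha.const_mul (1 / 4)).mul ((hL.pow 2).sub hQ)).mul (hw i)
  have h2 := ((ha.const_mul (1 / 2)).mul hL).mul ((hG i).sub (hγ.mul (hw i)))
  have h3 := ((ha.const_mul (1 / 2)).mul hΨ).mul (hw i)
  have h4 := (hb.mul hV).mul (hG i)
  refine HasDerivAt.congr_deriv (((h1.add h2).sub h3).add h4) ?_
  simp only [Pi.mul_apply, Pi.sub_apply, Pi.pow_apply]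
  push_cast
  ring

theorem hasDerivAt_density {L Q : ℝ → ℝ} {L' Q' : ℝ} (ha : HasDerivAt a a' t)
    (hL : HasDerivAt L L' t) (hQ : HasDerivAt Q Q' t) (hG : ∀ j, HasDerivAt (G j) (G' j) t)
    (hV : HasDerivAt V V' t) (β : ℝ) (hΨ : HasDerivAt Ψ Ψ' t) :
    HasDerivAt (fun h => a h * (L h ^ 2 / 4 + Q h / 4 + Ψ h / 2)
        + β * ((G 0 h ^ 2 + G 1 h ^ 2 + G 2 h ^ 2) / 2 + V h ^ 2 / 2 + Ψ h))
      (a' * (L t ^ 2 / 4 + Q t / 4 + Ψ t / 2) + a t * (L t * L' / 2 + Q' / 4 + Ψ' / 2)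
        + β * (G 0 t * G' 0 + G 1 t * G' 1 + G 2 t * G' 2 + V t * V' + Ψ')) t := by
  have h1 := ha.mul ((((hL.pow 2).div_const 4).add (hQ.div_const 4)).add (hΨ.div_const 2))
  have h2 := ((((((hG 0).pow 2).add ((hG 1).pow 2)).add ((hG 2).pow 2)).div_const 2).add
    ((hV.pow 2).div_const 2)).add hΨ |>.const_mul β
  refine HasDerivAt.congr_deriv (h1.add h2) ?_
  simp only [Pi.add_apply, Pi.pow_apply]
  push_cast
  ring

end Curves

/-- The algebraic identity behind the conservation law: the sum over `i` of the derivatives of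
`hasDerivAt_field`. -/
theorem divergence_algebra {w0 w1 w2 G0 G1 G2 s a a' U V V0 V1 V2 Ψ F b b0 b1 b2 : ℝ}
    {H00 H01 H02 H11 H12 H22 γ L Q : ℝ} {L0 L1 L2 γ0 γ1 γ2 Q0 Q1 Q2 : ℝ}
    (hw : w0 ^ 2 + w1 ^ 2 + w2 ^ 2 = 1)
    (hγ : γ = G0 * w0 + G1 * w1 + G2 * w2)
    (hL : L = γ + U * s + V) (hQ : Q = G0 ^ 2 + G1 ^ 2 + G2 ^ 2 - γ ^ 2)
    (hγ0 : γ0 = H00 * w0 + H01 * w1 + H02 * w2 + s * (G0 - γ * w0))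
    (hγ1 : γ1 = H01 * w0 + H11 * w1 + H12 * w2 + s * (G1 - γ * w1))
    (hγ2 : γ2 = H02 * w0 + H12 * w1 + H22 * w2 + s * (G2 - γ * w2))
    (hL0 : L0 = γ0 + G0 * s - U * s ^ 2 * w0 + V0)
    (hL1 : L1 = γ1 + G1 * s - U * s ^ 2 * w1 + V1)
    (hL2 : L2 = γ2 + G2 * s - U * s ^ 2 * w2 + V2)
    (hQ0 : Q0 = 2 * (G0 * H00 + G1 * H01 + G2 * H02) - 2 * γ * γ0)
    (hQ1 : Q1 = 2 * (G0 * H01 + G1 * H11 + G2 * H12) - 2 * γ * γ1)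
    (hQ2 : Q2 = 2 * (G0 * H02 + G1 * H12 + G2 * H22) - 2 * γ * γ2) :
    (1 / 4 * (a' * w0 * (L ^ 2 - Q) + a * (2 * L * L0 - Q0)) * w0
        + 1 / 4 * a * (L ^ 2 - Q) * (s * (1 - w0 * w0))
        + 1 / 2 * (a' * w0 * L + a * L0) * (G0 - γ * w0)
        + 1 / 2 * a * L * (H00 - γ0 * w0 - γ * (s * (1 - w0 * w0)))
        - 1 / 2 * (a' * w0 * Ψ + a * (F * G0)) * w0 - 1 / 2 * a * Ψ * (s * (1 - w0 * w0))
        + b0 * V * G0 + b * V0 * G0 + b * V * H00)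
      + (1 / 4 * (a' * w1 * (L ^ 2 - Q) + a * (2 * L * L1 - Q1)) * w1
        + 1 / 4 * a * (L ^ 2 - Q) * (s * (1 - w1 * w1))
        + 1 / 2 * (a' * w1 * L + a * L1) * (G1 - γ * w1)
        + 1 / 2 * a * L * (H11 - γ1 * w1 - γ * (s * (1 - w1 * w1)))
        - 1 / 2 * (a' * w1 * Ψ + a * (F * G1)) * w1 - 1 / 2 * a * Ψ * (s * (1 - w1 * w1))
        + b1 * V * G1 + b * V1 * G1 + b * V * H11)
      + (1 / 4 * (a' * w2 * (L ^ 2 - Q) + a * (2 * L * L2 - Q2)) * w2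
        + 1 / 4 * a * (L ^ 2 - Q) * (s * (1 - w2 * w2))
        + 1 / 2 * (a' * w2 * L + a * L2) * (G2 - γ * w2)
        + 1 / 2 * a * L * (H22 - γ2 * w2 - γ * (s * (1 - w2 * w2)))
        - 1 / 2 * (a' * w2 * Ψ + a * (F * G2)) * w2 - 1 / 2 * a * Ψ * (s * (1 - w2 * w2))
        + b2 * V * G2 + b * V2 * G2 + b * V * H22)
      = a' * (L ^ 2 / 4 - Q / 4 - Ψ / 2) + 1 / 2 * a * Q * s - a * Ψ * s - 1 / 2 * a * F * γ
        + 1 / 2 * a * L * (V0 * w0 + V1 * w1 + V2 * w2 + V * s + (H00 + H11 + H22))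
        + 1 / 2 * a * (V0 * G0 + V1 * G1 + V2 * G2 - γ * (V0 * w0 + V1 * w1 + V2 * w2))
        + V * (b0 * G0 + b1 * G1 + b2 * G2) + b * (V0 * G0 + V1 * G1 + V2 * G2)
        + b * V * (H00 + H11 + H22) := by
  -- `ww` is the Hessian evaluated twice on the radial direction and `gw` the Hessian paired with
  -- the gradient and the radial direction. Apart from the trace, these are the only second-order
  -- quantities that occur, and they cancel at the end.
  set ww := w0 * (H00 * w0 + H01 * w1 + H02 * w2) + w1 * (H01 * w0 + H11 * w1 + H12 * w2)
    + w2 * (H02 * w0 + H12 * w1 + H22 * w2) with hww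
  set gw := G0 * (H00 * w0 + H01 * w1 + H02 * w2) + G1 * (H01 * w0 + H11 * w1 + H12 * w2)
    + G2 * (H02 * w0 + H12 * w1 + H22 * w2) with hgw
  set Vr := V0 * w0 + V1 * w1 + V2 * w2 with hVr
  have S0 : γ0 * w0 + γ1 * w1 + γ2 * w2 = ww := by
    rw [hγ0, hγ1, hγ2, hww]; linear_combination (-s * γ) * hw - s * hγ
  have S1 : L0 * w0 + L1 * w1 + L2 * w2 = ww + γ * s - U * s ^ 2 + Vr := by
    rw [hL0, hL1, hL2, hVr]; linear_combination S0 - s * hγ - U * s ^ 2 * hw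
  have S2 : Q0 * w0 + Q1 * w1 + Q2 * w2 = 2 * gw - 2 * γ * ww := by
    rw [hQ0, hQ1, hQ2, hgw]; linear_combination (-2 * γ) * S0
  have S3 : w0 * (G0 - γ * w0) + w1 * (G1 - γ * w1) + w2 * (G2 - γ * w2) = 0 := by
    linear_combination -hγ - γ * hw
  -- The term `2 * s * Q` consists of one `s * Q` from the turning of the radial direction and one
  -- from differentiating `u / |x|`.
  have S4 : L0 * (G0 - γ * w0) + L1 * (G1 - γ * w1) + L2 * (G2 - γ * w2)
      = gw - γ * ww + 2 * s * Q + (V0 * G0 + V1 * G1 + V2 * G2 - γ * Vr) := by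
    rw [hL0, hL1, hL2, hγ0, hγ1, hγ2, hgw, hww, hVr, hQ]
    linear_combination (-s * γ - U * s ^ 2) * S3 + 2 * s * γ * hγ
  have S5 : (H00 - γ0 * w0 - γ * (s * (1 - w0 * w0))) + (H11 - γ1 * w1 - γ * (s * (1 - w1 * w1)))
      + (H22 - γ2 * w2 - γ * (s * (1 - w2 * w2))) = H00 + H11 + H22 - ww - 2 * γ * s := by
    linear_combination -S0 + γ * s * hw
  linear_combination (1 / 4 * a' * (L ^ 2 - Q) - 1 / 4 * a * (L ^ 2 - Q) * s - 1 / 2 * a' * Ψ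
      + 1 / 2 * a * Ψ * s) * hw + 1 / 2 * a * L * S1 - 1 / 4 * a * S2 + 1 / 2 * a' * L * S3
    + 1 / 2 * a * S4 + 1 / 2 * a * L * S5 + 1 / 2 * a * L * s * hL + 1 / 2 * a * F * hγ

end WaveEnergy
end

noncomputable section
namespace WaveEnergy

/-! ### Regularity of mollified solutions -/

/-- By translation invariance of Lebesgue measure one constant serves all centres `x`. -/
theorem exists_enorm_kernel_le {k : E3 → ℝ} (hk : Continuous k) (hc : HasCompactSupport k)
    {q : ℝ≥0∞} (hq : 1 ≤ q) : ∃ C : ℝ≥0∞, C ≠ ⊤ ∧ ∀ (f : E3 → ℝ) (x : E3),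
      AEStronglyMeasurable f volume → ‖∫ y, k (x - y) * f y‖ₑ ≤ C * eLpNorm f q volume := by
  obtain ⟨C, hC, h⟩ := exists_enorm_integral_smul_le (F := ℝ) hk hc hq
  refine ⟨C, hC, fun f x hf => ?_⟩
  have hmp := Measure.measurePreserving_sub_left (volume : Measure E3) x
  have e1 : ∫ y, k (x - y) * f y = ∫ y, k y • f (x - y) := by
    rw [← integral_sub_left_eq_self _ volume x]
    simp
  rw [e1]
  refine (h (fun y => f (x - y)) (hf.comp_measurePreserving hmp)).trans_eq ?_
  congr 1
  exact eLpNorm_comp_measurePreserving hf hmp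

/-- Joint continuity: replacing the time `z.1` by `t` costs an error that is small uniformly in the
space variable, and at the fixed time `t` the convolution is continuous in space. -/
theorem continuous_kernel {k : E3 → ℝ} (hk : Continuous k) (hc : HasCompactSupport k)
    {q : ℝ≥0∞} (hq : 1 ≤ q) {f : ℝ → E3 → ℝ} (hf : ∀ t, MemLp (f t) q)
    (hcont : ∀ t, Tendsto (fun s => eLpNorm (f s - f t) q volume) (𝓝 t) (𝓝 0)) :
    Continuous fun z : ℝ × E3 => ∫ y, k (z.2 - y) * f z.1 y := by
  obtain ⟨C, hC, h⟩ := exists_enorm_kernel_le hk hc hq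
  have i : ∀ t x, Integrable fun y => k (x - y) * f t y := fun t x =>
    integrable_kernel_smul hk hc ((hf t).locallyIntegrable hq) x
  have hx : ∀ t, Continuous fun x => ∫ y, k (x - y) * f t y := fun t => by
    have := hc.continuous_convolution_left (ContinuousLinearMap.lsmul ℝ ℝ) (μ := volume) hk
      ((hf t).locallyIntegrable hq)
    convert this using 1
    ext x; rw [convolution_eq_swap]; rfl
  rw [continuous_iff_continuousAt]
  rintro ⟨t, x⟩
  have h1 : Tendsto (fun z : ℝ × E3 => ∫ y, k (z.2 - y) * (f z.1 - f t) y) (𝓝 (t, x)) (𝓝 0) := by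
    rw [tendsto_iff_edist_tendsto_0]
    have h0 : Tendsto (fun z : ℝ × E3 => C * eLpNorm (f z.1 - f t) q volume) (𝓝 (t, x)) (𝓝 0) := by
      have := ENNReal.Tendsto.const_mul (hcont t) (Or.inr hC)
      rw [mul_zero] at this
      exact this.comp (continuous_fst.tendsto (t, x))
    refine tendsto_of_tendsto_of_tendsto_of_le_of_le tendsto_const_nhds h0 (fun _ => zero_le)
      fun z => ?_
    simp only [edist_zero_right]
    exact h _ _ ((hf z.1).sub (hf t)).aestronglyMeasurable
  have h2 : Tendsto (fun z : ℝ × E3 => ∫ y, k (z.2 - y) * f t y) (𝓝 (t, x))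
      (𝓝 (∫ y, k (x - y) * f t y)) := ((hx t).tendsto x).comp (continuous_snd.tendsto (t, x))
  have h3 := h1.add h2
  rw [zero_add] at h3
  refine h3.congr fun z => ?_
  have i1 : Integrable fun y => k (z.2 - y) * (f z.1 - f t) y := by
    have := (i z.1 z.2).sub (i t z.2)
    refine this.congr (.of_forall fun y => ?_)
    simp [mul_sub]
  rw [← integral_add i1 (i t z.2)]
  refine integral_congr_ae (.of_forall fun y => ?_)
  simp only [Pi.sub_apply]
  ring

theorem kernel_comp_sub_contDiff {k : E3 → ℝ} (hk : ContDiff ℝ ∞ k) (x : E3) :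
    ContDiff ℝ ∞ fun y => k (x - y) := hk.comp (contDiff_const.sub contDiff_id)

theorem rho_deriv_contDiff (n : ℕ) (i : Fin 3) :
    ContDiff ℝ ∞ fun y => fderiv ℝ (rho n) y (basisVec i) :=
  ((rho_contDiff n).fderiv_right (m := ∞) (by simp)).clm_apply contDiff_const

theorem rho_deriv_hasCompactSupport (n : ℕ) (i : Fin 3) :
    HasCompactSupport fun y => fderiv ℝ (rho n) y (basisVec i) :=
  (rho_hasCompactSupport n).fderiv_apply ℝ (basisVec i)

theorem mollify_apply_coord (n : ℕ) {g : E3 → E3} (hg : LocallyIntegrable g) (x : E3) (i : Fin 3) :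
    mollify n g x i = mollify n (fun y => g y i) x := by
  have h := (EuclideanSpace.proj i : E3 →L[ℝ] ℝ).integral_comp_comm
    (integrable_kernel_smul (rho_continuous n) (rho_hasCompactSupport n) hg x)
  exact h.symm

theorem LocallyIntegrable.coord {g : E3 → E3} (hg : LocallyIntegrable g) (i : Fin 3) :
    LocallyIntegrable fun y => g y i := by
  intro x
  obtain ⟨s, hs, hi⟩ := hg x
  exact ⟨s, hs, (EuclideanSpace.proj i : E3 →L[ℝ] ℝ).integrable_comp hi⟩

section Solution

variable {p : ℝ} {u : ℝ → E3 → ℝ} {Du : ℝ → E3 → E3} {ut : ℝ → E3 → ℝ}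

theorem IsSolution.locallyIntegrable_velocity (hu : IsSolution p u Du ut) (t : ℝ) :
    LocallyIntegrable (ut t) := (hu.memLp_time t).locallyIntegrable (by norm_num)

theorem IsSolution.continuous_mollify_position (hu : IsSolution p u Du ut) (n : ℕ) :
    Continuous fun z : ℝ × E3 => mollify n (u z.1) z.2 :=
  continuous_kernel (rho_continuous n) (rho_hasCompactSupport n) (by norm_num)
    (fun t => (hu.homogeneousH1 t).memLp) hu.tendsto_position

theorem IsSolution.continuous_mollify_velocity (hu : IsSolution p u Du ut) (n : ℕ) :
    Continuous fun z : ℝ × E3 => mollify n (ut z.1) z.2 :=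
  continuous_kernel (rho_continuous n) (rho_hasCompactSupport n) (by norm_num)
    hu.memLp_time hu.continuous_time

theorem IsSolution.continuous_mollify_coord (hu : IsSolution p u Du ut) (n : ℕ) (i : Fin 3) :
    Continuous fun z : ℝ × E3 => mollify n (Du z.1) z.2 i := by
  simp_rw [fun t => mollify_apply_coord n (hu.homogeneousH1 t).locallyIntegrable_grad]
  exact continuous_kernel (rho_continuous n) (rho_hasCompactSupport n) (by norm_num)
    (fun t => memLp_coord (hu.homogeneousH1 t).memLp_grad i) (hu.tendsto_coord i)

/-- The second derivatives of the mollified solution. -/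
def hess (Du : ℝ → E3 → E3) (n : ℕ) (t : ℝ) (x : E3) (j i : Fin 3) : ℝ :=
  fderiv ℝ (mollify n fun y => Du t y j) x (basisVec i)

/-- The spatial derivatives of the mollified velocity. -/
def gradV (ut : ℝ → E3 → ℝ) (n : ℕ) (t : ℝ) (x : E3) (i : Fin 3) : ℝ :=
  fderiv ℝ (mollify n (ut t)) x (basisVec i)

theorem IsSolution.continuous_hess (hu : IsSolution p u Du ut) (n : ℕ) (j i : Fin 3) :
    Continuous fun z : ℝ × E3 => hess Du n z.1 z.2 j i := by
  simp_rw [hess, fun t => mollify_lineDeriv n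
    (LocallyIntegrable.coord (hu.homogeneousH1 t).locallyIntegrable_grad j)]
  exact continuous_kernel (rho_deriv_contDiff n i).continuous (rho_deriv_hasCompactSupport n i)
    (by norm_num) (fun t => memLp_coord (hu.homogeneousH1 t).memLp_grad j) (hu.tendsto_coord j)

theorem IsSolution.continuous_gradV (hu : IsSolution p u Du ut) (n : ℕ) (i : Fin 3) :
    Continuous fun z : ℝ × E3 => gradV ut n z.1 z.2 i := by
  simp_rw [gradV, fun t => mollify_lineDeriv n (hu.locallyIntegrable_velocity t)]
  exact continuous_kernel (rho_deriv_contDiff n i).continuous (rho_deriv_hasCompactSupport n i)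
    (by norm_num) hu.memLp_time hu.continuous_time

theorem IsSolution.fderiv_mollify (hu : IsSolution p u Du ut) (n : ℕ) (t : ℝ) (x : E3) (i : Fin 3) :
    fderiv ℝ (mollify n (u t)) x (basisVec i) = mollify n (Du t) x i := by
  rw [mollify_fderiv_of_weakGradient n (hu.homogeneousH1 t).locallyIntegrable
    (hu.homogeneousH1 t).locallyIntegrable_grad (hu.homogeneousH1 t).weakGradient, inner_basisVec]

/-- The components of the mollified gradient are the partial derivatives of the smooth function
`mollify n (u t)`, so its second derivatives commute. -/
theorem IsSolution.hess_symm (hu : IsSolution p u Du ut) (n : ℕ) (t : ℝ) (x : E3) (i j : Fin 3) :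
    hess Du n t x i j = hess Du n t x j i := by
  have hs := mollify_contDiff n (hu.homogeneousH1 t).locallyIntegrable
  have hd : Differentiable ℝ (fderiv ℝ (mollify n (u t))) :=
    (hs.fderiv_right (m := ∞) (by simp)).differentiable (by simp)
  have key : ∀ i j, hess Du n t x i j
      = fderiv ℝ (fderiv ℝ (mollify n (u t))) x (basisVec j) (basisVec i) := by
    intro i j
    have e : (mollify n fun y => Du t y i) = fun x => fderiv ℝ (mollify n (u t)) x (basisVec i) := by
      ext x
      rw [hu.fderiv_mollify, mollify_apply_coord n (hu.homogeneousH1 t).locallyIntegrable_grad]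
    rw [hess, e, fderiv_clm_apply (hd x) (differentiableAt_const _)]
    simp
  rw [key, key]
  exact (hs.contDiffAt.isSymmSndFDerivAt (by simpa using ENat.LEInfty.out)).eq _ _

theorem hasDerivAt_of_sub_eq_integral {f g : ℝ → ℝ} (hg : Continuous g)
    (h : ∀ a b, f b - f a = ∫ t in a..b, g t) (t : ℝ) : HasDerivAt f (g t) t := by
  have : f = fun b => f 0 + ∫ t in (0 : ℝ)..b, g t := by
    ext b; rw [← h 0 b]; ring
  rw [this]
  exact (intervalIntegral.integral_hasDerivAt_right (hg.intervalIntegrable _ _)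
    (hg.stronglyMeasurableAtFilter _ _) hg.continuousAt).const_add _

/-- The mollified velocity is continuous in time, so the integrated identity upgrades to a classical
derivative at every time. -/
theorem IsSolution.hasDerivAt_mollify_position (hu : IsSolution p u Du ut) (n : ℕ) (x : E3) (t : ℝ) :
    HasDerivAt (fun t => mollify n (u t) x) (mollify n (ut t) x) t :=
  hasDerivAt_of_sub_eq_integral
    ((hu.continuous_mollify_velocity n).comp (continuous_id.prodMk continuous_const))
    (fun a b => hu.integral_position (kernel_comp_sub_contDiff (rho_contDiff n) x)
      (hasCompactSupport_comp_sub (rho_hasCompactSupport n) x) a b) t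

theorem IsSolution.hasDerivAt_mollify_coord (hu : IsSolution p u Du ut) (n : ℕ) (x : E3) (i : Fin 3)
    (t : ℝ) : HasDerivAt (fun t => mollify n (Du t) x i) (gradV ut n t x i) t := by
  refine hasDerivAt_of_sub_eq_integral
    ((hu.continuous_gradV n i).comp (continuous_id.prodMk continuous_const)) (fun a b => ?_) t
  simp_rw [← hu.fderiv_mollify, fun t => mollify_lineDeriv n (hu.homogeneousH1 t).locallyIntegrable,
    gradV, fun t => mollify_lineDeriv n (hu.locallyIntegrable_velocity t)]
  exact hu.integral_position (kernel_comp_sub_contDiff (rho_deriv_contDiff n i) x)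
    (hasCompactSupport_comp_sub (rho_deriv_hasCompactSupport n i) x) a b

/-- The right-hand side of the evolution equation of the mollified velocity. -/
def accel (p : ℝ) (u : ℝ → E3 → ℝ) (Du : ℝ → E3 → E3) (n : ℕ) (t : ℝ) (x : E3) : ℝ :=
  (∑ i, hess Du n t x i i) - mollify n (fun y => nonlin p (u t y)) x

theorem IsSolution.locallyIntegrable_mollify_nonlin (hp₃ : 3 ≤ p) (hp₅ : p ≤ 5)
    (hu : IsSolution p u Du ut) (n : ℕ) (x : E3) :
    LocallyIntegrable fun t => mollify n (fun y => nonlin p (u t y)) x :=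
  (hu.locLp_nonlin hp₃ hp₅).locallyIntegrable (by norm_num)
    (kernel_comp_sub_contDiff (rho_contDiff n) x).continuous
    (hasCompactSupport_comp_sub (rho_hasCompactSupport n) x)

theorem IsSolution.locallyIntegrable_accel (hp₃ : 3 ≤ p) (hp₅ : p ≤ 5)
    (hu : IsSolution p u Du ut) (n : ℕ) (x : E3) :
    LocallyIntegrable fun t => accel p u Du n t x := by
  refine LocallyIntegrable.sub (Continuous.locallyIntegrable ?_)
    (hu.locallyIntegrable_mollify_nonlin hp₃ hp₅ n x)
  exact continuous_finsetSum _ fun i _ => (hu.continuous_hess n i i).comp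
    (continuous_id.prodMk continuous_const)

theorem IsSolution.mollify_velocity_sub (hp₃ : 3 ≤ p) (hp₅ : p ≤ 5) (hu : IsSolution p u Du ut)
    (n : ℕ) (x : E3) (a b : ℝ) :
    mollify n (ut b) x - mollify n (ut a) x = ∫ t in a..b, accel p u Du n t x := by
  have h := hu.integral_velocity hp₃ hp₅ (kernel_comp_sub_contDiff (rho_contDiff n) x)
    (hasCompactSupport_comp_sub (rho_hasCompactSupport n) x) a b
  refine h.trans (intervalIntegral.integral_congr fun t _ => ?_)
  simp only [accel]
  congr 1
  rw [← Finset.sum_neg_distrib]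
  refine Finset.sum_congr rfl fun i _ => ?_
  rw [hess, mollify_lineDeriv n
    (LocallyIntegrable.coord (hu.homogeneousH1 t).locallyIntegrable_grad i), ← integral_neg]
  refine integral_congr_ae (.of_forall fun y => ?_)
  simp only [smul_eq_mul]
  rw [fderiv_comp_sub_left ((rho_contDiff n).differentiable (by simp))]
  ring

/-- Only almost every time is available: the mollified nonlinearity is merely locally integrable in
`t`. The fundamental theorem of calculus therefore has to go through absolute continuity. -/
theorem IsSolution.ae_hasDerivAt_mollify_velocity (hp₃ : 3 ≤ p) (hp₅ : p ≤ 5)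
    (hu : IsSolution p u Du ut) (n : ℕ) (x : E3) :
    ∀ᵐ t, HasDerivAt (fun t => mollify n (ut t) x) (accel p u Du n t x) t := by
  filter_upwards [LocallyIntegrable.ae_hasDerivAt_integral
    (hu.locallyIntegrable_accel hp₃ hp₅ n x)] with t ht
  have : (fun t => mollify n (ut t) x)
      = fun t => mollify n (ut 0) x + ∫ s in (0 : ℝ)..t, accel p u Du n s x := by
    ext t; rw [← hu.mollify_velocity_sub hp₃ hp₅]; ring
  rw [this]
  exact (ht 0).const_add _

theorem IsSolution.absolutelyContinuous_mollify_velocity (hp₃ : 3 ≤ p) (hp₅ : p ≤ 5)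
    (hu : IsSolution p u Du ut) (n : ℕ) (x : E3) (a b : ℝ) :
    AbsolutelyContinuousOnInterval (fun t => mollify n (ut t) x) a b := by
  have : (fun t => mollify n (ut t) x)
      = (fun t => ∫ s in a..t, accel p u Du n s x) + fun _ => mollify n (ut a) x := by
    ext t; rw [Pi.add_apply, ← hu.mollify_velocity_sub hp₃ hp₅]; ring
  rw [this]
  exact (LocallyIntegrable.intervalIntegrable' (hu.locallyIntegrable_accel hp₃ hp₅ n x) _ _
    |>.absolutelyContinuousOnInterval_intervalIntegral left_mem_uIcc).add
    (contDiff_const (n := 1)).contDiffOn.absolutelyContinuousOnInterval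

theorem absolutelyContinuous_of_hasDerivAt {f f' : ℝ → ℝ} (h : ∀ t, HasDerivAt f (f' t) t)
    (hc : Continuous f') (a b : ℝ) : AbsolutelyContinuousOnInterval f a b := by
  refine ContDiffOn.absolutelyContinuousOnInterval (ContDiff.contDiffOn ?_)
  rw [contDiff_one_iff_deriv]
  exact ⟨fun t => (h t).differentiableAt, by rwa [funext fun t => (h t).deriv]⟩

end Solution

end WaveEnergy
end

noncomputable section
namespace WaveEnergy

/-! ### The conservation law for the mollified solution -/

theorem LPlus_eq (a : ℝ) (g : E3) (b : ℝ) (x : E3) :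
    LPlus a g b x = (∑ j, g j * radial x j) + a * ‖x‖⁻¹ + b := by
  rw [LPlus, inner_eq_sum, div_eq_mul_inv]

theorem norm_angular_sq_eq (g x : E3) :
    ‖angular g x‖ ^ 2 = g 0 ^ 2 + g 1 ^ 2 + g 2 ^ 2 - (∑ j, g j * radial x j) ^ 2 := by
  rw [norm_angular_sq, norm_sq_eq_sum, inner_eq_sum]

/-- The vector field whose divergence enters the conservation law. -/
def field (α : ℝ → ℝ) (β U V Ψ : E3 → ℝ) (G : E3 → E3) (i : Fin 3) (x : E3) : ℝ :=
  1 / 4 * α ‖x‖ * (LPlus (U x) (G x) (V x) x ^ 2 - ‖angular (G x) x‖ ^ 2) * radial x i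
    + 1 / 2 * α ‖x‖ * LPlus (U x) (G x) (V x) x * angular (G x) x i
    - 1 / 2 * α ‖x‖ * Ψ x * radial x i + β x * V x * G x i

section Field

variable {α : ℝ → ℝ} {β U V Ψ : E3 → ℝ} {G : E3 → E3} {δ R : ℝ}

theorem field_eventuallyEq (h0 : ∀ r, r ≤ δ → α r = 0) {x : E3} (hx : ‖x‖ < δ) (i : Fin 3) :
    field α β U V Ψ G i =ᶠ[𝓝 x] fun x => β x * V x * G x i := by
  filter_upwards [(continuous_norm.isOpen_preimage _ isOpen_Iio).mem_nhds hx] with y hy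
  simp [field, h0 _ (le_of_lt hy)]

theorem contDiff_coord (hG : ContDiff ℝ 1 G) (i : Fin 3) : ContDiff ℝ 1 fun x => G x i :=
  (EuclideanSpace.proj i : E3 →L[ℝ] ℝ).contDiff.comp hG

theorem contDiffAt_radial {x : E3} (hx : x ≠ 0) (i : Fin 3) :
    ContDiffAt ℝ 1 (fun x : E3 => radial x i) x :=
  ((contDiffAt_norm ℝ hx).inv (norm_ne_zero_iff.2 hx)).mul
    (contDiff_coord contDiff_id i).contDiffAt

/-- Near the origin `α` kills every singular term and only the `β` term remains; elsewhere the norm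
is smooth. -/
theorem contDiff_field (hδ : 0 < δ) (hα : ContDiff ℝ 1 α) (h0 : ∀ r, r ≤ δ → α r = 0)
    (hβ : ContDiff ℝ 1 β) (hU : ContDiff ℝ 1 U) (hV : ContDiff ℝ 1 V) (hΨ : ContDiff ℝ 1 Ψ)
    (hG : ContDiff ℝ 1 G) (i : Fin 3) : ContDiff ℝ 1 (field α β U V Ψ G i) := by
  rw [contDiff_iff_contDiffAt]
  intro x
  by_cases hx : ‖x‖ < δ
  · refine ContDiffAt.congr_of_eventuallyEq ?_ (field_eventuallyEq h0 hx i)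
    exact ((hβ.mul hV).mul (contDiff_coord hG i)).contDiffAt
  · have hx0 : x ≠ 0 := by
      rintro rfl; simp at hx; linarith
    have ha : ContDiffAt ℝ 1 (fun x : E3 => α ‖x‖) x :=
      hα.contDiffAt.comp x (contDiffAt_norm ℝ hx0)
    have hi := (contDiffAt_norm ℝ hx0 (n := 1)).inv (norm_ne_zero_iff.2 hx0)
    have hr := contDiffAt_radial hx0
    have hg := fun j => (contDiff_coord hG j).contDiffAt (x := x)
    have hγ : ContDiffAt ℝ 1 (fun x => ∑ j, G x j * radial x j) x :=
      ContDiffAt.sum fun j _ => (hg j).mul (hr j)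
    have hL : ContDiffAt ℝ 1 (fun x => LPlus (U x) (G x) (V x) x) x := by
      simp_rw [LPlus_eq]
      exact (hγ.add (hU.contDiffAt.mul hi)).add hV.contDiffAt
    have hQ : ContDiffAt ℝ 1 (fun x => ‖angular (G x) x‖ ^ 2) x := by
      simp_rw [norm_angular_sq_eq]
      exact ((((hg 0).pow 2).add ((hg 1).pow 2)).add ((hg 2).pow 2)).sub (hγ.pow 2)
    have hA : ContDiffAt ℝ 1 (fun x => angular (G x) x i) x := by
      simp_rw [angular_apply, inner_eq_sum]
      exact (hg i).sub (hγ.mul (hr i))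
    exact ((((contDiffAt_const.mul ha).mul ((hL.pow 2).sub hQ)).mul (hr i)).add
      (((contDiffAt_const.mul ha).mul hL).mul hA)).sub
      (((contDiffAt_const.mul ha).mul hΨ.contDiffAt).mul (hr i)) |>.add
      ((hβ.contDiffAt.mul hV.contDiffAt).mul (hg i))

theorem hasCompactSupport_field (hR : ∀ r, R ≤ r → α r = 0) (hβR : ∀ x, R ≤ ‖x‖ → β x = 0)
    (i : Fin 3) : HasCompactSupport (field α β U V Ψ G i) := by
  refine HasCompactSupport.intro (isCompact_closedBall (0 : E3) R) fun x hx => ?_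
  rw [mem_closedBall_zero_iff, not_le] at hx
  simp [field, hR _ hx.le, hβR x hx.le]

theorem integral_fderiv_eq_zero {w : E3 → ℝ} (hw : ContDiff ℝ 1 w) (hc : HasCompactSupport w)
    (e : E3) : ∫ x, fderiv ℝ w x e = 0 := by
  have i1 : Integrable fun x => fderiv ℝ w x e :=
    ((hw.continuous_fderiv one_ne_zero).clm_apply continuous_const).integrable_of_hasCompactSupport
      (hc.fderiv_apply ℝ e)
  have h := integral_mul_fderiv_eq_neg_fderiv_mul_of_integrable (f := fun _ : E3 => (1 : ℝ)) (g := w)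
    (v := e) (by simp) (by simpa using i1)
    (by simpa using hw.continuous.integrable_of_hasCompactSupport hc)
    (fun x _ => differentiableAt_const _) fun x _ => hw.differentiable one_ne_zero x
  simpa using h

/-- The divergence of `field`. -/
theorem sum_fderiv_field (hδ : 0 < δ) (hα : ContDiff ℝ 1 α) (h0 : ∀ r, r ≤ δ → α r = 0)
    (hβ : ContDiff ℝ 1 β) (hU : ContDiff ℝ 1 U) (hV : ContDiff ℝ 1 V) (hΨ : ContDiff ℝ 1 Ψ)
    (hG : ContDiff ℝ 1 G) (x : E3) {H : Fin 3 → Fin 3 → ℝ} {V' : Fin 3 → ℝ} {F : ℝ}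
    (hU' : ∀ i, fderiv ℝ U x (basisVec i) = G x i)
    (hH : ∀ j i, fderiv ℝ (fun x => G x j) x (basisVec i) = H j i) (hHs : ∀ i j, H i j = H j i)
    (hV' : ∀ i, fderiv ℝ V x (basisVec i) = V' i)
    (hΨ' : ∀ i, fderiv ℝ Ψ x (basisVec i) = F * G x i) :
    ∑ i, fderiv ℝ (field α β U V Ψ G i) x (basisVec i)
      = deriv α ‖x‖ * (LPlus (U x) (G x) (V x) x ^ 2 / 4 - ‖angular (G x) x‖ ^ 2 / 4 - Ψ x / 2)
        + α ‖x‖ * (‖angular (G x) x‖ ^ 2 / 2 - Ψ x) * ‖x‖⁻¹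
        + α ‖x‖ / 2 * (LPlus (U x) (G x) (V x) x
            * ((∑ i, V' i * radial x i) + V x * ‖x‖⁻¹ + ∑ i, H i i)
          + (∑ i, V' i * G x i) - (∑ j, G x j * radial x j) * (∑ i, V' i * radial x i)
          - F * ∑ j, G x j * radial x j)
        + V x * fderiv ℝ β x (G x) + β x * ((∑ i, V' i * G x i) + V x * ∑ i, H i i) := by
  have hc := contDiff_field hδ hα h0 hβ hU hV hΨ hG
  have d1 : ∀ {f : E3 → ℝ}, ContDiff ℝ 1 f → ∀ i,
      HasLineDerivAt ℝ f (fderiv ℝ f x (basisVec i)) x (basisVec i) := fun hf i =>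
    (hf.differentiable one_ne_zero x).hasFDerivAt.hasLineDerivAt _
  rw [clm_apply_eq_sum (fderiv ℝ β x)]
  by_cases hx : ‖x‖ < δ
  · have ha : α ‖x‖ = 0 := h0 _ hx.le
    have ha' : deriv α ‖x‖ = 0 := by
      have : α =ᶠ[𝓝 ‖x‖] fun _ => 0 := by
        filter_upwards [Iio_mem_nhds hx] with r hr using h0 r (le_of_lt hr)
      rw [this.deriv_eq]; simp
    have hi : ∀ i, fderiv ℝ (field α β U V Ψ G i) x (basisVec i)
        = fderiv ℝ β x (basisVec i) * V x * G x i + β x * V' i * G x i + β x * V x * H i i := by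
      intro i
      rw [(field_eventuallyEq h0 hx i).fderiv_eq]
      have h := (((hβ.differentiable one_ne_zero x).hasFDerivAt.mul
        (hV.differentiable one_ne_zero x).hasFDerivAt).mul
        ((contDiff_coord hG i).differentiable one_ne_zero x).hasFDerivAt).fderiv
      erw [h]
      simp [hV', hH]
      ring
    simp_rw [hi, ha, ha', Fin.sum_univ_three]
    ring
  · have hx0 : x ≠ 0 := by
      rintro rfl; simp at hx; linarith
    have e0 : ∀ i : Fin 3, x + (0 : ℝ) • basisVec i = x := fun i => by simp
    -- The value left open is supplied by `hasDerivAt_field`, applied along the line through `x` in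
    -- the direction `basisVec i`. The three values are then summed with `divergence_algebra`.
    have key : ∀ i, fderiv ℝ (field α β U V Ψ G i) x (basisVec i) = _ := fun i => by
      refine HasLineDerivAt.unique (d1 (hc i) i) ?_
      have ha : HasDerivAt (fun h : ℝ => α ‖x + h • basisVec i‖) (deriv α ‖x‖ * radial x i) 0 := by
        have h1 : HasDerivAt α (deriv α ‖x‖) ‖x + (0 : ℝ) • basisVec i‖ := by
          rw [e0]; exact (hα.differentiable one_ne_zero _).hasDerivAt
        exact h1.comp 0 (hasLineDerivAt_norm hx0 i)
      have hG1 : ∀ j, HasDerivAt (fun h : ℝ => G (x + h • basisVec i) j) (H j i) 0 := fun j => by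
        rw [← hH]; exact d1 (contDiff_coord hG j) i
      have hw : ∀ j, HasDerivAt (fun h : ℝ => radial (x + h • basisVec i) j) _ 0 := fun j =>
        hasLineDerivAt_radial hx0 i j
      have hγ := hasDerivAt_radial_component hG1 hw
      have hQ := hasDerivAt_angular_sq hG1 hγ
      have hL := (hγ.add (HasDerivAt.mul (d1 hU i) (hasLineDerivAt_norm_inv hx0 i))).add (d1 hV i)
      have hfield := hasDerivAt_field i ha hL hQ hγ hw hG1 (d1 hV i) (d1 hβ i) (d1 hΨ i)
      refine HasDerivAt.congr_of_eventuallyEq hfield (.of_forall fun h => ?_)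
      simp only [field, LPlus_eq, norm_angular_sq_eq, angular_apply, inner_eq_sum]
      rfl
    rw [Fin.sum_univ_three, key 0, key 1, key 2]
    simp only [e0, LPlus_eq, norm_angular_sq_eq, hU', hV', hΨ', Pi.add_apply, Pi.mul_apply]
    have hs := sum_radial_sq hx0
    have alg := divergence_algebra (s := ‖x‖⁻¹) (a := α ‖x‖) (a' := deriv α ‖x‖) (U := U x) (V := V x)
      (V0 := V' 0) (V1 := V' 1) (V2 := V' 2) (Ψ := Ψ x) (F := F) (b := β x)
      (b0 := fderiv ℝ β x (basisVec 0)) (b1 := fderiv ℝ β x (basisVec 1))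
      (b2 := fderiv ℝ β x (basisVec 2)) (H00 := H 0 0) (H01 := H 0 1) (H02 := H 0 2)
      (H11 := H 1 1) (H12 := H 1 2) (H22 := H 2 2) (G0 := G x 0) (G1 := G x 1) (G2 := G x 2)
      hs rfl rfl rfl rfl rfl rfl rfl rfl rfl rfl rfl rfl
    simp only [Fin.sum_univ_three, hHs 1 0, hHs 2 0, hHs 2 1]
    simp only [if_true, if_neg (show (0 : Fin 3) ≠ 1 by decide), if_neg (show (0 : Fin 3) ≠ 2 by decide),
      if_neg (show (1 : Fin 3) ≠ 0 by decide), if_neg (show (1 : Fin 3) ≠ 2 by decide),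
      if_neg (show (2 : Fin 3) ≠ 0 by decide), if_neg (show (2 : Fin 3) ≠ 1 by decide)]
    linear_combination alg

end Field

end WaveEnergy
end

noncomputable section
namespace WaveEnergy

/-! ### The weighted energy identity for the mollified solution -/

/-- A weight `A(t, |x|)` for the inward energy, vanishing for `|x| ≤ δ` and `|x| ≥ R`, with
derivatives `At`, `Ar`, and a compactly supported weight `β` for the energy. -/
structure CutWeight (A At Ar : ℝ → ℝ → ℝ) (β : E3 → ℝ) (δ R : ℝ) : Prop where
  pos : 0 < δ
  hasDerivAt_time : ∀ t r, HasDerivAt (fun s => A s r) (At t r) t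
  hasDerivAt_radius : ∀ t r, HasDerivAt (A t) (Ar t r) r
  continuous : Continuous fun q : ℝ × ℝ => A q.1 q.2
  continuous_time : Continuous fun q : ℝ × ℝ => At q.1 q.2
  continuous_radius : Continuous fun q : ℝ × ℝ => Ar q.1 q.2
  zero_of_le : ∀ t r, r ≤ δ → A t r = 0
  zero_of_ge : ∀ t r, R ≤ r → A t r = 0
  contDiff : ContDiff ℝ 1 β
  zero_outside : ∀ x, R ≤ ‖x‖ → β x = 0

/-- The weighted density. -/
def weightedDensity (p : ℝ) (A : ℝ → ℝ → ℝ) (β : E3 → ℝ) (t a : ℝ) (g : E3) (b : ℝ) (x : E3) : ℝ :=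
  A t ‖x‖ * inwardDensity p a g b x + β x * energyDensity p a g b

/-- The rate of change of the weighted density, up to a divergence. -/
def weightedRate (p : ℝ) (A At Ar : ℝ → ℝ → ℝ) (β : E3 → ℝ) (t a : ℝ) (g : E3) (b : ℝ) (x : E3) :
    ℝ :=
  At t ‖x‖ * inwardDensity p a g b x - Ar t ‖x‖ * fluxDensity p a g b x
    - A t ‖x‖ * morawetzDensity p a g x - b * fderiv ℝ β x g

/-- The multiplier of the equation. -/
def multiplier (A : ℝ → ℝ → ℝ) (β : E3 → ℝ) (t a : ℝ) (g : E3) (b : ℝ) (x : E3) : ℝ :=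
  A t ‖x‖ / 2 * LPlus a g b x + β x * b

namespace CutWeight

variable {A At Ar : ℝ → ℝ → ℝ} {β : E3 → ℝ} {δ R : ℝ}

theorem time_zero_of_le (hw : CutWeight A At Ar β δ R) {t r : ℝ} (h : r ≤ δ) : At t r = 0 := by
  have h1 := hw.hasDerivAt_time t r
  simp_rw [hw.zero_of_le _ r h] at h1
  exact h1.unique (hasDerivAt_const _ _)

theorem time_zero_of_ge (hw : CutWeight A At Ar β δ R) {t r : ℝ} (h : R ≤ r) : At t r = 0 := by
  have h1 := hw.hasDerivAt_time t r
  simp_rw [hw.zero_of_ge _ r h] at h1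
  exact h1.unique (hasDerivAt_const _ _)

theorem radius_zero_of_le (hw : CutWeight A At Ar β δ R) {t r : ℝ} (h : r ≤ δ) : Ar t r = 0 := by
  have h1 := (hw.hasDerivAt_radius t r).hasDerivWithinAt (s := Iic r)
  have h2 : HasDerivWithinAt (A t) 0 (Iic r) r :=
    (hasDerivWithinAt_const r (Iic r) (0 : ℝ)).congr
      (fun s hs => hw.zero_of_le t s (le_trans hs h)) (hw.zero_of_le t r h)
  exact (uniqueDiffOn_Iic r r self_mem_Iic).eq_deriv _ h1 h2

theorem radius_zero_of_ge (hw : CutWeight A At Ar β δ R) {t r : ℝ} (h : R ≤ r) : Ar t r = 0 := by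
  have h1 := (hw.hasDerivAt_radius t r).hasDerivWithinAt (s := Ici r)
  have h2 : HasDerivWithinAt (A t) 0 (Ici r) r :=
    (hasDerivWithinAt_const r (Ici r) (0 : ℝ)).congr
      (fun s hs => hw.zero_of_ge t s (h.trans hs)) (hw.zero_of_ge t r h)
  exact (uniqueDiffOn_Ici r r self_mem_Ici).eq_deriv _ h1 h2

theorem contDiff_radius (hw : CutWeight A At Ar β δ R) (t : ℝ) : ContDiff ℝ 1 (A t) := by
  have h : deriv (A t) = Ar t := by
    ext r; exact (hw.hasDerivAt_radius t r).deriv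
  rw [contDiff_one_iff_deriv, h]
  exact ⟨fun r => (hw.hasDerivAt_radius t r).differentiableAt,
    hw.continuous_radius.comp (continuous_const.prodMk continuous_id)⟩

theorem fderiv_zero (hw : CutWeight A At Ar β δ R) {x : E3} (hx : R < ‖x‖) : fderiv ℝ β x = 0 := by
  have : β =ᶠ[𝓝 x] fun _ => 0 := by
    filter_upwards [(continuous_norm.isOpen_preimage _ isOpen_Ioi).mem_nhds hx] with y hy
    exact hw.zero_outside y (le_of_lt hy)
  rw [this.fderiv_eq]; simp

end CutWeight

/-- The weight vanishes in a neighbourhood of `x = 0`, so `f` may be singular there, as are all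
quantities involving `x / |x|` or `u / |x|`. -/
theorem continuous_cut_mul {A : ℝ → ℝ → ℝ} {δ : ℝ} (hδ : 0 < δ)
    (hA : Continuous fun q : ℝ × ℝ => A q.1 q.2) (h0 : ∀ t r, r ≤ δ → A t r = 0)
    {f : ℝ × E3 → ℝ} (hf : ∀ z, z.2 ≠ 0 → ContinuousAt f z) :
    Continuous fun z : ℝ × E3 => A z.1 ‖z.2‖ * f z := by
  rw [continuous_iff_continuousAt]
  intro z
  by_cases hz : z.2 = 0
  · refine continuousAt_const.congr (f := fun _ => (0 : ℝ)) ?_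
    have : {z : ℝ × E3 | ‖z.2‖ < δ} ∈ 𝓝 z :=
      (isOpen_lt (continuous_snd.norm) continuous_const).mem_nhds (by simpa [hz] using hδ)
    filter_upwards [this] with y hy
    simp [h0 y.1 ‖y.2‖ (le_of_lt hy)]
  · exact (hA.comp (continuous_fst.prodMk continuous_snd.norm)).continuousAt.mul (hf z hz)

/-- Mollification acts on slices, so a strongly measurable representative is substituted first. By
Fubini it agrees with `f` on almost every time slice, and for those times the integrals over `y`
coincide at every `x`. -/
theorem aestronglyMeasurable_mollify {F : Type*} [NormedAddCommGroup F] [NormedSpace ℝ F]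
    (n : ℕ) {f : ℝ → E3 → F}
    (hf : AEStronglyMeasurable (fun z : ℝ × E3 => f z.1 z.2) volume) :
    AEStronglyMeasurable (fun z : ℝ × E3 => mollify n (f z.1) z.2) volume := by
  obtain ⟨g, hg, hfg⟩ := hf
  refine ⟨fun z => ∫ y, rho n (z.2 - y) • g (z.1, y), ?_, ?_⟩
  · refine StronglyMeasurable.integral_prod_right'
      (f := fun q : (ℝ × E3) × E3 => rho n (q.1.2 - q.2) • g (q.1.1, q.2)) ?_
    refine StronglyMeasurable.smul (Continuous.stronglyMeasurable ?_) ?_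
    · exact (rho_continuous n).comp ((continuous_snd.comp continuous_fst).sub continuous_snd)
    · exact hg.comp_measurable ((measurable_fst.comp measurable_fst).prodMk measurable_snd)
  · have h1 : ∀ᵐ t : ℝ, ∀ᵐ y : E3, f t y = g (t, y) := by
      rw [Measure.volume_eq_prod] at hfg
      exact Measure.ae_ae_of_ae_prod hfg
    have h2 : ∀ᵐ z : ℝ × E3, ∀ᵐ y : E3, f z.1 y = g (z.1, y) := by
      rw [Measure.volume_eq_prod]
      exact Measure.quasiMeasurePreserving_fst.ae h1
    filter_upwards [h2] with z hz
    refine integral_congr_ae ?_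
    filter_upwards [hz] with y hy
    simp only [hy]

theorem integrableOn_of_continuous {f : ℝ × E3 → ℝ} (hf : Continuous f) {R : ℝ}
    (h0 : ∀ z, R < ‖z.2‖ → f z = 0) (t₁ t₂ : ℝ) : IntegrableOn f (Icc t₁ t₂ ×ˢ univ) := by
  refine IntegrableOn.of_forall_sdiff_eq_zero (s := Icc t₁ t₂ ×ˢ Metric.closedBall (0 : E3) R)
    (hf.continuousOn.integrableOn_compact (isCompact_Icc.prod (isCompact_closedBall _ _)))
    (measurableSet_Icc.prod MeasurableSet.univ) fun z hz => h0 z ?_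
  by_contra h
  exact hz.2 ⟨hz.1.1, by simpa using h⟩

section Solution

variable {p : ℝ} {u : ℝ → E3 → ℝ} {Du : ℝ → E3 → E3} {ut : ℝ → E3 → ℝ}
  {A At Ar : ℝ → ℝ → ℝ} {β : E3 → ℝ} {δ R : ℝ}

theorem contDiff_one_potential {p : ℝ} (hp : 1 < p) : ContDiff ℝ 1 (potential p) := by
  have h : deriv (potential p) = nonlin p := by
    ext r; exact (hasDerivAt_potential hp.le r).deriv
  rw [contDiff_one_iff_deriv, h]
  exact ⟨fun r => (hasDerivAt_potential hp.le r).differentiableAt, continuous_nonlin hp⟩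

theorem continuousAt_radial {z : ℝ × E3} (hz : z.2 ≠ 0) (i : Fin 3) :
    ContinuousAt (fun z : ℝ × E3 => radial z.2 i) z :=
  (contDiffAt_radial hz i).continuousAt.comp continuous_snd.continuousAt

theorem continuousAt_LPlus {U V : ℝ × E3 → ℝ} {G : ℝ × E3 → E3} (hU : Continuous U)
    (hV : Continuous V) (hG : ∀ i, Continuous fun z => G z i) {z : ℝ × E3} (hz : z.2 ≠ 0) :
    ContinuousAt (fun z => LPlus (U z) (G z) (V z) z.2) z := by
  simp_rw [LPlus_eq]
  exact ((tendsto_finsetSum _ fun j _ => (hG j).continuousAt.mul (continuousAt_radial hz j)).add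
    (hU.continuousAt.mul (continuous_snd.norm.continuousAt.inv₀ (norm_ne_zero_iff.2 hz)))).add
    hV.continuousAt

theorem continuousAt_angular {G : ℝ × E3 → E3} (hG : ∀ i, Continuous fun z => G z i)
    {z : ℝ × E3} (hz : z.2 ≠ 0) :
    ContinuousAt (fun z => ‖angular (G z) z.2‖ ^ 2) z := by
  simp_rw [norm_angular_sq_eq]
  exact ((((hG 0).pow 2).add ((hG 1).pow 2)).add ((hG 2).pow 2)).continuousAt.sub
    ((tendsto_finsetSum _ fun j _ => (hG j).continuousAt.mul (continuousAt_radial hz j)).pow 2)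

/-- The mollified acceleration without the nonlinear term enters the time derivative of the weighted
density through this expression. -/
def densityDeriv (p : ℝ) (A At : ℝ → ℝ → ℝ) (β : E3 → ℝ) (t a : ℝ) (g : E3) (b : ℝ)
    (V' : Fin 3 → ℝ) (c : ℝ) (x : E3) : ℝ :=
  At t ‖x‖ * inwardDensity p a g b x
    + A t ‖x‖ * (LPlus a g b x * ((∑ j, V' j * radial x j) + b * ‖x‖⁻¹ + c) / 2
      + (2 * (g 0 * V' 0 + g 1 * V' 1 + g 2 * V' 2)
          - 2 * (∑ j, g j * radial x j) * ∑ j, V' j * radial x j) / 4 + nonlin p a * b / 2)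
    + β x * (g 0 * V' 0 + g 1 * V' 1 + g 2 * V' 2 + b * c + nonlin p a * b)

theorem hasDerivAt_weightedDensity (hp : 1 ≤ p) (hw : CutWeight A At Ar β δ R) {U V : ℝ → ℝ}
    {G : ℝ → E3} {V' : Fin 3 → ℝ} {c t : ℝ} {x : E3} (hU : HasDerivAt U (V t) t)
    (hG : ∀ j, HasDerivAt (fun t => G t j) (V' j) t) (hV : HasDerivAt V c t) :
    HasDerivAt (fun t => weightedDensity p A β t (U t) (G t) (V t) x)
      (densityDeriv p A At β t (U t) (G t) (V t) V' c x) t := by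
  have hγ := hasDerivAt_radial_component hG (fun j => hasDerivAt_const t (radial x j))
  have hL := (hγ.add (hU.mul_const ‖x‖⁻¹)).add hV
  have h := hasDerivAt_density (hw.hasDerivAt_time t ‖x‖) hL (hasDerivAt_angular_sq hG hγ) hG hV
    (β x) ((hasDerivAt_potential hp (U t)).comp t hU)
  refine (h.congr_of_eventuallyEq (.of_forall fun s => ?_)).congr_deriv ?_
  · simp only [weightedDensity, inwardDensity, energyDensity, LPlus_eq, norm_angular_sq_eq,
      Pi.add_apply, Function.comp]
    rw [norm_sq_eq_sum]
  · simp only [densityDeriv, inwardDensity, LPlus_eq, norm_angular_sq_eq, Pi.add_apply,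
      Function.comp, mul_zero, add_zero]

/-- Affine dependence on the acceleration. It separates the part continuous in space-time from the
nonlinear part, which is only integrable in time. -/
theorem densityDeriv_sub (t a : ℝ) (g : E3) (b : ℝ) (V' : Fin 3 → ℝ) (c F : ℝ) (x : E3) :
    densityDeriv p A At β t a g b V' (c - F) x
      = densityDeriv p A At β t a g b V' c x - multiplier A β t a g b x * F := by
  simp only [densityDeriv, multiplier]
  ring

/-- The balance law for a state whose acceleration is the Laplacian minus an arbitrary `F`. Keeping
`F` free leaves the error `nonlin p (U x) - F`; for the mollified solution this is the commutator of
mollification and nonlinearity. -/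
theorem densityDeriv_eq (hp : 1 ≤ p) (hw : CutWeight A At Ar β δ R) {t : ℝ} {U V : E3 → ℝ}
    {G : E3 → E3} {H : Fin 3 → Fin 3 → ℝ} {V' : Fin 3 → ℝ} (F x)
    (hU : ContDiff ℝ 1 U) (hV : ContDiff ℝ 1 V) (hG : ContDiff ℝ 1 G)
    (hΨ : ContDiff ℝ 1 fun x => potential p (U x))
    (hU' : ∀ i, fderiv ℝ U x (basisVec i) = G x i)
    (hH : ∀ j i, fderiv ℝ (fun x => G x j) x (basisVec i) = H j i) (hHs : ∀ i j, H i j = H j i)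
    (hV' : ∀ i, fderiv ℝ V x (basisVec i) = V' i) :
    densityDeriv p A At β t (U x) (G x) (V x) V' ((∑ i, H i i) - F) x
      = ∑ i, fderiv ℝ (field (A t) β U V (fun x => potential p (U x)) G i) x (basisVec i)
        + (weightedRate p A At Ar β t (U x) (G x) (V x) x
          + multiplier A β t (U x) (G x) (V x) x * (nonlin p (U x) - F)) := by
  have hΨ' : ∀ i, fderiv ℝ (fun x => potential p (U x)) x (basisVec i)
      = nonlin p (U x) * G x i := fun i => by
    have h := (hasDerivAt_potential hp (U x)).comp_hasFDerivAt x
      (hU.differentiable one_ne_zero x).hasFDerivAt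
    have h2 := h.fderiv
    simp only [Function.comp_def] at h2
    rw [h2]
    simp [hU']
  rw [sum_fderiv_field hw.pos (hw.contDiff_radius t) (hw.zero_of_le t) hw.contDiff hU hV hΨ hG x
    hU' hH hHs hV' hΨ', (hw.hasDerivAt_radius t ‖x‖).deriv]
  have hm := mul_nonlin hp (U x)
  simp only [densityDeriv, weightedRate, multiplier, inwardDensity, fluxDensity, morawetzDensity,
    LPlus_eq, Fin.sum_univ_three]
  linear_combination -A t ‖x‖ / 2 * ‖x‖⁻¹ * hm

theorem continuous_weightedDensity (hp : 1 ≤ p) (hw : CutWeight A At Ar β δ R) {U V : ℝ × E3 → ℝ}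
    {G : ℝ × E3 → E3} (hU : Continuous U) (hV : Continuous V)
    (hG : ∀ i, Continuous fun z => G z i) :
    Continuous fun z : ℝ × E3 => weightedDensity p A β z.1 (U z) (G z) (V z) z.2 := by
  have hP : Continuous fun z => potential p (U z) :=
    (continuous_iff_continuousAt.2 fun s => (hasDerivAt_potential hp s).continuousAt).comp hU
  refine Continuous.add (continuous_cut_mul hw.pos hw.continuous hw.zero_of_le fun z hz => ?_) ?_
  · exact ((((continuousAt_LPlus hU hV hG hz).pow 2).div_const 4).add
      ((continuousAt_angular hG hz).div_const 4)).add (hP.continuousAt.div_const 2)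
  · refine (hw.contDiff.continuous.comp continuous_snd).mul ?_
    simp_rw [energyDensity, norm_sq_eq_sum]
    exact ((((((hG 0).pow 2).add ((hG 1).pow 2)).add ((hG 2).pow 2)).div_const 2).add
      ((hV.pow 2).div_const 2)).add hP

theorem continuous_multiplier (hw : CutWeight A At Ar β δ R) {U V : ℝ × E3 → ℝ}
    {G : ℝ × E3 → E3} (hU : Continuous U) (hV : Continuous V)
    (hG : ∀ i, Continuous fun z => G z i) :
    Continuous fun z : ℝ × E3 => multiplier A β z.1 (U z) (G z) (V z) z.2 := by
  simp_rw [multiplier]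
  refine Continuous.add ?_ ((hw.contDiff.continuous.comp continuous_snd).mul hV)
  refine continuous_cut_mul (A := fun t r => A t r / 2) hw.pos (hw.continuous.div_const 2)
    (fun t r hr => by simp [hw.zero_of_le t r hr]) fun z hz => continuousAt_LPlus hU hV hG hz

theorem continuous_densityDeriv (hp : 1 < p) (hw : CutWeight A At Ar β δ R) {U V c : ℝ × E3 → ℝ}
    {G : ℝ × E3 → E3} {V' : ℝ × E3 → Fin 3 → ℝ} (hU : Continuous U) (hV : Continuous V)
    (hG : ∀ i, Continuous fun z => G z i) (hV' : ∀ i, Continuous fun z => V' z i)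
    (hc : Continuous c) :
    Continuous fun z : ℝ × E3 => densityDeriv p A At β z.1 (U z) (G z) (V z) (V' z) (c z) z.2 := by
  have hP : Continuous fun z => potential p (U z) :=
    (continuous_iff_continuousAt.2 fun s => (hasDerivAt_potential hp.le s).continuousAt).comp hU
  have hN : Continuous fun z => nonlin p (U z) := (continuous_nonlin hp).comp hU
  have hGV : Continuous fun z => G z 0 * V' z 0 + G z 1 * V' z 1 + G z 2 * V' z 2 :=
    (((hG 0).mul (hV' 0)).add ((hG 1).mul (hV' 1))).add ((hG 2).mul (hV' 2))
  refine Continuous.add (Continuous.add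
    (continuous_cut_mul hw.pos hw.continuous_time (fun t r hr => hw.time_zero_of_le hr)
      fun z hz => ?_)
    (continuous_cut_mul hw.pos hw.continuous hw.zero_of_le fun z hz => ?_)) ?_
  · exact ((((continuousAt_LPlus hU hV hG hz).pow 2).div_const 4).add
      ((continuousAt_angular hG hz).div_const 4)).add (hP.continuousAt.div_const 2)
  · have hi : ContinuousAt (fun z : ℝ × E3 => ‖z.2‖⁻¹) z :=
      continuous_snd.norm.continuousAt.inv₀ (norm_ne_zero_iff.2 hz)
    have h1 : ContinuousAt (fun z => ∑ j, V' z j * radial z.2 j) z :=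
      tendsto_finsetSum _ fun j _ => (hV' j).continuousAt.mul (continuousAt_radial hz j)
    have h2 : ContinuousAt (fun z => ∑ j, G z j * radial z.2 j) z :=
      tendsto_finsetSum _ fun j _ => (hG j).continuousAt.mul (continuousAt_radial hz j)
    exact ((((continuousAt_LPlus hU hV hG hz).mul
      ((h1.add (hV.continuousAt.mul hi)).add hc.continuousAt)).div_const 2).add
      ((((hGV.continuousAt).const_mul 2).sub ((h2.const_mul 2).mul h1)).div_const 4)).add
      (((hN.mul hV).div_const 2).continuousAt)
  · exact (hw.contDiff.continuous.comp continuous_snd).mul ((hGV.add (hV.mul hc)).add (hN.mul hV))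

end Solution

end WaveEnergy
end

/-! ### Integrating the mollified balance law over space and time -/

noncomputable section
namespace WaveEnergy

theorem volume_restrict_strip (t₁ t₂ : ℝ) :
    (volume : Measure (ℝ × E3)).restrict (Icc t₁ t₂ ×ˢ univ)
      = (volume.restrict (Icc t₁ t₂)).prod volume := by
  rw [Measure.volume_eq_prod, ← Measure.prod_restrict, Measure.restrict_univ]

/-- On the bounded set that supports `m` over the time interval, the mollification is bounded
uniformly in `x` by `‖f t‖` in `L²`, which is integrable in time. -/
theorem integrableOn_mul_mollify {m : ℝ × E3 → ℝ} (hm : Continuous m) {R : ℝ}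
    (h0 : ∀ z, R < ‖z.2‖ → m z = 0) {f : ℝ → E3 → ℝ} (hf : LocLp 2 f) (n : ℕ) (t₁ t₂ : ℝ) :
    IntegrableOn (fun z => m z * mollify n (f z.1) z.2) (Icc t₁ t₂ ×ˢ univ) := by
  obtain ⟨C, hC⟩ := (isCompact_Icc.prod (isCompact_closedBall (0 : E3) R)).exists_bound_of_continuousOn
    (s := Icc t₁ t₂ ×ˢ Metric.closedBall (0 : E3) R) hm.continuousOn
  obtain ⟨C', hC', hk⟩ := exists_enorm_kernel_le (rho_continuous n) (rho_hasCompactSupport n)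
    (q := 2) (by norm_num)
  have hmeas : AEStronglyMeasurable (fun z : ℝ × E3 => m z * mollify n (f z.1) z.2) volume :=
    hm.aestronglyMeasurable.mul (aestronglyMeasurable_mollify n hf.meas)
  refine ⟨hmeas.restrict, ?_⟩
  have hv := volume_restrict_strip t₁ t₂
  rw [HasFiniteIntegral, lintegral_congr_ae (.of_forall fun z => rfl), hv,
    lintegral_prod _ (by rw [← hv]; exact hmeas.restrict.enorm)]
  have hfm : ∀ᵐ t : ℝ, AEStronglyMeasurable (f t) volume := hf.meas.prodMk_left
  have hb : ∀ᵐ t ∂(volume.restrict (Icc t₁ t₂)),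
      ∫⁻ x, ‖m (t, x) * mollify n (f t) x‖ₑ
        ≤ (ENNReal.ofReal C * C' * volume (Metric.closedBall (0 : E3) R)) * eLpNorm (f t) 2 volume := by
    filter_upwards [ae_restrict_of_ae hfm, ae_restrict_mem measurableSet_Icc] with t ht htI
    calc ∫⁻ x, ‖m (t, x) * mollify n (f t) x‖ₑ
        ≤ ∫⁻ x, (Metric.closedBall (0 : E3) R).indicator
            (fun _ => ENNReal.ofReal C * (C' * eLpNorm (f t) 2 volume)) x := by
          refine lintegral_mono fun x => ?_
          by_cases hx : x ∈ Metric.closedBall (0 : E3) R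
          · rw [indicator_of_mem hx, enorm_mul]
            refine mul_le_mul' ?_ (hk (f t) x ht)
            rw [← ofReal_norm]
            exact ENNReal.ofReal_le_ofReal (hC (t, x) ⟨htI, hx⟩)
          · rw [indicator_of_notMem hx, h0 (t, x) (by simpa using hx)]; simp
      _ = _ := by
          rw [lintegral_indicator measurableSet_closedBall, setLIntegral_const]
          ring
  refine (lintegral_mono_ae hb).trans_lt ?_
  have hfin : ENNReal.ofReal C * C' * volume (Metric.closedBall (0 : E3) R) < ⊤ :=
    ENNReal.mul_lt_top (ENNReal.mul_lt_top ENNReal.ofReal_lt_top hC'.lt_top)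
      measure_closedBall_lt_top
  rw [lintegral_const_mul' _ _ hfin.ne]
  exact ENNReal.mul_lt_top hfin (hf.lint t₁ t₂)

theorem Continuous.slice {f : ℝ × E3 → ℝ} (hf : Continuous f) (x : E3) :
    Continuous fun t => f (t, x) := by
  have h := hf.comp (continuous_id.prodMk (continuous_const (y := x)))
  exact h

theorem absolutelyContinuous_const (c a b : ℝ) :
    AbsolutelyContinuousOnInterval (fun _ : ℝ => c) a b :=
  (contDiff_const (n := 1)).contDiffOn.absolutelyContinuousOnInterval

theorem absolutelyContinuous_density {A U V P : ℝ → ℝ} {G : Fin 3 → ℝ → ℝ} {t₁ t₂ : ℝ}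
    (hA : AbsolutelyContinuousOnInterval A t₁ t₂) (hU : AbsolutelyContinuousOnInterval U t₁ t₂)
    (hV : AbsolutelyContinuousOnInterval V t₁ t₂) (hP : AbsolutelyContinuousOnInterval P t₁ t₂)
    (hG : ∀ i, AbsolutelyContinuousOnInterval (G i) t₁ t₂) (w : E3) (s β : ℝ) :
    AbsolutelyContinuousOnInterval (fun t => A t * (((∑ j, G j t * w j) + U t * s + V t) ^ 2 / 4
      + (G 0 t ^ 2 + G 1 t ^ 2 + G 2 t ^ 2 - (∑ j, G j t * w j) ^ 2) / 4 + P t / 2)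
      + β * ((G 0 t ^ 2 + G 1 t ^ 2 + G 2 t ^ 2) / 2 + V t ^ 2 / 2 + P t)) t₁ t₂ := by
  have hc := fun c => absolutelyContinuous_const c t₁ t₂
  have hγ : AbsolutelyContinuousOnInterval (fun t => ∑ j, G j t * w j) t₁ t₂ := by
    simp_rw [Fin.sum_univ_three]
    exact (((hG 0).mul (hc (w 0))).add ((hG 1).mul (hc (w 1)))).add ((hG 2).mul (hc (w 2)))
  have hL : AbsolutelyContinuousOnInterval (fun t => (∑ j, G j t * w j) + U t * s + V t) t₁ t₂ :=
    (hγ.add (hU.mul (hc s))).add hV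
  have hS : AbsolutelyContinuousOnInterval
      (fun t => G 0 t * G 0 t + G 1 t * G 1 t + G 2 t * G 2 t) t₁ t₂ :=
    (((hG 0).mul (hG 0)).add ((hG 1).mul (hG 1))).add ((hG 2).mul (hG 2))
  have h1 := hA.mul ((((hL.mul hL).mul (hc (1 / 4))).add
      ((hS.sub (hγ.mul hγ)).mul (hc (1 / 4)))).add (hP.mul (hc (1 / 2))))
  have h2 := (hc β).mul (((hS.mul (hc (1 / 2))).add ((hV.mul hV).mul (hc (1 / 2)))).add hP)
  refine (congrArg (AbsolutelyContinuousOnInterval · t₁ t₂) (funext fun t => ?_)).mp (h1.add h2)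
  simp only [Pi.add_apply, Pi.mul_apply, Pi.sub_apply]
  ring

section Solution

variable {p : ℝ} {u : ℝ → E3 → ℝ} {Du : ℝ → E3 → E3} {ut : ℝ → E3 → ℝ}
  {A At Ar : ℝ → ℝ → ℝ} {β : E3 → ℝ} {δ R : ℝ}

/-- At fixed `x` the density combines absolutely continuous functions of time. Differentiability
almost everywhere would not by itself justify the fundamental theorem of calculus. -/
theorem absolutelyContinuous_weightedDensity (hp₃ : 3 ≤ p) (hp₅ : p ≤ 5)
    (hu : IsSolution p u Du ut) (hw : CutWeight A At Ar β δ R) (n : ℕ) (x : E3) (t₁ t₂ : ℝ) :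
    AbsolutelyContinuousOnInterval (fun t => weightedDensity p A β t (mollify n (u t) x)
      (mollify n (Du t) x) (mollify n (ut t) x) x) t₁ t₂ := by
  have cU : Continuous fun t => mollify n (u t) x :=
    Continuous.slice (hu.continuous_mollify_position n) x
  have cV : Continuous fun t => mollify n (ut t) x :=
    Continuous.slice (hu.continuous_mollify_velocity n) x
  have cG : ∀ i, Continuous fun t => gradV ut n t x i := fun i =>
    Continuous.slice (hu.continuous_gradV n i) x
  have hV := hu.absolutelyContinuous_mollify_velocity hp₃ hp₅ n x t₁ t₂
  have hU := absolutelyContinuous_of_hasDerivAt (hu.hasDerivAt_mollify_position n x) cV t₁ t₂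
  have hG := fun i =>
    absolutelyContinuous_of_hasDerivAt (hu.hasDerivAt_mollify_coord n x i) (cG i) t₁ t₂
  have hP : AbsolutelyContinuousOnInterval (fun t => potential p (mollify n (u t) x)) t₁ t₂ :=
    absolutelyContinuous_of_hasDerivAt
      (f' := fun t => nonlin p (mollify n (u t) x) * mollify n (ut t) x)
      (fun t => (hasDerivAt_potential (by linarith : 1 ≤ p) _).comp t
        (hu.hasDerivAt_mollify_position n x t))
      (((continuous_nonlin (by linarith)).comp cU).mul cV) t₁ t₂
  have hA : AbsolutelyContinuousOnInterval (fun t => A t ‖x‖) t₁ t₂ :=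
    absolutelyContinuous_of_hasDerivAt (fun t => hw.hasDerivAt_time t ‖x‖)
      (hw.continuous_time.comp (continuous_id.prodMk continuous_const)) t₁ t₂
  have h := absolutelyContinuous_density (G := fun i t => mollify n (Du t) x i) hA hU hV hP hG (radial x) ‖x‖⁻¹ (β x)
  convert h using 2 with t
  rw [weightedDensity, inwardDensity, energyDensity, LPlus_eq, norm_angular_sq_eq, norm_sq_eq_sum]

/-- The rate of change of the weighted density of the mollified solution, up to a divergence. -/
def mollifiedRate (p : ℝ) (u : ℝ → E3 → ℝ) (Du : ℝ → E3 → E3) (ut : ℝ → E3 → ℝ)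
    (A At Ar : ℝ → ℝ → ℝ) (β : E3 → ℝ) (n : ℕ) (t : ℝ) (x : E3) : ℝ :=
  weightedRate p A At Ar β t (mollify n (u t) x) (mollify n (Du t) x) (mollify n (ut t) x) x
    + multiplier A β t (mollify n (u t) x) (mollify n (Du t) x) (mollify n (ut t) x) x
      * (nonlin p (mollify n (u t) x) - mollify n (fun y => nonlin p (u t y)) x)

/-- The weighted energy identity for the mollified solution. -/
theorem IsSolution.mollified_identity (hp₃ : 3 ≤ p) (hp₅ : p ≤ 5)
    (hu : IsSolution p u Du ut) (hw : CutWeight A At Ar β δ R) (n : ℕ) {t₁ t₂ : ℝ} (h : t₁ ≤ t₂) :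
    IntegrableOn (fun t => ∫ x, mollifiedRate p u Du ut A At Ar β n t x) (Icc t₁ t₂) ∧
    (∫ x, weightedDensity p A β t₂ (mollify n (u t₂) x) (mollify n (Du t₂) x)
        (mollify n (ut t₂) x) x)
      - ∫ x, weightedDensity p A β t₁ (mollify n (u t₁) x) (mollify n (Du t₁) x)
        (mollify n (ut t₁) x) x
      = ∫ t in Icc t₁ t₂, ∫ x, mollifiedRate p u Du ut A At Ar β n t x := by
  have hp : 1 < p := by linarith
  set U := fun z : ℝ × E3 => mollify n (u z.1) z.2 with hU
  set V := fun z : ℝ × E3 => mollify n (ut z.1) z.2 with hV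
  set G := fun z : ℝ × E3 => mollify n (Du z.1) z.2 with hG
  have cU : Continuous U := hu.continuous_mollify_position n
  have cV : Continuous V := hu.continuous_mollify_velocity n
  have cG : ∀ i, Continuous fun z => G z i := hu.continuous_mollify_coord n
  set T : ℝ × E3 → ℝ := fun z => densityDeriv p A At β z.1 (U z) (G z) (V z)
    (gradV ut n z.1 z.2) (accel p u Du n z.1 z.2) z.2 with hT
  have hTint : IntegrableOn T (Icc t₁ t₂ ×ˢ univ) := by
    -- The first term is continuous with bounded spatial support; the nonlinear source needs the
    -- separate `L¹` in time argument.
    have e : T = fun z => densityDeriv p A At β z.1 (U z) (G z) (V z)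
        (gradV ut n z.1 z.2) (∑ i, hess Du n z.1 z.2 i i) z.2
        - multiplier A β z.1 (U z) (G z) (V z) z.2
          * mollify n (fun y => nonlin p (u z.1 y)) z.2 := by
      ext z; rw [hT]; simp only [accel]; rw [densityDeriv_sub]
    rw [e]
    refine Integrable.sub (integrableOn_of_continuous (R := R) ?_ ?_ t₁ t₂)
      (integrableOn_mul_mollify (R := R) ?_ ?_ (hu.locLp_nonlin hp₃ hp₅) n t₁ t₂)
    · exact continuous_densityDeriv hp hw cU cV cG (fun i => hu.continuous_gradV n i)
        (continuous_finsetSum _ fun i _ => hu.continuous_hess n i i)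
    · intro z hz
      simp [densityDeriv, hw.zero_of_ge _ _ hz.le, hw.time_zero_of_ge hz.le,
        hw.zero_outside _ hz.le]
    · exact continuous_multiplier hw cU cV cG
    · intro z hz
      simp [multiplier, hw.zero_of_ge _ _ hz.le, hw.zero_outside _ hz.le]
  have hDint : ∀ t, Integrable fun x => weightedDensity p A β t (mollify n (u t) x)
      (mollify n (Du t) x) (mollify n (ut t) x) x := fun t => by
    refine Continuous.integrable_of_hasCompactSupport
      ((continuous_weightedDensity hp.le hw cU cV cG).comp (continuous_const.prodMk continuous_id))
      (HasCompactSupport.intro (isCompact_closedBall (0 : E3) R) fun x hx => ?_)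
    rw [mem_closedBall_zero_iff, not_le] at hx
    simp [weightedDensity, hw.zero_of_ge _ _ hx.le, hw.zero_outside _ hx.le]
  -- Integration in time comes first, at fixed `x`; Fubini then exchanges it with the space
  -- integral, so that no differentiation under the integral is needed.
  have hFTC : ∀ x, weightedDensity p A β t₂ (mollify n (u t₂) x) (mollify n (Du t₂) x)
        (mollify n (ut t₂) x) x - weightedDensity p A β t₁ (mollify n (u t₁) x)
        (mollify n (Du t₁) x) (mollify n (ut t₁) x) x = ∫ t in Icc t₁ t₂, T (t, x) := fun x => by
    rw [← (absolutelyContinuous_weightedDensity hp₃ hp₅ hu hw n x t₁ t₂).integral_deriv_eq_sub,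
      intervalIntegral.integral_of_le h, integral_Icc_eq_integral_Ioc]
    refine integral_congr_ae (ae_restrict_of_ae ?_)
    filter_upwards [hu.ae_hasDerivAt_mollify_velocity hp₃ hp₅ n x] with t ht
    exact (hasDerivAt_weightedDensity hp.le hw (hu.hasDerivAt_mollify_position n x t)
      (fun j => hu.hasDerivAt_mollify_coord n x j t) ht).deriv
  rw [IntegrableOn, volume_restrict_strip] at hTint
  suffices hae : ∀ᵐ t ∂(volume.restrict (Icc t₁ t₂)),
      ∫ x, T (t, x) = ∫ x, mollifiedRate p u Du ut A At Ar β n t x by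
    refine ⟨hTint.integral_prod_left.congr hae, ?_⟩
    rw [← integral_sub (hDint t₂) (hDint t₁), integral_congr_ae (.of_forall hFTC),
      ← integral_integral_swap (f := fun t x => T (t, x)) hTint]
    exact integral_congr_ae hae
  filter_upwards [hTint.prod_right_ae] with t ht
  have sU : ContDiff ℝ ∞ (mollify n (u t)) :=
    mollify_contDiff n (hu.homogeneousH1 t).locallyIntegrable
  have sV : ContDiff ℝ ∞ (mollify n (ut t)) := mollify_contDiff n (hu.locallyIntegrable_velocity t)
  have sG : ContDiff ℝ ∞ (mollify n (Du t)) :=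
    mollify_contDiff n (hu.homogeneousH1 t).locallyIntegrable_grad
  have s1 : (1 : WithTop ℕ∞) ≤ ((⊤ : ℕ∞) : WithTop ℕ∞) := by simp
  have sP := (contDiff_one_potential hp).comp (sU.of_le s1)
  have hW := fun i => contDiff_field hw.pos (hw.contDiff_radius t) (hw.zero_of_le t) hw.contDiff
    (sU.of_le s1) (sV.of_le s1) sP (sG.of_le s1) i
  have hWc : ∀ i, HasCompactSupport (field (A t) β (mollify n (u t)) (mollify n (ut t))
    (potential p ∘ mollify n (u t)) (mollify n (Du t)) i) := fun i =>
      hasCompactSupport_field (hw.zero_of_ge t) hw.zero_outside i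
  have hWi : ∀ i, Integrable fun x => fderiv ℝ (field (A t) β (mollify n (u t)) (mollify n (ut t))
      (potential p ∘ mollify n (u t)) (mollify n (Du t)) i) x (basisVec i) := fun i =>
    (((hW i).continuous_fderiv one_ne_zero).clm_apply
      continuous_const).integrable_of_hasCompactSupport ((hWc i).fderiv_apply ℝ _)
  -- The two rates differ by the divergence of a compactly supported `C¹` field, whose integral
  -- vanishes.
  have hpt : ∀ x, mollifiedRate p u Du ut A At Ar β n t x
      = T (t, x) - ∑ i, fderiv ℝ (field (A t) β (mollify n (u t)) (mollify n (ut t))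
      (potential p ∘ mollify n (u t)) (mollify n (Du t)) i) x (basisVec i) := fun x => by
    rw [eq_sub_iff_add_eq, add_comm]
    refine (densityDeriv_eq hp.le hw _ x (sU.of_le s1) (sV.of_le s1) (sG.of_le s1) sP
      (hu.fderiv_mollify n t x) (H := hess Du n t x) (V' := gradV ut n t x) ?_
      (fun i j => hu.hess_symm n t x i j) fun i => rfl).symm
    intro j i
    rw [hess]
    congr 2
    ext y
    exact mollify_apply_coord n (hu.homogeneousH1 t).locallyIntegrable_grad y j
  simp_rw [hpt]
  rw [integral_sub ht (integrable_finsetSum _ fun i _ => hWi i),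
    integral_finsetSum _ fun i _ => hWi i,
    Finset.sum_eq_zero fun i _ => integral_fderiv_eq_zero (hW i) (hWc i) _, sub_zero]

end Solution

end WaveEnergy
end

noncomputable section
namespace WaveEnergy

/-! ### Bounds and measurability of the densities -/

section Bounds

variable {p a b : ℝ} {g x : E3}

theorem potential_nonneg (hp : -1 < p) (s : ℝ) : 0 ≤ potential p s :=
  div_nonneg (Real.rpow_nonneg (abs_nonneg s) _) (by linarith)

/-- For `p ≤ 5` the potential energy is at most critical, so on balls it is controlled by the `L⁶`
norm; the constant `1` accounts for the indicator of a ball in later bounds. -/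
theorem abs_rpow_le_one_add_pow_six (hp₃ : 3 ≤ p) (hp₅ : p ≤ 5) (s : ℝ) :
    |s| ^ (p + 1) ≤ 1 + |s| ^ 6 := by
  rcases le_total |s| 1 with h | h
  · have := Real.rpow_le_one (abs_nonneg s) h (by linarith : 0 ≤ p + 1)
    linarith [pow_nonneg (abs_nonneg s) 6]
  · have := Real.rpow_le_rpow_of_exponent_le h (by push_cast; linarith : p + 1 ≤ (6 : ℕ))
    rw [Real.rpow_natCast] at this
    linarith

theorem sq_le_one_add_pow_six (s : ℝ) : s ^ 2 ≤ 1 + |s| ^ 6 := by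
  have h : |s| ^ 6 = (s ^ 2) ^ 3 := by rw [← sq_abs]; ring
  rw [h]
  have := sq_nonneg s
  rcases le_total (s ^ 2) 1 with h1 | h1
  · have := pow_nonneg this 3; linarith
  · have := le_self_pow₀ h1 (by norm_num : 3 ≠ 0); linarith

theorem potential_le (hp₃ : 3 ≤ p) (hp₅ : p ≤ 5) (s : ℝ) :
    (p + 1) * potential p s ≤ 1 + |s| ^ 6 := by
  rw [potential, mul_div_cancel₀ _ (by linarith)]
  exact abs_rpow_le_one_add_pow_six hp₃ hp₅ s

/-- The sum of the powers of the solution that are integrable in space. -/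
def stateSize (a : ℝ) (g : E3) (b : ℝ) : ℝ := |a| ^ 6 + ‖g‖ ^ 2 + b ^ 2

theorem stateSize_nonneg : 0 ≤ stateSize a g b := by unfold stateSize; positivity

theorem norm_radial_le (x : E3) : ‖radial x‖ ≤ 1 := by
  rcases eq_or_ne x 0 with rfl | hx
  · simp [radial]
  · exact (norm_radial hx).le

theorem abs_inner_radial_le (g x : E3) : |inner ℝ g (radial x)| ≤ ‖g‖ := by
  refine (abs_real_inner_le_norm g _).trans ?_
  exact mul_le_of_le_one_right (norm_nonneg _) (norm_radial_le x)

theorem sq_inner_radial_le (g x : E3) : inner ℝ g (radial x) ^ 2 ≤ ‖g‖ ^ 2 := by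
  rw [← sq_abs (inner ℝ g (radial x))]
  exact pow_le_pow_left₀ (abs_nonneg _) (abs_inner_radial_le g x) 2

theorem norm_angular_sq_le (g x : E3) : ‖angular g x‖ ^ 2 ≤ ‖g‖ ^ 2 := by
  rw [norm_angular_sq]; nlinarith [sq_nonneg (inner ℝ g (radial x))]

theorem LPlus_sq_le : LPlus a g b x ^ 2 ≤ 3 * (‖g‖ ^ 2 + (a * ‖x‖⁻¹) ^ 2 + b ^ 2) := by
  rw [LPlus, div_eq_mul_inv]
  nlinarith [sq_inner_radial_le g x, sq_nonneg (inner ℝ g (radial x) - a * ‖x‖⁻¹),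
    sq_nonneg (inner ℝ g (radial x) - b), sq_nonneg (a * ‖x‖⁻¹ - b)]

theorem inwardDensity_nonneg (hp : -1 < p) : 0 ≤ inwardDensity p a g b x := by
  have := potential_nonneg hp a
  unfold inwardDensity; positivity

theorem abs_fluxDensity_le (hp : -1 < p) : |fluxDensity p a g b x| ≤ inwardDensity p a g b x := by
  have h1 := potential_nonneg hp a
  have h2 := sq_nonneg (LPlus a g b x)
  have h3 := sq_nonneg ‖angular g x‖
  rw [abs_le]
  unfold fluxDensity inwardDensity
  constructor <;> linarith

theorem morawetzDensity_nonneg (hp : 1 ≤ p) : 0 ≤ morawetzDensity p a g x := by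
  have := potential_nonneg (by linarith : -1 < p) a
  have : 0 ≤ (p - 1) / 2 := by linarith
  unfold morawetzDensity; positivity

variable {δ : ℝ}

theorem sq_mul_inv_le (hδ : 0 < δ) (hx : δ ≤ ‖x‖) : (a * ‖x‖⁻¹) ^ 2 ≤ δ⁻¹ ^ 2 * (1 + |a| ^ 6) := by
  have h := inv_anti₀ hδ hx
  have h0 : 0 ≤ ‖x‖⁻¹ := by positivity
  rw [mul_pow, mul_comm]
  exact mul_le_mul (pow_le_pow_left₀ h0 h 2) (sq_le_one_add_pow_six a) (sq_nonneg _) (sq_nonneg _)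

theorem LPlus_sq_le_stateSize (hδ : 0 < δ) (hx : δ ≤ ‖x‖) :
    LPlus a g b x ^ 2 ≤ 3 * (1 + δ⁻¹ ^ 2) * (1 + stateSize a g b) := by
  refine LPlus_sq_le.trans ?_
  have h := sq_mul_inv_le (a := a) hδ hx
  unfold stateSize
  nlinarith [pow_nonneg (abs_nonneg a) 6, sq_nonneg ‖g‖, sq_nonneg b, sq_nonneg δ⁻¹,
    mul_nonneg (sq_nonneg δ⁻¹) (sq_nonneg ‖g‖), mul_nonneg (sq_nonneg δ⁻¹) (sq_nonneg b)]

theorem inwardDensity_le_stateSize (hp₃ : 3 ≤ p) (hp₅ : p ≤ 5) (hδ : 0 < δ) (hx : δ ≤ ‖x‖) :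
    inwardDensity p a g b x ≤ 2 * (1 + δ⁻¹ ^ 2) * (1 + stateSize a g b) := by
  have h1 := LPlus_sq_le_stateSize (a := a) (g := g) (b := b) hδ hx
  have h2 := norm_angular_sq_le g x
  have h3 := potential_le hp₃ hp₅ a
  have h4 := potential_nonneg (by linarith : -1 < p) a
  have h5 : 0 ≤ δ⁻¹ ^ 2 * (1 + stateSize a g b) :=
    mul_nonneg (sq_nonneg _) (by linarith [stateSize_nonneg (a := a) (g := g) (b := b)])
  unfold inwardDensity stateSize at *
  nlinarith [pow_nonneg (abs_nonneg a) 6, sq_nonneg ‖g‖, sq_nonneg b]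

theorem energyDensity_nonneg (hp : -1 < p) : 0 ≤ energyDensity p a g b := by
  have := potential_nonneg hp a
  unfold energyDensity; positivity

theorem energyDensity_le_stateSize (hp₃ : 3 ≤ p) (hp₅ : p ≤ 5) :
    energyDensity p a g b ≤ 1 + stateSize a g b := by
  have h3 := potential_le hp₃ hp₅ a
  have h4 := potential_nonneg (by linarith : -1 < p) a
  unfold energyDensity stateSize
  nlinarith [pow_nonneg (abs_nonneg a) 6, sq_nonneg ‖g‖, sq_nonneg b]

theorem morawetzDensity_le_stateSize (hp₃ : 3 ≤ p) (hp₅ : p ≤ 5) (hδ : 0 < δ) (hx : δ ≤ ‖x‖) :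
    morawetzDensity p a g x ≤ δ⁻¹ * (1 + stateSize a g b) := by
  have h := inv_anti₀ hδ hx
  have h2 := norm_angular_sq_le g x
  have h3 := potential_le hp₃ hp₅ a
  have h4 := potential_nonneg (by linarith : -1 < p) a
  rw [morawetzDensity, mul_comm]
  refine mul_le_mul h ?_ ?_ (by positivity)
  · unfold stateSize
    nlinarith [pow_nonneg (abs_nonneg a) 6, sq_nonneg ‖g‖, sq_nonneg b]
  · have : 0 ≤ (p - 1) / 2 := by linarith
    positivity

end Bounds

theorem measurable_radial : Measurable radial := (measurable_norm.inv).smul measurable_id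

theorem measurable_LPlus : Measurable fun q : ℝ × E3 × ℝ × E3 =>
    LPlus q.1 q.2.1 q.2.2.1 q.2.2.2 := by
  have := measurable_radial
  unfold LPlus
  fun_prop

theorem measurable_angular : Measurable fun q : E3 × E3 => angular q.1 q.2 := by
  have := measurable_radial
  unfold angular
  fun_prop

theorem measurable_potential (p : ℝ) : Measurable (potential p) := by
  unfold potential
  fun_prop

theorem measurable_inwardDensity (p : ℝ) : Measurable fun q : ℝ × E3 × ℝ × E3 =>
    inwardDensity p q.1 q.2.1 q.2.2.1 q.2.2.2 := by
  have h1 := measurable_LPlus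
  have h2 : Measurable fun q : ℝ × E3 × ℝ × E3 => angular q.2.1 q.2.2.2 :=
    measurable_angular.comp (by fun_prop : Measurable fun q : ℝ × E3 × ℝ × E3 => (q.2.1, q.2.2.2))
  have h3 := measurable_potential p
  unfold inwardDensity
  fun_prop

theorem measurable_fluxDensity (p : ℝ) : Measurable fun q : ℝ × E3 × ℝ × E3 =>
    fluxDensity p q.1 q.2.1 q.2.2.1 q.2.2.2 := by
  have h1 := measurable_LPlus
  have h2 : Measurable fun q : ℝ × E3 × ℝ × E3 => angular q.2.1 q.2.2.2 :=
    measurable_angular.comp (by fun_prop : Measurable fun q : ℝ × E3 × ℝ × E3 => (q.2.1, q.2.2.2))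
  have h3 := measurable_potential p
  unfold fluxDensity
  fun_prop

theorem measurable_morawetzDensity (p : ℝ) : Measurable fun q : ℝ × E3 × ℝ × E3 =>
    morawetzDensity p q.1 q.2.1 q.2.2.2 := by
  have h2 : Measurable fun q : ℝ × E3 × ℝ × E3 => angular q.2.1 q.2.2.2 :=
    measurable_angular.comp (by fun_prop : Measurable fun q : ℝ × E3 × ℝ × E3 => (q.2.1, q.2.2.2))
  have h3 := measurable_potential p
  unfold morawetzDensity
  fun_prop

theorem measurable_energyDensity (p : ℝ) : Measurable fun q : ℝ × E3 × ℝ × E3 =>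
    energyDensity p q.1 q.2.1 q.2.2.1 := by
  have h3 := measurable_potential p
  unfold energyDensity
  fun_prop

namespace CutWeight

variable {A At Ar : ℝ → ℝ → ℝ} {β : E3 → ℝ} {δ R : ℝ}

/-- A common bound for the weights on a bounded time interval. -/
theorem exists_bound (hw : CutWeight A At Ar β δ R) (t₁ t₂ : ℝ) :
    ∃ C, 0 ≤ C ∧ (∀ t ∈ Icc t₁ t₂, ∀ r, |A t r| ≤ C ∧ |At t r| ≤ C ∧ |Ar t r| ≤ C)
      ∧ ∀ x, |β x| ≤ C ∧ ‖fderiv ℝ β x‖ ≤ C := by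
  have hK : IsCompact (Icc t₁ t₂ ×ˢ Icc δ R) := isCompact_Icc.prod isCompact_Icc
  obtain ⟨C1, h1⟩ := hK.exists_bound_of_continuousOn hw.continuous.continuousOn
  obtain ⟨C2, h2⟩ := hK.exists_bound_of_continuousOn hw.continuous_time.continuousOn
  obtain ⟨C3, h3⟩ := hK.exists_bound_of_continuousOn hw.continuous_radius.continuousOn
  have hB : IsCompact (Metric.closedBall (0 : E3) R) := isCompact_closedBall _ _
  obtain ⟨C4, h4⟩ := hB.exists_bound_of_continuousOn hw.contDiff.continuous.continuousOn
  obtain ⟨C5, h5⟩ := hB.exists_bound_of_continuousOn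
    (hw.contDiff.continuous_fderiv one_ne_zero).continuousOn
  set C := |C1| + |C2| + |C3| + |C4| + |C5| with hC
  have a1 := abs_nonneg C1; have a2 := abs_nonneg C2; have a3 := abs_nonneg C3
  have a4 := abs_nonneg C4; have a5 := abs_nonneg C5
  have b1 := le_abs_self C1; have b2 := le_abs_self C2; have b3 := le_abs_self C3
  have b4 := le_abs_self C4; have b5 := le_abs_self C5
  have hC0 : 0 ≤ C := by positivity
  refine ⟨C, hC0, fun t ht r => ?_, fun x => ?_⟩
  · by_cases hr : r ∈ Icc δ R
    · have e1 := h1 (t, r) ⟨ht, hr⟩; have e2 := h2 (t, r) ⟨ht, hr⟩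
      have e3 := h3 (t, r) ⟨ht, hr⟩
      simp only [Real.norm_eq_abs] at e1 e2 e3
      refine ⟨?_, ?_, ?_⟩ <;> linarith
    · rw [mem_Icc, not_and_or, not_le, not_le] at hr
      rcases hr with hr | hr
      · simp [hw.zero_of_le t r hr.le, hw.time_zero_of_le (t := t) hr.le,
          hw.radius_zero_of_le (t := t) hr.le, hC0]
      · simp [hw.zero_of_ge t r hr.le, hw.time_zero_of_ge (t := t) hr.le,
          hw.radius_zero_of_ge (t := t) hr.le, hC0]
  · by_cases hx : x ∈ Metric.closedBall (0 : E3) R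
    · have e1 := h4 x hx; have e2 := h5 x hx
      rw [Real.norm_eq_abs] at e1
      constructor <;> linarith
    · rw [mem_closedBall_zero_iff, not_le] at hx
      simp [hw.zero_outside x hx.le, hw.fderiv_zero hx, hC0]

/-- Bounds for the terms of the weighted identity in terms of the size of the state. -/
theorem exists_density_bound {p : ℝ} (hp₃ : 3 ≤ p) (hp₅ : p ≤ 5) (hw : CutWeight A At Ar β δ R)
    (t₁ t₂ : ℝ) : ∃ C, 0 ≤ C ∧ ∀ t ∈ Icc t₁ t₂, ∀ a g b x,
      |weightedDensity p A β t a g b x|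
        ≤ C * ((Metric.closedBall (0 : E3) R).indicator 1 x + stateSize a g b) ∧
      |weightedRate p A At Ar β t a g b x|
        ≤ C * ((Metric.closedBall (0 : E3) R).indicator 1 x + stateSize a g b) ∧
      multiplier A β t a g b x ^ 2
        ≤ C * ((Metric.closedBall (0 : E3) R).indicator 1 x + stateSize a g b) := by
  obtain ⟨C, hC0, hC, hCβ⟩ := hw.exists_bound t₁ t₂
  have hδ := hw.pos
  have hp : -1 < p := by linarith
  set D := 1 + δ⁻¹ ^ 2 with hD
  have hD1 : 1 ≤ D := by rw [hD]; nlinarith [sq_nonneg δ⁻¹]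
  have hd : δ⁻¹ ≤ D := by rw [hD]; nlinarith [sq_nonneg (δ⁻¹ - 1)]
  have hd0 : 0 ≤ δ⁻¹ := by positivity
  -- `C ^ 2` is needed because the multiplier is squared, `D` bounds the inverse powers of `‖x‖` on
  -- the support of the weights, and `6` covers the sum of the constants of the four terms of the
  -- rate.
  refine ⟨(C + C ^ 2) * (6 * D), by positivity, fun t ht a g b x => ?_⟩
  have hs := stateSize_nonneg (a := a) (g := g) (b := b)
  by_cases hxR : x ∈ Metric.closedBall (0 : E3) R
  swap
  · rw [indicator_of_notMem hxR]
    rw [mem_closedBall_zero_iff, not_le] at hxR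
    have : 0 ≤ (C + C ^ 2) * (6 * D) * (0 + stateSize a g b) := by positivity
    simpa [weightedDensity, weightedRate, multiplier, hw.zero_of_ge t _ hxR.le,
      hw.time_zero_of_ge (t := t) hxR.le, hw.radius_zero_of_ge (t := t) hxR.le,
      hw.zero_outside x hxR.le, hw.fderiv_zero hxR] using this
  rw [indicator_of_mem hxR, Pi.one_apply]
  set S := 1 + stateSize a g b with hS
  have hS1 : 1 ≤ S := by linarith
  obtain ⟨hA, hAt, hAr⟩ := hC t ht ‖x‖
  obtain ⟨hβ, hβ'⟩ := hCβ x
  have hDS : 0 ≤ D * S := by positivity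
  -- Singular densities need bounds only for `‖x‖ ≥ δ`, since the weights vanish for `‖x‖ ≤ δ`.
  have key : ∀ {α f M : ℝ}, |α| ≤ C → (‖x‖ ≤ δ → α = 0) → 0 ≤ M → (δ ≤ ‖x‖ → |f| ≤ M) →
      |α * f| ≤ C * M := by
    intro α f M h1 h2 hM h3
    rcases le_total ‖x‖ δ with h | h
    · rw [h2 h, zero_mul, abs_zero]; positivity
    · rw [abs_mul]; exact mul_le_mul h1 (h3 h) (abs_nonneg _) hC0
  have hin : δ ≤ ‖x‖ → |inwardDensity p a g b x| ≤ 2 * (D * S) := fun h => by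
    rw [abs_of_nonneg (inwardDensity_nonneg hp), ← mul_assoc]
    exact inwardDensity_le_stateSize hp₃ hp₅ hδ h
  have e1 := key hA (hw.zero_of_le t _) (by positivity) hin
  have e2 := key hAt (fun h => hw.time_zero_of_le h) (by positivity) hin
  have e3 := key hAr (fun h => hw.radius_zero_of_le h) (by positivity)
    (fun h => (abs_fluxDensity_le hp).trans ((le_abs_self _).trans (hin h)))
  have e4 : |A t ‖x‖ * morawetzDensity p a g x| ≤ C * (D * S) :=
    key hA (hw.zero_of_le t _) hDS fun h => by
      rw [abs_of_nonneg (morawetzDensity_nonneg (by linarith))]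
      exact (morawetzDensity_le_stateSize (b := b) hp₃ hp₅ hδ h).trans
        (mul_le_mul_of_nonneg_right hd (by positivity))
  have hb2 : b ^ 2 ≤ S := by
    rw [hS, stateSize]; nlinarith [pow_nonneg (abs_nonneg a) 6, sq_nonneg ‖g‖]
  have hSD : S ≤ D * S := le_mul_of_one_le_left (by positivity) hD1
  have hCS : C * S ≤ C * (D * S) := mul_le_mul_of_nonneg_left hSD hC0
  have hC2 : 0 ≤ C ^ 2 * (D * S) := by positivity
  have hC1 : 0 ≤ C * (D * S) := by positivity
  have hE : (C + C ^ 2) * (6 * D) * S = 6 * (C * (D * S)) + 6 * (C ^ 2 * (D * S)) := by ring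
  refine ⟨?_, ?_, ?_⟩
  · have e5 : |β x * energyDensity p a g b| ≤ C * S := by
      rw [abs_mul, abs_of_nonneg (energyDensity_nonneg hp)]
      exact mul_le_mul hβ (energyDensity_le_stateSize hp₃ hp₅) (energyDensity_nonneg hp) hC0
    refine (abs_add_le _ _).trans ?_
    rw [hE]
    linarith
  · have e5 : |b * fderiv ℝ β x g| ≤ C * S := by
      rw [abs_mul]
      have := (fderiv ℝ β x).le_opNorm g
      rw [Real.norm_eq_abs] at this
      have h2 : |b| * |fderiv ℝ β x g| ≤ |b| * (C * ‖g‖) :=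
        mul_le_mul_of_nonneg_left (this.trans (mul_le_mul_of_nonneg_right hβ' (norm_nonneg _)))
          (abs_nonneg _)
      refine h2.trans ?_
      have : |b| * ‖g‖ ≤ S := by
        rw [hS, stateSize]
        nlinarith [pow_nonneg (abs_nonneg a) 6, sq_nonneg (|b| - ‖g‖), sq_abs b, sq_nonneg b,
          sq_nonneg ‖g‖]
      nlinarith
    refine (abs_sub _ _).trans ?_
    refine (add_le_add_left ((abs_sub _ _).trans (add_le_add_left (abs_sub _ _) _)) _).trans ?_
    rw [hE]
    linarith
  · have e5 : (A t ‖x‖ / 2 * LPlus a g b x) ^ 2 ≤ C ^ 2 * (D * S) := by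
      rcases le_total ‖x‖ δ with h | h
      · rw [hw.zero_of_le t _ h]; simpa using hC2
      · rw [mul_pow]
        have h1 := LPlus_sq_le_stateSize (a := a) (g := g) (b := b) hδ h
        have h2 : (A t ‖x‖ / 2) ^ 2 ≤ C ^ 2 / 4 := by
          rw [div_pow]
          have := pow_le_pow_left₀ (abs_nonneg _) hA 2
          rw [sq_abs] at this
          linarith
        refine (mul_le_mul h2 h1 (sq_nonneg _) (by positivity)).trans ?_
        rw [← hS, ← hD]
        linarith [show C ^ 2 / 4 * (3 * D * S) = 3 / 4 * (C ^ 2 * (D * S)) by ring]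
    have e6 : (β x * b) ^ 2 ≤ C ^ 2 * (D * S) := by
      rw [mul_pow]
      have := pow_le_pow_left₀ (abs_nonneg _) hβ 2
      rw [sq_abs] at this
      exact mul_le_mul this (hb2.trans hSD) (sq_nonneg _) (by positivity)
    rw [multiplier]
    rw [hE]
    linarith [sq_nonneg (A t ‖x‖ / 2 * LPlus a g b x - β x * b),
      add_sq (A t ‖x‖ / 2 * LPlus a g b x) (β x * b), sub_sq (A t ‖x‖ / 2 * LPlus a g b x) (β x * b)]

end CutWeight

end WaveEnergy
end

noncomputable section
namespace WaveEnergy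

/-! ### The weighted energy identity -/

theorem mollify_add (n : ℕ) {f g : E3 → ℝ} (hf : LocallyIntegrable f) (hg : LocallyIntegrable g)
    (x : E3) : mollify n (fun x => f x + g x) x = mollify n f x + mollify n g x := by
  have h := integral_add (integrable_kernel_smul (rho_continuous n) (rho_hasCompactSupport n) hf x)
    (integrable_kernel_smul (rho_continuous n) (rho_hasCompactSupport n) hg x)
  rw [mollify, mollify, mollify, ← h]
  refine integral_congr_ae (.of_forall fun y => ?_)
  simp only [smul_eq_mul]
  ring

theorem continuous_potential {p : ℝ} (hp : 1 ≤ p) : Continuous (potential p) :=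
  continuous_iff_continuousAt.2 fun s => (hasDerivAt_potential hp s).continuousAt

theorem continuous_LPlus (x : E3) : Continuous fun q : ℝ × E3 × ℝ => LPlus q.1 q.2.1 q.2.2 x := by
  unfold LPlus; fun_prop

theorem continuous_angular (x : E3) : Continuous fun g : E3 => angular g x := by
  unfold angular; fun_prop

theorem continuous_inwardDensity {p : ℝ} (hp : 1 ≤ p) (x : E3) :
    Continuous fun q : ℝ × E3 × ℝ => inwardDensity p q.1 q.2.1 q.2.2 x := by
  have h1 := continuous_LPlus x
  have h2 := continuous_angular x
  have h3 := continuous_potential hp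
  unfold inwardDensity; fun_prop

theorem continuous_fluxDensity {p : ℝ} (hp : 1 ≤ p) (x : E3) :
    Continuous fun q : ℝ × E3 × ℝ => fluxDensity p q.1 q.2.1 q.2.2 x := by
  have h1 := continuous_LPlus x
  have h2 := continuous_angular x
  have h3 := continuous_potential hp
  unfold fluxDensity; fun_prop

theorem continuous_morawetzDensity {p : ℝ} (hp : 1 ≤ p) (x : E3) :
    Continuous fun q : ℝ × E3 × ℝ => morawetzDensity p q.1 q.2.1 x := by
  have h2 := continuous_angular x
  have h3 := continuous_potential hp
  unfold morawetzDensity; fun_prop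

theorem continuous_energyDensity {p : ℝ} (hp : 1 ≤ p) :
    Continuous fun q : ℝ × E3 × ℝ => energyDensity p q.1 q.2.1 q.2.2 := by
  have h3 := continuous_potential hp
  unfold energyDensity; fun_prop

section Weights

variable {p : ℝ} {A At Ar : ℝ → ℝ → ℝ} {β : E3 → ℝ} {δ R : ℝ}

theorem continuous_weightedDensity_state (hp : 1 ≤ p) (t : ℝ) (x : E3) :
    Continuous fun q : ℝ × E3 × ℝ => weightedDensity p A β t q.1 q.2.1 q.2.2 x := by
  have h1 := continuous_inwardDensity hp x
  have h2 := continuous_energyDensity hp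
  unfold weightedDensity; fun_prop

theorem continuous_weightedRate_state (hp : 1 ≤ p) (t : ℝ) (x : E3) :
    Continuous fun q : ℝ × E3 × ℝ => weightedRate p A At Ar β t q.1 q.2.1 q.2.2 x := by
  have h1 := continuous_inwardDensity hp x
  have h2 := continuous_fluxDensity hp x
  have h3 := continuous_morawetzDensity hp x
  unfold weightedRate; fun_prop

theorem continuous_multiplier_state (t : ℝ) (x : E3) :
    Continuous fun q : ℝ × E3 × ℝ => multiplier A β t q.1 q.2.1 q.2.2 x := by
  have h1 := continuous_LPlus x
  unfold multiplier; fun_prop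

theorem CutWeight.measurable_weightedDensity (hw : CutWeight A At Ar β δ R) (t : ℝ) :
    Measurable fun q : ℝ × E3 × ℝ × E3 =>
      weightedDensity p A β t q.1 q.2.1 q.2.2.1 q.2.2.2 := by
  have h1 := measurable_inwardDensity p
  have h2 := measurable_energyDensity p
  have h3 := hw.contDiff.continuous.measurable
  have h4 : Measurable (A t) :=
    (hw.continuous.comp (continuous_const.prodMk continuous_id)).measurable
  unfold weightedDensity; fun_prop

theorem CutWeight.measurable_weightedRate (hw : CutWeight A At Ar β δ R) (t : ℝ) :
    Measurable fun q : ℝ × E3 × ℝ × E3 =>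
      weightedRate p A At Ar β t q.1 q.2.1 q.2.2.1 q.2.2.2 := by
  have h1 := measurable_inwardDensity p
  have h2 := measurable_fluxDensity p
  have h3 := measurable_morawetzDensity p
  have h4 : Measurable (A t) :=
    (hw.continuous.comp (continuous_const.prodMk continuous_id)).measurable
  have h5 : Measurable (At t) :=
    (hw.continuous_time.comp (continuous_const.prodMk continuous_id)).measurable
  have h6 : Measurable (Ar t) :=
    (hw.continuous_radius.comp (continuous_const.prodMk continuous_id)).measurable
  have h7 : Measurable fun q : ℝ × E3 × ℝ × E3 => fderiv ℝ β q.2.2.2 q.2.1 :=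
    (((hw.contDiff.continuous_fderiv one_ne_zero).comp
      (by fun_prop : Continuous fun q : ℝ × E3 × ℝ × E3 => q.2.2.2)).clm_apply
      (by fun_prop)).measurable
  unfold weightedRate; fun_prop

theorem CutWeight.measurable_multiplier (hw : CutWeight A At Ar β δ R) (t : ℝ) :
    Measurable fun q : ℝ × E3 × ℝ × E3 => multiplier A β t q.1 q.2.1 q.2.2.1 q.2.2.2 := by
  have h1 := measurable_LPlus
  have h3 := hw.contDiff.continuous.measurable
  have h4 : Measurable (A t) :=
    (hw.continuous.comp (continuous_const.prodMk continuous_id)).measurable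
  unfold multiplier; fun_prop

end Weights

section Solution

variable {p : ℝ} {u : ℝ → E3 → ℝ} {Du : ℝ → E3 → E3} {ut : ℝ → E3 → ℝ}
  {A At Ar : ℝ → ℝ → ℝ} {β : E3 → ℝ} {δ R : ℝ}

theorem IsSolution.integrable_pow_six (hu : IsSolution p u Du ut) (t : ℝ) :
    Integrable fun x => |u t x| ^ 6 := by
  have h := (hu.homogeneousH1 t).memLp.integrable_norm_pow (p := 6) (by norm_num)
  simpa using h

theorem IsSolution.integrable_grad_sq (hu : IsSolution p u Du ut) (t : ℝ) :
    Integrable fun x => ‖Du t x‖ ^ 2 := by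
  have h := (hu.homogeneousH1 t).memLp_grad.integrable_norm_pow (p := 2) (by norm_num)
  simpa using h

theorem IsSolution.integrable_velocity_sq (hu : IsSolution p u Du ut) (t : ℝ) :
    Integrable fun x => ut t x ^ 2 := by
  have h := (hu.memLp_time t).integrable_norm_pow (p := 2) (by norm_num)
  simpa using h

theorem IsSolution.integrable_stateSize (hu : IsSolution p u Du ut) (t : ℝ) :
    Integrable fun x => stateSize (u t x) (Du t x) (ut t x) :=
  ((hu.integrable_pow_six t).add (hu.integrable_grad_sq t)).add (hu.integrable_velocity_sq t)

theorem IsSolution.stateSize_mollify_le (hu : IsSolution p u Du ut) (n : ℕ) (t : ℝ) (x : E3) :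
    stateSize (mollify n (u t) x) (mollify n (Du t) x) (mollify n (ut t) x)
      ≤ mollify n (fun x => stateSize (u t x) (Du t x) (ut t x)) x := by
  have i1 := (hu.integrable_pow_six t).locallyIntegrable
  have i2 := (hu.integrable_grad_sq t).locallyIntegrable
  have i3 := (hu.integrable_velocity_sq t).locallyIntegrable
  have h1 := norm_mollify_rpow_le n (q := 6) (by norm_num)
    (hu.homogeneousH1 t).locallyIntegrable (by simpa using i1) x
  have h2 := norm_mollify_sq_le n (hu.homogeneousH1 t).locallyIntegrable_grad i2 x
  have h3 := norm_mollify_sq_le n (hu.locallyIntegrable_velocity t) (by simpa using i3) x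
  have h4 := mollify_add n (f := fun x => |u t x| ^ 6 + ‖Du t x‖ ^ 2) (i1.add i2) i3 x
  have h5 := mollify_add n i1 i2 x
  simp only [stateSize]
  rw [h4, h5]
  simp at h1 h3
  linarith

theorem IsSolution.continuous_lintegral_pow {F : Type*} [NormedAddCommGroup F] {q : ℕ}
    (hq : q ≠ 0) {f : ℝ → E3 → F} (hf : Continuous fun t => eLpNorm (f t) q volume)
    (hm : ∀ t, MemLp (f t) q volume) : Continuous fun t => ∫ x, ‖f t x‖ ^ q := by
  have : ∀ t, ∫ x, ‖f t x‖ ^ q = (eLpNorm (f t) q volume ^ q).toReal := fun t => by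
    rw [eLpNorm_eq_lintegral_rpow_enorm_toReal (by simpa using hq) (by simp)]
    rw [← ENNReal.rpow_natCast, ← ENNReal.rpow_mul]
    simp only [ENNReal.toReal_natCast]
    rw [one_div, inv_mul_cancel₀ (by exact_mod_cast hq), ENNReal.rpow_one,
      integral_eq_lintegral_of_nonneg_ae (f := fun x => ‖f t x‖ ^ q)
        (.of_forall fun x => by positivity) ((hm t).1.norm.pow q)]
    congr 2
    ext x
    rw [ENNReal.rpow_natCast, ← ofReal_norm, ENNReal.ofReal_pow (norm_nonneg _)]
  simp_rw [this, ENNReal.toReal_pow]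
  refine Continuous.pow ?_ q
  rw [continuous_iff_continuousAt] at hf ⊢
  exact fun t => (ENNReal.tendsto_toReal (hm t).2.ne).comp (hf t)

theorem IsSolution.continuous_stateSize (hu : IsSolution p u Du ut) :
    Continuous fun t => ∫ x, stateSize (u t x) (Du t x) (ut t x) := by
  have h1 := IsSolution.continuous_lintegral_pow (q := 6) (by norm_num)
    (continuous_eLpNorm (q := 6) (by norm_num) (fun t => (hu.homogeneousH1 t).memLp)
      hu.tendsto_position) fun t => (hu.homogeneousH1 t).memLp
  have h2 := IsSolution.continuous_lintegral_pow (q := 2) (by norm_num)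
    (continuous_eLpNorm (q := 2) (by norm_num) (fun t => (hu.homogeneousH1 t).memLp_grad)
      hu.continuous_grad) fun t => (hu.homogeneousH1 t).memLp_grad
  have h3 := IsSolution.continuous_lintegral_pow (q := 2) (by norm_num)
    (continuous_eLpNorm (q := 2) (by norm_num) hu.memLp_time hu.continuous_time) hu.memLp_time
  refine ((h1.add h2).add h3).congr fun t => ?_
  have e1 := integral_add (hu.integrable_pow_six t) (hu.integrable_grad_sq t)
  have e2 := integral_add ((hu.integrable_pow_six t).add (hu.integrable_grad_sq t))
    (hu.integrable_velocity_sq t)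
  simp only [Pi.add_apply] at e2
  simp only [stateSize, e2, e1, Pi.add_apply, Real.norm_eq_abs, sq_abs]

theorem IsSolution.ae_tendsto_mollify (hu : IsSolution p u Du ut) (t : ℝ) :
    ∀ᵐ x, Tendsto (fun n => ((mollify n (u t) x, mollify n (Du t) x, mollify n (ut t) x) :
      ℝ × E3 × ℝ)) atTop (𝓝 (u t x, Du t x, ut t x)) := by
  filter_upwards [mollify_tendsto_ae (hu.homogeneousH1 t).locallyIntegrable,
    mollify_tendsto_ae (hu.homogeneousH1 t).locallyIntegrable_grad,
    mollify_tendsto_ae (hu.locallyIntegrable_velocity t)] with x h1 h2 h3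
  exact h1.prodMk_nhds (h2.prodMk_nhds h3)

theorem IsSolution.aestronglyMeasurable_state (hu : IsSolution p u Du ut) {f : ℝ × E3 × ℝ × E3 → ℝ}
    (hf : Measurable f) (n : ℕ) (t : ℝ) : AEStronglyMeasurable
      (fun x => f (mollify n (u t) x, mollify n (Du t) x, mollify n (ut t) x, x)) volume := by
  have h1 : Continuous (mollify n (u t)) :=
    (mollify_contDiff n (hu.homogeneousH1 t).locallyIntegrable).continuous
  have h2 : Continuous (mollify n (Du t)) :=
    (mollify_contDiff n (hu.homogeneousH1 t).locallyIntegrable_grad).continuous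
  have h3 : Continuous (mollify n (ut t)) :=
    (mollify_contDiff n (hu.locallyIntegrable_velocity t)).continuous
  exact (hf.comp (h1.prodMk (h2.prodMk (h3.prodMk continuous_id))).measurable).aestronglyMeasurable

theorem integrable_indicator_ball (R : ℝ) :
    Integrable ((Metric.closedBall (0 : E3) R).indicator (1 : E3 → ℝ)) :=
  (integrable_indicator_iff measurableSet_closedBall).2
    (integrableOn_const (measure_closedBall_lt_top).ne)

/-- Convergence of integrals of densities along mollification. -/
theorem IsSolution.tendsto_integral_state (hu : IsSolution p u Du ut) {f : ℝ × E3 × ℝ × E3 → ℝ}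
    (hf : Measurable f) (hc : ∀ x, Continuous fun q : ℝ × E3 × ℝ => f (q.1, q.2.1, q.2.2, x))
    {C : ℝ} (t : ℝ) (hb : ∀ a g b x, |f (a, g, b, x)|
      ≤ C * ((Metric.closedBall (0 : E3) R).indicator 1 x + stateSize a g b)) (hC : 0 ≤ C) :
    Tendsto (fun n => ∫ x, f (mollify n (u t) x, mollify n (Du t) x, mollify n (ut t) x, x)) atTop
      (𝓝 (∫ x, f (u t x, Du t x, ut t x, x))) := by
  have hi := hu.integrable_stateSize t
  have h1 := integrable_indicator_ball R
  refine tendsto_integral_of_tendsto_bound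
    (h := fun n x => C * ((Metric.closedBall (0 : E3) R).indicator 1 x
      + mollify n (fun x => stateSize (u t x) (Du t x) (ut t x)) x))
    (k := fun x => C * ((Metric.closedBall (0 : E3) R).indicator 1 x
      + stateSize (u t x) (Du t x) (ut t x)))
    (hu.aestronglyMeasurable_state hf · t) (fun n => (h1.add (mollify_integrable n hi)).const_mul C)
    ((h1.add hi).const_mul C) (fun n => .of_forall fun x => ?_) ?_ ?_ ?_
  · refine (hb _ _ _ _).trans (mul_le_mul_of_nonneg_left ?_ hC)
    exact add_le_add le_rfl (hu.stateSize_mollify_le n t x)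
  · filter_upwards [hu.ae_tendsto_mollify t] with x hx
    exact ((hc x).tendsto _).comp hx
  · filter_upwards [mollify_tendsto_ae hi.locallyIntegrable] with x hx
    exact (hx.const_add _).const_mul C
  -- Mollification preserves integrals, so the integrals of the bounds do not depend on `n`; this is
  -- the reason for dominated convergence with moving bounds.
  · refine tendsto_const_nhds.congr fun n => ?_
    rw [integral_const_mul, integral_const_mul, integral_add h1 hi,
      integral_add h1 (mollify_integrable n hi), mollify_integral n hi]

theorem sq_nonlin {p : ℝ} (hp : 1 < p) (s : ℝ) : nonlin p s ^ 2 = ‖s‖ ^ (2 * p) := by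
  rw [← sq_abs, abs_nonlin (by linarith), Real.norm_eq_abs, mul_comm, Real.rpow_mul (abs_nonneg _),
    Real.rpow_two]

/-- From `(a - b)² ≤ 2a² + 2b²`, with Jensen for the power `2p` on the first term and for the square
on the second. Both are dominated by the mollification of the same integrable function. -/
theorem IsSolution.remainder_sq_le (hp : 1 < p) (hu : IsSolution p u Du ut) (n : ℕ) {t : ℝ}
    (hN : MemLp (fun y => nonlin p (u t y)) 2) (x : E3) :
    (nonlin p (mollify n (u t) x) - mollify n (fun y => nonlin p (u t y)) x) ^ 2
      ≤ 4 * mollify n (fun y => nonlin p (u t y) ^ 2) x := by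
  have hi : Integrable fun y => nonlin p (u t y) ^ 2 := by
    simpa using hN.integrable_norm_pow (p := 2) (by norm_num)
  have h1 := norm_mollify_rpow_le n (q := 2 * p) (by linarith) (hu.homogeneousH1 t).locallyIntegrable
    (by simp_rw [← sq_nonlin hp]; exact hi.locallyIntegrable) x
  simp_rw [← sq_nonlin hp] at h1
  have h2 := norm_mollify_sq_le n (hN.locallyIntegrable (by norm_num))
    (by simpa using hi.locallyIntegrable) x
  simp only [Real.norm_eq_abs, sq_abs] at h2
  nlinarith [sq_nonneg (nonlin p (mollify n (u t) x) + mollify n (fun y => nonlin p (u t y)) x)]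

/-- Young's inequality with a free parameter. The value `1` serves for convergence at a fixed time;
a value adapted to the size of the nonlinearity serves for a majorant integrable in time. -/
theorem abs_mul_le_weighted {m r M lam : ℝ} (hl : 0 < lam) (hr : r ^ 2 ≤ 4 * M) :
    |m * r| ≤ lam * m ^ 2 + lam⁻¹ * M := by
  have h : |m * r| ≤ lam * m ^ 2 + lam⁻¹ * (r ^ 2 / 4) := by
    rw [abs_le]
    have e1 : lam * m ^ 2 + lam⁻¹ * (r ^ 2 / 4) - m * r = lam * (m - lam⁻¹ * r / 2) ^ 2 := by
      field_simp; ring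
    have e2 : lam * m ^ 2 + lam⁻¹ * (r ^ 2 / 4) + m * r = lam * (m + lam⁻¹ * r / 2) ^ 2 := by
      field_simp; ring
    have p1 : 0 ≤ lam * (m - lam⁻¹ * r / 2) ^ 2 := by positivity
    have p2 : 0 ≤ lam * (m + lam⁻¹ * r / 2) ^ 2 := by positivity
    constructor <;> linarith
  refine h.trans (add_le_add_right (mul_le_mul_of_nonneg_left ?_ (by positivity)) _)
  linarith

theorem integral_sq_nonlin {t : ℝ}
    (hN : MemLp (fun y => nonlin p (u t y)) 2) :
    ∫ y, nonlin p (u t y) ^ 2 = (eLpNorm (fun y => nonlin p (u t y)) 2 volume).toReal ^ 2 := by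
  have h := eLpNorm_two_sq (fun y => nonlin p (u t y))
  rw [← ENNReal.toReal_pow, h, integral_eq_lintegral_of_nonneg_ae
    (f := fun y => nonlin p (u t y) ^ 2) (.of_forall fun x => by positivity) (hN.1.pow 2)]
  simp

/-- Bound and convergence of the rate of the mollified solution at almost every time. -/
theorem IsSolution.tendsto_mollifiedRate (hp₃ : 3 ≤ p) (hp₅ : p ≤ 5) (hu : IsSolution p u Du ut)
    (hw : CutWeight A At Ar β δ R) {t₁ t₂ : ℝ} : ∃ C : ℝ, ∀ t ∈ Icc t₁ t₂,
      MemLp (fun y => nonlin p (u t y)) 2 →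
      Tendsto (fun n => ∫ x, mollifiedRate p u Du ut A At Ar β n t x) atTop
        (𝓝 (∫ x, weightedRate p A At Ar β t (u t x) (Du t x) (ut t x) x)) ∧
      ∀ n, ‖∫ x, mollifiedRate p u Du ut A At Ar β n t x‖
        ≤ C * (1 + (eLpNorm (fun y => nonlin p (u t y)) 2 volume).toReal) := by
  obtain ⟨C, hC0, hC⟩ := hw.exists_density_bound hp₃ hp₅ t₁ t₂
  have hp : 1 < p := by linarith
  have hk := integrable_indicator_ball R
  set k : E3 → ℝ := (Metric.closedBall (0 : E3) R).indicator 1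
  have hk0 : 0 ≤ ∫ x, k x := integral_nonneg fun x => indicator_nonneg (fun _ _ => zero_le_one) x
  obtain ⟨B, hB⟩ := (isCompact_Icc (a := t₁) (b := t₂)).exists_bound_of_continuousOn
    hu.continuous_stateSize.continuousOn
  refine ⟨2 * (C * ((∫ x, k x) + |B|)) + 1, fun t ht hN => ?_⟩
  have hi := hu.integrable_stateSize t
  have hW : Integrable fun y => nonlin p (u t y) ^ 2 := by
    simpa using hN.integrable_norm_pow (p := 2) (by norm_num)
  set H : E3 → ℝ := fun x => stateSize (u t x) (Du t x) (ut t x)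
  set W : E3 → ℝ := fun y => nonlin p (u t y) ^ 2
  set N := (eLpNorm (fun y => nonlin p (u t y)) 2 volume).toReal with hNdef
  have hN0 : 0 ≤ N := ENNReal.toReal_nonneg
  have hH0 : 0 ≤ ∫ x, H x := integral_nonneg fun x => stateSize_nonneg
  have hHB : ∫ x, H x ≤ |B| :=
    (le_abs_self _).trans ((hB t ht).trans (le_abs_self B))
  have hkH : ∀ n, Integrable fun x => C * (k x + mollify n H x) := fun n =>
    (hk.add (mollify_integrable n hi)).const_mul C
  have hkHint : ∀ n, ∫ x, C * (k x + mollify n H x) = C * ((∫ x, k x) + ∫ x, H x) := fun n => by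
    rw [integral_const_mul, integral_add hk (mollify_integrable n hi), mollify_integral n hi]
  have hrate : ∀ n x, |weightedRate p A At Ar β t (mollify n (u t) x) (mollify n (Du t) x)
      (mollify n (ut t) x) x| ≤ C * (k x + mollify n H x) := fun n x =>
    ((hC t ht _ _ _ x).2.1).trans (mul_le_mul_of_nonneg_left
      (add_le_add le_rfl (hu.stateSize_mollify_le n t x)) hC0)
  have hmult : ∀ n x, multiplier A β t (mollify n (u t) x) (mollify n (Du t) x)
      (mollify n (ut t) x) x ^ 2 ≤ C * (k x + mollify n H x) := fun n x =>
    ((hC t ht _ _ _ x).2.2).trans (mul_le_mul_of_nonneg_left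
      (add_le_add le_rfl (hu.stateSize_mollify_le n t x)) hC0)
  have hrm := hu.aestronglyMeasurable_state (hw.measurable_weightedRate (p := p) t)
  have hmm := hu.aestronglyMeasurable_state (hw.measurable_multiplier t)
  have hRm : ∀ n, AEStronglyMeasurable (fun x => nonlin p (mollify n (u t) x)
      - mollify n (fun y => nonlin p (u t y)) x) volume := fun n =>
    (((continuous_nonlin hp).comp
      (mollify_contDiff n (hu.homogeneousH1 t).locallyIntegrable).continuous).sub
      (mollify_contDiff n (hN.locallyIntegrable (by norm_num))).continuous).aestronglyMeasurable
  have hprod : ∀ n x (lam : ℝ), 0 < lam → |multiplier A β t (mollify n (u t) x)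
      (mollify n (Du t) x) (mollify n (ut t) x) x * (nonlin p (mollify n (u t) x)
      - mollify n (fun y => nonlin p (u t y)) x)|
      ≤ lam * (C * (k x + mollify n H x)) + lam⁻¹ * mollify n W x := fun n x lam hl =>
    (abs_mul_le_weighted hl (hu.remainder_sq_le hp n hN x)).trans
      (add_le_add_left (mul_le_mul_of_nonneg_left (hmult n x) hl.le) _)
  have hbi : ∀ n (lam : ℝ), Integrable fun x =>
      lam * (C * (k x + mollify n H x)) + lam⁻¹ * mollify n W x := fun n lam =>
    ((hkH n).const_mul lam).add ((mollify_integrable n hW).const_mul _)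
  have hbint : ∀ n (lam : ℝ), ∫ x, (lam * (C * (k x + mollify n H x)) + lam⁻¹ * mollify n W x)
      = lam * (C * ((∫ x, k x) + ∫ x, H x)) + lam⁻¹ * ∫ x, W x := fun n lam => by
    rw [integral_add ((hkH n).const_mul lam) ((mollify_integrable n hW).const_mul _),
      integral_const_mul lam, hkHint, integral_const_mul, mollify_integral n hW]
  have hri : ∀ n, Integrable fun x => weightedRate p A At Ar β t (mollify n (u t) x)
      (mollify n (Du t) x) (mollify n (ut t) x) x := fun n =>
    (hkH n).mono' (hrm n t) (.of_forall fun x => hrate n x)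
  have hmi : ∀ n, Integrable fun x => multiplier A β t (mollify n (u t) x)
      (mollify n (Du t) x) (mollify n (ut t) x) x * (nonlin p (mollify n (u t) x)
      - mollify n (fun y => nonlin p (u t y)) x) := fun n =>
    (hbi n 1).mono' ((hmm n t).mul (hRm n)) (.of_forall fun x => hprod n x 1 one_pos)
  have hsplit : ∀ n, ∫ x, mollifiedRate p u Du ut A At Ar β n t x
      = (∫ x, weightedRate p A At Ar β t (mollify n (u t) x)
        (mollify n (Du t) x) (mollify n (ut t) x) x)
      + ∫ x, multiplier A β t (mollify n (u t) x)
      (mollify n (Du t) x) (mollify n (ut t) x) x * (nonlin p (mollify n (u t) x)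
      - mollify n (fun y => nonlin p (u t y)) x) := fun n => integral_add (hri n) (hmi n)
  refine ⟨?_, fun n => ?_⟩
  · simp_rw [hsplit]
    rw [← add_zero (∫ x, weightedRate p A At Ar β t (u t x) (Du t x) (ut t x) x)]
    refine Tendsto.add (hu.tendsto_integral_state (hw.measurable_weightedRate (p := p) t)
      (fun x => continuous_weightedRate_state hp.le t x) t
      (fun a g b x => (hC t ht a g b x).2.1) hC0) ?_
    rw [← integral_zero E3 ℝ (μ := volume)]
    refine tendsto_integral_of_tendsto_bound (h := fun n x =>
        1 * (C * (k x + mollify n H x)) + 1⁻¹ * mollify n W x)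
      (k := fun x => 1 * (C * (k x + H x)) + 1⁻¹ * W x)
      (fun n => (hmm n t).mul (hRm n)) (fun n => hbi n 1)
      ((((hk.add hi).const_mul C).const_mul 1).add (hW.const_mul _))
      (fun n => .of_forall fun x => hprod n x 1 one_pos) ?_ ?_ ?_
    · filter_upwards [hu.ae_tendsto_mollify t,
        mollify_tendsto_ae (hN.locallyIntegrable (by norm_num))] with x hx hx2
      have h1 := ((continuous_multiplier_state (A := A) (β := β) t x).tendsto _).comp hx
      have h2 := (((continuous_nonlin hp).comp continuous_fst).tendsto _).comp hx
      have h3 := h1.mul (h2.sub hx2)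
      simpa using h3
    · filter_upwards [mollify_tendsto_ae hi.locallyIntegrable,
        mollify_tendsto_ae hW.locallyIntegrable] with x hx hx2
      exact (((hx.const_add _).const_mul C).const_mul 1).add (hx2.const_mul _)
    · refine tendsto_const_nhds.congr fun n => ?_
      have e1 : Integrable fun x => C * (k x + H x) := (hk.add hi).const_mul C
      rw [hbint, integral_add (e1.const_mul 1) (hW.const_mul _),
        integral_const_mul, integral_const_mul, integral_const_mul, integral_add hk hi]
  -- With the parameter `1 + N` and `∫ W = N ^ 2`, both terms of Young's inequality are linear in `1
  -- + N`. A fixed parameter would give `N ^ 2`, whereas only integrability of `N` in time is known.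
  · have hl : 0 < 1 + N := by linarith
    rw [hsplit]
    have b1 : ‖∫ x, weightedRate p A At Ar β t (mollify n (u t) x)
        (mollify n (Du t) x) (mollify n (ut t) x) x‖ ≤ C * ((∫ x, k x) + ∫ x, H x) := by
      rw [← hkHint n]
      exact norm_integral_le_of_norm_le (hkH n) (.of_forall fun x => hrate n x)
    have b2 : ‖∫ x, multiplier A β t (mollify n (u t) x)
        (mollify n (Du t) x) (mollify n (ut t) x) x * (nonlin p (mollify n (u t) x)
        - mollify n (fun y => nonlin p (u t y)) x)‖
        ≤ (1 + N) * (C * ((∫ x, k x) + ∫ x, H x)) + (1 + N)⁻¹ * ∫ x, W x := by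
      rw [← hbint n]
      exact norm_integral_le_of_norm_le (hbi n _) (.of_forall fun x => hprod n x _ hl)
    have b3 : (1 + N)⁻¹ * ∫ x, W x ≤ 1 + N := by
      rw [integral_sq_nonlin hN, ← hNdef, inv_mul_le_iff₀ hl]
      nlinarith
    have b4 : C * ((∫ x, k x) + ∫ x, H x) ≤ C * ((∫ x, k x) + |B|) :=
      mul_le_mul_of_nonneg_left (by linarith) hC0
    have b5 : (1 + N) * (C * ((∫ x, k x) + ∫ x, H x)) ≤ (1 + N) * (C * ((∫ x, k x) + |B|)) :=
      mul_le_mul_of_nonneg_left b4 hl.le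
    have b6 : C * ((∫ x, k x) + |B|) ≤ (1 + N) * (C * ((∫ x, k x) + |B|)) :=
      le_mul_of_one_le_left (by positivity) (by linarith)
    refine (norm_add_le _ _).trans ?_
    linarith

/-- The weighted energy identity. -/
theorem IsSolution.weighted_identity (hp₃ : 3 ≤ p) (hp₅ : p ≤ 5) (hu : IsSolution p u Du ut)
    (hw : CutWeight A At Ar β δ R) {t₁ t₂ : ℝ} (h : t₁ ≤ t₂) :
    (∫ x, weightedDensity p A β t₂ (u t₂ x) (Du t₂ x) (ut t₂ x) x)
      - ∫ x, weightedDensity p A β t₁ (u t₁ x) (Du t₁ x) (ut t₁ x) x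
      = ∫ t in Icc t₁ t₂, ∫ x, weightedRate p A At Ar β t (u t x) (Du t x) (ut t x) x := by
  have hp : 1 < p := by linarith
  obtain ⟨C, hC0, hC⟩ := hw.exists_density_bound hp₃ hp₅ t₁ t₂
  have hD : ∀ t ∈ Icc t₁ t₂, Tendsto (fun n => ∫ x, weightedDensity p A β t (mollify n (u t) x)
      (mollify n (Du t) x) (mollify n (ut t) x) x) atTop
      (𝓝 (∫ x, weightedDensity p A β t (u t x) (Du t x) (ut t x) x)) := fun t ht =>
    hu.tendsto_integral_state (hw.measurable_weightedDensity (p := p) t)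
      (fun x => continuous_weightedDensity_state hp.le t x) t
      (fun a g b x => (hC t ht a g b x).1) hC0
  have h1 := (hD t₂ (right_mem_Icc.2 h)).sub (hD t₁ (left_mem_Icc.2 h))
  refine tendsto_nhds_unique h1 ?_
  simp_rw [fun n => (hu.mollified_identity hp₃ hp₅ hw n h).2]
  obtain ⟨C', hC'⟩ := hu.tendsto_mollifiedRate hp₃ hp₅ hw (t₁ := t₁) (t₂ := t₂)
  have hN : LocLp 2 fun t x => nonlin p (u t x) := hu.locLp_nonlin hp₃ hp₅
  have hm : AEMeasurable fun t => eLpNorm (fun y => nonlin p (u t y)) 2 volume := by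
    simpa using aemeasurable_eLpNorm (q := 2) (by norm_num) hN.meas
  have hae : ∀ᵐ t, MemLp (fun y => nonlin p (u t y)) 2 := by
    have := LocLp.ae_memLp (q := 2) (by norm_num) (by simpa using hN)
    simpa using this
  -- The majorant is linear in the `L²` norm of the nonlinearity, which is integrable on bounded
  -- intervals by the Strichartz bound.
  refine tendsto_integral_of_dominated_convergence
    (fun t => C' * (1 + (eLpNorm (fun y => nonlin p (u t y)) 2 volume).toReal))
    (fun n => (hu.mollified_identity hp₃ hp₅ hw n h).1.aestronglyMeasurable) ?_ (fun n => ?_) ?_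
  · refine Integrable.const_mul (Integrable.add (integrableOn_const (by simp)) ?_) _
    exact integrable_toReal_of_lintegral_ne_top hm.restrict (hN.lint t₁ t₂).ne
  · filter_upwards [ae_restrict_of_ae hae, ae_restrict_mem measurableSet_Icc] with t h2 h3
    exact (hC' t h3 h2).2 n
  · filter_upwards [ae_restrict_of_ae hae, ae_restrict_mem measurableSet_Icc] with t h2 h3
    exact (hC' t h3 h2).1

end Solution

end WaveEnergy
end

noncomputable section
namespace WaveEnergy

/-! ### Energy bound and integrability of the densities -/

/-- With the inward weight equal to zero, the weighted identity reduces to the local conservation of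
energy. -/
theorem cutWeight_cutoff (n : ℕ) :
    CutWeight (fun _ _ => 0) (fun _ _ => 0) (fun _ _ => 0) (cutoff n) 1 (2 * ((n : ℝ) + 1)) where
  pos := one_pos
  hasDerivAt_time _ _ := hasDerivAt_const _ _
  hasDerivAt_radius _ _ := hasDerivAt_const _ _
  continuous := continuous_const
  continuous_time := continuous_const
  continuous_radius := continuous_const
  zero_of_le _ _ _ := rfl
  zero_of_ge _ _ _ := rfl
  contDiff := (cutoff_contDiff n).of_le (by simp)
  zero_outside _ hx := cutoff_eq_zero hx

/-- An integrable majorant of all densities. -/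
def totalDensity (p a : ℝ) (g : E3) (b : ℝ) (x : E3) : ℝ :=
  ‖g‖ ^ 2 + (‖x‖⁻¹ * a) ^ 2 + b ^ 2 + potential p a

theorem totalDensity_nonneg {p a b : ℝ} {g x : E3} (hp : -1 < p) : 0 ≤ totalDensity p a g b x := by
  have := potential_nonneg hp a
  unfold totalDensity; positivity

theorem inwardDensity_le_totalDensity {p a b : ℝ} {g x : E3} (hp : -1 < p) :
    inwardDensity p a g b x ≤ totalDensity p a g b x := by
  have h1 := LPlus_sq_le (a := a) (g := g) (b := b) (x := x)
  have h2 := norm_angular_sq_le g x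
  have h3 := potential_nonneg hp a
  rw [mul_comm a] at h1
  unfold inwardDensity totalDensity
  nlinarith [sq_nonneg b, sq_nonneg (‖x‖⁻¹ * a)]

/-- A factor `‖x‖` compensates the singularity of the Morawetz density. Hence weights vanishing
linearly at the origin have an integrable rate without any a priori Morawetz bound. -/
theorem norm_mul_morawetzDensity_le {p a b : ℝ} {g x : E3} (hp₃ : 3 ≤ p) (hp₅ : p ≤ 5) :
    ‖x‖ * morawetzDensity p a g x ≤ 2 * totalDensity p a g b x := by
  have h2 := norm_angular_sq_le g x
  have h3 := potential_nonneg (by linarith : -1 < p) a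
  have h5 : 0 ≤ (p - 1) / 2 * potential p a + ‖angular g x‖ ^ 2 / 2 := by
    have : 0 ≤ (p - 1) / 2 := by linarith
    positivity
  have h4 : ‖x‖ * morawetzDensity p a g x
      ≤ (p - 1) / 2 * potential p a + ‖angular g x‖ ^ 2 / 2 := by
    rw [morawetzDensity, mul_comm, mul_assoc]
    exact mul_le_of_le_one_right h5 (inv_mul_le_one (a := ‖x‖))
  unfold totalDensity
  nlinarith [sq_nonneg b, sq_nonneg (‖x‖⁻¹ * a)]

/-- The restriction of Lebesgue measure to a time slab. -/
def slab (t₁ t₂ : ℝ) : Measure (ℝ × E3) := (volume.restrict (Icc t₁ t₂)).prod volume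

instance (t₁ t₂ : ℝ) : SFinite (slab t₁ t₂) := by unfold slab; infer_instance

theorem slab_eq (t₁ t₂ : ℝ) : slab t₁ t₂ = volume.restrict (Icc t₁ t₂ ×ˢ univ) :=
  (volume_restrict_strip t₁ t₂).symm

section Solution

variable {p : ℝ} {u : ℝ → E3 → ℝ} {Du : ℝ → E3 → E3} {ut : ℝ → E3 → ℝ}

theorem IsSolution.aestronglyMeasurable_slice (hu : IsSolution p u Du ut)
    {f : ℝ × E3 × ℝ × E3 → ℝ} (hf : Measurable f) (t : ℝ) :
    AEStronglyMeasurable (fun x => f (u t x, Du t x, ut t x, x)) volume :=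
  (hf.comp_aemeasurable ((hu.homogeneousH1 t).memLp.1.aemeasurable.prodMk
    ((hu.homogeneousH1 t).memLp_grad.1.aemeasurable.prodMk
      ((hu.memLp_time t).1.aemeasurable.prodMk aemeasurable_id)))).aestronglyMeasurable

theorem IsSolution.aestronglyMeasurable_joint (hu : IsSolution p u Du ut)
    {f : ℝ × ℝ × E3 × ℝ × E3 → ℝ} (hf : Measurable f) :
    AEStronglyMeasurable (fun z : ℝ × E3 => f (z.1, u z.1 z.2, Du z.1 z.2, ut z.1 z.2, z.2)) volume :=
  (hf.comp_aemeasurable (measurable_fst.aemeasurable.prodMk (hu.aestronglyMeasurable.aemeasurable.prodMk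
    (hu.aestronglyMeasurable_grad.aemeasurable.prodMk
      (hu.aestronglyMeasurable_time.aemeasurable.prodMk measurable_snd.aemeasurable))))).aestronglyMeasurable

theorem energy_eq (t : ℝ) : energy p (u t) (Du t) (ut t)
    = ∫⁻ x, ENNReal.ofReal (energyDensity p (u t x) (Du t x) (ut t x)) := rfl

/-- The energy at any time is bounded by the initial energy. -/
theorem IsSolution.energy_le (hp₃ : 3 ≤ p) (hp₅ : p ≤ 5) (hu : IsSolution p u Du ut)
    (hE : energy p (u 0) (Du 0) (ut 0) < ⊤) (t : ℝ) :
    energy p (u t) (Du t) (ut t) ≤ energy p (u 0) (Du 0) (ut 0) := by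
  have hp : -1 < p := by linarith
  have hm : ∀ t, AEStronglyMeasurable (fun x => energyDensity p (u t x) (Du t x) (ut t x)) volume :=
    hu.aestronglyMeasurable_slice (measurable_energyDensity p)
  have hi0 : Integrable fun x => energyDensity p (u 0 x) (Du 0 x) (ut 0 x) :=
    (lintegral_ofReal_ne_top_iff_integrable (hm 0)
      (.of_forall fun x => energyDensity_nonneg hp)).1 hE.ne
  set I : ℕ → ℝ → ℝ := fun n t => ∫ x, cutoff n x * energyDensity p (u t x) (Du t x) (ut t x) with hI
  have hid : ∀ (n : ℕ) {a b : ℝ}, a ≤ b → I n b - I n a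
      = ∫ s in Icc a b, ∫ x, -(ut s x * fderiv ℝ (cutoff n) x (Du s x)) := fun n a b hab => by
    have := hu.weighted_identity hp₃ hp₅ (cutWeight_cutoff n) hab
    simpa [weightedDensity, weightedRate] using this
  obtain ⟨M, hM0, hM⟩ := exists_fderiv_cutoff_le
  obtain ⟨B, hB⟩ := (isCompact_uIcc (a := 0) (b := t)).exists_bound_of_continuousOn
    hu.continuous_stateSize.continuousOn
  have hB0 : 0 ≤ B := (norm_nonneg _).trans (hB 0 left_mem_uIcc)
  -- The cutoff costs only the flux through its layer, which is `O(1 / n)` times a bound for the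
  -- state that is uniform on the time interval.
  have hbd : ∀ n : ℕ, ∀ s ∈ uIcc 0 t, ‖∫ x, -(ut s x * fderiv ℝ (cutoff n) x (Du s x))‖
      ≤ M / (n + 1) * B := fun n s hs => by
    have hn : 0 ≤ M / ((n : ℝ) + 1) := by positivity
    have h1 : ‖∫ x, -(ut s x * fderiv ℝ (cutoff n) x (Du s x))‖
        ≤ ∫ x, M / (n + 1) * stateSize (u s x) (Du s x) (ut s x) := by
      refine norm_integral_le_of_norm_le ((hu.integrable_stateSize s).const_mul _)
        (.of_forall fun x => ?_)
      rw [norm_neg, norm_mul]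
      have h2 := ((fderiv ℝ (cutoff n) x).le_opNorm (Du s x)).trans
        (mul_le_mul_of_nonneg_right (hM n x) (norm_nonneg _))
      refine (mul_le_mul_of_nonneg_left h2 (norm_nonneg _)).trans ?_
      rw [show ‖ut s x‖ * (M / (n + 1) * ‖Du s x‖) = M / (n + 1) * (‖ut s x‖ * ‖Du s x‖) by ring]
      refine mul_le_mul_of_nonneg_left ?_ hn
      rw [stateSize, Real.norm_eq_abs]
      nlinarith [sq_abs (ut s x), sq_nonneg (|ut s x| - ‖Du s x‖), pow_nonneg (abs_nonneg (u s x)) 6,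
        sq_nonneg ‖Du s x‖, sq_nonneg (ut s x)]
    rw [integral_const_mul] at h1
    exact h1.trans (mul_le_mul_of_nonneg_left ((le_abs_self _).trans (hB s hs)) hn)
  have hle : ∀ n : ℕ, I n t ≤ I n 0 + M / (n + 1) * B * |t| := fun n => by
    have key : ∀ {a b : ℝ}, a ≤ b → Icc a b ⊆ uIcc 0 t → |I n b - I n a| ≤ M / (n + 1) * B * (b - a) :=
      fun {a b} hab hsub => by
        rw [hid n hab, ← Real.norm_eq_abs]
        refine (norm_setIntegral_le_of_norm_le_const (by simp)
          fun s hs => hbd n s (hsub hs)).trans ?_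
        simp [Measure.real, hab]
    rcases le_total 0 t with h | h
    · have := key h (by rw [uIcc_of_le h])
      rw [abs_of_nonneg h]
      linarith [le_abs_self (I n t - I n 0)]
    · have := key h (by rw [uIcc_of_ge h])
      rw [abs_of_nonpos h]
      linarith [neg_abs_le (I n 0 - I n t)]
  have hI0 : ∀ n, I n 0 ≤ ∫ x, energyDensity p (u 0 x) (Du 0 x) (ut 0 x) := fun n => by
    refine integral_mono_of_nonneg (.of_forall fun x =>
      mul_nonneg (cutoff_nonneg n x) (energyDensity_nonneg hp)) hi0 (.of_forall fun x => ?_)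
    exact mul_le_of_le_one_left (energyDensity_nonneg hp) (cutoff_le_one n x)
  rw [energy_eq, energy_eq, ← ofReal_integral_eq_lintegral_ofReal hi0
    (.of_forall fun x => energyDensity_nonneg hp)]
  have hci : ∀ n, Integrable fun x => cutoff n x * energyDensity p (u t x) (Du t x) (ut t x) := by
    intro n
    obtain ⟨C, hC0, hC⟩ := (cutWeight_cutoff n).exists_density_bound hp₃ hp₅ t t
    refine Integrable.mono' (((integrable_indicator_ball (2 * ((n : ℝ) + 1))).add
      (hu.integrable_stateSize t)).const_mul C)
      ((cutoff_contDiff n).continuous.aestronglyMeasurable.mul (hm t)) (.of_forall fun x => ?_)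
    simpa [weightedDensity] using (hC t (by simp) (u t x) (Du t x) (ut t x) x).1
  -- Finiteness of the energy at time `t` is not known beforehand; Fatou supplies it together with
  -- the inequality, which is all that is needed.
  have hfat : ∫⁻ x, ENNReal.ofReal (energyDensity p (u t x) (Du t x) (ut t x))
      ≤ liminf (fun n : ℕ => ∫⁻ x, ENNReal.ofReal
        (cutoff n x * energyDensity p (u t x) (Du t x) (ut t x))) atTop := by
    refine le_trans (lintegral_mono fun x => ?_) (lintegral_liminf_le' fun n =>
      ((hci n).1.aemeasurable.ennreal_ofReal))
    have h1 := (cutoff_tendsto x).mul_const (energyDensity p (u t x) (Du t x) (ut t x))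
    rw [one_mul] at h1
    exact ((ENNReal.continuous_ofReal.tendsto _).comp h1).liminf_eq.ge
  refine hfat.trans ?_
  have hlim : Tendsto (fun n : ℕ => ENNReal.ofReal
      ((∫ x, energyDensity p (u 0 x) (Du 0 x) (ut 0 x)) + M / (n + 1) * B * |t|)) atTop
      (𝓝 (ENNReal.ofReal (∫ x, energyDensity p (u 0 x) (Du 0 x) (ut 0 x)))) := by
    refine ENNReal.tendsto_ofReal ?_
    have h1 := (tendsto_one_div_add_atTop_nhds_zero_nat (𝕜 := ℝ)).const_mul (M * B * |t|)
    have h2 := h1.const_add (∫ x, energyDensity p (u 0 x) (Du 0 x) (ut 0 x))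
    rw [mul_zero, add_zero] at h2
    refine h2.congr fun n => ?_
    ring
  rw [← hlim.liminf_eq]
  refine liminf_le_liminf (.of_forall fun n => ?_)
  rw [← ofReal_integral_eq_lintegral_ofReal (hci n) (.of_forall fun x =>
    mul_nonneg (cutoff_nonneg n x) (energyDensity_nonneg hp))]
  exact ENNReal.ofReal_le_ofReal ((hle n).trans (by linarith [hI0 n]))

theorem measurable_totalDensity (p : ℝ) : Measurable fun q : ℝ × E3 × ℝ × E3 =>
    totalDensity p q.1 q.2.1 q.2.2.1 q.2.2.2 := by
  have h3 := measurable_potential p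
  unfold totalDensity
  fun_prop

/-- The majorant `totalDensity` along the solution has uniformly bounded integral. -/
theorem IsSolution.lintegral_totalDensity_le (hp₃ : 3 ≤ p) (hp₅ : p ≤ 5) (hu : IsSolution p u Du ut)
    (hE : energy p (u 0) (Du 0) (ut 0) < ⊤) (t : ℝ) :
    ∫⁻ x, ENNReal.ofReal (totalDensity p (u t x) (Du t x) (ut t x) x)
      ≤ 10 * energy p (u 0) (Du 0) (ut 0) := by
  have hp : -1 < p := by linarith
  have h1 := hu.energy_le hp₃ hp₅ hE t
  have hh : ∫⁻ x, ENNReal.ofReal ((‖x‖⁻¹ * u t x) ^ 2)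
      ≤ 4 * ∫⁻ x, ENNReal.ofReal (‖Du t x‖ ^ 2) := by
    have h2 := pow_le_pow_left' (hu.homogeneousH1 t).hardy 2
    rw [mul_pow, eLpNorm_two_sq, eLpNorm_two_sq] at h2
    simp only [Real.norm_eq_abs, sq_abs, show (2 : ℝ≥0∞) ^ 2 = 4 by norm_num] at h2
    exact h2
  have hg := (hu.integrable_grad_sq t).1.aemeasurable.ennreal_ofReal
  have hb := (hu.integrable_velocity_sq t).1.aemeasurable.ennreal_ofReal
  have hP : AEMeasurable (fun x => ENNReal.ofReal (potential p (u t x))) volume :=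
    ((measurable_potential p).comp_aemeasurable
      (hu.homogeneousH1 t).memLp.1.aemeasurable).ennreal_ofReal
  have e1 : ∫⁻ x, ENNReal.ofReal (totalDensity p (u t x) (Du t x) (ut t x) x)
      = (∫⁻ x, ENNReal.ofReal (‖Du t x‖ ^ 2)) + (∫⁻ x, ENNReal.ofReal ((‖x‖⁻¹ * u t x) ^ 2))
        + (∫⁻ x, ENNReal.ofReal (ut t x ^ 2)) + ∫⁻ x, ENNReal.ofReal (potential p (u t x)) := by
    rw [← lintegral_add_left' hg, ← lintegral_add_right' _ hb, ← lintegral_add_right' _ hP]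
    refine lintegral_congr fun x => ?_
    have := potential_nonneg hp (u t x)
    rw [totalDensity, ENNReal.ofReal_add (by positivity) this,
      ENNReal.ofReal_add (by positivity) (by positivity),
      ENNReal.ofReal_add (by positivity) (by positivity)]
  have e2 : 10 * energy p (u t) (Du t) (ut t) = 5 * (∫⁻ x, ENNReal.ofReal (‖Du t x‖ ^ 2))
      + 5 * (∫⁻ x, ENNReal.ofReal (ut t x ^ 2))
      + 10 * ∫⁻ x, ENNReal.ofReal (potential p (u t x)) := by
    rw [energy_eq, ← lintegral_const_mul' _ _ (by simp), ← lintegral_const_mul' _ _ (by simp),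
      ← lintegral_const_mul' _ _ (by simp), ← lintegral_const_mul' _ _ (by simp),
      ← lintegral_add_left' (hg.const_mul _), ← lintegral_add_right' _ (hP.const_mul _)]
    refine lintegral_congr fun x => ?_
    have := potential_nonneg hp (u t x)
    rw [show (10 : ℝ≥0∞) = ENNReal.ofReal 10 by simp, show (5 : ℝ≥0∞) = ENNReal.ofReal 5 by simp,
      ← ENNReal.ofReal_mul (by norm_num), ← ENNReal.ofReal_mul (by norm_num),
      ← ENNReal.ofReal_mul (by norm_num), ← ENNReal.ofReal_mul (by norm_num),
      ← ENNReal.ofReal_add (by positivity) (by positivity),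
      ← ENNReal.ofReal_add (by positivity) (by positivity)]
    congr 1
    rw [energyDensity]; ring
  refine le_trans ?_ (mul_le_mul_right h1 10)
  rw [e1, e2]
  -- The gradient and Hardy terms add up to `1 + 4 = 5` gradient terms, which is `10` times the
  -- gradient's share in the energy. This is the origin of the constant `10`.
  have h5 : (∫⁻ x, ENNReal.ofReal (‖Du t x‖ ^ 2)) + ∫⁻ x, ENNReal.ofReal ((‖x‖⁻¹ * u t x) ^ 2)
      ≤ 5 * ∫⁻ x, ENNReal.ofReal (‖Du t x‖ ^ 2) := by
    refine (add_le_add_right hh _).trans_eq ?_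
    ring
  refine add_le_add (add_le_add h5 ?_) ?_
  · exact le_mul_of_one_le_left' (by norm_num)
  · exact le_mul_of_one_le_left' (by norm_num)

theorem IsSolution.integrable_totalDensity (hp₃ : 3 ≤ p) (hp₅ : p ≤ 5) (hu : IsSolution p u Du ut)
    (hE : energy p (u 0) (Du 0) (ut 0) < ⊤) (t : ℝ) :
    Integrable fun x => totalDensity p (u t x) (Du t x) (ut t x) x :=
  (lintegral_ofReal_ne_top_iff_integrable
    (hu.aestronglyMeasurable_slice (measurable_totalDensity p) t)
    (.of_forall fun x => totalDensity_nonneg (by linarith))).1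
    ((hu.lintegral_totalDensity_le hp₃ hp₅ hE t).trans_lt
      (ENNReal.mul_lt_top (by simp) hE)).ne

theorem IsSolution.aestronglyMeasurable_slab (hu : IsSolution p u Du ut)
    {f : ℝ × ℝ × E3 × ℝ × E3 → ℝ} (hf : Measurable f) (t₁ t₂ : ℝ) : AEStronglyMeasurable
      (fun z : ℝ × E3 => f (z.1, u z.1 z.2, Du z.1 z.2, ut z.1 z.2, z.2)) (slab t₁ t₂) := by
  rw [slab_eq]
  exact (hu.aestronglyMeasurable_joint hf).restrict

theorem IsSolution.integrable_totalDensity_slab (hp₃ : 3 ≤ p) (hp₅ : p ≤ 5)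
    (hu : IsSolution p u Du ut) (hE : energy p (u 0) (Du 0) (ut 0) < ⊤) (t₁ t₂ : ℝ) :
    Integrable (fun z : ℝ × E3 => totalDensity p (u z.1 z.2) (Du z.1 z.2) (ut z.1 z.2) z.2)
      (slab t₁ t₂) := by
  have hm := hu.aestronglyMeasurable_slab
    (f := fun q => totalDensity p q.2.1 q.2.2.1 q.2.2.2.1 q.2.2.2.2)
    ((measurable_totalDensity p).comp measurable_snd) t₁ t₂
  refine (lintegral_ofReal_ne_top_iff_integrable hm
    (.of_forall fun x => totalDensity_nonneg (by linarith))).1 (LT.lt.ne ?_)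
  rw [slab, lintegral_prod _ (by rw [← slab]; exact hm.aemeasurable.ennreal_ofReal)]
  refine (lintegral_mono fun t => hu.lintegral_totalDensity_le hp₃ hp₅ hE t).trans_lt ?_
  rw [lintegral_const]
  exact ENNReal.mul_lt_top (ENNReal.mul_lt_top (by simp) hE) (by simp)

end Solution

end WaveEnergy
end

noncomputable section
namespace WaveEnergy

/-! ### Weights that do not vanish near the origin and at infinity -/

/-- A cutoff on the half-line, equal to `1` on `[2 / (n + 1), n + 1]`. -/
def ramp (n : ℕ) (r : ℝ) : ℝ :=
  Real.smoothTransition ((n + 1) * r - 1) * (1 - Real.smoothTransition (r / (n + 1) - 1))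

theorem ramp_contDiff (n : ℕ) : ContDiff ℝ 1 (ramp n) :=
  (Real.smoothTransition.contDiff.comp (by fun_prop)).mul
    (contDiff_const.sub (Real.smoothTransition.contDiff.comp (by fun_prop)))

theorem ramp_nonneg (n : ℕ) (r : ℝ) : 0 ≤ ramp n r :=
  mul_nonneg (Real.smoothTransition.nonneg _) (sub_nonneg.2 (Real.smoothTransition.le_one _))

theorem ramp_le_one (n : ℕ) (r : ℝ) : ramp n r ≤ 1 :=
  mul_le_one₀ (Real.smoothTransition.le_one _) (sub_nonneg.2 (Real.smoothTransition.le_one _))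
    (by linarith [Real.smoothTransition.nonneg (r / (n + 1) - 1)])

theorem ramp_zero_of_le {n : ℕ} {r : ℝ} (h : r ≤ 1 / (n + 1)) : ramp n r = 0 := by
  have : (n + 1) * r - 1 ≤ 0 := by
    rw [le_div_iff₀ (by positivity)] at h; linarith
  rw [ramp, Real.smoothTransition.zero_of_nonpos this, zero_mul]

theorem ramp_zero_of_ge {n : ℕ} {r : ℝ} (h : 2 * ((n : ℝ) + 1) ≤ r) : ramp n r = 0 := by
  have : 1 ≤ r / (n + 1) - 1 := by
    rw [le_sub_iff_add_le, le_div_iff₀ (by positivity)]; linarith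
  rw [ramp, Real.smoothTransition.one_of_one_le this, sub_self, mul_zero]

theorem ramp_eq_one {n : ℕ} {r : ℝ} (h1 : 2 ≤ (n + 1) * r) (h2 : r ≤ n + 1) : ramp n r = 1 := by
  have : r / (n + 1) - 1 ≤ 0 := by
    rw [sub_nonpos, div_le_one (by positivity)]; exact h2
  rw [ramp, Real.smoothTransition.zero_of_nonpos this,
    Real.smoothTransition.one_of_one_le (by linarith)]
  norm_num

theorem eventually_ramp_eq {r : ℝ} (hr : 0 < r) :
    ∀ᶠ n : ℕ in atTop, ramp n =ᶠ[𝓝 r] fun _ => 1 := by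
  obtain ⟨N, hN⟩ := exists_nat_gt (max (2 / r) r)
  filter_upwards [eventually_ge_atTop N] with n hn
  have hn' : (N : ℝ) ≤ n := by exact_mod_cast hn
  have h1 : 2 / r < n + 1 := by linarith [le_max_left (2 / r) r]
  have h2 : r < n + 1 := by linarith [le_max_right (2 / r) r]
  rw [div_lt_iff₀ hr] at h1
  have o1 : ∀ᶠ s in 𝓝 r, 2 < ((n : ℝ) + 1) * s :=
    (continuous_const.mul continuous_id).continuousAt.eventually (lt_mem_nhds h1)
  filter_upwards [o1, gt_mem_nhds h2] with s hs1 hs2 using ramp_eq_one hs1.le (le_of_lt hs2)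

theorem ramp_tendsto {r : ℝ} (hr : 0 < r) : Tendsto (fun n => ramp n r) atTop (𝓝 1) :=
  tendsto_const_nhds.congr' ((eventually_ramp_eq hr).mono fun _ h => h.eq_of_nhds.symm)

theorem deriv_ramp_tendsto {r : ℝ} (hr : 0 < r) :
    Tendsto (fun n => deriv (ramp n) r) atTop (𝓝 0) :=
  tendsto_const_nhds.congr' ((eventually_ramp_eq hr).mono fun _ h => by simp [h.deriv_eq])

theorem exists_deriv_smoothTransition_le :
    ∃ S, 0 ≤ S ∧ ∀ x, |deriv Real.smoothTransition x| ≤ S := by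
  obtain ⟨S, hS⟩ := (isCompact_Icc (a := (0 : ℝ)) (b := 1)).exists_bound_of_continuousOn
    ((Real.smoothTransition.contDiff (n := 1)).continuous_deriv le_rfl).continuousOn
  have hS0 : 0 ≤ S := (norm_nonneg _).trans (hS 0 (by simp))
  refine ⟨S, hS0, fun x => ?_⟩
  by_cases hx : x ∈ Icc (0 : ℝ) 1
  · exact hS x hx
  · rw [mem_Icc, not_and_or, not_le, not_le] at hx
    rcases hx with hx | hx
    · have : Real.smoothTransition =ᶠ[𝓝 x] fun _ => 0 := by
        filter_upwards [gt_mem_nhds hx] with y hy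
        exact Real.smoothTransition.zero_of_nonpos (le_of_lt hy)
      rw [this.deriv_eq]; simpa using hS0
    · have : Real.smoothTransition =ᶠ[𝓝 x] fun _ => 1 := by
        filter_upwards [lt_mem_nhds hx] with y hy
        exact Real.smoothTransition.one_of_one_le (le_of_lt hy)
      rw [this.deriv_eq]; simpa using hS0

theorem deriv_smoothTransition_eq_zero {x : ℝ} (hx : 1 < x ∨ x < 0) :
    deriv Real.smoothTransition x = 0 := by
  rcases hx with hx | hx
  · have : Real.smoothTransition =ᶠ[𝓝 x] fun _ => 1 := by
      filter_upwards [lt_mem_nhds hx] with y hy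
      exact Real.smoothTransition.one_of_one_le (le_of_lt hy)
    rw [this.deriv_eq]; simp
  · have : Real.smoothTransition =ᶠ[𝓝 x] fun _ => 0 := by
      filter_upwards [gt_mem_nhds hx] with y hy
      exact Real.smoothTransition.zero_of_nonpos (le_of_lt hy)
    rw [this.deriv_eq]; simp

/-- Scale invariance: in both transition regions the derivative is bounded by a constant over the
radius. Multiplied by a weight of size `O(r)`, it stays bounded uniformly in `n`. -/
theorem exists_mul_deriv_ramp_le : ∃ S, 0 ≤ S ∧ ∀ (n : ℕ) (r : ℝ), 0 ≤ r →
    r * |deriv (ramp n) r| ≤ S := by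
  obtain ⟨S, hS0, hS⟩ := exists_deriv_smoothTransition_le
  refine ⟨4 * S, by positivity, fun n r hr => ?_⟩
  have hn : (0 : ℝ) < n + 1 := by positivity
  have hd : ∀ x, HasDerivAt Real.smoothTransition (deriv Real.smoothTransition x) x := fun x =>
    ((Real.smoothTransition.contDiff (n := 1)).differentiable one_ne_zero x).hasDerivAt
  have h1 : HasDerivAt (fun r : ℝ => Real.smoothTransition ((n + 1) * r - 1))
      (deriv Real.smoothTransition ((n + 1) * r - 1) * (n + 1)) r := by
    refine (hd _).comp r ?_
    simpa using ((hasDerivAt_id r).const_mul ((n : ℝ) + 1)).sub_const 1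
  have h2 : HasDerivAt (fun r : ℝ => Real.smoothTransition (r / (n + 1) - 1))
      (deriv Real.smoothTransition (r / (n + 1) - 1) * (1 / (n + 1))) r := by
    refine (hd _).comp r ?_
    simpa using ((hasDerivAt_id r).div_const ((n : ℝ) + 1)).sub_const 1
  have h3 := (h1.mul (h2.const_sub 1)).deriv
  have h4 : deriv (ramp n) r = _ := h3
  rw [h4]
  set s1 := Real.smoothTransition ((n + 1) * r - 1)
  set s2 := Real.smoothTransition (r / (n + 1) - 1)
  set d1 := deriv Real.smoothTransition ((n + 1) * r - 1) with hd1
  set d2 := deriv Real.smoothTransition (r / (n + 1) - 1) with hd2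
  have a1 : |s1| ≤ 1 := by
    rw [abs_of_nonneg (Real.smoothTransition.nonneg _)]; exact Real.smoothTransition.le_one _
  have a2 : |1 - s2| ≤ 1 := by
    rw [abs_of_nonneg (sub_nonneg.2 (Real.smoothTransition.le_one _))]
    linarith [Real.smoothTransition.nonneg (r / (n + 1) - 1)]
  have b1 : (n + 1) * r * |d1| ≤ 2 * S := by
    by_cases h : (n + 1) * r ≤ 2
    · exact mul_le_mul h (hS _) (abs_nonneg _) (by norm_num)
    · rw [hd1, deriv_smoothTransition_eq_zero (Or.inl (by linarith))]; simp; positivity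
  have b2 : r / (n + 1) * |d2| ≤ 2 * S := by
    by_cases h : r / (n + 1) ≤ 2
    · exact mul_le_mul h (hS _) (abs_nonneg _) (by norm_num)
    · rw [hd2, deriv_smoothTransition_eq_zero (Or.inl (by linarith))]; simp; positivity
  have c1 : |d1 * (n + 1) * (1 - s2)| ≤ |d1| * (n + 1) := by
    rw [abs_mul, abs_mul, abs_of_pos hn]
    exact mul_le_of_le_one_right (by positivity) a2
  have c2 : |s1 * (-(d2 * (1 / (n + 1))))| ≤ |d2| * (1 / (n + 1)) := by
    rw [abs_mul, abs_neg, abs_mul, abs_of_pos (by positivity : (0 : ℝ) < 1 / (n + 1))]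
    exact mul_le_of_le_one_left (by positivity) a1
  calc r * |d1 * (n + 1) * (1 - s2) + s1 * (-(d2 * (1 / (n + 1))))|
      ≤ r * (|d1| * (n + 1) + |d2| * (1 / (n + 1))) :=
        mul_le_mul_of_nonneg_left ((abs_add_le _ _).trans (add_le_add c1 c2)) hr
    _ = (n + 1) * r * |d1| + r / (n + 1) * |d2| := by ring
    _ ≤ 4 * S := by linarith

/-- A weight `α(t, |x|)` for the inward energy with bounded derivatives and vanishing at the
origin. -/
structure RadialWeight (α αt αr : ℝ → ℝ → ℝ) (C t₁ t₂ : ℝ) : Prop where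
  hasDerivAt_time : ∀ t r, HasDerivAt (fun s => α s r) (αt t r) t
  hasDerivAt_radius : ∀ t r, HasDerivAt (α t) (αr t r) r
  continuous : Continuous fun q : ℝ × ℝ => α q.1 q.2
  continuous_time : Continuous fun q : ℝ × ℝ => αt q.1 q.2
  continuous_radius : Continuous fun q : ℝ × ℝ => αr q.1 q.2
  bound : ∀ t ∈ Icc t₁ t₂, ∀ r, 0 ≤ r → |α t r| ≤ C
  bound_linear : ∀ t ∈ Icc t₁ t₂, ∀ r, 0 ≤ r → |α t r| ≤ C * r
  bound_time : ∀ t ∈ Icc t₁ t₂, ∀ r, 0 ≤ r → |αt t r| ≤ C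
  bound_radius : ∀ t ∈ Icc t₁ t₂, ∀ r, 0 ≤ r → |αr t r| ≤ C

theorem RadialWeight.cutWeight {α αt αr : ℝ → ℝ → ℝ} {C t₁ t₂ : ℝ}
    (h : RadialWeight α αt αr C t₁ t₂) (n : ℕ) :
    CutWeight (fun t r => α t r * ramp n r) (fun t r => αt t r * ramp n r)
      (fun t r => αr t r * ramp n r + α t r * deriv (ramp n) r) (fun _ => 0) (1 / (n + 1))
      (2 * ((n : ℝ) + 1)) where
  pos := by positivity
  hasDerivAt_time t r := (h.hasDerivAt_time t r).mul_const _
  hasDerivAt_radius t r := (h.hasDerivAt_radius t r).mul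
    ((ramp_contDiff n).differentiable one_ne_zero r).hasDerivAt
  continuous := h.continuous.mul ((ramp_contDiff n).continuous.comp continuous_snd)
  continuous_time := h.continuous_time.mul ((ramp_contDiff n).continuous.comp continuous_snd)
  continuous_radius := (h.continuous_radius.mul
    ((ramp_contDiff n).continuous.comp continuous_snd)).add
    (h.continuous.mul (((ramp_contDiff n).continuous_deriv le_rfl).comp continuous_snd))
  zero_of_le t r hr := by rw [ramp_zero_of_le hr, mul_zero]
  zero_of_ge t r hr := by rw [ramp_zero_of_ge hr, mul_zero]
  contDiff := contDiff_const
  zero_outside _ _ := rfl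

/-- The density of the inward energy of the solution at a space-time point. -/
def inwardAt (p : ℝ) (u : ℝ → E3 → ℝ) (Du : ℝ → E3 → E3) (ut : ℝ → E3 → ℝ) (z : ℝ × E3) : ℝ :=
  inwardDensity p (u z.1 z.2) (Du z.1 z.2) (ut z.1 z.2) z.2

/-- The flux density of the solution at a space-time point. -/
def fluxAt (p : ℝ) (u : ℝ → E3 → ℝ) (Du : ℝ → E3 → E3) (ut : ℝ → E3 → ℝ) (z : ℝ × E3) : ℝ :=
  fluxDensity p (u z.1 z.2) (Du z.1 z.2) (ut z.1 z.2) z.2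

/-- The Morawetz density of the solution at a space-time point. -/
def morawetzAt (p : ℝ) (u : ℝ → E3 → ℝ) (Du : ℝ → E3 → E3) (z : ℝ × E3) : ℝ :=
  morawetzDensity p (u z.1 z.2) (Du z.1 z.2) z.2

/-- The integrable majorant of the solution at a space-time point. -/
def totalAt (p : ℝ) (u : ℝ → E3 → ℝ) (Du : ℝ → E3 → E3) (ut : ℝ → E3 → ℝ) (z : ℝ × E3) : ℝ :=
  totalDensity p (u z.1 z.2) (Du z.1 z.2) (ut z.1 z.2) z.2

theorem ae_slab_ne_zero (t₁ t₂ : ℝ) : ∀ᵐ z ∂slab t₁ t₂, z.2 ≠ 0 :=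
  Measure.quasiMeasurePreserving_snd.ae (Measure.ae_ne (volume : Measure E3) 0)

theorem ae_slab_mem (t₁ t₂ : ℝ) : ∀ᵐ z ∂slab t₁ t₂, z.1 ∈ Icc t₁ t₂ :=
  Measure.quasiMeasurePreserving_fst.ae (ae_restrict_mem measurableSet_Icc)

section Solution

variable {p : ℝ} {u : ℝ → E3 → ℝ} {Du : ℝ → E3 → E3} {ut : ℝ → E3 → ℝ}

theorem IsSolution.aestronglyMeasurable_inwardAt (hu : IsSolution p u Du ut) :
    AEStronglyMeasurable (inwardAt p u Du ut) volume :=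
  hu.aestronglyMeasurable_joint ((measurable_inwardDensity p).comp measurable_snd)

theorem IsSolution.aestronglyMeasurable_fluxAt (hu : IsSolution p u Du ut) :
    AEStronglyMeasurable (fluxAt p u Du ut) volume :=
  hu.aestronglyMeasurable_joint ((measurable_fluxDensity p).comp measurable_snd)

theorem IsSolution.aestronglyMeasurable_morawetzAt (hu : IsSolution p u Du ut) :
    AEStronglyMeasurable (morawetzAt p u Du) volume :=
  hu.aestronglyMeasurable_joint ((measurable_morawetzDensity p).comp measurable_snd)

theorem aestronglyMeasurable_slab_of {f : ℝ × E3 → ℝ} (hf : AEStronglyMeasurable f volume)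
    (t₁ t₂ : ℝ) : AEStronglyMeasurable f (slab t₁ t₂) := by
  rw [slab_eq]; exact hf.restrict

theorem continuous_weight {f : ℝ → ℝ → ℝ} (hf : Continuous fun q : ℝ × ℝ => f q.1 q.2) :
    Continuous fun z : ℝ × E3 => f z.1 ‖z.2‖ :=
  hf.comp (continuous_fst.prodMk continuous_snd.norm)

/-- The rate in the radial weighted identity. -/
def radialRate (p : ℝ) (u : ℝ → E3 → ℝ) (Du : ℝ → E3 → E3) (ut : ℝ → E3 → ℝ)
    (α αt αr : ℝ → ℝ → ℝ) (z : ℝ × E3) : ℝ :=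
  αt z.1 ‖z.2‖ * inwardAt p u Du ut z - αr z.1 ‖z.2‖ * fluxAt p u Du ut z
    - α z.1 ‖z.2‖ * morawetzAt p u Du z

/-- The derivatives of the weight meet densities bounded by the majorant; the weight itself meets
the singular Morawetz density and must therefore be linear in `‖x‖`. -/
theorem abs_radialRate_le (hp₃ : 3 ≤ p) (hp₅ : p ≤ 5) {α αt αr : ℝ → ℝ → ℝ} {C : ℝ} (hC : 0 ≤ C)
    {z : ℝ × E3} (h1 : |αt z.1 ‖z.2‖| ≤ C) (h2 : |αr z.1 ‖z.2‖| ≤ C)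
    (h3 : |α z.1 ‖z.2‖| ≤ C * ‖z.2‖) :
    |radialRate p u Du ut α αt αr z| ≤ 4 * C * totalAt p u Du ut z := by
  have hp : -1 < p := by linarith
  have e0 : inwardAt p u Du ut z ≤ totalAt p u Du ut z := inwardDensity_le_totalDensity hp
  have e1 : |αt z.1 ‖z.2‖ * inwardAt p u Du ut z| ≤ C * totalAt p u Du ut z := by
    rw [abs_mul, abs_of_nonneg (a := inwardAt p u Du ut z) (inwardDensity_nonneg hp)]
    exact mul_le_mul h1 e0 (inwardDensity_nonneg hp) hC
  have e2 : |αr z.1 ‖z.2‖ * fluxAt p u Du ut z| ≤ C * totalAt p u Du ut z := by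
    rw [abs_mul]
    exact mul_le_mul h2 ((abs_fluxDensity_le hp).trans e0) (abs_nonneg _) hC
  have e3 : |α z.1 ‖z.2‖ * morawetzAt p u Du z| ≤ 2 * C * totalAt p u Du ut z := by
    have h0 : 0 ≤ morawetzAt p u Du z := morawetzDensity_nonneg (by linarith)
    rw [abs_mul, abs_of_nonneg h0]
    refine (mul_le_mul_of_nonneg_right h3 h0).trans ?_
    have := mul_le_mul_of_nonneg_left (norm_mul_morawetzDensity_le (a := u z.1 z.2)
      (g := Du z.1 z.2) (b := ut z.1 z.2) (x := z.2) hp₃ hp₅) hC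
    rw [morawetzAt, totalAt]
    linarith
  refine (abs_sub _ _).trans ?_
  refine (add_le_add_left (abs_sub _ _) _).trans ?_
  linarith

variable {α αt αr : ℝ → ℝ → ℝ} {C t₁ t₂ : ℝ}

theorem IsSolution.aestronglyMeasurable_radialRate (hu : IsSolution p u Du ut)
    (h1 : Continuous fun q : ℝ × ℝ => α q.1 q.2) (h2 : Continuous fun q : ℝ × ℝ => αt q.1 q.2)
    (h3 : Continuous fun q : ℝ × ℝ => αr q.1 q.2) :
    AEStronglyMeasurable (radialRate p u Du ut α αt αr) (slab t₁ t₂) :=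
  aestronglyMeasurable_slab_of
    ((((continuous_weight h2).aestronglyMeasurable.mul hu.aestronglyMeasurable_inwardAt).sub
      ((continuous_weight h3).aestronglyMeasurable.mul hu.aestronglyMeasurable_fluxAt)).sub
      ((continuous_weight h1).aestronglyMeasurable.mul hu.aestronglyMeasurable_morawetzAt)) _ _

theorem IsSolution.integrable_radialRate (hp₃ : 3 ≤ p) (hp₅ : p ≤ 5) (hu : IsSolution p u Du ut)
    (hE : energy p (u 0) (Du 0) (ut 0) < ⊤) (hC : 0 ≤ C) (hw : RadialWeight α αt αr C t₁ t₂) :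
    Integrable (radialRate p u Du ut α αt αr) (slab t₁ t₂) := by
  refine ((hu.integrable_totalDensity_slab hp₃ hp₅ hE t₁ t₂).const_mul (4 * C)).mono'
    (hu.aestronglyMeasurable_radialRate hw.continuous hw.continuous_time hw.continuous_radius) ?_
  filter_upwards [ae_slab_mem t₁ t₂] with z hz
  exact abs_radialRate_le hp₃ hp₅ hC (hw.bound_time _ hz _ (norm_nonneg _))
    (hw.bound_radius _ hz _ (norm_nonneg _)) (hw.bound_linear _ hz _ (norm_nonneg _))

/-- The weighted identity for radial weights. -/
theorem IsSolution.radial_identity (hp₃ : 3 ≤ p) (hp₅ : p ≤ 5) (hu : IsSolution p u Du ut)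
    (hE : energy p (u 0) (Du 0) (ut 0) < ⊤) (hC : 0 ≤ C) (hw : RadialWeight α αt αr C t₁ t₂)
    (h : t₁ ≤ t₂) :
    (∫ x, α t₂ ‖x‖ * inwardAt p u Du ut (t₂, x)) - ∫ x, α t₁ ‖x‖ * inwardAt p u Du ut (t₁, x)
      = ∫ z, radialRate p u Du ut α αt αr z ∂slab t₁ t₂ := by
  have hp : -1 < p := by linarith
  obtain ⟨S, hS0, hS⟩ := exists_mul_deriv_ramp_le
  have hramp : ∀ (n : ℕ) (r : ℝ), |ramp n r| ≤ 1 := fun n r => by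
    rw [abs_of_nonneg (ramp_nonneg n r)]; exact ramp_le_one n r
  have hT := hu.integrable_totalDensity_slab hp₃ hp₅ hE t₁ t₂
  set rate : ℕ → ℝ × E3 → ℝ := fun n => radialRate p u Du ut (fun t r => α t r * ramp n r)
    (fun t r => αt t r * ramp n r) (fun t r => αr t r * ramp n r + α t r * deriv (ramp n) r)
    with hrate
  have hrb : ∀ n, ∀ᵐ z ∂slab t₁ t₂, ‖rate n z‖ ≤ 4 * (C + C * S) * totalAt p u Du ut z := fun n => by
    filter_upwards [ae_slab_mem t₁ t₂] with z hz
    have hz0 := norm_nonneg z.2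
    have b1 := hw.bound_time _ hz _ hz0
    have b2 := hw.bound_radius _ hz _ hz0
    have b3 := hw.bound_linear _ hz _ hz0
    have b4 := hramp n ‖z.2‖
    have hCS : 0 ≤ C * S := by positivity
    -- The linear vanishing of `α` at the origin pays for the derivative of the cutoff, in the inner
    -- as well as in the outer transition region.
    have b5 : |α z.1 ‖z.2‖ * deriv (ramp n) ‖z.2‖| ≤ C * S := by
      rw [abs_mul]
      refine (mul_le_mul_of_nonneg_right b3 (abs_nonneg _)).trans ?_
      rw [mul_assoc]
      exact mul_le_mul_of_nonneg_left (hS n _ hz0) hC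
    have one : ∀ {v B : ℝ}, |v| ≤ B → |v * ramp n ‖z.2‖| ≤ B := fun {v B} hv => by
      rw [abs_mul]
      exact (mul_le_of_le_one_right (abs_nonneg _) b4).trans hv
    refine abs_radialRate_le hp₃ hp₅ (by positivity) ((one b1).trans (by linarith))
      ((abs_add_le _ _).trans (add_le_add (one b2) b5)) ((one b3).trans ?_)
    exact mul_le_mul_of_nonneg_right (by linarith) hz0
  have hrm : ∀ n, AEStronglyMeasurable (rate n) (slab t₁ t₂) := fun n =>
    hu.aestronglyMeasurable_radialRate (hw.cutWeight n).continuous (hw.cutWeight n).continuous_time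
      (hw.cutWeight n).continuous_radius
  have hid : ∀ n, (∫ x, α t₂ ‖x‖ * ramp n ‖x‖ * inwardAt p u Du ut (t₂, x))
      - ∫ x, α t₁ ‖x‖ * ramp n ‖x‖ * inwardAt p u Du ut (t₁, x)
      = ∫ z, rate n z ∂slab t₁ t₂ := fun n => by
    have h1 := hu.weighted_identity hp₃ hp₅ (hw.cutWeight n) h
    have h2 := integral_prod (μ := volume.restrict (Icc t₁ t₂)) (ν := (volume : Measure E3)) (rate n)
      ((hT.const_mul _).mono' (hrm n) (hrb n))
    rw [slab, h2]
    simpa [weightedDensity, weightedRate, hrate, radialRate, inwardAt, fluxAt, morawetzAt] using h1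
  have hlim : ∀ t ∈ Icc t₁ t₂, Tendsto (fun n => ∫ x, α t ‖x‖ * ramp n ‖x‖ * inwardAt p u Du ut (t, x))
      atTop (𝓝 (∫ x, α t ‖x‖ * inwardAt p u Du ut (t, x))) := fun t ht => by
    have hcα : Continuous fun x : E3 => α t ‖x‖ :=
      hw.continuous.comp (continuous_const.prodMk continuous_norm)
    have hm : AEStronglyMeasurable (fun x => inwardAt p u Du ut (t, x)) volume :=
      hu.aestronglyMeasurable_slice (measurable_inwardDensity p) t
    refine tendsto_integral_of_dominated_convergence
      (fun x => C * totalDensity p (u t x) (Du t x) (ut t x) x)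
      (fun n => ((hcα.mul ((ramp_contDiff n).continuous.comp
        continuous_norm)).aestronglyMeasurable).mul hm)
      ((hu.integrable_totalDensity hp₃ hp₅ hE t).const_mul C) (fun n => .of_forall fun x => ?_) ?_
    · rw [norm_mul, norm_mul, Real.norm_eq_abs, Real.norm_eq_abs,
        Real.norm_of_nonneg (r := inwardAt p u Du ut (t, x)) (inwardDensity_nonneg hp)]
      refine mul_le_mul ?_ (inwardDensity_le_totalDensity hp) (inwardDensity_nonneg hp) hC
      exact (mul_le_of_le_one_right (abs_nonneg _) (hramp n _)).trans
        (hw.bound t ht _ (norm_nonneg _))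
    · filter_upwards [Measure.ae_ne (volume : Measure E3) 0] with x hx
      have := ((ramp_tendsto (norm_pos_iff.2 hx)).const_mul (α t ‖x‖)).mul_const
        (inwardAt p u Du ut (t, x))
      simpa using this
  refine tendsto_nhds_unique ((hlim t₂ (right_mem_Icc.2 h)).sub (hlim t₁ (left_mem_Icc.2 h))) ?_
  simp_rw [hid]
  -- At every point off the origin the cutoff is eventually identically `1` nearby, so its
  -- derivative contributes nothing in the limit.
  refine tendsto_integral_of_dominated_convergence
    (fun z => 4 * (C + C * S) * totalAt p u Du ut z) hrm (hT.const_mul _) hrb ?_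
  filter_upwards [ae_slab_ne_zero t₁ t₂] with z hz
  have r1 := ramp_tendsto (norm_pos_iff.2 hz)
  have r2 := deriv_ramp_tendsto (norm_pos_iff.2 hz)
  have := (((r1.const_mul (αt z.1 ‖z.2‖)).mul_const (inwardAt p u Du ut z)).sub
    (((r1.const_mul (αr z.1 ‖z.2‖)).add (r2.const_mul (α z.1 ‖z.2‖))).mul_const
      (fluxAt p u Du ut z))).sub
    ((r1.const_mul (α z.1 ‖z.2‖)).mul_const (morawetzAt p u Du z))
  simpa [hrate, radialRate] using this

end Solution

end WaveEnergy
end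

noncomputable section
namespace WaveEnergy

/-! ### Monotonicity, Morawetz estimate and decay of the inward energy -/

/-- A regularization of the constant weight `1`, vanishing at the origin. -/
def soft (ε r : ℝ) : ℝ := r ^ 2 / (r ^ 2 + ε ^ 2)

/-- The derivative of `soft`. -/
def soft' (ε r : ℝ) : ℝ := 2 * r * ε ^ 2 / (r ^ 2 + ε ^ 2) ^ 2

section Soft

variable {ε : ℝ}

theorem hasDerivAt_soft (hε : 0 < ε) (r : ℝ) : HasDerivAt (soft ε) (soft' ε r) r := by
  have h0 : r ^ 2 + ε ^ 2 ≠ 0 := by positivity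
  have h := (hasDerivAt_pow 2 r).div ((hasDerivAt_pow 2 r).add_const (ε ^ 2)) h0
  refine h.congr_deriv ?_
  rw [soft']
  congr 1
  push_cast
  ring

theorem continuous_soft (hε : 0 < ε) : Continuous (soft ε) :=
  continuous_iff_continuousAt.2 fun r => (hasDerivAt_soft hε r).continuousAt

theorem continuous_soft' (hε : 0 < ε) : Continuous (soft' ε) := by
  unfold soft'
  exact Continuous.div (by fun_prop) (by fun_prop) fun r => by positivity

theorem soft_nonneg (r : ℝ) : 0 ≤ soft ε r := by unfold soft; positivity

theorem soft_le_one (r : ℝ) : soft ε r ≤ 1 :=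
  div_le_one_of_le₀ (by linarith [sq_nonneg ε]) (by positivity)

theorem soft_le_mul (hε : 0 < ε) {r : ℝ} (hr : 0 ≤ r) : soft ε r ≤ ε⁻¹ * r := by
  rw [soft, div_le_iff₀ (by positivity)]
  have : ε⁻¹ * r * (r ^ 2 + ε ^ 2) = ε⁻¹ * r * (r - ε) ^ 2 + 2 * r ^ 2 := by field_simp; ring
  have h2 : 0 ≤ ε⁻¹ * r * (r - ε) ^ 2 := by positivity
  nlinarith

theorem soft'_nonneg {r : ℝ} (hr : 0 ≤ r) : 0 ≤ soft' ε r := by unfold soft'; positivity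

theorem soft'_le (hε : 0 < ε) (r : ℝ) : soft' ε r ≤ ε⁻¹ := by
  rw [soft', div_le_iff₀ (by positivity)]
  have : ε⁻¹ * (r ^ 2 + ε ^ 2) ^ 2 - 2 * r * ε ^ 2
      = ε⁻¹ * (r ^ 4 + r ^ 2 * ε ^ 2 + ε ^ 2 * (r - ε) ^ 2) := by field_simp; ring
  have h2 : 0 ≤ ε⁻¹ * (r ^ 4 + r ^ 2 * ε ^ 2 + ε ^ 2 * (r - ε) ^ 2) := by positivity
  linarith

/-- This identity converts the term with the derivative of the regularization into a multiple of the
Morawetz density. The resulting factor `soft - soft ^ 2` tends to `0` away from the origin. -/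
theorem soft'_mul (hε : 0 < ε) (r : ℝ) : soft' ε r * r = 2 * (soft ε r - soft ε r ^ 2) := by
  have h0 : r ^ 2 + ε ^ 2 ≠ 0 := by positivity
  rw [soft', soft]
  field_simp
  ring

theorem soft_tendsto {r : ℝ} (hr : r ≠ 0) :
    Tendsto (fun n : ℕ => soft (1 / ((n : ℝ) + 1)) r) atTop (𝓝 1) := by
  have h := (((tendsto_one_div_add_atTop_nhds_zero_nat (𝕜 := ℝ)).pow 2).const_add (r ^ 2))
  have h2 := (tendsto_const_nhds (x := r ^ 2)).div h (by positivity)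
  rw [zero_pow two_ne_zero, add_zero, div_self (by positivity)] at h2
  exact h2

end Soft

/-- Inward waves are functions of `t + r`, so weights `c(t + r)` are constant along their
characteristics. The factor `soft ε` adds the required linear vanishing at the origin, at the price
of a constant of order `ε⁻¹`. -/
theorem radialWeight_soft {ε : ℝ} (hε : 0 < ε) {c c' : ℝ → ℝ} (hc : ∀ s, HasDerivAt c (c' s) s)
    (hcc : Continuous c') {B : ℝ} (h1 : ∀ s, |c s| ≤ 1) (hB : ∀ s, |c' s| ≤ B) (t₁ t₂ : ℝ) :
    RadialWeight (fun t r => c (t + r) * soft ε r) (fun t r => c' (t + r) * soft ε r)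
      (fun t r => c' (t + r) * soft ε r + c (t + r) * soft' ε r) (1 + B + ε⁻¹) t₁ t₂ := by
  have hB0 : 0 ≤ B := (abs_nonneg _).trans (hB 0)
  have hε0 : 0 ≤ ε⁻¹ := by positivity
  have cc : Continuous c := continuous_iff_continuousAt.2 fun s => (hc s).continuousAt
  have hadd : Continuous fun q : ℝ × ℝ => q.1 + q.2 := by fun_prop
  have s1 := (continuous_soft hε).comp (continuous_snd (X := ℝ) (Y := ℝ))
  have s2 := (continuous_soft' hε).comp (continuous_snd (X := ℝ) (Y := ℝ))
  have e1 : ∀ r, |soft ε r| ≤ 1 := fun r => by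
    rw [abs_of_nonneg (soft_nonneg r)]; exact soft_le_one r
  have e2 : ∀ {r}, 0 ≤ r → |soft' ε r| ≤ ε⁻¹ := fun {r} hr => by
    rw [abs_of_nonneg (soft'_nonneg hr)]; exact soft'_le hε r
  have m1 : ∀ t r, |c' (t + r) * soft ε r| ≤ B := fun t r => by
    rw [abs_mul]; exact (mul_le_of_le_one_right (abs_nonneg _) (e1 r)).trans (hB _)
  refine ⟨fun t r => ?_, fun t r => ?_, (cc.comp hadd).mul s1, (hcc.comp hadd).mul s1,
    ((hcc.comp hadd).mul s1).add ((cc.comp hadd).mul s2), fun t _ r hr => ?_, fun t _ r hr => ?_,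
    fun t _ r hr => ?_, fun t _ r hr => ?_⟩
  · exact ((hc (t + r)).comp_add_const t r).mul_const _
  · exact ((hc (t + r)).comp_const_add t r).mul (hasDerivAt_soft hε r)
  · rw [abs_mul]
    have := mul_le_one₀ (h1 (t + r)) (abs_nonneg _) (e1 r)
    linarith
  · rw [abs_mul, abs_of_nonneg (soft_nonneg r)]
    refine (mul_le_of_le_one_left (soft_nonneg r) (h1 _)).trans ((soft_le_mul hε hr).trans ?_)
    exact mul_le_mul_of_nonneg_right (by linarith) hr
  · exact (m1 t r).trans (by linarith)
  · refine (abs_add_le _ _).trans ?_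
    rw [abs_mul (c (t + r))]
    have := mul_le_mul (h1 (t + r)) (e2 hr) (abs_nonneg _) zero_le_one
    linarith [m1 t r]

section Solution

variable {p : ℝ} {u : ℝ → E3 → ℝ} {Du : ℝ → E3 → E3} {ut : ℝ → E3 → ℝ}

/-- The sign of the rate for the regularized weights. -/
theorem radialRate_soft_le (hp₃ : 3 ≤ p) {ε : ℝ} (hε : 0 < ε) {c c' : ℝ → ℝ} {z : ℝ × E3}
    (hz : z.2 ≠ 0) (hc : 0 ≤ c (z.1 + ‖z.2‖)) (hc' : 0 ≤ c' (z.1 + ‖z.2‖)) :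
    radialRate p u Du ut (fun t r => c (t + r) * soft ε r) (fun t r => c' (t + r) * soft ε r)
      (fun t r => c' (t + r) * soft ε r + c (t + r) * soft' ε r) z
      ≤ c' (z.1 + ‖z.2‖) * ‖z.2‖ * soft ε ‖z.2‖ * morawetzAt p u Du z
        - c (z.1 + ‖z.2‖) * soft ε ‖z.2‖ ^ 2 * morawetzAt p u Du z := by
  have hr : 0 < ‖z.2‖ := norm_pos_iff.2 hz
  have hψ := potential_nonneg (by linarith : -1 < p) (u z.1 z.2)
  have hQ := sq_nonneg ‖angular (Du z.1 z.2) z.2‖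
  have hL := sq_nonneg (LPlus (u z.1 z.2) (Du z.1 z.2) (ut z.1 z.2) z.2)
  have hs := soft_nonneg (ε := ε) ‖z.2‖
  have hs' := soft'_nonneg (ε := ε) hr.le
  have hmul := soft'_mul hε ‖z.2‖
  simp only [radialRate, inwardAt, fluxAt, morawetzAt, inwardDensity, fluxDensity]
  have hm : morawetzDensity p (u z.1 z.2) (Du z.1 z.2) z.2 * ‖z.2‖
      = (p - 1) / 2 * potential p (u z.1 z.2) + ‖angular (Du z.1 z.2) z.2‖ ^ 2 / 2 := by
    rw [morawetzDensity, mul_assoc, inv_mul_cancel₀ hr.ne', mul_one]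
  set m := morawetzDensity p (u z.1 z.2) (Du z.1 z.2) z.2
  set r := ‖z.2‖
  set ψ := potential p (u z.1 z.2)
  set Q := ‖angular (Du z.1 z.2) z.2‖ ^ 2
  set L := LPlus (u z.1 z.2) (Du z.1 z.2) (ut z.1 z.2) z.2 ^ 2
  set C := c (z.1 + r)
  set C' := c' (z.1 + r)
  set b := soft ε r
  set b' := soft' ε r
  -- This is where `p ≥ 3` enters: it says `(p - 1) / 2 ≥ 1`.
  have hq : Q / 2 + ψ ≤ m * r := by rw [hm]; nlinarith
  have h1 : C' * b * (Q / 2 + ψ) ≤ C' * b * (m * r) :=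
    mul_le_mul_of_nonneg_left hq (by positivity)
  -- The part of the flux with the unfavourable sign is half of what `hq` bounds. With `soft'_mul`
  -- it becomes `C * m * (b - b ^ 2)`, which leaves `-C * b ^ 2 * m` of the Morawetz term; the part
  -- with `L` has a favourable sign and is dropped.
  have h2 : C * b' * (Q / 4 + ψ / 2) ≤ C * b' * (m * r / 2) :=
    mul_le_mul_of_nonneg_left (by linarith) (by positivity)
  have h3 : C * b' * (m * r / 2) = C * m * (b - b ^ 2) := by
    linear_combination C * m / 2 * hmul
  have h4 : 0 ≤ C * b' * (L / 4) := by positivity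
  linarith

/-- The inward energy, as a real number. -/
def inwardReal (p : ℝ) (u : ℝ → E3 → ℝ) (Du : ℝ → E3 → E3) (ut : ℝ → E3 → ℝ) (t : ℝ) : ℝ :=
  ∫ x, inwardAt p u Du ut (t, x)

theorem IsSolution.integrable_inwardAt (hp₃ : 3 ≤ p) (hp₅ : p ≤ 5) (hu : IsSolution p u Du ut)
    (hE : energy p (u 0) (Du 0) (ut 0) < ⊤) (t : ℝ) :
    Integrable fun x => inwardAt p u Du ut (t, x) := by
  refine (hu.integrable_totalDensity hp₃ hp₅ hE t).mono'
    (hu.aestronglyMeasurable_slice (measurable_inwardDensity p) t) (.of_forall fun x => ?_)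
  rw [Real.norm_of_nonneg (r := inwardAt p u Du ut (t, x)) (inwardDensity_nonneg (by linarith))]
  exact inwardDensity_le_totalDensity (by linarith)

theorem inwardReal_nonneg (hp₃ : 3 ≤ p) (t : ℝ) : 0 ≤ inwardReal p u Du ut t :=
  integral_nonneg fun _ => inwardDensity_nonneg (by linarith)

theorem IsSolution.inwardEnergy_eq (hp₃ : 3 ≤ p) (hp₅ : p ≤ 5) (hu : IsSolution p u Du ut)
    (hE : energy p (u 0) (Du 0) (ut 0) < ⊤) (t : ℝ) :
    inwardEnergy p u Du ut t = ENNReal.ofReal (inwardReal p u Du ut t) := by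
  rw [inwardReal, ofReal_integral_eq_lintegral_ofReal (hu.integrable_inwardAt hp₃ hp₅ hE t)
    (.of_forall fun x => inwardDensity_nonneg (by linarith)), inwardEnergy]
  refine lintegral_congr fun x => ?_
  congr 1
  rw [inwardAt, inwardDensity, potential, div_div, mul_comm (p + 1) 2]

theorem IsSolution.inwardReal_le (hp₃ : 3 ≤ p) (hp₅ : p ≤ 5) (hu : IsSolution p u Du ut)
    (hE : energy p (u 0) (Du 0) (ut 0) < ⊤) (t : ℝ) :
    inwardReal p u Du ut t ≤ (10 * energy p (u 0) (Du 0) (ut 0)).toReal := by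
  rw [← ENNReal.ofReal_le_iff_le_toReal (ENNReal.mul_lt_top (by simp) hE).ne,
    ← hu.inwardEnergy_eq hp₃ hp₅ hE]
  refine le_trans (lintegral_mono fun x => ENNReal.ofReal_le_ofReal ?_)
    (hu.lintegral_totalDensity_le hp₃ hp₅ hE t)
  have := inwardDensity_le_totalDensity (a := u t x) (g := Du t x) (b := ut t x) (x := x)
    (by linarith : -1 < p)
  rwa [inwardDensity, potential, div_div, mul_comm (p + 1) 2] at this

/-- Integrals of the inward energy density against bounded converging weights. -/
theorem IsSolution.tendsto_integral_mul_inwardAt (hp₃ : 3 ≤ p) (hp₅ : p ≤ 5)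
    (hu : IsSolution p u Du ut) (hE : energy p (u 0) (Du 0) (ut 0) < ⊤) (t : ℝ)
    {w : ℕ → ℝ → ℝ} {w₀ : ℝ → ℝ} (hw : ∀ n, Continuous (w n)) (h1 : ∀ n r, 0 ≤ r → |w n r| ≤ 1)
    (hl : ∀ r, 0 < r → Tendsto (fun n => w n r) atTop (𝓝 (w₀ r))) :
    Tendsto (fun n => ∫ x : E3, w n ‖x‖ * inwardAt p u Du ut (t, x)) atTop
      (𝓝 (∫ x : E3, w₀ ‖x‖ * inwardAt p u Du ut (t, x))) := by
  have hi := hu.integrable_inwardAt hp₃ hp₅ hE t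
  refine tendsto_integral_of_dominated_convergence _
    (fun n => ((hw n).comp continuous_norm).aestronglyMeasurable.mul hi.1) hi.norm
    (fun n => .of_forall fun x => ?_) ?_
  · rw [norm_mul]
    exact mul_le_of_le_one_left (norm_nonneg _) (h1 n _ (norm_nonneg _))
  · filter_upwards [Measure.ae_ne (volume : Measure E3) 0] with x hx
    exact (hl _ (norm_pos_iff.2 hx)).mul_const _

theorem abs_soft_le_one (ε r : ℝ) : |soft ε r| ≤ 1 := by
  rw [abs_of_nonneg (soft_nonneg r)]; exact soft_le_one r

/-- The radial identity with the weight `soft ε` in place of `1`. The sign of its rate bounds `soft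
^ 2` times the Morawetz density by the loss of weighted inward energy, uniformly in `ε`. The
inequality may be strict in the limit: the discarded flux concentrates at the origin. -/
theorem IsSolution.morawetz_estimate (hp₃ : 3 ≤ p) (hp₅ : p ≤ 5) (hu : IsSolution p u Du ut)
    (hE : energy p (u 0) (Du 0) (ut 0) < ⊤) {t₁ t₂ : ℝ} (h : t₁ ≤ t₂) :
    inwardReal p u Du ut t₂ ≤ inwardReal p u Du ut t₁ ∧
      Integrable (morawetzAt p u Du) (slab t₁ t₂) ∧
      ∫ z, morawetzAt p u Du z ∂slab t₁ t₂
        ≤ inwardReal p u Du ut t₁ - inwardReal p u Du ut t₂ := by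
  have hp : -1 < p := by linarith
  have hpos : ∀ n : ℕ, (0 : ℝ) < 1 / ((n : ℝ) + 1) := fun n => by positivity
  set b : ℕ → ℝ → ℝ := fun n => soft (1 / ((n : ℝ) + 1)) with hb
  have hm0 : ∀ z, 0 ≤ morawetzAt p u Du z := fun z => morawetzDensity_nonneg (by linarith)
  have hw : ∀ n : ℕ, RadialWeight _ _ _ _ t₁ t₂ := fun n =>
    radialWeight_soft (hpos n) (c := fun _ => 1) (c' := fun _ => 0) (B := 0)
      (fun s => hasDerivAt_const _ _) continuous_const (by simp) (by simp) t₁ t₂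
  have hC : ∀ n : ℕ, (0 : ℝ) ≤ 1 + 0 + (1 / ((n : ℝ) + 1))⁻¹ := fun n => by positivity
  have hri := fun n => hu.integrable_radialRate hp₃ hp₅ hE (hC n) (hw n)
  have hle : ∀ n, ∀ᵐ z ∂slab t₁ t₂, b n ‖z.2‖ ^ 2 * morawetzAt p u Du z ≤ - radialRate p u Du ut
      (fun t r => 1 * soft (1 / ((n : ℝ) + 1)) r) (fun t r => 0 * soft (1 / ((n : ℝ) + 1)) r)
      (fun t r => 0 * soft (1 / ((n : ℝ) + 1)) r + 1 * soft' (1 / ((n : ℝ) + 1)) r) z := fun n => by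
    filter_upwards [ae_slab_ne_zero t₁ t₂] with z hz
    have := radialRate_soft_le (u := u) (Du := Du) (ut := ut) hp₃ (hpos n) (c := fun _ => 1)
      (c' := fun _ => 0) hz zero_le_one le_rfl
    simp only [hb]
    linarith
  have hmeas : ∀ n, AEStronglyMeasurable (fun z => b n ‖z.2‖ ^ 2 * morawetzAt p u Du z)
      (slab t₁ t₂) := fun n =>
    ((((continuous_soft (hpos n)).comp continuous_snd.norm).pow 2).aestronglyMeasurable).mul
      (aestronglyMeasurable_slab_of hu.aestronglyMeasurable_morawetzAt _ _)
  have hbi : ∀ n, Integrable (fun z => b n ‖z.2‖ ^ 2 * morawetzAt p u Du z) (slab t₁ t₂) := fun n =>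
    (hri n).neg.mono' (hmeas n) (by
      filter_upwards [hle n] with z hz
      rwa [Real.norm_of_nonneg (mul_nonneg (sq_nonneg _) (hm0 z))])
  have hest : ∀ n, ∫ z, b n ‖z.2‖ ^ 2 * morawetzAt p u Du z ∂slab t₁ t₂
      ≤ (∫ x, b n ‖x‖ * inwardAt p u Du ut (t₁, x))
        - ∫ x, b n ‖x‖ * inwardAt p u Du ut (t₂, x) := fun n => by
    refine (integral_mono_ae (hbi n) (hri n).neg (hle n)).trans_eq ?_
    have := hu.radial_identity hp₃ hp₅ hE (hC n) (hw n) h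
    simp only [one_mul] at this ⊢
    rw [Pi.neg_def, integral_neg, ← this, neg_sub]
  have hlim : ∀ t, Tendsto (fun n => ∫ x, b n ‖x‖ * inwardAt p u Du ut (t, x)) atTop
      (𝓝 (inwardReal p u Du ut t)) := fun t => by
    have := hu.tendsto_integral_mul_inwardAt hp₃ hp₅ hE t (w := b) (w₀ := fun _ => 1)
      (fun n => continuous_soft (hpos n)) (fun n r _ => abs_soft_le_one _ _)
      fun r hr => soft_tendsto hr.ne'
    simpa [inwardReal] using this
  have hlim2 := (hlim t₁).sub (hlim t₂)
  have hdiff : 0 ≤ inwardReal p u Du ut t₁ - inwardReal p u Du ut t₂ :=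
    ge_of_tendsto' hlim2 fun n => le_trans (integral_nonneg fun z =>
      mul_nonneg (sq_nonneg _) (hm0 z)) (hest n)
  -- Integrability of the Morawetz density is a conclusion, so the limit `ε → 0` is taken with Fatou
  -- in `ℝ≥0∞`.
  have hfat : ∫⁻ z, ENNReal.ofReal (morawetzAt p u Du z) ∂slab t₁ t₂
      ≤ ENNReal.ofReal (inwardReal p u Du ut t₁ - inwardReal p u Du ut t₂) := by
    have h1 : ∫⁻ z, ENNReal.ofReal (morawetzAt p u Du z) ∂slab t₁ t₂ ≤ liminf (fun n =>
        ∫⁻ z, ENNReal.ofReal (b n ‖z.2‖ ^ 2 * morawetzAt p u Du z) ∂slab t₁ t₂) atTop := by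
      refine le_trans (lintegral_mono_ae ?_) (lintegral_liminf_le' fun n =>
        (hmeas n).aemeasurable.ennreal_ofReal)
      filter_upwards [ae_slab_ne_zero t₁ t₂] with z hz
      have := ((soft_tendsto (norm_ne_zero_iff.2 hz)).pow 2).mul_const (morawetzAt p u Du z)
      rw [one_pow, one_mul] at this
      exact ((ENNReal.continuous_ofReal.tendsto _).comp this).liminf_eq.ge
    refine h1.trans ?_
    rw [← ((ENNReal.continuous_ofReal.tendsto _).comp hlim2).liminf_eq]
    refine liminf_le_liminf (.of_forall fun n => ?_)
    rw [← ofReal_integral_eq_lintegral_ofReal (hbi n)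
      (.of_forall fun z => mul_nonneg (sq_nonneg _) (hm0 z))]
    exact ENNReal.ofReal_le_ofReal (hest n)
  have hint : Integrable (morawetzAt p u Du) (slab t₁ t₂) :=
    (lintegral_ofReal_ne_top_iff_integrable
      (aestronglyMeasurable_slab_of hu.aestronglyMeasurable_morawetzAt _ _)
      (.of_forall hm0)).1 (hfat.trans_lt ENNReal.ofReal_lt_top).ne
  refine ⟨by linarith, hint, ?_⟩
  rwa [← ENNReal.ofReal_le_ofReal_iff hdiff, ofReal_integral_eq_lintegral_ofReal hint
    (.of_forall hm0)]

/-- A bounded increasing function with `s c'(s) ≤ c(s)`. -/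
def slope (N s : ℝ) : ℝ := s / √(s ^ 2 + N ^ 2)

/-- The derivative of `slope`. -/
def slope' (N s : ℝ) : ℝ := N ^ 2 / (√(s ^ 2 + N ^ 2) * (s ^ 2 + N ^ 2))

section Slope

variable {N : ℝ}

theorem hasDerivAt_slope (hN : 0 < N) (s : ℝ) : HasDerivAt (slope N) (slope' N s) s := by
  have h0 : 0 < s ^ 2 + N ^ 2 := by positivity
  have hs : 0 < √(s ^ 2 + N ^ 2) := Real.sqrt_pos.2 h0
  have h1 := ((hasDerivAt_pow 2 s).add_const (N ^ 2)).sqrt h0.ne'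
  have h := (hasDerivAt_id s).div h1 hs.ne'
  refine h.congr_deriv ?_
  have hsq : √(s ^ 2 + N ^ 2) ^ 2 = s ^ 2 + N ^ 2 := Real.sq_sqrt h0.le
  have hN2 : N ^ 2 = √(s ^ 2 + N ^ 2) ^ 2 - s ^ 2 := by rw [hsq]; ring
  rw [slope']
  simp only [id]
  set w := √(s ^ 2 + N ^ 2)
  rw [← hsq, hN2]
  field_simp
  push_cast
  ring

theorem continuous_slope' (hN : 0 < N) : Continuous (slope' N) := by
  unfold slope'
  refine Continuous.div (by fun_prop) (by fun_prop) fun s => ?_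
  have h0 : 0 < s ^ 2 + N ^ 2 := by positivity
  have := Real.sqrt_pos.2 h0
  positivity

theorem abs_slope_le_one (s : ℝ) : |slope N s| ≤ 1 := by
  rw [slope, abs_div, abs_of_nonneg (Real.sqrt_nonneg _)]
  refine div_le_one_of_le₀ (Real.abs_le_sqrt ?_) (Real.sqrt_nonneg _)
  linarith [sq_nonneg N]

theorem slope'_nonneg (s : ℝ) : 0 ≤ slope' N s := by unfold slope'; positivity

theorem slope_nonneg {s : ℝ} (hs : 0 ≤ s) : 0 ≤ slope N s := by unfold slope; positivity

theorem slope'_le (hN : 0 < N) (s : ℝ) : slope' N s ≤ N⁻¹ := by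
  have h0 : 0 < s ^ 2 + N ^ 2 := by positivity
  have h1 : N ≤ √(s ^ 2 + N ^ 2) := Real.le_sqrt_of_sq_le (by linarith [sq_nonneg s])
  rw [slope', div_le_iff₀ (by positivity)]
  have h2 : N * N ^ 2 ≤ √(s ^ 2 + N ^ 2) * (s ^ 2 + N ^ 2) :=
    mul_le_mul h1 (by linarith [sq_nonneg s]) (by positivity) (by positivity)
  calc N ^ 2 = N⁻¹ * (N * N ^ 2) := by field_simp
    _ ≤ _ := mul_le_mul_of_nonneg_left h2 (by positivity)

theorem slope'_mul_le (hN : 0 < N) {s : ℝ} (hs : 0 ≤ s) : slope' N s * s ≤ slope N s := by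
  have h0 : 0 < s ^ 2 + N ^ 2 := by positivity
  have h1 : slope' N s * s = slope N s * (N ^ 2 / (s ^ 2 + N ^ 2)) := by
    rw [slope', slope]; field_simp
  rw [h1]
  exact mul_le_of_le_one_right (slope_nonneg hs)
    (div_le_one_of_le₀ (by linarith [sq_nonneg s]) h0.le)

theorem slope_monotone (hN : 0 < N) : Monotone (slope N) :=
  monotone_of_deriv_nonneg (fun s => (hasDerivAt_slope hN s).differentiableAt) fun s => by
    rw [(hasDerivAt_slope hN s).deriv]; exact slope'_nonneg s

/-- Complementary to `slope_tendsto_one`: as `N → ∞` the weight vanishes at each fixed point, hence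
on the data at time `0`, while for fixed `N` it saturates at late times. -/
theorem slope_tendsto_zero (s : ℝ) :
    Tendsto (fun n : ℕ => slope ((n : ℝ) + 1) s) atTop (𝓝 0) := by
  have hn : Tendsto (fun n : ℕ => ((n : ℝ) + 1)) atTop atTop :=
    tendsto_atTop_add_const_right _ _ tendsto_natCast_atTop_atTop
  refine tendsto_const_nhds.div_atTop (tendsto_atTop_mono (fun n => ?_) hn)
  exact Real.le_sqrt_of_sq_le (by linarith [sq_nonneg s])

theorem slope_tendsto_one (N : ℝ) : Tendsto (slope N) atTop (𝓝 1) := by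
  have h2 : Tendsto (fun s : ℝ => 1 / √(1 + N ^ 2 / s ^ 2)) atTop (𝓝 (1 / √(1 + 0))) := by
    refine Tendsto.div tendsto_const_nhds ((Real.continuous_sqrt.tendsto _).comp
      (tendsto_const_nhds.add (tendsto_const_nhds.div_atTop (tendsto_pow_atTop two_ne_zero)))) ?_
    simp
  simp only [add_zero, Real.sqrt_one, div_one] at h2
  refine h2.congr' ?_
  filter_upwards [eventually_gt_atTop 0] with s hs
  have : s ^ 2 + N ^ 2 = s ^ 2 * (1 + N ^ 2 / s ^ 2) := by field_simp
  rw [slope, this, Real.sqrt_mul (by positivity), Real.sqrt_sq hs.le]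
  field_simp

end Slope

/-- The inward energy weighted by an increasing function of `t + |x|` does not increase. -/
theorem IsSolution.slope_estimate (hp₃ : 3 ≤ p) (hp₅ : p ≤ 5) (hu : IsSolution p u Du ut)
    (hE : energy p (u 0) (Du 0) (ut 0) < ⊤) {N : ℝ} (hN : 0 < N) {t : ℝ} (ht : 0 ≤ t) :
    slope N t * inwardReal p u Du ut t ≤ ∫ x, slope N ‖x‖ * inwardAt p u Du ut (0, x) := by
  have hp : -1 < p := by linarith
  have hpos : ∀ n : ℕ, (0 : ℝ) < 1 / ((n : ℝ) + 1) := fun n => by positivity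
  set b : ℕ → ℝ → ℝ := fun n => soft (1 / ((n : ℝ) + 1)) with hb
  have hm0 : ∀ z, 0 ≤ morawetzAt p u Du z := fun z => morawetzDensity_nonneg (by linarith)
  have cs : Continuous (slope N) :=
    continuous_iff_continuousAt.2 fun s => (hasDerivAt_slope hN s).continuousAt
  have hw : ∀ n : ℕ, RadialWeight _ _ _ _ 0 t := fun n =>
    radialWeight_soft (hpos n) (c := slope N) (c' := slope' N) (B := N⁻¹)
      (hasDerivAt_slope hN) (continuous_slope' hN) abs_slope_le_one
      (fun s => by rw [abs_of_nonneg (slope'_nonneg s)]; exact slope'_le hN s) 0 t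
  have hC : ∀ n : ℕ, (0 : ℝ) ≤ 1 + N⁻¹ + (1 / ((n : ℝ) + 1))⁻¹ := fun n => by positivity
  have hmi := (hu.morawetz_estimate hp₃ hp₅ hE ht).2.1
  have hbc : ∀ n, Continuous fun z : ℝ × E3 => b n ‖z.2‖ := fun n =>
    (continuous_soft (hpos n)).comp continuous_snd.norm
  have hbd : ∀ n (z : ℝ × E3), ‖(b n ‖z.2‖ - b n ‖z.2‖ ^ 2) * morawetzAt p u Du z‖
      ≤ morawetzAt p u Du z := fun n z => by
    have h1 := soft_nonneg (ε := 1 / ((n : ℝ) + 1)) ‖z.2‖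
    have h2 := soft_le_one (ε := 1 / ((n : ℝ) + 1)) ‖z.2‖
    rw [norm_mul, Real.norm_of_nonneg (hm0 z), Real.norm_eq_abs]
    refine mul_le_of_le_one_left (hm0 z) ?_
    rw [abs_le]
    simp only [hb]
    constructor <;> nlinarith
  have herrm : ∀ n, AEStronglyMeasurable
      (fun z => (b n ‖z.2‖ - b n ‖z.2‖ ^ 2) * morawetzAt p u Du z) (slab 0 t) := fun n =>
    ((hbc n).sub ((hbc n).pow 2)).aestronglyMeasurable.mul hmi.1
  -- The regularization at the origin leaves this error, which vanishes by domination because the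
  -- Morawetz density is already known to be integrable.
  have herr : Tendsto (fun n => ∫ z, (b n ‖z.2‖ - b n ‖z.2‖ ^ 2) * morawetzAt p u Du z ∂slab 0 t)
      atTop (𝓝 0) := by
    have h0 : (0 : ℝ) = ∫ _z, (0 : ℝ) ∂slab 0 t := by simp
    nth_rewrite 2 [h0]
    refine tendsto_integral_of_dominated_convergence _ herrm hmi
      (fun n => .of_forall fun z => hbd n z) ?_
    filter_upwards [ae_slab_ne_zero 0 t] with z hz
    have h1 := soft_tendsto (norm_ne_zero_iff.2 hz)
    have := (h1.sub (h1.pow 2)).mul_const (morawetzAt p u Du z)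
    simpa only [one_pow, sub_self, zero_mul] using this
  have hest : ∀ n, (∫ x, slope N (t + ‖x‖) * b n ‖x‖ * inwardAt p u Du ut (t, x))
      ≤ (∫ x, slope N (0 + ‖x‖) * b n ‖x‖ * inwardAt p u Du ut (0, x))
        + ∫ z, (b n ‖z.2‖ - b n ‖z.2‖ ^ 2) * morawetzAt p u Du z ∂slab 0 t := fun n => by
    rw [← sub_le_iff_le_add', hu.radial_identity hp₃ hp₅ hE (hC n) (hw n) ht]
    refine integral_mono_ae (hu.integrable_radialRate hp₃ hp₅ hE (hC n) (hw n))
      (hmi.mono' (herrm n) (.of_forall fun z => hbd n z)) ?_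
    filter_upwards [ae_slab_ne_zero 0 t, ae_slab_mem 0 t] with z hz hzt
    have hr := norm_nonneg z.2
    have hs : 0 ≤ z.1 + ‖z.2‖ := add_nonneg hzt.1 hr
    refine (radialRate_soft_le hp₃ (hpos n) hz (slope_nonneg hs) (slope'_nonneg _)).trans ?_
    have h1 := slope'_mul_le hN hs
    -- For `t ≥ 0` the radius is at most `t + r`, so `r c' ≤ (t + r) c' ≤ c`. This is why the
    -- estimate starts at time `0`.
    have h2 : slope' N (z.1 + ‖z.2‖) * ‖z.2‖ ≤ slope N (z.1 + ‖z.2‖) := by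
      nlinarith [slope'_nonneg (N := N) (z.1 + ‖z.2‖), hzt.1]
    have h3 := (le_abs_self _).trans (abs_slope_le_one (N := N) (z.1 + ‖z.2‖))
    have h4 := soft_nonneg (ε := 1 / ((n : ℝ) + 1)) ‖z.2‖
    have h5 := soft_le_one (ε := 1 / ((n : ℝ) + 1)) ‖z.2‖
    rw [← sub_mul]
    refine mul_le_mul_of_nonneg_right ?_ (hm0 z)
    have h6 := mul_le_mul_of_nonneg_right h2 h4
    have h7 : 0 ≤ (1 - slope N (z.1 + ‖z.2‖)) * (soft (1 / ((n : ℝ) + 1)) ‖z.2‖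
        - soft (1 / ((n : ℝ) + 1)) ‖z.2‖ ^ 2) := mul_nonneg (by linarith) (by nlinarith)
    simp only [hb]
    linarith
  have hlim : ∀ s, Tendsto (fun n => ∫ x, slope N (s + ‖x‖) * b n ‖x‖ * inwardAt p u Du ut (s, x))
      atTop (𝓝 (∫ x, slope N (s + ‖x‖) * inwardAt p u Du ut (s, x))) := fun s => by
    refine hu.tendsto_integral_mul_inwardAt hp₃ hp₅ hE s (w := fun n r => slope N (s + r) * b n r)
      (w₀ := fun r => slope N (s + r))
      (fun n => (cs.comp (by fun_prop)).mul (continuous_soft (hpos n))) (fun n r _ => ?_)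
      fun r hr => ?_
    · rw [abs_mul]
      exact mul_le_one₀ (abs_slope_le_one _) (abs_nonneg _) (abs_soft_le_one _ _)
    · simpa only [mul_one] using (soft_tendsto hr.ne').const_mul (slope N (s + r))
  have hfin := le_of_tendsto_of_tendsto' (hlim t) ((hlim 0).add herr) hest
  simp only [zero_add, add_zero] at hfin
  refine le_trans ?_ hfin
  rw [inwardReal, ← integral_const_mul]
  have hi := hu.integrable_inwardAt hp₃ hp₅ hE t
  refine integral_mono (hi.const_mul _) (hi.bdd_mul (c := 1)
    (cs.comp (by fun_prop : Continuous fun x : E3 => t + ‖x‖)).aestronglyMeasurable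
    (.of_forall fun x => abs_slope_le_one _)) fun x => ?_
  exact mul_le_mul_of_nonneg_right (slope_monotone hN (by linarith [norm_nonneg x]))
    (inwardDensity_nonneg hp)

/-- The inward energy tends to zero. -/
theorem IsSolution.tendsto_inwardReal (hp₃ : 3 ≤ p) (hp₅ : p ≤ 5) (hu : IsSolution p u Du ut)
    (hE : energy p (u 0) (Du 0) (ut 0) < ⊤) :
    Tendsto (inwardReal p u Du ut) atTop (𝓝 0) := by
  have hlim := hu.tendsto_integral_mul_inwardAt hp₃ hp₅ hE 0
    (w := fun n => slope ((n : ℝ) + 1)) (w₀ := fun _ => 0)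
    (fun n => continuous_iff_continuousAt.2 fun s =>
      (hasDerivAt_slope (by positivity) s).continuousAt)
    (fun n r _ => abs_slope_le_one r) fun r _ => slope_tendsto_zero r
  simp only [zero_mul, integral_zero] at hlim
  rw [Metric.tendsto_atTop]
  intro e he
  -- First `N = n + 1` is chosen so that the weighted inward energy at time `0` is below `e / 2`,
  -- then `T` so that the weight exceeds `1 / 2` after `T`.
  obtain ⟨n, hn⟩ := (hlim.eventually (gt_mem_nhds (half_pos he))).exists
  have h1 := (slope_tendsto_one ((n : ℝ) + 1)).eventually
    (lt_mem_nhds (by norm_num : (1 / 2 : ℝ) < 1))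
  obtain ⟨T, hT⟩ := (h1.and (eventually_ge_atTop 0)).exists_forall_of_atTop
  refine ⟨T, fun t ht => ?_⟩
  obtain ⟨h2, h3⟩ := hT t ht
  have h4 := hu.slope_estimate hp₃ hp₅ hE (N := (n : ℝ) + 1) (by positivity) h3
  have h0 := inwardReal_nonneg (u := u) (Du := Du) (ut := ut) hp₃ t
  rw [Real.dist_eq, sub_zero, abs_of_nonneg h0]
  nlinarith

end Solution

end WaveEnergy
end

noncomputable section
namespace WaveEnergy

/-! ### Polar coordinates in a time slab -/

/-- The measure `r² dr` on the half-line. -/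
def radialMeasure : Measure ℝ :=
  (volume.restrict (Ioi 0)).withDensity fun r => ENNReal.ofReal (r ^ 2)

instance : SFinite radialMeasure := by unfold radialMeasure; infer_instance

theorem map_volumeIoiPow : (Measure.volumeIoiPow 2).map Subtype.val = radialMeasure := by
  ext s hs
  rw [Measure.map_apply measurable_subtype_coe hs, Measure.volumeIoiPow,
    withDensity_apply _ (measurable_subtype_coe hs), radialMeasure, withDensity_apply _ hs,
    setLIntegral_subtype measurableSet_Ioi _ fun a : ℝ => .ofReal (a ^ 2),
    Measure.restrict_restrict hs, Subtype.image_preimage_coe, inter_comm]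

/-- The Jacobian `r²` is built into `radialMeasure`; the origin, omitted by the polar homeomorphism,
is a null set. -/
theorem measurePreserving_polar : MeasurePreserving
    (fun q : Metric.sphere (0 : E3) 1 × ℝ => q.2 • (q.1 : E3))
    ((volume : Measure E3).toSphere.prod radialMeasure) volume := by
  have hm : Measurable fun q : Metric.sphere (0 : E3) 1 × ℝ => q.2 • (q.1 : E3) :=
    (continuous_snd.smul (continuous_subtype_val.comp continuous_fst)).measurable
  have h1 : MeasurePreserving (homeomorphUnitSphereProd E3).toMeasurableEquiv
      ((volume : Measure E3).comap (↑)) ((volume : Measure E3).toSphere.prod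
        (Measure.volumeIoiPow 2)) := by
    have := (volume : Measure E3).measurePreserving_homeomorphUnitSphereProd
    rw [show Module.finrank ℝ E3 - 1 = 2 by simp] at this
    exact this
  have h2 : MeasurePreserving (Subtype.val : ({0}ᶜ : Set E3) → E3)
      ((volume : Measure E3).comap (↑)) volume := by
    refine ⟨measurable_subtype_coe, ?_⟩
    rw [map_comap_subtype_coe (measurableSet_singleton _).compl, Measure.restrict_eq_self_of_ae_mem]
    exact Measure.ae_ne volume 0
  have h3 := h2.comp h1.symm
  have h4 : MeasurePreserving (Prod.map id Subtype.val)
      ((volume : Measure E3).toSphere.prod (Measure.volumeIoiPow 2))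
      ((volume : Measure E3).toSphere.prod radialMeasure) :=
    (MeasurePreserving.id _).prod ⟨measurable_subtype_coe, map_volumeIoiPow⟩
  refine ⟨hm, ?_⟩
  rw [← h4.map_eq, Measure.map_map hm h4.measurable]
  exact h3.map_eq

theorem measurePreserving_polar_slab (t₁ t₂ : ℝ) : MeasurePreserving
    (fun q : (ℝ × Metric.sphere (0 : E3) 1) × ℝ => (q.1.1, q.2 • (q.1.2 : E3)))
    ((cylinderMeasure t₁ t₂).prod radialMeasure) (slab t₁ t₂) :=
  ((MeasurePreserving.id _).prod measurePreserving_polar).comp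
    (measurePreserving_prodAssoc (volume.restrict (Icc t₁ t₂)) (volume : Measure E3).toSphere
      radialMeasure)

instance (t₁ t₂ : ℝ) : SFinite (cylinderMeasure t₁ t₂) := by
  unfold cylinderMeasure; infer_instance

section Polar

variable {F : ℝ × E3 → ℝ} {t₁ t₂ : ℝ}

theorem integrable_polar (hF : Integrable F (slab t₁ t₂)) :
    Integrable (fun q : (ℝ × Metric.sphere (0 : E3) 1) × ℝ => F (q.1.1, q.2 • (q.1.2 : E3)))
      ((cylinderMeasure t₁ t₂).prod radialMeasure) :=
  (measurePreserving_polar_slab t₁ t₂).integrable_comp_of_integrable hF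

/-- Fubini gives this for almost every `r` with respect to `r² dr`, which has the same null sets in
`(0, ∞)` as Lebesgue measure. -/
theorem integrable_sphere (hF : Integrable F (slab t₁ t₂)) : ∀ᵐ r : ℝ, 0 < r →
    Integrable (fun q : ℝ × Metric.sphere (0 : E3) 1 => F (q.1, r • (q.2 : E3)))
      (cylinderMeasure t₁ t₂) := by
  have h := (integrable_polar hF).prod_left_ae
  rw [radialMeasure, ae_withDensity_iff (by fun_prop), ae_restrict_iff' measurableSet_Ioi] at h
  filter_upwards [h] with r hr h0
  refine hr h0 ?_
  simpa using h0.ne'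

theorem integrableOn_sphere_integral (hF : Integrable F (slab t₁ t₂)) :
    IntegrableOn (fun r : ℝ => r ^ 2 * ∫ q : ℝ × Metric.sphere (0 : E3) 1, F (q.1, r • (q.2 : E3))
      ∂cylinderMeasure t₁ t₂) (Ioi 0) := by
  have h := (integrable_polar hF).integral_prod_right
  rw [radialMeasure, integrable_withDensity_iff_integrable_smul' (by fun_prop) (by simp)] at h
  refine h.congr (.of_forall fun r => ?_)
  simp only [smul_eq_mul]
  rw [ENNReal.toReal_ofReal (sq_nonneg r)]

theorem integral_slab_eq_polar (hF : Integrable F (slab t₁ t₂)) :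
    ∫ z, F z ∂slab t₁ t₂ = ∫ r in Ioi (0 : ℝ), r ^ 2 *
      ∫ q : ℝ × Metric.sphere (0 : E3) 1, F (q.1, r • (q.2 : E3)) ∂cylinderMeasure t₁ t₂ := by
  have h1 := (measurePreserving_polar_slab t₁ t₂).map_eq
  rw [← h1, integral_map (measurePreserving_polar_slab t₁ t₂).measurable.aemeasurable
    (by rw [h1]; exact hF.1), integral_prod_symm _ (integrable_polar hF), radialMeasure,
    integral_withDensity_eq_integral_toReal_smul (by fun_prop) (by simp)]
  refine integral_congr_ae (.of_forall fun r => ?_)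
  simp only [smul_eq_mul]
  rw [ENNReal.toReal_ofReal (sq_nonneg r)]

theorem norm_smul_sphere {r : ℝ} (hr : 0 < r) (y : Metric.sphere (0 : E3) 1) :
    ‖r • (y : E3)‖ = r := by
  rw [norm_smul, norm_eq_of_mem_sphere, mul_one, Real.norm_of_nonneg hr.le]

theorem integral_slab_weight_eq {ψ : ℝ → ℝ} (hψ : Continuous ψ) {C : ℝ} (hC : ∀ r, |ψ r| ≤ C)
    (hF : Integrable F (slab t₁ t₂)) :
    ∫ z, ψ ‖z.2‖ * F z ∂slab t₁ t₂ = ∫ r in Ioi (0 : ℝ), ψ r * (r ^ 2 *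
      ∫ q : ℝ × Metric.sphere (0 : E3) 1, F (q.1, r • (q.2 : E3)) ∂cylinderMeasure t₁ t₂) := by
  have hi : Integrable (fun z => ψ ‖z.2‖ * F z) (slab t₁ t₂) := hF.bdd_mul (c := C)
    (hψ.comp continuous_snd.norm).aestronglyMeasurable (.of_forall fun z => hC _)
  rw [integral_slab_eq_polar hi]
  refine setIntegral_congr_fun measurableSet_Ioi fun r hr => ?_
  simp only [norm_smul_sphere hr, integral_const_mul]
  ring

end Polar

/-! ### Primitives of test functions on the half-line -/

/-- Writing `∫ η(‖x‖) f` with `η` a primitive of `ψ` through the tails of `f`. -/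
theorem integral_primitive_mul {X : Type*} [MeasurableSpace X] {ν : Measure X} [SFinite ν]
    {f ρ : X → ℝ} (hf : Integrable f ν) (hρ : Measurable ρ) (hρ0 : ∀ x, 0 ≤ ρ x) {ψ : ℝ → ℝ}
    (hψ : Integrable ψ) :
    ∫ x, (∫ s in (0 : ℝ)..ρ x, ψ s) * f x ∂ν
      = ∫ s in Ioi (0 : ℝ), ψ s * ∫ x in {x | s < ρ x}, f x ∂ν := by
  have hmeas : MeasurableSet {q : X × ℝ | q.2 < ρ q.1} :=
    measurableSet_lt measurable_snd (hρ.comp measurable_fst)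
  -- Layer-cake argument: both sides are iterated integrals of `f x * ψ s` over `0 < s < ρ x`.
  have hint : Integrable (fun q : X × ℝ => {q : X × ℝ | q.2 < ρ q.1}.indicator
      (fun q => f q.1 * ψ q.2) q) (ν.prod (volume.restrict (Ioi 0))) :=
    (hf.mul_prod hψ.restrict).indicator hmeas
  have h := integral_integral_swap (f := fun x s => {q : X × ℝ | q.2 < ρ q.1}.indicator
      (fun q => f q.1 * ψ q.2) (x, s)) hint
  have e1 : ∀ x, ∫ s in Ioi (0 : ℝ), {q : X × ℝ | q.2 < ρ q.1}.indicator
      (fun q => f q.1 * ψ q.2) (x, s) = (∫ s in (0 : ℝ)..ρ x, ψ s) * f x := fun x => by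
    have : ∀ s, {q : X × ℝ | q.2 < ρ q.1}.indicator (fun q => f q.1 * ψ q.2) (x, s)
        = (Iio (ρ x)).indicator (fun s => f x * ψ s) s := fun s => rfl
    simp_rw [this]
    rw [setIntegral_indicator measurableSet_Iio, Ioi_inter_Iio, integral_const_mul,
      intervalIntegral.integral_of_le (hρ0 x), integral_Ioc_eq_integral_Ioo, mul_comm]
  have e2 : ∀ s, ∫ x, {q : X × ℝ | q.2 < ρ q.1}.indicator (fun q => f q.1 * ψ q.2) (x, s) ∂ν
      = ψ s * ∫ x in {x | s < ρ x}, f x ∂ν := fun s => by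
    have : ∀ x, {q : X × ℝ | q.2 < ρ q.1}.indicator (fun q => f q.1 * ψ q.2) (x, s)
        = {x | s < ρ x}.indicator (fun x => f x * ψ s) x := fun x => rfl
    simp_rw [this]
    rw [integral_indicator (measurableSet_lt measurable_const hρ), integral_mul_const, mul_comm]
  rw [integral_congr_ae (.of_forall fun x => (e1 x).symm), h]
  exact integral_congr_ae (.of_forall e2)

/-- Monotonicity provides measurability and local integrability of the tails in `s` at no further
cost. -/
theorem antitone_tail {X : Type*} [MeasurableSpace X] {ν : Measure X} {f ρ : X → ℝ}
    (hf : Integrable f ν) (hf0 : ∀ x, 0 ≤ f x) :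
    Antitone fun s => ∫ x in {x | s < ρ x}, f x ∂ν := fun _ _ hs =>
  setIntegral_mono_set hf.integrableOn (.of_forall hf0)
    (Eventually.of_forall fun _ hx => lt_of_le_of_lt hs hx)

theorem tendsto_tail {X : Type*} [MeasurableSpace X] {ν : Measure X} {f ρ : X → ℝ}
    (hf : Integrable f ν) (hρ : Measurable ρ) (hρ0 : ∀ᵐ x ∂ν, 0 < ρ x) :
    Tendsto (fun s => ∫ x in {x | s < ρ x}, f x ∂ν) (𝓝[>] 0) (𝓝 (∫ x, f x ∂ν)) := by
  have e : ∀ s, ∫ x in {x | s < ρ x}, f x ∂ν = ∫ x, {x | s < ρ x}.indicator f x ∂ν := fun s =>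
    (integral_indicator (measurableSet_lt measurable_const hρ)).symm
  simp_rw [e]
  refine tendsto_integral_filter_of_dominated_convergence (fun x => ‖f x‖)
    (.of_forall fun s => hf.1.indicator (measurableSet_lt measurable_const hρ))
    (.of_forall fun s => .of_forall fun x => norm_indicator_le_norm_self _ _) hf.norm ?_
  filter_upwards [hρ0] with x hx
  refine tendsto_const_nhds.congr' ?_
  filter_upwards [nhdsWithin_le_nhds (gt_mem_nhds hx)] with s hs
  rw [indicator_of_mem]
  exact hs

end WaveEnergy
end

noncomputable section
namespace WaveEnergy

/-! ### The flux of inward energy through small cylinders -/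

theorem integrable_mul_tail {X : Type*} [MeasurableSpace X] {ν : Measure X} {f ρ : X → ℝ}
    (hf : Integrable f ν) (hf0 : ∀ x, 0 ≤ f x) {ψ : ℝ → ℝ} (hψ : Integrable ψ) :
    IntegrableOn (fun s => ψ s * ∫ x in {x | s < ρ x}, f x ∂ν) (Ioi 0) := by
  refine (hψ.restrict (s := Ioi 0)).mul_bdd (c := ∫ x, f x ∂ν)
    (antitone_tail hf hf0).measurable.aestronglyMeasurable (.of_forall fun s => ?_)
  rw [Real.norm_of_nonneg (integral_nonneg hf0)]
  exact setIntegral_le_integral hf (.of_forall hf0)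

/-- A weight with an arbitrary prescribed radial derivative `ψ` makes the radial identity test the
flux against `ψ`. Starting the primitive at `0` gives the linear vanishing at the origin. -/
theorem radialWeight_primitive {ψ : ℝ → ℝ} (hψ : Continuous ψ) (hi : Integrable ψ) {B : ℝ}
    (hB : ∀ r, |ψ r| ≤ B) (t₁ t₂ : ℝ) :
    RadialWeight (fun _ r => ∫ s in (0 : ℝ)..r, ψ s) (fun _ _ => 0) (fun _ r => ψ r)
      (B + ∫ s, ‖ψ s‖) t₁ t₂ := by
  have hB0 : 0 ≤ B := (abs_nonneg _).trans (hB 0)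
  have hI0 : 0 ≤ ∫ s, ‖ψ s‖ := integral_nonneg fun s => norm_nonneg _
  have hd : ∀ r, HasDerivAt (fun r => ∫ s in (0 : ℝ)..r, ψ s) (ψ r) r := fun r =>
    intervalIntegral.integral_hasDerivAt_right (hψ.intervalIntegrable _ _)
      (hψ.stronglyMeasurableAtFilter _ _) hψ.continuousAt
  have hc : Continuous fun r => ∫ s in (0 : ℝ)..r, ψ s :=
    continuous_iff_continuousAt.2 fun r => (hd r).continuousAt
  refine ⟨fun t r => hasDerivAt_const _ _, fun t r => hd r, hc.comp continuous_snd,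
    continuous_const, hψ.comp continuous_snd, fun t _ r hr => ?_, fun t _ r hr => ?_,
    fun t _ r hr => ?_, fun t _ r hr => ?_⟩
  · have h1 : |∫ s in (0 : ℝ)..r, ψ s| ≤ ∫ s, ‖ψ s‖ := by
      rw [← Real.norm_eq_abs]
      exact intervalIntegral.norm_integral_le_integral_norm_uIoc.trans
        (setIntegral_le_integral hi.norm (.of_forall fun s => norm_nonneg _))
    linarith
  · have h1 := intervalIntegral.norm_integral_le_of_norm_le_const (a := 0) (b := r) (f := ψ)
      (fun s _ => hB s)
    rw [sub_zero, abs_of_nonneg hr, Real.norm_eq_abs] at h1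
    exact h1.trans (mul_le_mul_of_nonneg_right (by linarith) hr)
  · simp only [abs_zero]; positivity
  · linarith [hB r]

theorem eventually_essNhdsZero {P : ℝ → Prop} (h : ∀ᵐ r : ℝ, 0 < r → P r) :
    ∀ᶠ r in essNhdsZero, P r := by
  have h1 : ∀ᶠ r in essNhdsZero, 0 < r := mem_inf_of_left self_mem_nhdsWithin
  have h2 : ∀ᶠ r in essNhdsZero, 0 < r → P r := mem_inf_of_right h
  filter_upwards [h1, h2] with r h3 h4 using h4 h3

/-- A null set cannot contain an interval `(0, e)`. Without this, essential limits would not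
determine the flux. -/
instance : NeBot essNhdsZero := by
  refine inf_neBot_iff.2 fun {s} hs {s'} hs' => ?_
  obtain ⟨e, he, hsub⟩ := mem_nhdsGT_iff_exists_Ioo_subset.1 hs
  by_contra hne
  rw [not_nonempty_iff_eq_empty] at hne
  have h0 : volume (Ioo 0 e) ≤ volume s'ᶜ := measure_mono fun x hx hx' =>
    (eq_empty_iff_forall_notMem.1 hne x) ⟨hsub hx, hx'⟩
  rw [mem_ae_iff.1 hs', Real.volume_Ioo, sub_zero, nonpos_iff_eq_zero, ENNReal.ofReal_eq_zero] at h0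
  exact absurd h0 (not_le.2 he)

section Solution

variable {p : ℝ} {u : ℝ → E3 → ℝ} {Du : ℝ → E3 → E3} {ut : ℝ → E3 → ℝ} {t₁ t₂ : ℝ}

theorem cylinderFluxDensity_eq (t : ℝ) (x : E3) :
    cylinderFluxDensity p u Du ut t x = fluxAt p u Du ut (t, x) := by
  rw [cylinderFluxDensity, fluxAt, fluxDensity, potential, div_div, mul_comm (p + 1) 2]

theorem IsSolution.integrable_fluxAt (hp₃ : 3 ≤ p) (hp₅ : p ≤ 5) (hu : IsSolution p u Du ut)
    (hE : energy p (u 0) (Du 0) (ut 0) < ⊤) (t₁ t₂ : ℝ) :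
    Integrable (fluxAt p u Du ut) (slab t₁ t₂) :=
  (hu.integrable_totalDensity_slab hp₃ hp₅ hE t₁ t₂).mono'
    (aestronglyMeasurable_slab_of hu.aestronglyMeasurable_fluxAt _ _)
    (.of_forall fun _ => (abs_fluxDensity_le (by linarith)).trans
      (inwardDensity_le_totalDensity (by linarith)))

theorem IsSolution.integrable_cylinderFlux (hp₃ : 3 ≤ p) (hp₅ : p ≤ 5) (hu : IsSolution p u Du ut)
    (hE : energy p (u 0) (Du 0) (ut 0) < ⊤) (t₁ t₂ : ℝ) : ∀ᶠ r in essNhdsZero,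
    Integrable (fun q : ℝ × Metric.sphere (0 : E3) 1 =>
      r ^ 2 * cylinderFluxDensity p u Du ut q.1 (r • (q.2 : E3))) (cylinderMeasure t₁ t₂) := by
  refine eventually_essNhdsZero ?_
  filter_upwards [integrable_sphere (hu.integrable_fluxAt hp₃ hp₅ hE t₁ t₂)] with r hr h0
  simp_rw [cylinderFluxDensity_eq]
  exact (hr h0).const_mul _

/-- The energy balance outside the cylinder of radius `s`. -/
def exteriorBalance (p : ℝ) (u : ℝ → E3 → ℝ) (Du : ℝ → E3 → E3) (ut : ℝ → E3 → ℝ) (t₁ t₂ s : ℝ) :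
    ℝ :=
  (∫ x in {x : E3 | s < ‖x‖}, inwardAt p u Du ut (t₁, x))
    - (∫ x in {x : E3 | s < ‖x‖}, inwardAt p u Du ut (t₂, x))
    - ∫ z in {z : ℝ × E3 | s < ‖z.2‖}, morawetzAt p u Du z ∂slab t₁ t₂

theorem cylinderFlux_eq_mul (r : ℝ) : cylinderFlux p u Du ut t₁ t₂ r = r ^ 2 *
    ∫ q : ℝ × Metric.sphere (0 : E3) 1, fluxAt p u Du ut (q.1, r • (q.2 : E3))
      ∂cylinderMeasure t₁ t₂ := by
  rw [cylinderFlux, integral_const_mul]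
  simp_rw [cylinderFluxDensity_eq]

/-- The radial identity is applied with primitives of test functions `ψ` on `(0, ∞)`. The flux term
becomes `∫ ψ Φ` in polar coordinates, and the other terms become `∫ ψ` times tails over `‖x‖ > s`.
Since `ψ` is arbitrary, the integrands agree for almost every radius. -/
theorem IsSolution.cylinderFlux_ae_eq (hp₃ : 3 ≤ p) (hp₅ : p ≤ 5) (hu : IsSolution p u Du ut)
    (hE : energy p (u 0) (Du 0) (ut 0) < ⊤) (h : t₁ ≤ t₂) : ∀ᵐ r : ℝ, 0 < r →
      cylinderFlux p u Du ut t₁ t₂ r = exteriorBalance p u Du ut t₁ t₂ r := by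
  have hp : -1 < p := by linarith
  have hi := hu.integrable_inwardAt hp₃ hp₅ hE
  have hi0 : ∀ t x, 0 ≤ inwardAt p u Du ut (t, x) := fun t x => inwardDensity_nonneg hp
  have hm := (hu.morawetz_estimate hp₃ hp₅ hE h).2.1
  have hm0 : ∀ z, 0 ≤ morawetzAt p u Du z := fun z => morawetzDensity_nonneg (by linarith)
  have hf := hu.integrable_fluxAt hp₃ hp₅ hE t₁ t₂
  have hΦ : IntegrableOn (cylinderFlux p u Du ut t₁ t₂) (Ioi 0) := by
    simp_rw [funext fun r => cylinderFlux_eq_mul (p := p) (u := u) (Du := Du) (ut := ut)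
      (t₁ := t₁) (t₂ := t₂) r]
    exact integrableOn_sphere_integral hf
  have hG : LocallyIntegrable (exteriorBalance p u Du ut t₁ t₂) :=
    ((antitone_tail (hi t₁) (hi0 t₁)).locallyIntegrable.sub
      (antitone_tail (hi t₂) (hi0 t₂)).locallyIntegrable).sub
      (antitone_tail hm hm0).locallyIntegrable
  -- Fundamental lemma of the calculus of variations on `(0, ∞)`; the origin is excluded because
  -- polar coordinates only see `r > 0`.
  have key := isOpen_Ioi.ae_eq_zero_of_integral_contDiff_smul_eq_zero (U := Ioi (0 : ℝ))
    (f := fun r => cylinderFlux p u Du ut t₁ t₂ r - exteriorBalance p u Du ut t₁ t₂ r)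
    (hΦ.locallyIntegrableOn.sub (hG.locallyIntegrableOn _)) ?_
  · filter_upwards [key] with r hr h0 using sub_eq_zero.1 (hr h0)
  intro ψ hψ hψc hψs
  have cψ := hψ.continuous
  have iψ : Integrable ψ := cψ.integrable_of_hasCompactSupport hψc
  obtain ⟨B, hB⟩ := hψc.exists_bound_of_continuous cψ
  have hB' : ∀ r, |ψ r| ≤ B := hB
  have hB0 : 0 ≤ B := (norm_nonneg _).trans (hB 0)
  have hI0 : 0 ≤ ∫ s, ‖ψ s‖ := integral_nonneg fun s => norm_nonneg _
  have hid := hu.radial_identity hp₃ hp₅ hE (add_nonneg hB0 hI0)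
    (radialWeight_primitive cψ iψ hB' t₁ t₂) h
  have hT1 := integrable_mul_tail (ρ := fun x : E3 => ‖x‖) (hi t₁) (hi0 t₁) iψ
  have hT2 := integrable_mul_tail (ρ := fun x : E3 => ‖x‖) (hi t₂) (hi0 t₂) iψ
  have hT3 := integrable_mul_tail (ρ := fun z : ℝ × E3 => ‖z.2‖) hm hm0 iψ
  have hTΦ : IntegrableOn (fun r => ψ r * cylinderFlux p u Du ut t₁ t₂ r) (Ioi 0) :=
    hΦ.bdd_mul (c := B) cψ.aestronglyMeasurable (.of_forall hB)
  have hη : ∀ r, 0 ≤ r → |∫ s in (0 : ℝ)..r, ψ s| ≤ B + ∫ s, ‖ψ s‖ := fun r hr =>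
    (radialWeight_primitive cψ iψ hB' t₁ t₂).bound t₁ (left_mem_Icc.2 h) r hr
  have cη : Continuous fun r => ∫ s in (0 : ℝ)..r, ψ s :=
    ((radialWeight_primitive cψ iψ hB' t₁ t₂).continuous).comp
      (continuous_const (y := t₁) |>.prodMk continuous_id)
  have hif : Integrable (fun z => ψ ‖z.2‖ * fluxAt p u Du ut z) (slab t₁ t₂) :=
    hf.bdd_mul (c := B) (cψ.comp continuous_snd.norm).aestronglyMeasurable
      (.of_forall fun z => hB _)
  have him : Integrable (fun z => (∫ s in (0 : ℝ)..‖z.2‖, ψ s) * morawetzAt p u Du z)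
      (slab t₁ t₂) :=
    hm.bdd_mul (c := B + ∫ s, ‖ψ s‖) (cη.comp continuous_snd.norm).aestronglyMeasurable
      (.of_forall fun z => hη _ (norm_nonneg _))
  have e1 : ∫ z, radialRate p u Du ut (fun _ r => ∫ s in (0 : ℝ)..r, ψ s) (fun _ _ => 0)
      (fun _ r => ψ r) z ∂slab t₁ t₂ = -(∫ z, ψ ‖z.2‖ * fluxAt p u Du ut z ∂slab t₁ t₂)
        - ∫ z, (∫ s in (0 : ℝ)..‖z.2‖, ψ s) * morawetzAt p u Du z ∂slab t₁ t₂ := by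
    have hneg : Integrable (fun z => -(ψ ‖z.2‖ * fluxAt p u Du ut z)) (slab t₁ t₂) := hif.neg
    rw [← integral_neg, ← integral_sub hneg him]
    refine integral_congr_ae (.of_forall fun z => ?_)
    simp [radialRate]
  rw [e1, integral_slab_weight_eq cψ hB' hf,
    integral_primitive_mul (ρ := fun z : ℝ × E3 => ‖z.2‖) hm measurable_snd.norm (fun z => norm_nonneg _) iψ,
    integral_primitive_mul (hi t₁) measurable_norm (fun x => norm_nonneg _) iψ,
    integral_primitive_mul (hi t₂) measurable_norm (fun x => norm_nonneg _) iψ] at hid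
  simp_rw [← cylinderFlux_eq_mul] at hid
  rw [← setIntegral_eq_integral_of_forall_compl_eq_zero (s := Ioi 0)]
  swap
  · intro r hr
    have : ψ r = 0 := image_eq_zero_of_notMem_tsupport fun h' => hr (hψs h')
    simp [this]
  have e2 : ∀ r, ψ r • (cylinderFlux p u Du ut t₁ t₂ r - exteriorBalance p u Du ut t₁ t₂ r)
      = ψ r * cylinderFlux p u Du ut t₁ t₂ r
        - (ψ r * (∫ x in {x : E3 | r < ‖x‖}, inwardAt p u Du ut (t₁, x))
          - ψ r * (∫ x in {x : E3 | r < ‖x‖}, inwardAt p u Du ut (t₂, x))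
          - ψ r * ∫ z in {z : ℝ × E3 | r < ‖z.2‖}, morawetzAt p u Du z ∂slab t₁ t₂) := fun r => by
    rw [smul_eq_mul, exteriorBalance]; ring
  simp_rw [e2]
  rw [integral_sub hTΦ (((hT1.fun_sub hT2)).fun_sub hT3), integral_sub (hT1.fun_sub hT2) hT3,
    integral_sub hT1 hT2]
  linarith

/-- The flux through small cylinders converges to the defect in the energy balance. -/
theorem IsSolution.tendsto_cylinderFlux (hp₃ : 3 ≤ p) (hp₅ : p ≤ 5) (hu : IsSolution p u Du ut)
    (hE : energy p (u 0) (Du 0) (ut 0) < ⊤) (h : t₁ ≤ t₂) :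
    Tendsto (cylinderFlux p u Du ut t₁ t₂) essNhdsZero
      (𝓝 (inwardReal p u Du ut t₁ - inwardReal p u Du ut t₂
        - ∫ z, morawetzAt p u Du z ∂slab t₁ t₂)) := by
  have hi := hu.integrable_inwardAt hp₃ hp₅ hE
  have hm := (hu.morawetz_estimate hp₃ hp₅ hE h).2.1
  have hx : ∀ᵐ x : E3, 0 < ‖x‖ := by
    filter_upwards [Measure.ae_ne (volume : Measure E3) 0] with x hx using norm_pos_iff.2 hx
  have hz : ∀ᵐ z ∂slab t₁ t₂, 0 < ‖z.2‖ := by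
    filter_upwards [ae_slab_ne_zero t₁ t₂] with z hz using norm_pos_iff.2 hz
  have hG := ((tendsto_tail (hi t₁) measurable_norm hx).sub
    (tendsto_tail (hi t₂) measurable_norm hx)).sub
    (tendsto_tail (ρ := fun z : ℝ × E3 => ‖z.2‖) hm measurable_snd.norm hz)
  -- The tails converge along the full one-sided neighbourhood filter of `0`; only their
  -- identification with the cylinder flux is restricted to almost every radius.
  refine (hG.mono_left (inf_le_left : essNhdsZero ≤ 𝓝[>] 0)).congr' ?_
  filter_upwards [eventually_essNhdsZero (hu.cylinderFlux_ae_eq hp₃ hp₅ hE h)] with r hr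
  rw [hr]
  rfl

end Solution

end WaveEnergy
end


/-! ### Time reversal and continuity of the inward energy -/

noncomputable section
namespace WaveEnergy

/-- Time reversal on space-time. -/
def timeReversal : (ℝ × E3) ≃L[ℝ] ℝ × E3 :=
  (ContinuousLinearEquiv.neg ℝ).prodCongr (ContinuousLinearEquiv.refl ℝ E3)

theorem timeReversal_apply (z : ℝ × E3) : timeReversal z = (-z.1, z.2) := rfl

theorem measurePreserving_timeReversal :
    MeasurePreserving timeReversal (volume : Measure (ℝ × E3)) volume :=
  (Measure.measurePreserving_neg (volume : Measure ℝ)).prod (MeasurePreserving.id volume)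

theorem integral_timeReversal (f : ℝ × E3 → ℝ) : ∫ z, f (timeReversal z) = ∫ z, f z :=
  measurePreserving_timeReversal.integral_comp
    timeReversal.toHomeomorph.measurableEmbedding f

theorem fderiv_comp_timeReversal (φ : ℝ × E3 → ℝ) (z v : ℝ × E3) :
    fderiv ℝ (φ ∘ timeReversal) z v = fderiv ℝ φ (timeReversal z) (timeReversal v) := by
  rw [timeReversal.comp_right_fderiv]; rfl

theorem eLpNorm_comp_neg (f : ℝ → ℝ≥0∞) (q : ℝ≥0∞) (a b : ℝ) :
    eLpNorm (fun t => f (-t)) q (volume.restrict (Icc a b))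
      = eLpNorm f q (volume.restrict (Icc (-b) (-a))) := by
  have he : MeasurableEmbedding (fun t : ℝ => -t) := (Homeomorph.neg ℝ).measurableEmbedding
  have h := (Measure.measurePreserving_neg (volume : Measure ℝ)).restrict_preimage_emb he
    (Icc (-b) (-a))
  have hs : (fun t : ℝ => -t) ⁻¹' Icc (-b) (-a) = Icc a b := by ext t; simp
  rw [hs] at h
  rw [← h.map_eq, he.eLpNorm_map_measure]
  rfl

variable {p : ℝ} {u : ℝ → E3 → ℝ} {Du : ℝ → E3 → E3} {ut : ℝ → E3 → ℝ}

/-- The equation is of second order in time, so reversal only changes the sign of the velocity. Each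
weak identity is the original one tested with the reversed test function. -/
theorem IsSolution.reverse (hu : IsSolution p u Du ut) :
    IsSolution p (fun t => u (-t)) (fun t => Du (-t)) (fun t x => -ut (-t) x) := by
  have hcomp : ∀ φ : ℝ × E3 → ℝ, HasCompactSupport φ → HasCompactSupport (φ ∘ timeReversal) :=
    fun φ hφ => hφ.comp_homeomorph timeReversal.toHomeomorph
  have hd : ∀ (φ : ℝ × E3 → ℝ) (z : ℝ × E3), fderiv ℝ (φ ∘ timeReversal) z (1, 0)
      = -fderiv ℝ φ (timeReversal z) (1, 0) := fun φ z => by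
    rw [fderiv_comp_timeReversal, ← map_neg]; congr 1; simp [timeReversal_apply]
  have hg : ∀ (φ : ℝ × E3 → ℝ) (z : ℝ × E3) (v : E3), fderiv ℝ (φ ∘ timeReversal) z (0, v)
      = fderiv ℝ φ (timeReversal z) (0, v) := fun φ z v => by
    rw [fderiv_comp_timeReversal]; congr 1; simp [timeReversal_apply]
  exact
  { aestronglyMeasurable := hu.aestronglyMeasurable.comp_measurePreserving
      measurePreserving_timeReversal
    aestronglyMeasurable_grad := hu.aestronglyMeasurable_grad.comp_measurePreserving
      measurePreserving_timeReversal
    aestronglyMeasurable_time := (hu.aestronglyMeasurable_time.comp_measurePreserving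
      measurePreserving_timeReversal).neg
    homogeneousH1 := fun t => hu.homogeneousH1 (-t)
    memLp_time := fun t => (hu.memLp_time (-t)).neg
    continuous_grad := fun t => (hu.continuous_grad (-t)).comp (continuous_neg.tendsto t)
    continuous_time := fun t => by
      refine ((hu.continuous_time (-t)).comp (continuous_neg.tendsto t)).congr fun s => ?_
      rw [Function.comp_apply, ← eLpNorm_neg]
      congr 1
      funext x
      simp only [Pi.neg_apply, Pi.sub_apply]
      ring
    strichartz := fun a b => by
      rw [eLpNorm_comp_neg (fun t => eLpNorm (u t) (ENNReal.ofReal (2 * p)) volume)]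
      exact hu.strichartz _ _
    time_derivative := fun φ hφ hc => by
      have h := hu.time_derivative (φ ∘ timeReversal) (hφ.comp timeReversal.contDiff) (hcomp φ hc)
      simp_rw [hd, mul_neg, integral_neg] at h
      rw [← integral_timeReversal, ← integral_timeReversal (fun z => -ut (-z.1) z.2 * φ z)]
      simp only [timeReversal_apply, neg_neg, neg_mul, integral_neg, Function.comp_apply] at h ⊢
      linarith
    equation := fun φ hφ hc => by
      have h := hu.equation (φ ∘ timeReversal) (hφ.comp timeReversal.contDiff) (hcomp φ hc)
      simp_rw [hd, hg] at h
      rw [← integral_timeReversal]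
      simpa only [timeReversal_apply, neg_neg, neg_mul, mul_neg, Function.comp_apply] using h }

theorem energy_reverse :
    energy p (u (-0)) (Du (-0)) (fun x => -ut (-0) x) = energy p (u 0) (Du 0) (ut 0) := by
  simp [energy]

/-- Changing the sign of the velocity turns `L₋` into `L₊`, so every result on the outward energy is
one on the inward energy. -/
theorem outwardEnergy_eq_inwardEnergy_reverse (t : ℝ) :
    outwardEnergy p u Du ut t
      = inwardEnergy p (fun t => u (-t)) (fun t => Du (-t)) (fun t x => -ut (-t) x) (-t) := by
  simp only [outwardEnergy, inwardEnergy, neg_neg, LPlus, LMinus, sub_eq_add_neg]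

/-- The outward energy as a real number. -/
def outwardReal (p : ℝ) (u : ℝ → E3 → ℝ) (Du : ℝ → E3 → E3) (ut : ℝ → E3 → ℝ) (t : ℝ) : ℝ :=
  inwardReal p (fun t => u (-t)) (fun t => Du (-t)) (fun t x => -ut (-t) x) (-t)

theorem IsSolution.outwardEnergy_eq (hp₃ : 3 ≤ p) (hp₅ : p ≤ 5) (hu : IsSolution p u Du ut)
    (hE : energy p (u 0) (Du 0) (ut 0) < ⊤) (t : ℝ) :
    outwardEnergy p u Du ut t = ENNReal.ofReal (outwardReal p u Du ut t) := by
  rw [outwardEnergy_eq_inwardEnergy_reverse]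
  exact hu.reverse.inwardEnergy_eq hp₃ hp₅ (by rwa [energy_reverse]) (-t)

theorem IsSolution.antitone_inwardReal (hp₃ : 3 ≤ p) (hp₅ : p ≤ 5) (hu : IsSolution p u Du ut)
    (hE : energy p (u 0) (Du 0) (ut 0) < ⊤) : Antitone (inwardReal p u Du ut) :=
  fun _ _ h => (hu.morawetz_estimate hp₃ hp₅ hE h).1

theorem IsSolution.monotone_outwardReal (hp₃ : 3 ≤ p) (hp₅ : p ≤ 5) (hu : IsSolution p u Du ut)
    (hE : energy p (u 0) (Du 0) (ut 0) < ⊤) : Monotone (outwardReal p u Du ut) :=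
  fun _ _ h => hu.reverse.antitone_inwardReal hp₃ hp₅ (by rwa [energy_reverse]) (neg_le_neg h)

theorem IsSolution.tendsto_outwardReal (hp₃ : 3 ≤ p) (hp₅ : p ≤ 5) (hu : IsSolution p u Du ut)
    (hE : energy p (u 0) (Du 0) (ut 0) < ⊤) :
    Tendsto (outwardReal p u Du ut) atBot (𝓝 0) :=
  (hu.reverse.tendsto_inwardReal hp₃ hp₅ (by rwa [energy_reverse])).comp tendsto_neg_atBot_atTop

/-- The momentum density of the solution at a space-time point. -/
def momentumAt (u : ℝ → E3 → ℝ) (Du : ℝ → E3 → E3) (ut : ℝ → E3 → ℝ) (z : ℝ × E3) : ℝ :=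
  ut z.1 z.2 * (inner ℝ (Du z.1 z.2) (radial z.2) + ‖z.2‖⁻¹ * u z.1 z.2)

/-- Angular and potential parts cancel, and polarization `(a + b)² - (a - b)² = 4ab` leaves the
product of velocity and radial derivative. -/
theorem IsSolution.inwardReal_sub_outwardReal (hp₃ : 3 ≤ p) (hp₅ : p ≤ 5)
    (hu : IsSolution p u Du ut) (hE : energy p (u 0) (Du 0) (ut 0) < ⊤) (t : ℝ) :
    inwardReal p u Du ut t - outwardReal p u Du ut t = ∫ x, momentumAt u Du ut (t, x) := by
  have h1 := hu.integrable_inwardAt hp₃ hp₅ hE t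
  have h2 := hu.reverse.integrable_inwardAt hp₃ hp₅ (by rwa [energy_reverse]) (-t)
  rw [outwardReal, inwardReal, inwardReal, ← integral_sub h1 h2]
  refine integral_congr_ae (.of_forall fun x => ?_)
  simp only [inwardAt, inwardDensity, neg_neg, LPlus, momentumAt]
  ring

theorem IsHomogeneousH1.memLp_hardy {f : E3 → ℝ} {g : E3 → E3} (h : IsHomogeneousH1 f g) :
    MemLp (fun x => ‖x‖⁻¹ * f x) 2 volume :=
  ⟨measurable_norm.inv.aestronglyMeasurable.mul h.memLp.1,
    h.hardy.trans_lt (ENNReal.mul_lt_top (by simp) h.memLp_grad.2)⟩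

theorem eLpNorm_inner_radial_le (g : E3 → E3) :
    eLpNorm (fun x => inner ℝ (g x) (radial x)) 2 volume ≤ eLpNorm g 2 volume :=
  eLpNorm_mono fun x => abs_inner_radial_le (g x) x

theorem aestronglyMeasurable_inner_radial {g : E3 → E3} (hg : AEStronglyMeasurable g volume) :
    AEStronglyMeasurable (fun x => inner ℝ (g x) (radial x)) volume :=
  hg.inner measurable_radial.aestronglyMeasurable

/-- The radial derivative `∂ᵣ(ru)/r` of the solution is square integrable. -/
theorem IsSolution.memLp_radial (hu : IsSolution p u Du ut) (t : ℝ) :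
    MemLp (fun x => inner ℝ (Du t x) (radial x) + ‖x‖⁻¹ * u t x) 2 volume :=
  MemLp.add ⟨aestronglyMeasurable_inner_radial (hu.homogeneousH1 t).memLp_grad.1,
    (eLpNorm_inner_radial_le _).trans_lt (hu.homogeneousH1 t).memLp_grad.2⟩
    (hu.homogeneousH1 t).memLp_hardy

/-- The term `u / |x|` is continuous in `L²` by Hardy's inequality applied to increments. -/
theorem IsSolution.tendsto_radial (hu : IsSolution p u Du ut) (t : ℝ) :
    Tendsto (fun s => eLpNorm (fun x => (inner ℝ (Du s x) (radial x) + ‖x‖⁻¹ * u s x)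
      - (inner ℝ (Du t x) (radial x) + ‖x‖⁻¹ * u t x)) 2 volume) (𝓝 t) (𝓝 0) := by
  have h := (hu.continuous_grad t).add (hu.tendsto_hardy t)
  rw [add_zero] at h
  refine tendsto_of_tendsto_of_tendsto_of_le_of_le tendsto_const_nhds h (fun _ => zero_le)
    fun s => ?_
  have hd := ((hu.homogeneousH1 s).sub (hu.homogeneousH1 t))
  have e : (fun x => (inner ℝ (Du s x) (radial x) + ‖x‖⁻¹ * u s x)
      - (inner ℝ (Du t x) (radial x) + ‖x‖⁻¹ * u t x))
      = (fun x => inner ℝ ((Du s - Du t) x) (radial x)) + fun x => ‖x‖⁻¹ * (u s x - u t x) := by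
    funext x
    simp only [Pi.add_apply, Pi.sub_apply, inner_sub_left]
    ring
  rw [e]
  refine (eLpNorm_add_le (aestronglyMeasurable_inner_radial hd.memLp_grad.1)
    hd.memLp_hardy.1 (by norm_num)).trans ?_
  exact add_le_add_left (eLpNorm_inner_radial_le _) _

theorem abs_integral_mul_le {f g : E3 → ℝ} (hf : MemLp f 2 volume) (hg : MemLp g 2 volume) :
    |∫ x, f x * g x| ≤ (eLpNorm f 2 volume).toReal * (eLpNorm g 2 volume).toReal := by
  have h := eLpNorm_smul_le_mul_eLpNorm (p := 2) (q := 2) (r := 1) hg.1 hf.1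
  rw [← ENNReal.toReal_mul]
  refine le_trans ?_ (ENNReal.toReal_mono (ENNReal.mul_lt_top hf.2 hg.2).ne h)
  rw [eLpNorm_one_eq_lintegral_enorm, ← integral_norm_eq_lintegral_enorm (hf.1.smul hg.1)]
  exact norm_integral_le_integral_norm fun x => f x * g x

/-- Square integrable functions depending continuously on a parameter have a continuous inner
product. -/
theorem continuous_integral_mul {f g : ℝ → E3 → ℝ} (hf : ∀ t, MemLp (f t) 2 volume)
    (hg : ∀ t, MemLp (g t) 2 volume)
    (cf : ∀ t, Tendsto (fun s => eLpNorm (fun x => f s x - f t x) 2 volume) (𝓝 t) (𝓝 0))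
    (cg : ∀ t, Tendsto (fun s => eLpNorm (fun x => g s x - g t x) 2 volume) (𝓝 t) (𝓝 0)) :
    Continuous fun t => ∫ x, f t x * g t x := by
  refine continuous_iff_continuousAt.2 fun t => ?_
  have hfs : ∀ s, MemLp (fun x => f s x - f t x) 2 volume := fun s => (hf s).sub (hf t)
  have hgs : ∀ s, MemLp (fun x => g s x - g t x) 2 volume := fun s => (hg s).sub (hg t)
  have tf : Tendsto (fun s => (eLpNorm (fun x => f s x - f t x) 2 volume).toReal) (𝓝 t) (𝓝 0) :=
    (ENNReal.tendsto_toReal ENNReal.zero_ne_top).comp (cf t)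
  have tg : Tendsto (fun s => (eLpNorm (fun x => g s x - g t x) 2 volume).toReal) (𝓝 t) (𝓝 0) :=
    (ENNReal.tendsto_toReal ENNReal.zero_ne_top).comp (cg t)
  have hlim := ((tf.mul tg).add (tf.mul_const (eLpNorm (g t) 2 volume).toReal)).add
    (tg.const_mul (eLpNorm (f t) 2 volume).toReal)
  simp only [mul_zero, zero_mul, add_zero] at hlim
  refine tendsto_iff_dist_tendsto_zero.2 (squeeze_zero (fun _ => dist_nonneg) (fun s => ?_) hlim)
  have i1 : Integrable fun x => (f s x - f t x) * (g s x - g t x) := (hfs s).integrable_mul (hgs s)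
  have i2 : Integrable fun x => (f s x - f t x) * g t x := (hfs s).integrable_mul (hg t)
  have i3 : Integrable fun x => f t x * (g s x - g t x) := (hf t).integrable_mul (hgs s)
  have i4 : Integrable fun x => f t x * g t x := (hf t).integrable_mul (hg t)
  have e : ∫ x, f s x * g s x = (∫ x, (f s x - f t x) * (g s x - g t x))
      + (∫ x, (f s x - f t x) * g t x) + (∫ x, f t x * (g s x - g t x))
      + ∫ x, f t x * g t x := by
    have i12 : Integrable fun x => (f s x - f t x) * (g s x - g t x) + (f s x - f t x) * g t x :=
      i1.add i2
    have i123 : Integrable fun x => (f s x - f t x) * (g s x - g t x) + (f s x - f t x) * g t x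
        + f t x * (g s x - g t x) := i12.add i3
    rw [← integral_add i1 i2, ← integral_add i12 i3, ← integral_add i123 i4]
    exact integral_congr_ae (.of_forall fun x => by ring)
  rw [Real.dist_eq, e, add_sub_cancel_right]
  refine (abs_add_le _ _).trans (add_le_add ((abs_add_le _ _).trans (add_le_add ?_ ?_)) ?_)
  · exact abs_integral_mul_le (hfs s) (hgs s)
  · exact abs_integral_mul_le (hfs s) (hg t)
  · exact abs_integral_mul_le (hf t) (hgs s)

/-- The difference of inward and outward energy is an `L²` inner product of continuous curves. As
one energy decreases and the other increases, the variation of the first is at most the variation of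
the difference. This avoids proving continuity in time of the potential energy. -/
theorem IsSolution.continuous_inwardReal (hp₃ : 3 ≤ p) (hp₅ : p ≤ 5) (hu : IsSolution p u Du ut)
    (hE : energy p (u 0) (Du 0) (ut 0) < ⊤) : Continuous (inwardReal p u Du ut) := by
  have hc : Continuous fun t => inwardReal p u Du ut t - outwardReal p u Du ut t := by
    simp_rw [hu.inwardReal_sub_outwardReal hp₃ hp₅ hE]
    exact continuous_integral_mul hu.memLp_time hu.memLp_radial hu.continuous_time
      hu.tendsto_radial
  have ha := hu.antitone_inwardReal hp₃ hp₅ hE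
  have hm := hu.monotone_outwardReal hp₃ hp₅ hE
  refine continuous_iff_continuousAt.2 fun t => ?_
  have h0 : Tendsto (fun s => |(inwardReal p u Du ut s - outwardReal p u Du ut s)
      - (inwardReal p u Du ut t - outwardReal p u Du ut t)|) (𝓝 t) (𝓝 0) := by
    simpa using ((hc.tendsto t).sub_const
      (inwardReal p u Du ut t - outwardReal p u Du ut t)).abs
  refine tendsto_iff_dist_tendsto_zero.2 (squeeze_zero (fun _ => dist_nonneg) (fun s => ?_) h0)
  rw [Real.dist_eq]
  rcases le_total s t with h | h
  · rw [abs_of_nonneg (sub_nonneg.2 (ha h))]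
    exact le_trans (by linarith [hm h]) (le_abs_self _)
  · rw [abs_of_nonpos (sub_nonpos.2 (ha h))]
    exact le_trans (by linarith [hm h]) (neg_le_abs _)

end WaveEnergy
end


noncomputable section
namespace WaveEnergy

/-! ### The flux measure at the origin -/

/-- A bounded continuous nondecreasing function is the distribution function of a finite measure
without atoms. -/
theorem exists_measure_Icc_eq {N : ℝ → ℝ} (hm : Monotone N) (hc : Continuous N) {C : ℝ}
    (hC : ∀ t, |N t| ≤ C) : ∃ μ : Measure ℝ, IsFiniteMeasure μ ∧ (∀ t, μ {t} = 0) ∧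
      ∀ t₁ t₂, t₁ ≤ t₂ → (μ (Icc t₁ t₂)).toReal = N t₂ - N t₁ := by
  obtain ⟨F, hF⟩ : ∃ F : StieltjesFunction ℝ, ∀ t, F t = N t :=
    ⟨⟨N, hm, fun t => hc.continuousWithinAt⟩, fun _ => rfl⟩
  -- Atoms and masses of closed intervals involve left limits; by continuity these are plain values,
  -- so there are no atoms and no correction at the left endpoint.
  have hl : ∀ t, Function.leftLim F t = N t := fun t => by
    rw [funext hF]
    exact (hc.continuousWithinAt (s := Iic t) (x := t)).leftLim_eq
  refine ⟨F.measure, F.isFiniteMeasure_of_forall_abs_le (C := C) fun t => by rw [hF]; exact hC t,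
    fun t => ?_, fun t₁ t₂ h => ?_⟩
  · rw [F.measure_singleton, hl, hF, sub_self, ENNReal.ofReal_zero]
  · rw [F.measure_Icc, hl, hF, ENNReal.toReal_ofReal (sub_nonneg.2 (hm h))]

variable {p : ℝ} {u : ℝ → E3 → ℝ} {Du : ℝ → E3 → E3} {ut : ℝ → E3 → ℝ} {t₁ t₂ : ℝ}

/-- The spatial Morawetz integral at a fixed time. -/
def morawetzRate (p : ℝ) (u : ℝ → E3 → ℝ) (Du : ℝ → E3 → E3) (t : ℝ) : ℝ :=
  ∫ x, morawetzAt p u Du (t, x)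

theorem IsSolution.intervalIntegrable_morawetzRate (hp₃ : 3 ≤ p) (hp₅ : p ≤ 5)
    (hu : IsSolution p u Du ut) (hE : energy p (u 0) (Du 0) (ut 0) < ⊤) (t₁ t₂ : ℝ) :
    IntervalIntegrable (morawetzRate p u Du) volume t₁ t₂ := by
  have key : ∀ a b : ℝ, a ≤ b → IntervalIntegrable (morawetzRate p u Du) volume a b := by
    intro a b h
    have hm := (hu.morawetz_estimate hp₃ hp₅ hE h).2.1.integral_prod_left
    exact (intervalIntegrable_iff_integrableOn_Icc_of_le h).2 hm
  rcases le_total t₁ t₂ with h | h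
  · exact key _ _ h
  · exact (key _ _ h).symm

theorem IsSolution.integral_morawetzRate (hp₃ : 3 ≤ p) (hp₅ : p ≤ 5) (hu : IsSolution p u Du ut)
    (hE : energy p (u 0) (Du 0) (ut 0) < ⊤) (h : t₁ ≤ t₂) :
    ∫ t in t₁..t₂, morawetzRate p u Du t = ∫ z, morawetzAt p u Du z ∂slab t₁ t₂ := by
  have hm := (hu.morawetz_estimate hp₃ hp₅ hE h).2.1
  rw [intervalIntegral.integral_of_le h, ← integral_Icc_eq_integral_Ioc, slab, integral_prod _ hm]
  rfl

/-- The cumulative flux of inward energy into the spatial origin since time `0`. -/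
def originFlux (p : ℝ) (u : ℝ → E3 → ℝ) (Du : ℝ → E3 → E3) (ut : ℝ → E3 → ℝ) (t : ℝ) : ℝ :=
  -inwardReal p u Du ut t - ∫ s in (0 : ℝ)..t, morawetzRate p u Du s

theorem IsSolution.originFlux_sub (hp₃ : 3 ≤ p) (hp₅ : p ≤ 5) (hu : IsSolution p u Du ut)
    (hE : energy p (u 0) (Du 0) (ut 0) < ⊤) (h : t₁ ≤ t₂) :
    originFlux p u Du ut t₂ - originFlux p u Du ut t₁
      = inwardReal p u Du ut t₁ - inwardReal p u Du ut t₂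
        - ∫ z, morawetzAt p u Du z ∂slab t₁ t₂ := by
  have hi := hu.intervalIntegrable_morawetzRate hp₃ hp₅ hE
  rw [← hu.integral_morawetzRate hp₃ hp₅ hE h, originFlux, originFlux,
    ← intervalIntegral.integral_add_adjacent_intervals (hi 0 t₁) (hi t₁ t₂)]
  ring

theorem IsSolution.continuous_originFlux (hp₃ : 3 ≤ p) (hp₅ : p ≤ 5) (hu : IsSolution p u Du ut)
    (hE : energy p (u 0) (Du 0) (ut 0) < ⊤) : Continuous (originFlux p u Du ut) :=
  (hu.continuous_inwardReal hp₃ hp₅ hE).neg.sub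
    (intervalIntegral.continuous_primitive (hu.intervalIntegrable_morawetzRate hp₃ hp₅ hE) 0)

/-- The possible defect in the Morawetz estimate is precisely a nonnegative increment of this
function. -/
theorem IsSolution.monotone_originFlux (hp₃ : 3 ≤ p) (hp₅ : p ≤ 5) (hu : IsSolution p u Du ut)
    (hE : energy p (u 0) (Du 0) (ut 0) < ⊤) : Monotone (originFlux p u Du ut) := fun _ _ h => by
  linarith [hu.originFlux_sub hp₃ hp₅ hE h, (hu.morawetz_estimate hp₃ hp₅ hE h).2.2]

/-- Each increment is at most the inward energy at its left endpoint, which is bounded uniformly in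
time. This yields finiteness of the measure. -/
theorem IsSolution.abs_originFlux_le (hp₃ : 3 ≤ p) (hp₅ : p ≤ 5) (hu : IsSolution p u Du ut)
    (hE : energy p (u 0) (Du 0) (ut 0) < ⊤) (t : ℝ) :
    |originFlux p u Du ut t| ≤ |originFlux p u Du ut 0|
      + (10 * energy p (u 0) (Du 0) (ut 0)).toReal := by
  have key : ∀ a b : ℝ, a ≤ b → originFlux p u Du ut b - originFlux p u Du ut a
      ≤ (10 * energy p (u 0) (Du 0) (ut 0)).toReal := fun a b h => by
    have h1 : 0 ≤ ∫ z, morawetzAt p u Du z ∂slab a b :=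
      integral_nonneg fun z => morawetzDensity_nonneg (by linarith)
    have h2 := inwardReal_nonneg (u := u) (Du := Du) (ut := ut) hp₃ b
    linarith [hu.originFlux_sub hp₃ hp₅ hE h, hu.inwardReal_le hp₃ hp₅ hE a]
  have hm := hu.monotone_originFlux hp₃ hp₅ hE
  have h0 := abs_le.1 (le_refl |originFlux p u Du ut 0|)
  have hC : 0 ≤ (10 * energy p (u 0) (Du 0) (ut 0)).toReal := ENNReal.toReal_nonneg
  rw [abs_le]
  rcases le_total 0 t with h | h
  · constructor <;> linarith [key _ _ h, hm h]
  · constructor <;> linarith [key _ _ h, hm h]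

theorem IsSolution.exists_originFluxMeasure (hp₃ : 3 ≤ p) (hp₅ : p ≤ 5)
    (hu : IsSolution p u Du ut) (hE : energy p (u 0) (Du 0) (ut 0) < ⊤) :
    ∃ μ : Measure ℝ, IsOriginFluxMeasure p u Du ut μ := by
  have hπ := Real.pi_pos
  -- The factor `π⁻¹` implements the normalization in which the flux equals `π μ`.
  obtain ⟨μ, hμ, h0, hI⟩ := exists_measure_Icc_eq
    ((hu.monotone_originFlux hp₃ hp₅ hE).const_mul (inv_nonneg.2 hπ.le))
    (continuous_const.mul (hu.continuous_originFlux hp₃ hp₅ hE))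
    (C := Real.pi⁻¹ * (|originFlux p u Du ut 0| + (10 * energy p (u 0) (Du 0) (ut 0)).toReal))
    (fun t => by
      rw [abs_mul, abs_of_pos (inv_pos.2 hπ)]
      exact mul_le_mul_of_nonneg_left (hu.abs_originFlux_le hp₃ hp₅ hE t) (inv_nonneg.2 hπ.le))
  refine ⟨μ, hμ, h0, fun t₁ t₂ _ => hu.integrable_cylinderFlux hp₃ hp₅ hE t₁ t₂,
    fun t₁ t₂ h => ?_⟩
  rw [hI t₁ t₂ h, ← mul_sub, ← mul_assoc, mul_inv_cancel₀ hπ.ne', one_mul,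
    hu.originFlux_sub hp₃ hp₅ hE h]
  exact hu.tendsto_cylinderFlux hp₃ hp₅ hE h

/-- Essential limits are unique, so the two finite measures agree on all compact intervals, and
these determine a measure. -/
theorem IsOriginFluxMeasure.ext {μ ν : Measure ℝ} (hμ : IsOriginFluxMeasure p u Du ut μ)
    (hν : IsOriginFluxMeasure p u Du ut ν) : μ = ν := by
  have := hμ.finite
  have := hν.finite
  refine Measure.ext_of_Icc μ ν fun a b h => ?_
  have h1 := tendsto_nhds_unique (hμ.flux a b h) (hν.flux a b h)
  exact (ENNReal.toReal_eq_toReal_iff' (measure_ne_top _ _) (measure_ne_top _ _)).1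
    (mul_left_cancel₀ Real.pi_ne_zero h1)

theorem IsSolution.morawetz_slab_eq (hp₃ : 3 ≤ p) (hp₅ : p ≤ 5) (hu : IsSolution p u Du ut)
    (hE : energy p (u 0) (Du 0) (ut 0) < ⊤) (h : t₁ ≤ t₂) :
    morawetz p u Du (Icc t₁ t₂ ×ˢ univ)
      = ENNReal.ofReal (∫ z, morawetzAt p u Du z ∂slab t₁ t₂) := by
  rw [ofReal_integral_eq_lintegral_ofReal (hu.morawetz_estimate hp₃ hp₅ hE h).2.1
    (.of_forall fun z => morawetzDensity_nonneg (by linarith)), slab_eq, morawetz]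
  refine lintegral_congr fun z => ?_
  congr 1
  have : p + 1 ≠ 0 := by linarith
  rw [morawetzAt, morawetzDensity, potential]
  field_simp

/-- Balance of inward energy on a bounded time interval. -/
theorem IsOriginFluxMeasure.inwardEnergy_balance {μ : Measure ℝ}
    (hμ : IsOriginFluxMeasure p u Du ut μ) (hp₃ : 3 ≤ p) (hp₅ : p ≤ 5)
    (hu : IsSolution p u Du ut) (hE : energy p (u 0) (Du 0) (ut 0) < ⊤) (h : t₁ ≤ t₂) :
    inwardEnergy p u Du ut t₁ = ENNReal.ofReal Real.pi * μ (Icc t₁ t₂)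
      + morawetz p u Du (Icc t₁ t₂ ×ˢ univ) + inwardEnergy p u Du ut t₂ := by
  have := hμ.finite
  have h1 := tendsto_nhds_unique (hμ.flux t₁ t₂ h) (hu.tendsto_cylinderFlux hp₃ hp₅ hE h)
  have h2 : 0 ≤ ∫ z, morawetzAt p u Du z ∂slab t₁ t₂ :=
    integral_nonneg fun z => morawetzDensity_nonneg (by linarith)
  have h3 : 0 ≤ Real.pi * (μ (Icc t₁ t₂)).toReal :=
    mul_nonneg Real.pi_pos.le ENNReal.toReal_nonneg
  rw [hu.morawetz_slab_eq hp₃ hp₅ hE h, hu.inwardEnergy_eq hp₃ hp₅ hE,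
    hu.inwardEnergy_eq hp₃ hp₅ hE, ← ENNReal.ofReal_toReal (measure_ne_top μ (Icc t₁ t₂)),
    ← ENNReal.ofReal_mul Real.pi_pos.le, ← ENNReal.ofReal_add h3 h2,
    ← ENNReal.ofReal_add (add_nonneg h3 h2) (inwardReal_nonneg hp₃ _)]
  congr 1
  linarith

theorem IsSolution.tendsto_inwardEnergy (hp₃ : 3 ≤ p) (hp₅ : p ≤ 5) (hu : IsSolution p u Du ut)
    (hE : energy p (u 0) (Du 0) (ut 0) < ⊤) :
    Tendsto (inwardEnergy p u Du ut) atTop (𝓝 0) := by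
  rw [funext (hu.inwardEnergy_eq hp₃ hp₅ hE), ← ENNReal.ofReal_zero]
  exact ENNReal.tendsto_ofReal (hu.tendsto_inwardReal hp₃ hp₅ hE)

/-- Balance of inward energy on an unbounded time interval. -/
theorem IsOriginFluxMeasure.inwardEnergy_eq {μ : Measure ℝ}
    (hμ : IsOriginFluxMeasure p u Du ut μ) (hp₃ : 3 ≤ p) (hp₅ : p ≤ 5)
    (hu : IsSolution p u Du ut) (hE : energy p (u 0) (Du 0) (ut 0) < ⊤) (t₀ : ℝ) :
    inwardEnergy p u Du ut t₀ = ENNReal.ofReal Real.pi * μ (Ici t₀)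
      + morawetz p u Du (Ici t₀ ×ˢ univ) := by
  -- The half-line is an increasing union of compact intervals. Flux and Morawetz terms pass to the
  -- limit by continuity from below, and the energy left at the right endpoint tends to zero.
  have hU : ⋃ s : ℝ, Icc t₀ s = Ici t₀ := by
    ext t
    simp only [mem_iUnion, mem_Icc, mem_Ici]
    exact ⟨fun ⟨_, h⟩ => h.1, fun h => ⟨t, h, le_rfl⟩⟩
  have hmono : Monotone fun s : ℝ => Icc t₀ s := fun _ _ h => Icc_subset_Icc_right h
  have h1 : Tendsto (fun s => μ (Icc t₀ s)) atTop (𝓝 (μ (Ici t₀))) := by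
    rw [← hU]; exact tendsto_measure_iUnion_atTop hmono
  have h2 : Tendsto (fun s => morawetz p u Du (Icc t₀ s ×ˢ univ)) atTop
      (𝓝 (morawetz p u Du (Ici t₀ ×ˢ univ))) := by
    -- The Morawetz integral is viewed as a measure with density, so that continuity from below
    -- applies to it.
    have key : ∀ I : Set ℝ, MeasurableSet I → morawetz p u Du (I ×ˢ univ)
        = volume.withDensity (fun z : ℝ × E3 => ENNReal.ofReal ((p - 1) / (2 * (p + 1))
          * (|u z.1 z.2| ^ (p + 1) / ‖z.2‖) + 1 / 2 * (‖angular (Du z.1 z.2) z.2‖ ^ 2 / ‖z.2‖)))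
          (I ×ˢ univ) := fun I hI =>
      (withDensity_apply _ (hI.prod MeasurableSet.univ)).symm
    simp_rw [key _ measurableSet_Icc, key _ measurableSet_Ici]
    rw [← hU, iUnion_prod_const]
    exact tendsto_measure_iUnion_atTop fun _ _ h => prod_mono (hmono h) Subset.rfl
  have h3 := ((ENNReal.Tendsto.const_mul h1 (Or.inr (ENNReal.ofReal_ne_top (r := Real.pi)))).add h2).add
    (hu.tendsto_inwardEnergy hp₃ hp₅ hE)
  rw [add_zero] at h3
  refine tendsto_nhds_unique (tendsto_const_nhds.congr' ?_) h3
  filter_upwards [eventually_ge_atTop t₀] with s hs using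
    hμ.inwardEnergy_balance hp₃ hp₅ hu hE hs

end WaveEnergy
end

theorem mainTheorem5 (p : ℝ) (hp₃ : 3 ≤ p) (hp₅ : p ≤ 5)
    (u : ℝ → WaveEnergy.E3 → ℝ) (Du : ℝ → WaveEnergy.E3 → WaveEnergy.E3)
    (ut : ℝ → WaveEnergy.E3 → ℝ)
    (hu : WaveEnergy.IsSolution p u Du ut)
    (hE : WaveEnergy.energy p (u 0) (Du 0) (ut 0) < ⊤) :
    (∀ t, WaveEnergy.inwardEnergy p u Du ut t < ⊤ ∧ WaveEnergy.outwardEnergy p u Du ut t < ⊤) ∧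
    Antitone (WaveEnergy.inwardEnergy p u Du ut) ∧
    Monotone (WaveEnergy.outwardEnergy p u Du ut) ∧
    Tendsto (WaveEnergy.inwardEnergy p u Du ut) atTop (𝓝 0) ∧
    Tendsto (WaveEnergy.outwardEnergy p u Du ut) atBot (𝓝 0) ∧
    (∃! μ : Measure ℝ, WaveEnergy.IsOriginFluxMeasure p u Du ut μ) ∧
    (∀ μ : Measure ℝ, WaveEnergy.IsOriginFluxMeasure p u Du ut μ →
      ∀ t₀ : ℝ, WaveEnergy.inwardEnergy p u Du ut t₀ =
        ENNReal.ofReal Real.pi * μ (Ici t₀)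
          + WaveEnergy.morawetz p u Du (Ici t₀ ×ˢ univ)) := by
  refine ⟨fun t => ⟨?_, ?_⟩, fun s t h => ?_, fun s t h => ?_,
    hu.tendsto_inwardEnergy hp₃ hp₅ hE, ?_, ?_, fun μ hμ => hμ.inwardEnergy_eq hp₃ hp₅ hu hE⟩
  · rw [hu.inwardEnergy_eq hp₃ hp₅ hE]
    exact ENNReal.ofReal_lt_top
  · rw [hu.outwardEnergy_eq hp₃ hp₅ hE]
    exact ENNReal.ofReal_lt_top
  · rw [hu.inwardEnergy_eq hp₃ hp₅ hE, hu.inwardEnergy_eq hp₃ hp₅ hE]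
    exact ENNReal.ofReal_le_ofReal (hu.antitone_inwardReal hp₃ hp₅ hE h)
  · rw [hu.outwardEnergy_eq hp₃ hp₅ hE, hu.outwardEnergy_eq hp₃ hp₅ hE]
    exact ENNReal.ofReal_le_ofReal (hu.monotone_outwardReal hp₃ hp₅ hE h)
  · rw [funext (hu.outwardEnergy_eq hp₃ hp₅ hE), ← ENNReal.ofReal_zero]
    exact ENNReal.tendsto_ofReal (hu.tendsto_outwardReal hp₃ hp₅ hE)
  · obtain ⟨μ, hμ⟩ := hu.exists_originFluxMeasure hp₃ hp₅ hE
    exact ⟨μ, hμ, fun ν hν => hν.ext hμ⟩
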